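/- **Channels.** A channel family consists of $\epsilon_{\max}\in(0,+\infty]$ and, for every $\epsilon\in(0,\epsilon_{\max})$, probability laws $p_\epsilon(\cdot\mid x)$ on $\mathbb R$, $x\in\{-1,+1\}$, with $p_\epsilon(-y\mid -x)=p_\epsilon(y\mid x)$. Let $c_\epsilon$ be the law of the half-loglikelihood $l=\frac12\ln\frac{p_\epsilon(y\mid+1)}{p_\epsilon(y\mid-1)}$ when $+1$ is sent. The family belongs to $\mathcal K$ if $l$ is a.s. finite and: (1) for every integer $p\ge1$ the derivative $T_{2p}(\epsilon)=\frac{d}{d\epsilon}\int c_\epsilon(dl)(\tanh l)^{2p}$ exists on $(0,\epsilon_{\max})$, and $\sup_{p\ge 1}|T_{2p}(\epsilon)|$ is bounded on compact subsets of $(0,\epsilon_{\max})$; (2) $\mathbb E[e^{r|l|}]<\infty$ for all $r>0$ and all $\epsilon\in(0,\epsilon_{\max})$; (3) there is $s_0>0$ with $\lim_{\epsilon\to0}\mathbb E[e^{-sl}]=0$ for all $0<s\le s_0$; (4) there is $H(\epsilon)>0$ with $e^{4H(\epsilon)}-1+\mathbb P(|l|>H(\epsilon))\to0$ as $\epsilon\to\epsilon_{\max}$.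 **Codes and ensembles.** On a bipartite multigraph with $n$ code-bit nodes $i$ (carrying $l_i$, i.i.d. with law $c_\epsilon$) and $m$ other nodes $a$, the LDPC posterior measure on $x\in\{\pm1\}^n$ is proportional to $\prod_{a}\frac12(1+\prod_{i\in\partial a}x_i)\prod_i e^{l_ix_i}$; the LDGM posterior measure on $u\in\{\pm1\}^m$ is proportional to $\prod_i e^{l_ix_i}$ with $x_i=\prod_{a\in\partial i}u_a$ (neighbours are counted with multiplicity). Let $\Lambda(z)=\sum_{l=1}^{l_{\max}}\Lambda_lz^l$ and $P(z)=\sum_{k=1}^{k_{\max}}P_kz^k$ be generating functions of probability distributions. The ensembles LDGM$(\Lambda,P)$ and LDPC$(\Lambda,P)$ are given by degree sequences with variable degrees in $\{1,\dots,l_{\max}\}$, check degrees in $\{1,\dots,k_{\max}\}$, equal numbers of sockets on both sides, and empirical degree distributions of the variable and check nodes equal to, or converging as $n\to\infty$ to, $\Lambda$ and $P$; the sockets are matched by a uniformly random bijection. Code bits are the variable nodes for LDPC and the check nodes for LDGM (whose variable nodes are the information bits). $\mathbb E_{\mathcal C}$ is the average over the ensemble. **GEXIT functions.** Let $\kappa=\Lambda'(1)/P'(1)$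 for LDGM and $\kappa=1$ for LDPC. With $h_n$ the Shannon entropy of the posterior measure averaged over the noise and divided by $n$, $g_n(\epsilon)=\kappa\frac{d}{d\epsilon}\mathbb E_{\mathcal C}[h_n]$. For a random variable $X\in[-1,1]$ independent of $l$, with law $\rho$, put $$\mathcal G_\epsilon(\rho)=\kappa\,\frac{d}{d\epsilon'}\Big|_{\epsilon'=\epsilon}\int c_{\epsilon'}(dl)\,\mathbb E_{X\sim\rho}\ln\frac{1+X\tanh l}{1+\tanh l}.$$ For even $d$ let $T_d(i)$ be the universal covering tree of the graph truncated at distance $d$ from the code-bit node $i$, with projection $\pi$, and let $\langle x_i\rangle^{BP}_{0,d}$ be the posterior mean of the root bit for the code on $T_d(i)$ of the same type with half-loglikelihood $l_{\pi(\nu)}$ at node $\nu$, where $l_i$ is set to $0$. Then $g^{BP}_{n,d}(\epsilon)=\mathbb E_{\mathcal C}\big[\frac1n\sum_i\mathcal G_\epsilon(\mathrm{law\ of\ }\langle x_i\rangle^{BP}_{0,d})\big]$, where the law is taken with respect to the noise. **Density evolution.** For LDGM: $v^{(0)}=0$; $\tanh u^{(t+1)}=\tanh l\prod_{a=1}^{k-1}\tanh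 v^{(t)}_a$ with $k$ of law $kP_k/P'(1)$; $v^{(t+1)}=\sum_{j=1}^{r-1}u_j^{(t+1)}$ with $r$ of law $r\Lambda_r/\Lambda'(1)$; $X^{(t)}=\prod_{a=1}^{k}\tanh v^{(t)}_a$ with $k$ of law $P_k$. For LDPC: $\lambda^{(0)}=l$; $\tanh w^{(t+1)}=\prod_{j=1}^{k-1}\tanh\lambda_j^{(t)}$ with $k$ of law $kP_k/P'(1)$; $\lambda^{(t+1)}=l+\sum_{a=1}^{r-1}w^{(t+1)}_a$ with $r$ of law $r\Lambda_r/\Lambda'(1)$; $X^{(t)}=\tanh\big(\sum_{a=1}^{r}w_a^{(t+1)}\big)$ with $r$ of law $\Lambda_r$. Here $l$ has law $c_\epsilon$ and all variables occurring on the right-hand sides are independent copies. Put $g^{DE}_t(\epsilon)=\mathcal G_\epsilon(\mathrm{law\ of\ }X^{(t)})$. **Corollary.** Let the channel family belong to $\mathcal K$ and let $l_{\max},k_{\max}$ be given. There are $\epsilon_g'\in[0,\epsilon_{\max})$ and $\epsilon_p'\in(0,\epsilon_{\max}]$, depending only on the channel family, $l_{\max}$ and $k_{\max}$, such that for all $\Lambda,P$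 as above, for the ensembles LDGM$(\Lambda,P)$ and every $\epsilon_g'<\epsilon<\epsilon_{\max}$, and for the ensembles LDPC$(\Lambda,P)$ and every finite $0<\epsilon<\epsilon_p'$, all the derivatives above exist, all the following limits exist, they depend on the ensemble only through its type and $\Lambda,P$, and $$\lim_{n\to\infty}g_n(\epsilon)=\lim_{d\to\infty,\ d\ \mathrm{even}}\ \lim_{n\to\infty}g^{BP}_{n,d}(\epsilon)=\lim_{t\to\infty}g^{DE}_t(\epsilon).$$ -/

import Mathlib

open MeasureTheory Filter Topology Polynomial

namespace SparseCode

noncomputable section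

/-! ### Channels -/

/-- A family of binary-input memoryless output-symmetric channels with real outputs, indexed by a
noise parameter `ε ∈ (0, εmax)`; `εmax` may be infinite. `W ε x` is the law of the output given
the input `x ∈ {±1}`. -/
structure Channel where
  εmax : EReal
  εmax_pos : 0 < εmax
  W : ℝ → ℤˣ → Measure ℝ
  prob : ∀ ε : ℝ, 0 < ε → (ε : EReal) < εmax → ∀ x, IsProbabilityMeasure (W ε x)
  symm : ∀ ε : ℝ, 0 < ε → (ε : EReal) < εmax → ∀ x, W ε (-x) = (W ε x).map (fun y => -y)

namespace Channel

/-- The open interval `(0, εmax)`. -/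
def dom (Ch : Channel) : Set ℝ := {ε | 0 < ε ∧ (ε : EReal) < Ch.εmax}

/-- The half-loglikelihood `½ ln (p(y ∣ +1) / p(y ∣ -1))`. -/
def halfLLR (Ch : Channel) (ε y : ℝ) : ℝ := (1 / 2) * llr (Ch.W ε 1) (Ch.W ε (-1)) y

/-- The law `c(l) dl` of the half-loglikelihood when `+1` is transmitted. -/
def c (Ch : Channel) (ε : ℝ) : Measure ℝ := (Ch.W ε 1).map (Ch.halfLLR ε)

/-- `∫ c(l) (tanh l)^{2p} dl`; its `ε`-derivative is `T_{2p}(ε)`. -/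
def tanhMoment (Ch : Channel) (p : ℕ) (ε : ℝ) : ℝ := ∫ l, Real.tanh l ^ (2 * p) ∂(Ch.c ε)

/-- `δ(ε, H) = e^{4H} - 1 + ℙ(|l| > H)`. -/
def delta (Ch : Channel) (ε H : ℝ) : ℝ := Real.exp (4 * H) - 1 + (Ch.c ε).real {l | H < |l|}

/-- The class `𝒦` of channels. -/
structure ClassK (Ch : Channel) : Prop where
  /-- The half-loglikelihood is almost surely finite. -/
  finite_llr : ∀ ε ∈ Ch.dom, Ch.W ε 1 ≪ Ch.W ε (-1)
  /-- The numbers `T_{2p}(ε)` exist. -/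
  T_exists : ∀ p : ℕ, 1 ≤ p → ∀ ε ∈ Ch.dom, DifferentiableAt ℝ (Ch.tanhMoment p) ε
  /-- The numbers `T_{2p}(ε)` are bounded uniformly in `p ≥ 1`, locally uniformly in `ε`. -/
  T_bounded : ∀ S ⊆ Ch.dom, IsCompact S →
    ∃ B : ℝ, ∀ p : ℕ, 1 ≤ p → ∀ ε ∈ S, |deriv (Ch.tanhMoment p) ε| ≤ B
  /-- Finite exponential moments. -/
  exp_moment : ∀ ε ∈ Ch.dom, ∀ r : ℝ, 0 < r → Integrable (fun l => Real.exp (r * |l|)) (Ch.c ε)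
  /-- Low noise condition. -/
  low_noise : ∃ s₀ : ℝ, 0 < s₀ ∧ ∀ s : ℝ, 0 < s → s ≤ s₀ →
    Tendsto (fun ε => ∫ l, Real.exp (-s * l) ∂(Ch.c ε)) (𝓝[>] 0) (𝓝 0)
  /-- High noise condition. -/
  high_noise : ∃ H : ℝ → ℝ, (∀ ε, 0 < H ε) ∧
    Tendsto (fun ε => Ch.delta ε (H ε))
      (Filter.comap (fun ε : ℝ => (ε : EReal)) (𝓝[<] Ch.εmax)) (𝓝 0)

end Channel

/-! ### Codes on bipartite multigraphs and their Gibbs measures -/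

/-- A bipartite multigraph. `V` is the set of code-bit nodes, `A` the set of the other nodes (parity
checks for an LDPC code, information bits for an LDGM code), `E` the set of edges. -/
structure Graph (V A E : Type) where
  bit : E → V
  oth : E → A

/-- The two kinds of codes. -/
inductive Kind where
  | ldgm
  | ldpc

/-- Value of a spin as a real number. -/
def spin (s : ℤˣ) : ℝ := ((s : ℤ) : ℝ)

/-- Gibbs average of `f` for unnormalised weights `w`. -/
def gibbsAvg {S : Type} [Fintype S] (w f : S → ℝ) : ℝ := (∑ s, f s * w s) / ∑ s, w s

/-- Gibbs (Shannon) entropy for unnormalised weights `w`. -/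
def gibbsEntropy {S : Type} [Fintype S] (w : S → ℝ) : ℝ := ∑ s, Real.negMulLog (w s / ∑ t, w t)

section Gibbs

variable {V A E : Type} [Fintype V] [Fintype A] [Fintype E]

open Classical in
/-- The code bit `x_i = ∏_{a ∈ ∂i} u_a` of an LDGM code (edges counted with multiplicity). -/
def codeBit (G : Graph V A E) (u : A → ℤˣ) (i : V) : ℝ :=
  ∏ e with G.bit e = i, spin (u (G.oth e))

/-- Posterior weight of the information word `u` of an LDGM code. -/
def ldgmWeight (G : Graph V A E) (l : V → ℝ) (u : A → ℤˣ) : ℝ :=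
  ∏ i, Real.exp (l i * codeBit G u i)

open Classical in
/-- Posterior weight of the word `x` for an LDPC code (edges counted with multiplicity). -/
def ldpcWeight (G : Graph V A E) (l : V → ℝ) (x : V → ℤˣ) : ℝ :=
  (∏ a : A, (1 / 2 : ℝ) * (1 + ∏ e with G.oth e = a, spin (x (G.bit e)))) *
    ∏ i, Real.exp (l i * spin (x i))

open Classical in
/-- The soft bit estimate `⟨x_i⟩` for the half-loglikelihoods `l`. -/
def softBit (κ : Kind) (G : Graph V A E) (l : V → ℝ) (i : V) : ℝ :=
  match κ with
  | .ldgm => gibbsAvg (ldgmWeight G l) (fun u => codeBit G u i)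
  | .ldpc => gibbsAvg (ldpcWeight G l) (fun x => spin (x i))

open Classical in
/-- Entropy of the posterior measure for the half-loglikelihoods `l`. -/
def posteriorEntropy (κ : Kind) (G : Graph V A E) (l : V → ℝ) : ℝ :=
  match κ with
  | .ldgm => gibbsEntropy (ldgmWeight G l)
  | .ldpc => gibbsEntropy (ldpcWeight G l)

end Gibbs

/-! ### The computational tree and the BP estimate -/

section Tree

variable {V A E : Type}

/-- Non-backtracking walks started at the code-bit node `i`, as lists of edges, last edge first.
A walk of even length ends at a code-bit node, one of odd length at a node of the other side. -/
def IsWalk (G : Graph V A E) (i : V) : List E → Prop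
  | [] => True
  | [e] => G.bit e = i
  | f :: e :: w => IsWalk G i (e :: w) ∧ f ≠ e ∧
      (if Odd (e :: w).length then G.oth f = G.oth e else G.bit f = G.bit e)

theorem IsWalk.tail {G : Graph V A E} {i : V} {w : List E} (h : IsWalk G i w) :
    IsWalk G i w.tail := by
  match w, h with
  | [], h => exact h
  | [_], _ => exact trivial
  | _ :: _ :: _, h => exact h.1

/-- Code-bit nodes of the computational tree of depth `d`. -/
def TreeBit (G : Graph V A E) (i : V) (d : ℕ) : Type :=
  {w : List E // IsWalk G i w ∧ w.length ≤ d ∧ Even w.length}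

/-- Other nodes of the computational tree of depth `d`. -/
def TreeOth (G : Graph V A E) (i : V) (d : ℕ) : Type :=
  {w : List E // IsWalk G i w ∧ w.length ≤ d ∧ Odd w.length}

/-- Edges of the computational tree of depth `d`: a nonempty walk `w` is joined to `w.tail`. -/
def TreeEdge (G : Graph V A E) (i : V) (d : ℕ) : Type :=
  {w : List E // IsWalk G i w ∧ w.length ≤ d ∧ w ≠ []}

instance [Finite E] (G : Graph V A E) (i : V) (d : ℕ) : Finite (TreeBit G i d) :=
  ((List.finite_length_le E d).subset (fun _ h => h.2.1) :
    {w : List E | IsWalk G i w ∧ w.length ≤ d ∧ Even w.length}.Finite).to_subtype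

instance [Finite E] (G : Graph V A E) (i : V) (d : ℕ) : Finite (TreeOth G i d) :=
  ((List.finite_length_le E d).subset (fun _ h => h.2.1) :
    {w : List E | IsWalk G i w ∧ w.length ≤ d ∧ Odd w.length}.Finite).to_subtype

instance [Finite E] (G : Graph V A E) (i : V) (d : ℕ) : Finite (TreeEdge G i d) :=
  ((List.finite_length_le E d).subset (fun _ h => h.2.1) :
    {w : List E | IsWalk G i w ∧ w.length ≤ d ∧ w ≠ []}.Finite).to_subtype

instance [Finite E] (G : Graph V A E) (i : V) (d : ℕ) : Fintype (TreeBit G i d) :=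
  Fintype.ofFinite _

instance [Finite E] (G : Graph V A E) (i : V) (d : ℕ) : Fintype (TreeOth G i d) :=
  Fintype.ofFinite _

instance [Finite E] (G : Graph V A E) (i : V) (d : ℕ) : Fintype (TreeEdge G i d) :=
  Fintype.ofFinite _

/-- The computational tree `T_d(i)`: the universal cover of the graph truncated at distance `d`
from `i`. -/
def compTree (G : Graph V A E) (i : V) (d : ℕ) :
    Graph (TreeBit G i d) (TreeOth G i d) (TreeEdge G i d) where
  bit w :=
    if h : Even w.1.length then ⟨w.1, w.2.1, w.2.2.1, h⟩
    else ⟨w.1.tail, w.2.1.tail, by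
      have h1 := w.2.2.1
      rw [List.length_tail]; omega, by
      have h2 := List.length_pos_iff.2 w.2.2.2
      rw [List.length_tail]
      rw [Nat.even_iff] at h ⊢; omega⟩
  oth w :=
    if h : Odd w.1.length then ⟨w.1, w.2.1, w.2.2.1, h⟩
    else ⟨w.1.tail, w.2.1.tail, by
      have h1 := w.2.2.1
      rw [List.length_tail]; omega, by
      have h2 := List.length_pos_iff.2 w.2.2.2
      rw [List.length_tail]
      rw [Nat.odd_iff] at h ⊢; omega⟩

/-- The root of the computational tree. -/
def treeRoot (G : Graph V A E) (i : V) (d : ℕ) : TreeBit G i d :=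
  ⟨[], trivial, Nat.zero_le d, Even.zero⟩

/-- The projection `π` from the code-bit nodes of the computational tree to the graph. -/
def treeProj (G : Graph V A E) (i : V) (d : ℕ) (w : TreeBit G i d) : V :=
  match w.1 with
  | [] => i
  | e :: _ => G.bit e

open Classical in
/-- The extrinsic BP estimate `⟨x_i⟩^{BP}_{0,d}`: the estimate of the root for the code on the
computational tree, with half-loglikelihood `l_{π(ν)}` at the node `ν`, where `l_i = 0`. -/
def bpEstimate [Finite E] (κ : Kind) (G : Graph V A E) (i : V) (d : ℕ) (l : V → ℝ) : ℝ :=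
  softBit κ (compTree G i d) (fun ν => Function.update l i 0 (treeProj G i d ν)) (treeRoot G i d)

end Tree

/-! ### Degree distributions and random ensembles -/

/-- Generating function of a (node) degree distribution supported on `{1, …, dmax}`. -/
structure IsDegreeDist (q : ℝ[X]) (dmax : ℕ) : Prop where
  nonneg : ∀ k, 0 ≤ q.coeff k
  coeff_zero : q.coeff 0 = 0
  sum_one : q.eval 1 = 1
  bounded : q.natDegree ≤ dmax

/-- A sequence of degree sequences of bipartite multigraphs whose size goes to infinity and whose
empirical degree distributions converge to `q` (on the `n N` code-bit nodes) and to `r` (on the `m N`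
other nodes), with all degrees in `{1, …, qmax}` resp. `{1, …, rmax}`. -/
structure DegreeSequence (q r : ℝ[X]) (qmax rmax : ℕ) where
  n : ℕ → ℕ
  m : ℕ → ℕ
  bitDeg : ∀ N, Fin (n N) → ℕ
  othDeg : ∀ N, Fin (m N) → ℕ
  bitDeg_mem : ∀ N i, 1 ≤ bitDeg N i ∧ bitDeg N i ≤ qmax
  othDeg_mem : ∀ N a, 1 ≤ othDeg N a ∧ othDeg N a ≤ rmax
  sum_eq : ∀ N, ∑ i, bitDeg N i = ∑ a, othDeg N a
  n_tendsto : Tendsto n atTop atTop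
  bit_freq : ∀ k, Tendsto (fun N => ((Finset.univ.filter (fun i => bitDeg N i = k)).card : ℝ) / n N)
    atTop (𝓝 (q.coeff k))
  oth_freq : ∀ k, Tendsto (fun N => ((Finset.univ.filter (fun a => othDeg N a = k)).card : ℝ) / m N)
    atTop (𝓝 (r.coeff k))

section Ensemble

variable {n m : ℕ}

/-- The graph obtained by joining the sockets of the code-bit nodes to those of the other nodes
through the bijection `σ`. -/
def socketGraph (bd : Fin n → ℕ) (od : Fin m → ℕ) (σ : (Σ i, Fin (bd i)) ≃ (Σ a, Fin (od a))) :
    Graph (Fin n) (Fin m) (Σ i, Fin (bd i)) where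
  bit e := e.1
  oth e := (σ e).1

/-- The average `𝔼_C` over a uniformly random bijection between the sockets. -/
def ensembleAvg (bd : Fin n → ℕ) (od : Fin m → ℕ)
    (F : Graph (Fin n) (Fin m) (Σ i, Fin (bd i)) → ℝ) : ℝ :=
  (∑ σ : (Σ i, Fin (bd i)) ≃ (Σ a, Fin (od a)), F (socketGraph bd od σ)) /
    Fintype.card ((Σ i, Fin (bd i)) ≃ (Σ a, Fin (od a)))

end Ensemble

/-! ### GEXIT functions -/

/-- The normalisation of the GEXIT functions: `Λ'(1)/P'(1)` for LDGM, `1` for LDPC. -/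
def gexitNorm (κ : Kind) (Λ P : ℝ[X]) : ℝ :=
  match κ with
  | .ldgm => Λ.derivative.eval 1 / P.derivative.eval 1
  | .ldpc => 1

/-- `h_n` for one graph: the posterior entropy per code bit, averaged over the noise. -/
def noiseEntropy {n m : ℕ} {E : Type} [Fintype E] (κ : Kind) (Ch : Channel)
    (G : Graph (Fin n) (Fin m) E) (ε : ℝ) : ℝ :=
  (1 / n) * ∫ l, posteriorEntropy κ G l ∂(Measure.pi fun _ : Fin n => Ch.c ε)

/-- `𝔼_C[h_n]`. -/
def meanEntropy {n m : ℕ} (κ : Kind) (Ch : Channel) (bd : Fin n → ℕ) (od : Fin m → ℕ) (ε : ℝ) : ℝ :=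
  ensembleAvg bd od fun G => noiseEntropy κ Ch G ε

/-- The MAP-GEXIT function `g_n(ε)`. -/
def mapGexit {n m : ℕ} (κ : Kind) (Λ P : ℝ[X]) (Ch : Channel) (bd : Fin n → ℕ) (od : Fin m → ℕ)
    (ε : ℝ) : ℝ :=
  gexitNorm κ Λ P * deriv (meanEntropy κ Ch bd od) ε

/-- `∫ dl c_ε(l) 𝔼[ln ((1 + X tanh l)/(1 + tanh l))]`, where `X` has law `ρ`. -/
def gexitIntegral (Ch : Channel) (ρ : Measure ℝ) (ε : ℝ) : ℝ :=
  ∫ l, ∫ x, Real.log ((1 + x * Real.tanh l) / (1 + Real.tanh l)) ∂ρ ∂(Ch.c ε)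

/-- The GEXIT functional `∫ dl (dc_ε(l)/dε) 𝔼[ln ((1 + X tanh l)/(1 + tanh l))]` for an extrinsic
estimate `X` with law `ρ` (up to normalisation); the law of `X` is not differentiated. -/
def gexitFunctional (Ch : Channel) (ρ : Measure ℝ) (ε : ℝ) : ℝ := deriv (gexitIntegral Ch ρ) ε

/-- The law of the extrinsic BP estimate of the bit `i` under the noise. -/
def bpLaw {n m : ℕ} {E : Type} [Finite E] (κ : Kind) (Ch : Channel) (ε : ℝ)
    (G : Graph (Fin n) (Fin m) E) (i : Fin n) (d : ℕ) : Measure ℝ :=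
  (Measure.pi fun _ : Fin n => Ch.c ε).map (bpEstimate κ G i d)

/-- The BP-GEXIT function `g^{BP}_{n,d}(ε)`, averaged over the ensemble and over the bit `i`. -/
def bpGexit {n m : ℕ} (κ : Kind) (Λ P : ℝ[X]) (Ch : Channel) (bd : Fin n → ℕ) (od : Fin m → ℕ)
    (d : ℕ) (ε : ℝ) : ℝ :=
  ensembleAvg bd od fun G =>
    (1 / n) * ∑ i, gexitNorm κ Λ P * gexitFunctional Ch (bpLaw κ Ch ε G i d) ε

/-! ### Density evolution, for the hyperbolic tangents of the messages -/

/-- `tanh` of the sum of messages with hyperbolic tangents `t`. -/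
def sumMsg {k : ℕ} (t : Fin k → ℝ) : ℝ :=
  (∏ j, (1 + t j) - ∏ j, (1 - t j)) / (∏ j, (1 + t j) + ∏ j, (1 - t j))

/-- The product of hyperbolic tangents. -/
def prodMsg {k : ℕ} (t : Fin k → ℝ) : ℝ := ∏ j, t j

/-- Law of `f (t_1, …, t_k)`, `t_j` i.i.d. with law `μ`, `k` random with generating function `q`. -/
def nodeMix (q : ℝ[X]) (μ : Measure ℝ) (f : ∀ k : ℕ, (Fin k → ℝ) → ℝ) : Measure ℝ :=
  ∑ k ∈ q.support, ENNReal.ofReal (q.coeff k) • (Measure.pi fun _ : Fin k => μ).map (f k)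

/-- Law of `f (t_1, …, t_{k-1})`, `t_j` i.i.d. with law `μ`, `k` random with `k q_k / q'(1)`. -/
def edgeMix (q : ℝ[X]) (μ : Measure ℝ) (f : ∀ k : ℕ, (Fin k → ℝ) → ℝ) : Measure ℝ :=
  ∑ k ∈ q.support, ENNReal.ofReal (k * q.coeff k / q.derivative.eval 1) •
    (Measure.pi fun _ : Fin (k - 1) => μ).map (f (k - 1))

/-- Law of `tanh v^{(d)}` for LDGM ensembles, `v` a message from an information bit to a code bit:
`v^{(0)} = 0`, `tanh u^{(d+1)} = tanh l ∏ tanh v^{(d)}`, `v^{(d+1)} = ∑ u^{(d+1)}`. -/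
def ldgmMsg (Λ P : ℝ[X]) (τ : Measure ℝ) : ℕ → Measure ℝ
  | 0 => Measure.dirac 0
  | d + 1 => edgeMix Λ
      ((τ.prod (edgeMix P (ldgmMsg Λ P τ d) (fun _ => prodMsg))).map (fun z => z.1 * z.2))
      (fun _ => sumMsg)

/-- Law of `tanh λ^{(d)}` for LDPC ensembles, `λ` a message from a variable to a check:
`λ^{(0)} = l`, `tanh w^{(d+1)} = ∏ tanh λ^{(d)}`, `λ^{(d+1)} = l + ∑ w^{(d+1)}`. -/
def ldpcMsg (Λ P : ℝ[X]) (τ : Measure ℝ) : ℕ → Measure ℝ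
  | 0 => τ
  | d + 1 => (τ.prod (edgeMix Λ (edgeMix P (ldpcMsg Λ P τ d) (fun _ => prodMsg))
      (fun _ => sumMsg))).map (fun z => (z.1 + z.2) / (1 + z.1 * z.2))

/-- Law of the density evolution estimate of a code bit: `∏ tanh v^{(d)}` over the neighbours of a
code bit for LDGM, `tanh (∑ w^{(d+1)})` over the checks of a code bit for LDPC. -/
def deLaw (κ : Kind) (Λ P : ℝ[X]) (Ch : Channel) (ε : ℝ) (d : ℕ) : Measure ℝ :=
  match κ with
  | .ldgm => nodeMix P (ldgmMsg Λ P ((Ch.c ε).map Real.tanh) d) (fun _ => prodMsg)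
  | .ldpc => nodeMix Λ (edgeMix P (ldpcMsg Λ P ((Ch.c ε).map Real.tanh) d) (fun _ => prodMsg))
      (fun _ => sumMsg)

/-- The density evolution prediction of the GEXIT function after `d` iterations. -/
def deGexit (κ : Kind) (Λ P : ℝ[X]) (Ch : Channel) (ε : ℝ) (d : ℕ) : ℝ :=
  gexitNorm κ Λ P * gexitFunctional Ch (deLaw κ Λ P Ch ε d) ε

end

end SparseCode

/-!
Expanding the logarithm turns the GEXIT integral into a series in the even moments of `tanh l`
(`hasSum_gexit`). Class `K` bounds the derivatives of these moments uniformly, so a GEXIT function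
is a series `∑ T_{2p} a_p` (`gexitSum`) whose coefficients `a_p` depend on the moments of an
estimate. For symmetric noise the odd moments equal the next even ones, by the Nishimori identity
(`SignInvariant.nishimori`), hence `a_p = O(p⁻²)` and limits are taken term by term
(`tendsto_gexitSum`). The derivative of the posterior entropy is the GEXIT series of the extrinsic
MAP estimates (`hasDerivAt_logPart`, `hasDerivAt_meanEntropy`). It thus suffices to show that, for
each `q`, the ensemble averages of the `2q`-th moments of the MAP estimate, of the estimate of
belief propagation and of density evolution have the same limit.

*Sandwich.* Both codes are Gibbs averages over a group of words, and restricting the words to a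
subgroup increases the even moments of a bit estimate (`SignInvariant.wordMean_mono`). Freezing or
freeing the bits at the boundary of a tree-like neighbourhood of the root therefore places the
moments of the MAP estimate between those of belief propagation started from pessimistic and from
optimistic messages (`moment_lo_le_mapLaw`, `moment_mapLaw_le_hi`). On trees belief propagation is
exact, and the computational tree reproduces its messages (`codeMean_compTree`).

*Local limit.* A uniformly random matching of the half-edges is explored by resampling the partner
of one half-edge at a time. Up to an error of order `1 / n` the new partner lies at a node that has
not been visited before, so the messages that reach a bit are asymptotically independent with the
laws of density evolution (`abs_avg_incMsg_sub_le`, `tendsto_avg_root`). The same lemma, applied to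
messages that mark walks returning to their start, shows that few bits have a neighbourhood that is
not a tree (`tendsto_avg_return`). No decay of the coefficients is lost at these bits, because there
the estimate of belief propagation is `1` or stays away from `±1` in terms of finitely many
observations (`Tame.abs_gexitCoeff_le`).

*Contraction.* Started from the pessimistic law, density evolution increases in the degradation
order, and it stays below the iterates from the optimistic law. The gap between the two is measured
by the Bhattacharyya functional `𝔼 √(1 - X²)`, which controls all even moments. The functional is
multiplicative under the addition of half-loglikelihoods (`bh_box`), and multiplication by an
independent `Y` contracts its gaps by `𝔼 Y²` (`bh_gap_mul`). One iteration multiplies the gap by at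
most `lmax * kmax` and the factor contributed by the observation. The latter tends to `0` at high
noise for LDGM and at low noise for LDPC (`exists_high_noise`, `exists_low_noise`); hence density
evolution forgets its initial law (`exists_tendsto_moment_rootLaw`), and the two sides of the
sandwich have the same limit.
-/

namespace SparseCode

open Fintype (card card_fin)
open Real (abs_tanh_lt_one add_one_le_exp cosh cosh_pos dist_eq exp exp_add exp_le_exp exp_nonneg
  exp_pos exp_sum log log_div log_le_log negMulLog norm_eq_abs sqrt_pos tanh tanh_neg)
open Finset (abs_sum_le_sum_abs card_univ disjoint_left le_sup mem_filter mem_image mem_insert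
  mem_univ mul_prod_erase mul_sum ne_of_mem_erase notMem_empty prod_bij prod_congr prod_eq_one
  prod_eq_zero prod_filter prod_insert prod_mul_distrib prod_pos range single_le_sum sum_add_distrib
  sum_congr sum_const sum_const_zero sum_div sum_filter sum_le_sum sum_mul sum_nonneg sum_pos
  sum_sub_distrib univ)
open Function (Bijective Injective Involutive LeftInverse comp_apply comp_def onFun update_eq_self
  update_idem update_of_ne update_self)
open Function renaming update → upd
open MeasureTheory renaming IsProbabilityMeasure → IsProb, ProbabilityMeasure → Prob
open MeasureTheory.Measure (dirac isProbabilityMeasure_map pi)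
open Set (Icc)
open ENNReal (ofReal)
open Nat (not_odd_iff_even)
open List (exists_cons_of_ne_nil finRange length_cons mem_toFinset nodup_finRange replicate)

noncomputable section

/-! ### Hyperbolic tangents -/

@[fun_prop]
lemma continuous_tanh : Continuous tanh := by
  rw [show tanh = fun x => Real.sinh x / cosh x from funext Real.tanh_eq_sinh_div_cosh]
  exact Real.continuous_sinh.div Real.continuous_cosh fun x => (cosh_pos x).ne'

@[fun_prop]
lemma measurable_tanh : Measurable tanh := continuous_tanh.measurable

lemma measurable_ofReal_one_add_tanh :
    Measurable (fun l => ofReal (1 + tanh l)) := by fun_prop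

lemma one_add_tanh_pos (l : ℝ) : 0 < 1 + tanh l := by linarith [Real.neg_one_lt_tanh l]

lemma one_add_tanh (l : ℝ) : 1 + tanh l = 2 / (1 + exp (-2 * l)) := by
  have h : exp (-2 * l) = exp (-l) * exp (-l) := by rw [← exp_add]; ring_nf
  have h2 : exp l * exp (-l) = 1 := by rw [← exp_add]; simp
  rw [Real.tanh_eq, h]
  have := exp_pos l
  have := exp_pos (-l)
  grind

lemma one_sub_tanh (l : ℝ) : 1 - tanh l = 2 / (1 + exp (2 * l)) := by
  have h := one_add_tanh (-l)
  aesop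

lemma one_add_mul_spin_eq (l : ℝ) (s : ℤˣ) : exp (l * spin s) = cosh l * (1 + tanh l * spin s) := by
  rw [Real.tanh_eq_sinh_div_cosh]
  rcases Int.units_eq_one_or s with rfl | rfl
  · simp [spin]; field_simp; rw [← Real.cosh_add_sinh]
  · simp [spin]; field_simp; rw [← Real.cosh_sub_sinh]; ring

lemma abs_pow_le_one {x : ℝ} (h : |x| ≤ 1) (q : ℕ) : |x ^ q| ≤ 1 := by
  rw [abs_pow]; exact pow_le_one₀ (abs_nonneg _) h

lemma abs_sub_one_le_two {x : ℝ} (h : |x| ≤ 1) : |x - 1| ≤ 2 := by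
  rw [abs_le] at *; constructor <;> linarith

/-- Laws of half-loglikelihoods of symmetric channels: `c(dl) = (1 + tanh l) s(dl)` with an even
probability measure `s`. -/
def IsSymmNoise (c : Measure ℝ) : Prop :=
  ∃ s : Measure ℝ, IsProb s ∧ s.map (fun l => -l) = s ∧
    c = s.withDensity (fun l => ofReal (1 + tanh l))

lemma isSymmNoise_dirac : IsSymmNoise (dirac 0) := by
  refine ⟨dirac 0, inferInstance, ?_, ?_⟩
  · simp
  · ext t ht
    rw [withDensity_apply _ ht, ← lintegral_indicator ht,  lintegral_dirac]
    by_cases h : (0:ℝ) ∈ t <;> simp [h]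

/-- The tilting relation `c(-dl) = e^{-2l} c(dl)` gives the even part. -/
lemma isSymmNoise_of_tilt (c : Measure ℝ) [IsProb c]
    (h : c.map (fun l => -l) = c.withDensity (fun l => ofReal (exp (-2 * l)))) :
    IsSymmNoise c := by
  have hneg : Measurable (fun l : ℝ => -l) := measurable_neg
  have hp : IsProb (c.map (fun l => -l)) :=
    isProbabilityMeasure_map hneg.aemeasurable
  have hm := measurable_ofReal_one_add_tanh
  have hm2 : Measurable (fun l : ℝ => ofReal (exp (-2 * l))) := by fun_prop
  refine ⟨(2⁻¹ : ENNReal) • (c + c.map (fun l => -l)), ⟨?_⟩, ?_, ?_⟩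
  · simp only [Measure.smul_apply, Measure.add_apply, measure_univ, smul_eq_mul]
    rw [one_add_one_eq_two]
    exact ENNReal.inv_mul_cancel (by simp) (by simp)
  · rw [Measure.map_smul, Measure.map_add _ _ hneg, Measure.map_map hneg hneg]
    simp [add_comm]
  · rw [h, withDensity_smul_measure, withDensity_add_measure, ← withDensity_mul _ hm2 hm]
    rw [← withDensity_add_left hm, ← withDensity_smul _ (by fun_prop)]
    conv_lhs => rw [← withDensity_one (μ := c)]
    congr 1
    ext l
    simp only [Pi.one_apply, Pi.smul_apply, Pi.add_apply, Pi.mul_apply, smul_eq_mul]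
    have h1 := one_add_tanh_pos l
    have h2 := exp_pos (-2 * l)
    rw [← ENNReal.ofReal_mul h2.le, ← ENNReal.ofReal_add h1.le (by positivity),
      show (2⁻¹ : ENNReal) = ofReal (2⁻¹) by
        rw [ENNReal.ofReal_inv_of_pos (by norm_num)]; simp,
      ← ENNReal.ofReal_mul (by norm_num), one_add_tanh]
    rw [eq_comm, ENNReal.ofReal_eq_one]
    field_simp

lemma Channel.halfLLR_neg (Ch : Channel) (hK : Ch.ClassK) {ε : ℝ} (hε : ε ∈ Ch.dom) :
    ∀ᵐ y ∂(Ch.W ε 1), Ch.halfLLR ε (-y) = - Ch.halfLLR ε y := by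
  have := Ch.prob ε hε.1 hε.2
  have hs := Ch.symm ε hε.1 hε.2
  have e1 : Ch.W ε (-1) = (Ch.W ε 1).map (MeasurableEquiv.neg ℝ) := by simpa using hs 1
  have e2 : Ch.W ε 1 = (Ch.W ε (-1)).map (MeasurableEquiv.neg ℝ) := by simpa using hs (-1)
  have hemb := (MeasurableEquiv.neg ℝ).measurableEmbedding
  have h := hemb.rnDeriv_map (Ch.W ε (-1)) (Ch.W ε 1)
  rw [← e1, ← e2] at h
  have hac : Ch.W ε 1 ≪ Ch.W ε (-1) := hK.finite_llr ε hε
  have hn := neg_llr hac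
  filter_upwards [h, hn] with y hy hn
  simp only [Channel.halfLLR, llr] at hn ⊢
  simp at hn
  have : (Ch.W ε 1).rnDeriv (Ch.W ε (-1)) (-y) = (Ch.W ε (-1)).rnDeriv (Ch.W ε 1) y := hy
  rw [this, ← hn]
  simp only [llr]
  ring

lemma Channel.measurable_halfLLR (Ch : Channel) (ε : ℝ) : Measurable (Ch.halfLLR ε) :=
  (measurable_llr _ _).const_mul _

lemma Channel.isProb_c (Ch : Channel) {ε : ℝ} (hε : ε ∈ Ch.dom) :
    IsProb (Ch.c ε) := by
  have := Ch.prob ε hε.1 hε.2 1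
  exact isProbabilityMeasure_map (Ch.measurable_halfLLR ε).aemeasurable

lemma Channel.c_tilt (Ch : Channel) (hK : Ch.ClassK) {ε : ℝ} (hε : ε ∈ Ch.dom) :
    (Ch.c ε).map (fun l => -l) = (Ch.c ε).withDensity (fun l => ofReal (exp (-2 * l))) := by
  have hprob := Ch.prob ε hε.1 hε.2
  have hs := Ch.symm ε hε.1 hε.2
  have e1 : Ch.W ε (-1) = (Ch.W ε 1).map (fun y => -y) := hs 1
  have hm := Ch.measurable_halfLLR ε
  have hneg : Measurable (fun l : ℝ => -l) := measurable_neg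
  have hac : Ch.W ε 1 ≪ Ch.W ε (-1) := hK.finite_llr ε hε
  have hac' : Ch.W ε (-1) ≪ Ch.W ε 1 := by
    have h2 : Ch.W ε 1 = (Ch.W ε (-1)).map (fun y => -y) := by simpa using hs (-1)
    have := hac.map hneg
    rwa [← h2, ← e1] at this
  have hodd := Ch.halfLLR_neg hK hε
  -- the law of `-l` under the input `+1` is the law of `l` under the input `-1`
  have h1 : (Ch.c ε).map (fun l => -l) = (Ch.W ε (-1)).map (Ch.halfLLR ε) := by
    rw [e1, Channel.c, Measure.map_map hneg hm, Measure.map_map hm hneg]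
    refine Measure.map_congr ?_
    filter_upwards [hodd] with y hy
    simp [hy]
  have h2 : (Ch.W ε 1).withDensity
      (fun y => ofReal (exp (-2 * Ch.halfLLR ε y))) = Ch.W ε (-1) := by
    rw [← Measure.withDensity_rnDeriv_eq _ _ hac']
    refine withDensity_congr_ae ?_
    filter_upwards [exp_neg_llr hac, Measure.rnDeriv_lt_top (Ch.W ε (-1)) (Ch.W ε 1)] with y hy hy2
    rw [← ENNReal.ofReal_toReal hy2.ne, ← hy]
    simp [Channel.halfLLR]
  rw [h1, ← h2]
  ext t ht
  have hmd : Measurable (fun l : ℝ => ofReal (exp (-2 * l))) := by fun_prop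
  rw [Measure.map_apply hm ht, withDensity_apply _ (hm ht), withDensity_apply _ ht, Channel.c,
    setLIntegral_map ht hmd hm]

lemma Channel.isSymmNoise_c (Ch : Channel) (hK : Ch.ClassK) {ε : ℝ} (hε : ε ∈ Ch.dom) :
    IsSymmNoise (Ch.c ε) := by
  have := Ch.isProb_c hε
  exact isSymmNoise_of_tilt _ (Ch.c_tilt hK hε)

lemma Channel.isOpen_dom (Ch : Channel) : IsOpen Ch.dom :=
  (isOpen_lt continuous_const continuous_id).inter
    (isOpen_lt continuous_coe_real_ereal continuous_const)

lemma Channel.exp_abs_integrable (Ch : Channel) (hK : Ch.ClassK) {ε : ℝ} (hε : ε ∈ Ch.dom) :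
    Integrable (fun l => |l|) (Ch.c ε) := by
  refine (hK.exp_moment ε hε 1 one_pos).mono' (by fun_prop) (ae_of_all _ fun l => ?_)
  simp
  linarith [add_one_le_exp |l|]

namespace IsSymmNoise

variable {c : Measure ℝ}

lemma integral_eq_even {s : Measure ℝ}
    (hc : c = s.withDensity (fun l => ofReal (1 + tanh l))) (f : ℝ → ℝ) :
    ∫ l, f l ∂c = ∫ l, (1 + tanh l) * f l ∂s := by
  rw [hc, integral_withDensity_eq_integral_toReal_smul
    measurable_ofReal_one_add_tanh (ae_of_all _ fun _ => by simp)]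
  congr with l
  simp [ENNReal.toReal_ofReal (one_add_tanh_pos l).le]

lemma integral_neg_eq {s : Measure ℝ} (hs : s.map (fun l => -l) = s) (f : ℝ → ℝ) :
    ∫ l, f (-l) ∂s = ∫ l, f l ∂s := by
  conv_rhs => rw [← hs]
  exact ((MeasurableEquiv.neg ℝ).measurableEmbedding.integral_map f).symm

lemma integrable_tanh_pow (s : Measure ℝ) [IsFiniteMeasure s] (k : ℕ) :
    Integrable (fun l => tanh l ^ k) s := by
  refine Integrable.of_bound (C := 1) ((measurable_tanh.pow_const k).aestronglyMeasurable)
    (ae_of_all _ fun l => abs_pow_le_one (abs_tanh_lt_one l).le k)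

lemma even_integral_odd {s : Measure ℝ} (hs : s.map (fun l => -l) = s) {k : ℕ} (hk : Odd k) :
    ∫ l, tanh l ^ k ∂s = 0 := by
  have h := integral_neg_eq hs (fun l => tanh l ^ k)
  simp only [tanh_neg, hk.neg_pow, integral_neg] at h
  linarith

lemma even_integral_even {s : Measure ℝ} [IsProb s] (hs : s.map (fun l => -l) = s)
    (hc : c = s.withDensity (fun l => ofReal (1 + tanh l))) {k : ℕ} (hk : Even k) :
    ∫ l, tanh l ^ k ∂s = ∫ l, tanh l ^ k ∂c := by
  rw [integral_eq_even hc]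
  have : ∀ l, (1 + tanh l) * tanh l ^ k = tanh l ^ k + tanh l ^ (k + 1) := by grind
  simp_rw [this]
  rw [integral_add (integrable_tanh_pow s k) (integrable_tanh_pow s _),
    even_integral_odd hs hk.add_one, add_zero]

/-- Odd moments of `tanh l` agree with the next even ones. -/
lemma moment_odd (h : IsSymmNoise c) {k : ℕ} (hk : Odd k) :
    ∫ l, tanh l ^ k ∂c = ∫ l, tanh l ^ (k + 1) ∂c := by
  obtain ⟨s, hp, hs, hc⟩ := h
  rw [← even_integral_even hs hc hk.add_one, integral_eq_even hc]
  have : ∀ l, (1 + tanh l) * tanh l ^ k = tanh l ^ k + tanh l ^ (k + 1) := by grind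
  simp_rw [this]
  rw [integral_add (integrable_tanh_pow s k) (integrable_tanh_pow s _),
    even_integral_odd hs hk, zero_add]

lemma isProb (h : IsSymmNoise c) : IsProb c := by
  obtain ⟨s, hp, hs, hc⟩ := h
  have h1 : ∫⁻ l, ofReal (1 + tanh l) ∂s = 1 := by
    rw [← ofReal_integral_eq_lintegral_ofReal, integral_add (integrable_const _)
      (by simpa using integrable_tanh_pow s 1)]
    · have := even_integral_odd hs (k := 1) odd_one
      simp at this
      simp [this]
    · exact (integrable_const _).add (by simpa using integrable_tanh_pow s 1)
    · exact ae_of_all _ fun l => (one_add_tanh_pos l).le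
  exact ⟨by rw [hc, withDensity_apply _ MeasurableSet.univ]; simpa using h1⟩

end IsSymmNoise

/-! ### The GEXIT functional as a power series -/

lemma neg_log_one_sub_abs_tanh_le (l : ℝ) : -log (1 - |tanh l|) ≤ 2 * |l| := by
  have h : |tanh l| = tanh |l| := by
    rcases le_total 0 l with h | h
    · rw [abs_of_nonneg h, abs_of_nonneg]
      rw [Real.tanh_eq_sinh_div_cosh]
      exact div_nonneg (Real.sinh_nonneg_iff.2 h) (cosh_pos l).le
    · rw [abs_of_nonpos h, tanh_neg, abs_of_nonpos]
      rw [Real.tanh_eq_sinh_div_cosh]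
      exact div_nonpos_of_nonpos_of_nonneg (Real.sinh_nonpos_iff.2 h) (cosh_pos l).le
  rw [h, one_sub_tanh, ← Real.log_inv, inv_div]
  rw [Real.log_le_iff_le_exp (by positivity)]
  have : 1 ≤ exp (2 * |l|) := Real.one_le_exp (by positivity)
  linarith

/-- `∑ 𝔼|Y|^k / k ≤ 𝔼[-ln (1 - |Y|)]`. -/
lemma summable_integral_abs_pow {Ω : Type*} [MeasurableSpace Ω] {μ : Measure Ω}
    [IsFiniteMeasure μ] {Y g : Ω → ℝ} (hY : Measurable Y) (hY1 : ∀ ω, |Y ω| < 1)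
    (hg : Integrable g μ) (h : ∀ ω, -log (1 - |Y ω|) ≤ g ω) :
    Summable (fun k : ℕ => (∫ ω, |Y ω| ^ (k + 1) ∂μ) / (k + 1)) := by
  have hint : ∀ k : ℕ, Integrable (fun ω => |Y ω| ^ (k + 1) / (k + 1)) μ := fun k => by
    refine Integrable.div_const (Integrable.of_bound (C := 1)
      ((hY.abs.pow_const _).aestronglyMeasurable) (ae_of_all _ fun ω => ?_)) _
    rw [norm_eq_abs, abs_pow, abs_abs]
    exact pow_le_one₀ (abs_nonneg _) (hY1 ω).le
  refine summable_of_sum_range_le (c := ∫ ω, g ω ∂μ)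
    (fun k => div_nonneg (integral_nonneg fun ω => by positivity) (by positivity)) fun n => ?_
  simp_rw [← integral_div]
  rw [← integral_finsetSum _ (fun k _ => hint k)]
  refine integral_mono (integrable_finsetSum _ fun k _ => hint k) hg fun ω => ?_
  have hs := Real.hasSum_pow_div_log_of_abs_lt_one (x := |Y ω|) (by simpa using hY1 ω)
  exact (sum_le_hasSum _ (fun k _ => by positivity) hs).trans (h ω)

/-- The `q`-th moment of a law. -/
def moment (ρ : Measure ℝ) (q : ℕ) : ℝ := ∫ x, x ^ q ∂ρ

/-- The coefficient of `∫ c(l) (tanh l)^{2(p+1)}` in the GEXIT integral of the law `ρ`. -/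
def gexitCoeff (ρ : Measure ℝ) (p : ℕ) : ℝ :=
  moment ρ (2 * p + 1) / (2 * p + 1) - moment ρ (2 * p + 2) / (2 * p + 2) -
    1 / ((2 * p + 1) * (2 * p + 2))

lemma ae_abs_le_of_forall {Ω : Type*} [MeasurableSpace Ω] {μ : Measure Ω} {f : Ω → ℝ}
    (h : ∀ ω, |f ω| ≤ 1) : ∀ᵐ x ∂(μ.map f), |x| ≤ 1 := by
  by_cases hf : AEMeasurable f μ
  · exact (ae_map_iff hf (p := fun x => |x| ≤ 1)
      (measurableSet_le (by fun_prop) measurable_const)).2 (ae_of_all _ h)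
  · simp [Measure.map_of_not_aemeasurable hf]

lemma integrable_pow_of_abs_le_one {ρ : Measure ℝ} [IsFiniteMeasure ρ]
    (hρ : ∀ᵐ x ∂ρ, |x| ≤ 1) (q : ℕ) : Integrable (fun x => x ^ q) ρ :=
  .of_bound (C := 1) (by fun_prop) (hρ.mono fun x hx => abs_pow_le_one hx q)

lemma abs_moment_le_one {ρ : Measure ℝ} [IsProb ρ]
    (hρ : ∀ᵐ x ∂ρ, |x| ≤ 1) (q : ℕ) : |moment ρ q| ≤ 1 := by
  have := norm_integral_le_of_norm_le_const (μ := ρ) (f := fun x => x ^ q) (C := 1)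
    (hρ.mono fun x hx => abs_pow_le_one hx q)
  simpa [moment] using this

lemma summable_tanh_moments {c : Measure ℝ} [IsFiniteMeasure c]
    (hc1 : Integrable (fun l => |l|) c) :
    Summable (fun k : ℕ => (∫ l, |tanh l| ^ (k + 1) ∂c) / (k + 1)) :=
  summable_integral_abs_pow measurable_tanh abs_tanh_lt_one (hc1.const_mul 2)
    neg_log_one_sub_abs_tanh_le

lemma norm_log_term_le {t a : ℝ} (ha : |a| ≤ 1) (k : ℕ) :
    ‖(-1) ^ k * t ^ (k + 1) * (a - 1) / ((k : ℝ) + 1)‖ ≤ 2 * (|t| ^ (k + 1) / (k + 1)) := by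
  have := abs_sub_one_le_two ha
  rw [norm_eq_abs, abs_div, abs_mul, abs_mul, abs_pow, abs_neg, abs_one, one_pow, one_mul, abs_pow,
    abs_of_pos (by positivity : (0 : ℝ) < k + 1), ← mul_div_assoc, mul_comm (2 : ℝ)]
  gcongr

lemma hasSum_gexit_inner {ρ : Measure ℝ} [IsProb ρ] (hρ : ∀ᵐ x ∂ρ, |x| ≤ 1)
    {t : ℝ} (ht : |t| < 1) :
    HasSum (fun k : ℕ => (-1) ^ k * t ^ (k + 1) * (moment ρ (k + 1) - 1) / (k + 1))
      (∫ x, log ((1 + x * t) / (1 + t)) ∂ρ) := by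
  have hlog : ∀ y : ℝ, |y| < 1 →
      HasSum (fun k : ℕ => (-1) ^ k * y ^ (k + 1) / (k + 1)) (log (1 + y)) := by
    intro y hy
    have h := (Real.hasSum_pow_div_log_of_abs_lt_one (x := -y) (by simpa using hy)).neg
    rw [neg_neg, sub_neg_eq_add] at h
    refine h.congr_fun fun k => ?_
    ring
  have hxt : ∀ x : ℝ, |x| ≤ 1 → |x * t| < 1 := fun x hx => by
    rw [abs_mul]; exact (mul_le_of_le_one_left (abs_nonneg _) hx).trans_lt ht
  have hpt : ∀ᵐ x ∂ρ, HasSum (fun k : ℕ => (-1) ^ k * t ^ (k + 1) * (x ^ (k + 1) - 1) / (k + 1))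
      (log ((1 + x * t) / (1 + t))) := by
    filter_upwards [hρ] with x hx
    have h1 := hxt x hx
    rw [log_div (by linarith [(abs_lt.1 h1).1]) (by linarith [(abs_lt.1 ht).1])]
    refine ((hlog _ h1).sub (hlog _ ht)).congr_fun fun k => ?_
    rw [mul_pow]; ring
  have hint : ∀ k : ℕ, Integrable
      (fun x => (-1) ^ k * t ^ (k + 1) * (x ^ (k + 1) - 1) / ((k : ℝ) + 1)) ρ := fun k =>
    (((integrable_pow_of_abs_le_one hρ _).sub (integrable_const _)).const_mul _).div_const _
  have hsum : Summable (fun k : ℕ => ∫ x, ‖(-1) ^ k * t ^ (k + 1) * (x ^ (k + 1) - 1) /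
      ((k : ℝ) + 1)‖ ∂ρ) := by
    refine Summable.of_nonneg_of_le (fun k => integral_nonneg fun _ => norm_nonneg _) (fun k => ?_)
      ((Real.hasSum_pow_div_log_of_abs_lt_one (x := |t|) (by simpa using ht)).summable.mul_left 2)
    have := norm_integral_le_of_norm_le_const (μ := ρ)
      (f := fun x => ‖(-1) ^ k * t ^ (k + 1) * (x ^ (k + 1) - 1) / ((k : ℝ) + 1)‖)
      (C := 2 * (|t| ^ (k + 1) / (k + 1))) (hρ.mono fun x hx => by
        rw [norm_norm]; exact norm_log_term_le (abs_pow_le_one hx _) k)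
    rw [probReal_univ, mul_one] at this
    exact (le_abs_self _).trans this
  have := hasSum_integral_of_summable_integral_norm hint hsum
  have e : ∫ x, ∑' k : ℕ, (-1) ^ k * t ^ (k + 1) * (x ^ (k + 1) - 1) / ((k : ℝ) + 1) ∂ρ =
      ∫ x, log ((1 + x * t) / (1 + t)) ∂ρ :=
    integral_congr_ae (hpt.mono fun x hx => hx.tsum_eq)
  rw [e] at this
  refine this.congr_fun fun k => ?_
  rw [integral_div, integral_const_mul, integral_sub (integrable_pow_of_abs_le_one hρ _)
    (integrable_const _)]
  simp [moment]

/-- Expansion of the GEXIT integral in the even moments of `tanh l`; odd moments of `tanh l` are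
paired with the next even ones, to which they are equal. -/
lemma hasSum_gexit {c ρ : Measure ℝ} (hc : IsSymmNoise c) (hc1 : Integrable (fun l => |l|) c)
    [IsProb ρ] (hρ : ∀ᵐ x ∂ρ, |x| ≤ 1) :
    HasSum (fun p : ℕ => (∫ l, tanh l ^ (2 * (p + 1)) ∂c) * gexitCoeff ρ p)
      (∫ l, ∫ x, log ((1 + x * tanh l) / (1 + tanh l)) ∂ρ ∂c) := by
  have := hc.isProb
  obtain ⟨F, hF⟩ : ∃ F : ℕ → ℝ → ℝ, F = fun k l =>
    (-1) ^ k * tanh l ^ (k + 1) * (moment ρ (k + 1) - 1) / ((k : ℝ) + 1) := ⟨_, rfl⟩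
  have hint : ∀ k, Integrable (F k) c := fun k => by
    rw [hF]
    exact (((IsSymmNoise.integrable_tanh_pow c (k + 1)).const_mul _).mul_const _).div_const _
  have hb : ∀ k l, ‖F k l‖ ≤ 2 * (|tanh l| ^ (k + 1) / (k + 1)) := fun k l => by
    rw [hF]
    exact norm_log_term_le (abs_moment_le_one hρ _) k
  have hint2 : ∀ k : ℕ, Integrable (fun l => 2 * (|tanh l| ^ (k + 1) / ((k : ℝ) + 1))) c :=
    fun k => (((IsSymmNoise.integrable_tanh_pow c (k + 1)).abs.congr
      (ae_of_all _ fun l => abs_pow _ _)).div_const _).const_mul _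
  have hsum : Summable (fun k : ℕ => ∫ l, ‖F k l‖ ∂c) := by
    refine Summable.of_nonneg_of_le (fun k => integral_nonneg fun _ => norm_nonneg _) (fun k => ?_)
      ((summable_tanh_moments hc1).mul_left 2)
    rw [← integral_div, ← integral_const_mul]
    exact integral_mono (hint k).norm (hint2 k) (hb k)
  have h := hasSum_integral_of_summable_integral_norm hint hsum
  have e : ∫ l, ∑' k, F k l ∂c =
      ∫ l, ∫ x, log ((1 + x * tanh l) / (1 + tanh l)) ∂ρ ∂c :=
    integral_congr_ae (ae_of_all _ fun l =>
      by rw [hF]; exact (hasSum_gexit_inner hρ (abs_tanh_lt_one l)).tsum_eq)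
  rw [e] at h
  have h1 : Summable (fun p : ℕ => ∫ l, F (2 * p) l ∂c) :=
    h.summable.comp_injective (i := fun p : ℕ => 2 * p) fun a b hab => by simpa using hab
  have h2 : Summable (fun p : ℕ => ∫ l, F (2 * p + 1) l ∂c) :=
    h.summable.comp_injective (i := fun p : ℕ => 2 * p + 1) fun a b hab => by simpa using hab
  have h3 := h1.hasSum.add h2.hasSum
  rw [tsum_even_add_odd (f := fun k => ∫ l, F k l ∂c) h1 h2, h.tsum_eq] at h3
  refine h3.congr_fun fun p => ?_
  simp only [hF]
  rw [integral_div, integral_mul_const, integral_const_mul, integral_div, integral_mul_const,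
    integral_const_mul, hc.moment_odd (k := 2 * p + 1) ⟨p, rfl⟩, gexitCoeff]
  rw [show 2 * p + 1 + 1 = 2 * (p + 1) by ring, (even_two_mul p).neg_one_pow,
    (even_two_mul p).add_one.neg_one_pow]
  push_cast
  have a1 : (2 * (p : ℝ) + 1) ≠ 0 := by positivity
  have a2 : (2 * (p : ℝ) + 1 + 1) ≠ 0 := by positivity
  have a3 : (2 * (p : ℝ) + 2) ≠ 0 := by positivity
  field_simp
  ring

/-- `∑_{p ≥ 1} T_{2p}(ε) a_p`, with the sequence `a` indexed from `0`. -/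
def gexitSum (Ch : Channel) (ε : ℝ) (a : ℕ → ℝ) : ℝ :=
  ∑' p, deriv (Ch.tanhMoment (p + 1)) ε * a p

lemma Channel.ClassK.local_bound {Ch : Channel} (hK : Ch.ClassK) {ε : ℝ} (hε : ε ∈ Ch.dom) :
    ∃ r > 0, ∃ B : ℝ, Metric.ball ε r ⊆ Ch.dom ∧ ∀ p : ℕ, ∀ y ∈ Metric.ball ε r,
      |deriv (Ch.tanhMoment (p + 1)) y| ≤ B := by
  obtain ⟨r, hr, hsub⟩ := Metric.nhds_basis_closedBall.mem_iff.1 (Ch.isOpen_dom.mem_nhds hε)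
  obtain ⟨B, hB⟩ := hK.T_bounded _ hsub (isCompact_closedBall ε r)
  exact ⟨r, hr, B, Metric.ball_subset_closedBall.trans hsub,
    fun p y hy => hB (p + 1) (by omega) y (Metric.ball_subset_closedBall hy)⟩

lemma hasDerivAt_gexitIntegral {Ch : Channel} (hK : Ch.ClassK) {ε : ℝ} (hε : ε ∈ Ch.dom)
    {ρ : Measure ℝ} [IsProb ρ] (hρ : ∀ᵐ x ∂ρ, |x| ≤ 1)
    (hs : Summable (gexitCoeff ρ)) :
    HasDerivAt (gexitIntegral Ch ρ) (gexitSum Ch ε (gexitCoeff ρ)) ε := by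
  obtain ⟨r, hr, B, hsub, hB⟩ := hK.local_bound hε
  have hsum : ∀ y ∈ Ch.dom, HasSum (fun p => Ch.tanhMoment (p + 1) y * gexitCoeff ρ p)
      (gexitIntegral Ch ρ y) := fun y hy =>
    hasSum_gexit (Ch.isSymmNoise_c hK hy) (Ch.exp_abs_integrable hK hy) hρ
  have h := hasDerivAt_tsum_of_isPreconnected (𝕜 := ℝ)
    (hs.abs.mul_left B) Metric.isOpen_ball (convex_ball ε r).isPreconnected
    (fun p y hy => ((hK.T_exists (p + 1) (by omega) y (hsub hy)).hasDerivAt).mul_const _)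
    (fun p y hy => by
      rw [norm_mul, norm_eq_abs, norm_eq_abs]
      exact mul_le_mul_of_nonneg_right (hB p y hy) (abs_nonneg _))
    (Metric.mem_ball_self hr) (hsum ε hε).summable (Metric.mem_ball_self hr)
  refine h.congr_of_eventuallyEq ?_
  filter_upwards [Metric.ball_mem_nhds ε hr] with y hy
  exact ((hsum y (hsub hy)).tsum_eq).symm

/-- The coefficients when the odd moments agree with the next even ones. -/
lemma gexitCoeff_of_symm {ρ : Measure ℝ}
    (h : ∀ p, moment ρ (2 * p + 1) = moment ρ (2 * p + 2)) (p : ℕ) :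
    gexitCoeff ρ p = (moment ρ (2 * p + 2) - 1) / ((2 * p + 1) * (2 * p + 2)) := by
  rw [gexitCoeff, h]
  grind

lemma summable_inv_odd_mul_even :
    Summable (fun p : ℕ => 1 / ((2 * (p : ℝ) + 1) * (2 * p + 2))) := by
  refine Summable.of_nonneg_of_le (fun p => by positivity) (fun p => ?_)
    ((summable_nat_add_iff 1).2 (Real.summable_one_div_nat_pow.2 (one_lt_two)))
  push_cast
  gcongr
  nlinarith [(Nat.cast_nonneg p : (0 : ℝ) ≤ p)]

lemma abs_gexitCoeff_le_of_symm {ρ : Measure ℝ} [IsProb ρ] (hρ : ∀ᵐ x ∂ρ, |x| ≤ 1)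
    (h : ∀ p, moment ρ (2 * p + 1) = moment ρ (2 * p + 2)) (p : ℕ) :
    |gexitCoeff ρ p| ≤ 2 * (1 / ((2 * (p : ℝ) + 1) * (2 * p + 2))) := by
  rw [gexitCoeff_of_symm h, abs_div, ← mul_div_assoc, mul_one,
    abs_of_pos (by positivity : (0 : ℝ) < (2 * p + 1) * (2 * p + 2))]
  gcongr
  exact abs_sub_one_le_two (abs_moment_le_one hρ _)

lemma summable_gexitCoeff_of_symm {ρ : Measure ℝ} [IsProb ρ] (hρ : ∀ᵐ x ∂ρ, |x| ≤ 1)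
    (h : ∀ p, moment ρ (2 * p + 1) = moment ρ (2 * p + 2)) : Summable (gexitCoeff ρ) :=
  .of_norm_bounded (summable_inv_odd_mul_even.mul_left 2) (abs_gexitCoeff_le_of_symm hρ h)

/-- Dominated convergence for the GEXIT series. -/
lemma tendsto_gexitSum {Ch : Channel} (hK : Ch.ClassK) {ε : ℝ} (hε : ε ∈ Ch.dom)
    {ι : Type*} {F : Filter ι} {a : ι → ℕ → ℝ} {a₀ u : ℕ → ℝ} (hu : Summable u)
    (hb : ∀ᶠ i in F, ∀ p, |a i p| ≤ u p) (h : ∀ p, Tendsto (fun i => a i p) F (𝓝 (a₀ p))) :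
    Tendsto (fun i => gexitSum Ch ε (a i)) F (𝓝 (gexitSum Ch ε a₀)) := by
  obtain ⟨r, hr, B, hsub, hB⟩ := hK.local_bound hε
  refine tendsto_tsum_of_dominated_convergence (bound := fun p => B * u p) (hu.mul_left B)
    (fun p => (h p).const_mul _) ?_
  filter_upwards [hb] with i hi p
  rw [norm_mul, norm_eq_abs, norm_eq_abs]
  exact mul_le_mul (hB p ε (Metric.mem_ball_self hr)) (hi p) (abs_nonneg _)
    ((abs_nonneg _).trans (hB p ε (Metric.mem_ball_self hr)))

/-! ### Spin systems given by a group of words -/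

lemma spin_one : spin 1 = 1 := by simp [spin]

lemma spin_mul (a b : ℤˣ) : spin (a * b) = spin a * spin b := by simp [spin]

lemma spin_sq (a : ℤˣ) : spin a * spin a = 1 := by
  rcases Int.units_eq_one_or a with rfl | rfl <;> simp [spin]

lemma abs_spin (a : ℤˣ) : |spin a| = 1 := by
  rcases Int.units_eq_one_or a with rfl | rfl <;> simp [spin]

section

variable {V U : Type} [Fintype V]

/-- Weight of the word `x` for the observations `t = tanh l`. -/
def wordWeight (x : V → ℤˣ) (t : V → ℝ) : ℝ := ∏ j, (1 + t j * spin (x j))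

/-- Componentwise hyperbolic tangent. -/
def tanhs (l : V → ℝ) : V → ℝ := fun j => tanh (l j)

omit [Fintype V] in
lemma measurable_tanhs : Measurable (tanhs : (V → ℝ) → V → ℝ) :=
  measurable_pi_lambda _ fun j => measurable_tanh.comp (measurable_pi_apply j)

/-- Change of the signs of the observations according to a word. -/
def flipBy (x : V → ℤˣ) (t : V → ℝ) : V → ℝ := fun j => t j * spin (x j)

omit [Fintype V] in
lemma measurable_flipBy (x : V → ℤˣ) : Measurable (flipBy x) :=
  measurable_pi_lambda _ fun j => (measurable_pi_apply j).mul_const _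

omit [Fintype V] in
lemma tanhs_flipBy (x : V → ℤˣ) (l : V → ℝ) : tanhs (flipBy x l) = flipBy x (tanhs l) := by
  ext j
  simp only [tanhs, flipBy]
  rcases Int.units_eq_one_or (x j) with h | h <;> simp [h, spin]

omit [Fintype V] in
lemma flipBy_flipBy (x y : V → ℤˣ) (t : V → ℝ) : flipBy x (flipBy y t) = flipBy (y * x) t := by
  ext j; simp [flipBy, spin_mul, mul_assoc]

lemma wordWeight_flipBy (x y : V → ℤˣ) (t : V → ℝ) :
    wordWeight x (flipBy y t) = wordWeight (y * x) t := by
  simp [wordWeight, flipBy, spin_mul, mul_assoc]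

lemma wordWeight_nonneg (x : V → ℤˣ) {t : V → ℝ} (ht : ∀ j, |t j| ≤ 1) : 0 ≤ wordWeight x t := by
  refine Finset.prod_nonneg fun j _ => ?_
  have : |t j * spin (x j)| ≤ 1 := by rw [abs_mul, abs_spin, mul_one]; exact ht j
  linarith [(abs_le.1 this).1]

lemma wordWeight_pos (x : V → ℤˣ) {t : V → ℝ} (ht : ∀ j, |t j| < 1) : 0 < wordWeight x t := by
  refine prod_pos fun j _ => ?_
  have : |t j * spin (x j)| < 1 := by rw [abs_mul, abs_spin, mul_one]; exact ht j
  linarith [(abs_lt.1 this).1]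

lemma wordWeight_tanhs_pos (x : V → ℤˣ) (l : V → ℝ) : 0 < wordWeight x (tanhs l) :=
  wordWeight_pos x fun _ => abs_tanh_lt_one _

lemma wordWeight_le (x : V → ℤˣ) {t : V → ℝ} (ht : ∀ j, |t j| ≤ 1) :
    wordWeight x t ≤ 2 ^ card V := by
  rw [← card_univ, ← Finset.prod_const]
  refine Finset.prod_le_prod (fun j _ => ?_) fun j _ => ?_ <;>
  · have : |t j * spin (x j)| ≤ 1 := by rw [abs_mul, abs_spin, mul_one]; exact ht j
    grind

lemma continuous_wordWeight (x : V → ℤˣ) : Continuous (wordWeight x) := by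
  unfold wordWeight; fun_prop

variable [Fintype U]

/-- Partition function of the words `χ g`, `g ∈ U`. -/
def partFn (χ : U → V → ℤˣ) (t : V → ℝ) : ℝ := ∑ g, wordWeight (χ g) t

/-- Unnormalised mean of the spin `i`. -/
def partNum (χ : U → V → ℤˣ) (i : V) (t : V → ℝ) : ℝ := ∑ g, spin (χ g i) * wordWeight (χ g) t

/-- Gibbs mean of the spin `i`. -/
def wordMean (χ : U → V → ℤˣ) (i : V) (t : V → ℝ) : ℝ := partNum χ i t / partFn χ t

lemma continuous_partFn (χ : U → V → ℤˣ) : Continuous (partFn χ) := by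
  unfold partFn; exact continuous_finsetSum _ fun g _ => continuous_wordWeight _

lemma continuous_partNum (χ : U → V → ℤˣ) (i : V) : Continuous (partNum χ i) := by
  exact continuous_finsetSum _ fun g _ => continuous_const.mul (continuous_wordWeight _)

lemma measurable_wordMean (χ : U → V → ℤˣ) (i : V) : Measurable (wordMean χ i) :=
  (continuous_partNum χ i).measurable.div (continuous_partFn χ).measurable

lemma partFn_nonneg (χ : U → V → ℤˣ) {t : V → ℝ} (ht : ∀ j, |t j| ≤ 1) : 0 ≤ partFn χ t :=
  sum_nonneg fun g _ => wordWeight_nonneg _ ht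

lemma partFn_pos [Nonempty U] (χ : U → V → ℤˣ) (l : V → ℝ) : 0 < partFn χ (tanhs l) :=
  sum_pos (fun g _ => wordWeight_tanhs_pos _ _) Finset.univ_nonempty

lemma abs_partNum_le (χ : U → V → ℤˣ) (i : V) {t : V → ℝ} (ht : ∀ j, |t j| ≤ 1) :
    |partNum χ i t| ≤ partFn χ t := by
  refine (abs_sum_le_sum_abs _ _).trans (sum_le_sum fun g _ => ?_)
  rw [abs_mul, abs_spin, one_mul, abs_of_nonneg (wordWeight_nonneg _ ht)]

lemma abs_wordMean_le (χ : U → V → ℤˣ) (i : V) {t : V → ℝ} (ht : ∀ j, |t j| ≤ 1) :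
    |wordMean χ i t| ≤ 1 := by
  rw [wordMean, abs_div, abs_of_nonneg (partFn_nonneg χ ht)]
  exact div_le_one_of_le₀ (abs_partNum_le χ i ht) (partFn_nonneg χ ht)

omit [Fintype V] in
lemma abs_tanhs_le (l : V → ℝ) (j : V) : |tanhs l j| ≤ 1 := (abs_tanh_lt_one _).le

end

/-! ### Invariance under sign changes and the Nishimori identity -/

section

variable {V U : Type} [Fintype V] [Fintype U] [Group U]

/-- Measures on the observations invariant under all changes of signs. -/
def SignInvariant (Q : Measure (V → ℝ)) : Prop := ∀ x : V → ℤˣ, Q.map (flipBy x) = Q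

/-- The law of the observations obtained from a sign invariant measure when the all-`+1` word is
sent. -/
def sentLaw (Q : Measure (V → ℝ)) : Measure (V → ℝ) :=
  Q.withDensity fun l => ofReal (wordWeight 1 (tanhs l))

lemma measurable_wordWeight_tanhs (x : V → ℤˣ) :
    Measurable fun l : V → ℝ => wordWeight x (tanhs l) :=
  (continuous_wordWeight x).measurable.comp measurable_tanhs

lemma integral_sentLaw (Q : Measure (V → ℝ)) (F : (V → ℝ) → ℝ) :
    ∫ l, F l ∂(sentLaw Q) = ∫ l, wordWeight 1 (tanhs l) * F l ∂Q := by
  rw [sentLaw, integral_withDensity_eq_integral_toReal_smul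
    (measurable_wordWeight_tanhs 1).ennreal_ofReal (ae_of_all _ fun _ => by simp)]
  congr with l
  simp [ENNReal.toReal_ofReal (wordWeight_tanhs_pos 1 l).le]

lemma integrable_sentLaw {Q : Measure (V → ℝ)} {F : (V → ℝ) → ℝ} :
    Integrable F (sentLaw Q) ↔ Integrable (fun l => wordWeight 1 (tanhs l) * F l) Q := by
  rw [sentLaw, integrable_withDensity_iff_integrable_smul'
    (measurable_wordWeight_tanhs 1).ennreal_ofReal (ae_of_all _ fun _ => by simp)]
  refine integrable_congr (ae_of_all _ fun l => ?_)
  simp [ENNReal.toReal_ofReal (wordWeight_tanhs_pos 1 l).le]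

omit [Fintype V] in
lemma measurableEmbedding_flipBy (x : V → ℤˣ) : MeasurableEmbedding (flipBy x) := by
  have h : LeftInverse (flipBy x) (flipBy x) := fun t => by
    ext j; simp [flipBy, mul_assoc, spin_sq]
  exact (MeasurableEquiv.mk ⟨flipBy x, flipBy x, h, h⟩ (measurable_flipBy x)
    (measurable_flipBy x)).measurableEmbedding

lemma SignInvariant.integral_flip {Q : Measure (V → ℝ)} (hQ : SignInvariant Q) (x : V → ℤˣ)
    (F : (V → ℝ) → ℝ) : ∫ l, F (flipBy x l) ∂Q = ∫ l, F l ∂Q := by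
  conv_rhs => rw [← hQ x]
  exact ((measurableEmbedding_flipBy x).integral_map F).symm

lemma SignInvariant.integrable_flip {Q : Measure (V → ℝ)} (hQ : SignInvariant Q) (x : V → ℤˣ)
    {F : (V → ℝ) → ℝ} : Integrable (fun l => F (flipBy x l)) Q ↔ Integrable F Q := by
  conv_rhs => rw [← hQ x]
  exact ((measurableEmbedding_flipBy x).integrable_map_iff).symm

/-- Sending the word `x` instead of the all-`+1` word amounts to a change of signs. -/
lemma SignInvariant.integral_word {Q : Measure (V → ℝ)} (hQ : SignInvariant Q) (x : V → ℤˣ)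
    (F : (V → ℝ) → ℝ) :
    ∫ l, wordWeight x (tanhs l) * F (flipBy x l) ∂Q = ∫ l, F l ∂(sentLaw Q) := by
  have hx : x * x = 1 := by ext j; simp
  have h1 : ∀ l : V → ℝ, flipBy 1 l = l := fun l => by ext j; simp [flipBy, spin_one]
  rw [integral_sentLaw, ← hQ.integral_flip x]
  simp only [tanhs_flipBy, wordWeight_flipBy, flipBy_flipBy, hx, h1]

lemma SignInvariant.integrable_word {Q : Measure (V → ℝ)} (hQ : SignInvariant Q) (x : V → ℤˣ)
    {F : (V → ℝ) → ℝ} (hF : Integrable F (sentLaw Q)) :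
    Integrable (fun l => wordWeight x (tanhs l) * F (flipBy x l)) Q := by
  rw [integrable_sentLaw, ← hQ.integrable_flip x] at hF
  simpa [tanhs_flipBy, wordWeight_flipBy] using hF

variable (χ : U →* (V → ℤˣ))

lemma partFn_flipBy (h : U) (t : V → ℝ) : partFn χ (flipBy (χ h) t) = partFn χ t := by
  simp only [partFn, wordWeight_flipBy, ← map_mul]
  exact Equiv.sum_comp (Equiv.mulLeft h) (fun g => wordWeight (χ g) t)

lemma partNum_flipBy (h : U) (i : V) (t : V → ℝ) :
    partNum χ i (flipBy (χ h) t) = spin (χ h i) * partNum χ i t := by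
  simp only [partNum, wordWeight_flipBy, ← map_mul]
  rw [← Equiv.sum_comp (Equiv.mulLeft h) (fun g => spin (χ g i) * wordWeight (χ g) t), mul_sum]
  refine sum_congr rfl fun g _ => ?_
  rw [Equiv.coe_mulLeft, map_mul, Pi.mul_apply, spin_mul, ← mul_assoc, ← mul_assoc, spin_sq,
    one_mul]

lemma wordMean_flipBy (h : U) (i : V) (t : V → ℝ) :
    wordMean χ i (flipBy (χ h) t) = spin (χ h i) * wordMean χ i t := by
  rw [wordMean, wordMean, partNum_flipBy, partFn_flipBy, mul_div_assoc]

/-- Average of a gauge invariant function. -/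
lemma SignInvariant.integral_gauge {Q : Measure (V → ℝ)} (hQ : SignInvariant Q)
    {F : (V → ℝ) → ℝ} (hF : Integrable F (sentLaw Q)) (hinv : ∀ g l, F (flipBy (χ g) l) = F l) :
    ∫ l, F l ∂(sentLaw Q) = (card U : ℝ)⁻¹ * ∫ l, partFn χ (tanhs l) * F l ∂Q := by
  have h1 : ∀ g, ∫ l, wordWeight (χ g) (tanhs l) * F l ∂Q = ∫ l, F l ∂(sentLaw Q) := fun g => by
    rw [← hQ.integral_word (χ g)]
    simp_rw [hinv]
  have h2 : ∀ g, Integrable (fun l => wordWeight (χ g) (tanhs l) * F l) Q := fun g => by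
    have := hQ.integrable_word (χ g) hF
    simp_rw [hinv] at this
    exact this
  simp_rw [partFn, sum_mul]
  rw [integral_finsetSum _ fun g _ => h2 g]
  simp_all

/-- The Nishimori identity. -/
lemma SignInvariant.nishimori {Q : Measure (V → ℝ)} (hQ : SignInvariant Q)
    {F : (V → ℝ) → ℝ} (hF : Integrable F (sentLaw Q)) :
    ∫ l, F l ∂(sentLaw Q) = ∫ l, (∑ g, wordWeight (χ g) (tanhs l) * F (flipBy (χ g) l)) /
      partFn χ (tanhs l) ∂(sentLaw Q) := by
  set K : (V → ℝ) → ℝ := fun l => (∑ g, wordWeight (χ g) (tanhs l) * F (flipBy (χ g) l)) /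
      partFn χ (tanhs l) with hK
  have hZK : ∀ l, partFn χ (tanhs l) * K l =
      ∑ g, wordWeight (χ g) (tanhs l) * F (flipBy (χ g) l) := fun l =>
    mul_div_cancel₀ _ (partFn_pos χ l).ne'
  have hinv : ∀ g l, K (flipBy (χ g) l) = K l := fun h l => by
    simp only [hK, tanhs_flipBy, partFn_flipBy, wordWeight_flipBy, flipBy_flipBy, ← map_mul]
    congr 1
    exact Equiv.sum_comp (Equiv.mulLeft h)
      (fun g => wordWeight (χ g) (tanhs l) * F (flipBy (χ g) l))
  have hsumint : Integrable (fun l => ∑ g, wordWeight (χ g) (tanhs l) * F (flipBy (χ g) l)) Q :=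
    integrable_finsetSum _ fun g _ => hQ.integrable_word (χ g) hF
  have hKint : Integrable K (sentLaw Q) := by
    rw [integrable_sentLaw]
    have hm : AEStronglyMeasurable (fun l => wordWeight 1 (tanhs l) / partFn χ (tanhs l)) Q :=
      ((measurable_wordWeight_tanhs 1).div
        ((continuous_partFn χ).measurable.comp measurable_tanhs)).aestronglyMeasurable
    refine (hsumint.bdd_mul (c := 1) hm (ae_of_all _ fun l => ?_)).congr (ae_of_all _ fun l => ?_)
    · have h1 := wordWeight_tanhs_pos (1 : V → ℤˣ) l
      have h2 := partFn_pos χ l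
      rw [norm_eq_abs, abs_of_pos (div_pos h1 h2)]
      refine div_le_one_of_le₀ ?_ h2.le
      have := single_le_sum (f := fun g => wordWeight (χ g) (tanhs l))
        (fun g _ => (wordWeight_tanhs_pos _ _).le) (mem_univ (1 : U))
      simpa [partFn] using this
    · grind
  rw [hQ.integral_gauge χ hKint hinv]
  simp_rw [hZK]
  rw [integral_finsetSum _ fun g _ => hQ.integrable_word (χ g) hF]
  simp_rw [hQ.integral_word]
  simp_all

lemma integrable_of_abs_le_one {α : Type*} [MeasurableSpace α] {μ : Measure α}
    [IsFiniteMeasure μ] {f : α → ℝ} (hf : Measurable f) (h : ∀ a, |f a| ≤ 1) : Integrable f μ :=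
  Integrable.of_bound (C := 1) hf.aestronglyMeasurable (ae_of_all _ h)

lemma abs_wordMean_pow_le {U : Type} [Fintype U] (χ : U → V → ℤˣ) (i : V) (q : ℕ) (l : V → ℝ) :
    |wordMean χ i (tanhs l) ^ q| ≤ 1 := by
  exact abs_pow_le_one (abs_wordMean_le χ i (abs_tanhs_le l)) _

lemma measurable_wordMean_tanhs {U : Type} [Fintype U] (χ : U → V → ℤˣ) (i : V) :
    Measurable fun l : V → ℝ => wordMean χ i (tanhs l) :=
  (measurable_wordMean χ i).comp measurable_tanhs

/-- Odd moments of the Gibbs mean agree with the next even ones. -/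
lemma SignInvariant.wordMean_odd {Q : Measure (V → ℝ)} (hQ : SignInvariant Q)
    [IsProb (sentLaw Q)] (i : V) {q : ℕ} (hq : Odd q) :
    ∫ l, wordMean χ i (tanhs l) ^ q ∂(sentLaw Q) =
      ∫ l, wordMean χ i (tanhs l) ^ (q + 1) ∂(sentLaw Q) := by
  rw [hQ.nishimori χ (integrable_of_abs_le_one ((measurable_wordMean_tanhs χ i).pow_const q)
    (abs_wordMean_pow_le χ i q))]
  congr with l
  simp only [tanhs_flipBy, wordMean_flipBy]
  have : ∀ a : ℤˣ, spin a ^ q = spin a := fun a => by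
    rcases Int.units_eq_one_or a with rfl | rfl <;> simp [spin, hq.neg_one_pow]
  simp_rw [mul_pow, this, ← mul_assoc]
  rw [← sum_mul, pow_succ', ← div_mul_eq_mul_div]
  simp only [wordMean, partNum]
  grind

/-- Fewer words means more information: the even moments of the Gibbs mean increase when the group
of words shrinks. The partition function of the larger group is the average over its elements of
the sign-changed partition functions of the smaller one, so the mean is a convex combination of
sign-changed means, and Jensen's inequality applies. -/
lemma SignInvariant.wordMean_mono {Q : Measure (V → ℝ)} (hQ : SignInvariant Q)
    [IsProb (sentLaw Q)] {U' : Type} [Fintype U'] [Group U']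
    (χ' : U' →* (V → ℤˣ)) (hsub : ∀ h, ∃ g, χ g = χ' h) (i : V) {q : ℕ} (hq : Even q) :
    ∫ l, wordMean χ i (tanhs l) ^ q ∂(sentLaw Q) ≤
      ∫ l, wordMean χ' i (tanhs l) ^ q ∂(sentLaw Q) := by
  have hpos : (0 : ℝ) < card U := by exact_mod_cast Fintype.card_pos
  have hpos' : (0 : ℝ) < card U' := by exact_mod_cast Fintype.card_pos
  have hspin : ∀ a : ℤˣ, spin a ^ q = 1 := fun a => by
    rcases Int.units_eq_one_or a with rfl | rfl <;> simp [spin, hq.neg_one_pow]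
  have hint : ∀ {U : Type} [Fintype U] (χ : U → V → ℤˣ),
      Integrable (fun l => wordMean χ i (tanhs l) ^ q) (sentLaw Q) := fun χ =>
    integrable_of_abs_le_one ((measurable_wordMean_tanhs χ i).pow_const q)
      (abs_wordMean_pow_le χ i q)
  have hg : ∀ {U : Type} [Fintype U] [Group U] (χ : U →* (V → ℤˣ)),
      ∀ g l, wordMean χ i (tanhs (flipBy (χ g) l)) ^ q = wordMean χ i (tanhs l) ^ q :=
    fun χ g l => by rw [tanhs_flipBy, wordMean_flipBy, mul_pow, hspin, one_mul]
  -- the average over the larger group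
  have hZ : ∀ t, ∑ g, partFn χ' (flipBy (χ g) t) = card U' * partFn χ t := fun t => by
    simp only [partFn, wordWeight_flipBy]
    rw [Finset.sum_comm, ← nsmul_eq_mul, ← card_univ (α := U'), ← sum_const]
    refine sum_congr rfl fun h _ => ?_
    obtain ⟨k, hk⟩ := hsub h
    rw [← hk]
    simp only [← map_mul]
    exact Equiv.sum_comp (Equiv.mulRight k) (fun g => wordWeight (χ g) t)
  have hN : ∀ t, ∑ g, spin (χ g i) * partNum χ' i (flipBy (χ g) t) =
      card U' * partNum χ i t := fun t => by
    simp only [partNum, wordWeight_flipBy, mul_sum (s := (univ : Finset U'))]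
    rw [Finset.sum_comm, ← nsmul_eq_mul, ← card_univ (α := U'), ← sum_const]
    refine sum_congr rfl fun h _ => ?_
    obtain ⟨k, hk⟩ := hsub h
    rw [← hk]
    simp only [← mul_assoc, ← spin_mul, ← Pi.mul_apply, ← map_mul]
    exact Equiv.sum_comp (Equiv.mulRight k) (fun g => spin (χ g i) * wordWeight (χ g) t)
  have hjensen : ∀ l, partFn χ (tanhs l) * wordMean χ i (tanhs l) ^ q ≤
      (card U' : ℝ)⁻¹ * ∑ g, partFn χ' (tanhs (flipBy (χ g) l)) *
        wordMean χ' i (tanhs (flipBy (χ g) l)) ^ q := fun l => by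
    have hZp := partFn_pos χ l
    have hZp' : ∀ g, 0 < partFn χ' (tanhs (flipBy (χ g) l)) := fun g => partFn_pos χ' _
    have hw : ∑ g, partFn χ' (tanhs (flipBy (χ g) l)) / (card U' * partFn χ (tanhs l)) = 1 := by
      rw [← sum_div]
      simp_rw [tanhs_flipBy]
      rw [hZ, div_self (by positivity)]
    have := hq.convexOn_pow (𝕜 := ℝ) |>.map_sum_le (t := univ)
      (w := fun g => partFn χ' (tanhs (flipBy (χ g) l)) / (card U' * partFn χ (tanhs l)))
      (p := fun g => spin (χ g i) * wordMean χ' i (tanhs (flipBy (χ g) l)))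
      (fun g _ => (div_pos (hZp' g) (by positivity)).le) hw (fun g _ => Set.mem_univ _)
    have hm : ∑ g, (partFn χ' (tanhs (flipBy (χ g) l)) / (card U' * partFn χ (tanhs l))) •
        (spin (χ g i) * wordMean χ' i (tanhs (flipBy (χ g) l))) = wordMean χ i (tanhs l) := by
      rw [wordMean, eq_div_iff hZp.ne']
      have h1 := hN (tanhs l)
      simp_rw [← tanhs_flipBy] at h1
      rw [← mul_right_inj' hpos'.ne', ← h1, sum_mul, mul_sum]
      refine sum_congr rfl fun g _ => ?_
      have := (hZp' g).ne'
      rw [wordMean, smul_eq_mul]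
      field_simp
    rw [hm] at this
    simp only [mul_pow, hspin, one_mul, smul_eq_mul] at this
    calc _ ≤ partFn χ (tanhs l) * _ := mul_le_mul_of_nonneg_left this hZp.le
      _ = _ := by
        rw [mul_sum, mul_sum]
        refine sum_congr rfl fun g _ => ?_
        field_simp
  rw [hQ.integral_gauge χ (hint χ) (hg χ), hQ.integral_gauge χ' (hint χ') (hg χ')]
  have hint2 : ∀ {U : Type} [Fintype U] [Group U] (χ : U →* (V → ℤˣ)), Integrable
      (fun l => partFn χ (tanhs l) * wordMean χ i (tanhs l) ^ q) Q := fun χ => by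
    simp_rw [partFn, sum_mul]
    refine integrable_finsetSum _ fun g _ => ?_
    have := hQ.integrable_word (χ g) (hint χ)
    simp_rw [hg] at this
    exact this
  calc _ ≤ (card U : ℝ)⁻¹ * ∫ l, (card U' : ℝ)⁻¹ * ∑ g,
        partFn χ' (tanhs (flipBy (χ g) l)) * wordMean χ' i (tanhs (flipBy (χ g) l)) ^ q ∂Q := by
        refine mul_le_mul_of_nonneg_left (integral_mono (hint2 χ) ?_ hjensen) (by positivity)
        exact (integrable_finsetSum _ fun g _ =>
          (hQ.integrable_flip (χ g)).2 (hint2 χ')).const_mul _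
    _ = _ := by
        rw [integral_const_mul, integral_finsetSum _ fun g _ =>
          (hQ.integrable_flip (χ g)).2 (hint2 χ')]
        have := fun g => hQ.integral_flip (χ g)
          (fun l => partFn χ' (tanhs l) * wordMean χ' i (tanhs l) ^ q)
        simp_rw [this]
        rw [sum_const, card_univ, nsmul_eq_mul]
        field_simp

end

/-! ### Product noise -/

section

variable {V : Type} [Fintype V]

lemma signInvariant_pi {s : V → Measure ℝ} [∀ j, IsProb (s j)]
    (hs : ∀ j, (s j).map (fun l => -l) = s j) : SignInvariant (pi s) := by
  intro x
  have h : ∀ j, (s j).map (fun l => l * spin (x j)) = s j := fun j => by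
    rcases Int.units_eq_one_or (x j) with h | h
    · simp [h, spin]
    · simpa [h, spin] using hs j
  have := Measure.pi_map_pi (μ := s) (f := fun j l => l * spin (x j))
    (fun j => (measurable_id.mul_const _).aemeasurable)
  simp_rw [h] at this
  exact this

lemma pi_eq_sentLaw {s c : V → Measure ℝ} [∀ j, IsProb (s j)] [∀ j, IsProb (c j)]
    (hc : ∀ j, c j = (s j).withDensity (fun l => ofReal (1 + tanh l))) :
    pi c = sentLaw (pi s) := by
  refine Measure.pi_eq fun A hA => ?_
  have hmeas : MeasurableSet (Set.univ.pi A) := MeasurableSet.univ_pi hA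
  have hind : ∀ l : V → ℝ, (Set.univ.pi A).indicator (fun l => wordWeight 1 (tanhs l)) l =
      ∏ j, (A j).indicator (fun a => 1 + tanh a) (l j) := fun l => by
    by_cases h : l ∈ Set.univ.pi A
    · rw [Set.indicator_of_mem h]
      refine prod_congr rfl fun j _ => ?_
      rw [Set.indicator_of_mem (h j trivial)]
      simp [tanhs, spin_one]
    · rw [Set.indicator_of_notMem h]
      obtain ⟨j, hj⟩ : ∃ j, l j ∉ A j := by simpa [Set.mem_pi] using h
      exact (prod_eq_zero (mem_univ j) (Set.indicator_of_notMem hj _)).symm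
  have hint : Integrable (fun l : V → ℝ => wordWeight 1 (tanhs l)) (pi s) :=
    Integrable.of_bound (C := 2 ^ card V)
      (measurable_wordWeight_tanhs 1).aestronglyMeasurable (ae_of_all _ fun l => by
        rw [norm_eq_abs, abs_of_pos (wordWeight_tanhs_pos _ _)]
        exact wordWeight_le _ (abs_tanhs_le l))
  have h1 : ∀ j, ∫ a, (A j).indicator (fun a => 1 + tanh a) a ∂(s j) = (c j).real (A j) :=
    fun j => by
      have := IsSymmNoise.integral_eq_even (hc j) ((A j).indicator 1)
      rw [integral_indicator_one (hA j)] at this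
      rw [this]
      congr with a
      by_cases h : a ∈ A j <;> simp [h]
  rw [sentLaw, withDensity_apply _ hmeas, ← ofReal_integral_eq_lintegral_ofReal hint.integrableOn
      (ae_of_all _ fun l => (wordWeight_tanhs_pos _ l).le),
    ← integral_indicator hmeas]
  simp_rw [hind]
  rw [integral_fintype_prod_eq_prod (fun j => (A j).indicator (fun a => 1 + tanh a))]
  simp_rw [h1]
  rw [ENNReal.ofReal_prod_of_nonneg fun _ _ => measureReal_nonneg]
  simp [measureReal_def]

/-- Independent symmetric noises come from a sign invariant measure. -/
lemma exists_signInvariant {c : V → Measure ℝ} (hc : ∀ j, IsSymmNoise (c j)) :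
    ∃ Q : Measure (V → ℝ), IsProb Q ∧ SignInvariant Q ∧ pi c = sentLaw Q := by
  have := fun j => (hc j).isProb
  choose s hp hs hcs using hc
  exact ⟨pi s, inferInstance, signInvariant_pi hs, pi_eq_sentLaw hcs⟩

omit [Fintype V] in
lemma measurable_update_pair [DecidableEq V] (i : V) :
    Measurable (fun z : (V → ℝ) × ℝ => upd z.1 i z.2) :=
  measurable_pi_lambda _ fun j => by
    by_cases h : j = i
    · fun_prop
    · fun_prop

/-- Resampling one coordinate of a product measure. -/
lemma pi_update_eq [DecidableEq V] (γ : V → Measure ℝ) [∀ j, IsProb (γ j)] (i : V) (c : Measure ℝ)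
    [IsProb c] :
    pi (upd γ i c) = ((pi γ).prod c).map (fun z => upd z.1 i z.2) := by
  have : ∀ j, IsProb (upd γ i c j) := fun j => by grind
  refine Measure.pi_eq fun A hA => ?_
  have hm := measurable_update_pair i
  have hpre : (fun z : (V → ℝ) × ℝ => upd z.1 i z.2) ⁻¹' (Set.univ.pi A) =
      (Set.univ.pi (upd A i Set.univ)) ×ˢ (A i) := by
    grind
  rw [Measure.map_apply hm (MeasurableSet.univ_pi hA), hpre, Measure.prod_prod, Measure.pi_pi,
    ← mul_prod_erase univ _ (mem_univ i),
    ← mul_prod_erase univ _ (mem_univ i)]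
  simp
  rw [mul_comm]
  congr 1
  refine prod_congr rfl fun j hj => ?_
  simp [ne_of_mem_erase hj]

lemma integral_pi_update [DecidableEq V] (γ : V → Measure ℝ) [∀ j, IsProb (γ j)] (i : V)
    (c : Measure ℝ) [IsProb c] {F : (V → ℝ) → ℝ}
    (hF : Integrable F (pi (upd γ i c))) (hFm : Measurable F) :
    ∫ l, F l ∂(pi (upd γ i c)) = ∫ l, ∫ a, F (upd l i a) ∂c ∂(pi γ) := by
  rw [pi_update_eq] at hF ⊢
  rw [integral_map (measurable_update_pair i).aemeasurable hFm.aestronglyMeasurable]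
  rw [integrable_map_measure hFm.aestronglyMeasurable (measurable_update_pair i).aemeasurable] at hF
  exact integral_prod _ hF

omit [Fintype V] in
lemma isSymmNoise_update [DecidableEq V] {γ : V → Measure ℝ} (hγ : ∀ j, IsSymmNoise (γ j)) (i : V)
    {c : Measure ℝ} (hc : IsSymmNoise c) (j : V) : IsSymmNoise (upd γ i c j) := by
  grind

end

/-! ### Convergence of laws on the cube -/

section

lemma tendsto_of_moments {ι : Type*} {F : Filter ι} {ν : ι → Prob ℝ}
    {ν₀ : Prob ℝ} (h : ∀ᶠ i in F, ∀ᵐ x ∂(ν i : Measure ℝ), x ∈ Icc (-1) 1)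
    (h₀ : ∀ᵐ x ∂(ν₀ : Measure ℝ), x ∈ Icc (-1) 1)
    (hm : ∀ q : ℕ, Tendsto (fun i => ∫ x, x ^ q ∂(ν i : Measure ℝ)) F
      (𝓝 (∫ x, x ^ q ∂(ν₀ : Measure ℝ)))) :
    Tendsto ν F (𝓝 ν₀) := by
  rw [ProbabilityMeasure.tendsto_iff_forall_integral_tendsto]
  intro f
  have hpow : ∀ {μ : Prob ℝ}, (∀ᵐ x ∂(μ : Measure ℝ), x ∈ Icc (-1) 1) →
      ∀ q : ℕ, Integrable (fun x => x ^ q) (μ : Measure ℝ) := fun hμ q =>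
    integrable_pow_of_abs_le_one (hμ.mono fun x hx => abs_le.2 hx) q
  have hpoly : ∀ {μ : Prob ℝ}, (∀ᵐ x ∂(μ : Measure ℝ), x ∈ Icc (-1) 1) →
      ∀ p : ℝ[X], Integrable (fun x => p.eval x) (μ : Measure ℝ) ∧
      ∫ x, p.eval x ∂(μ : Measure ℝ) =
      ∑ q ∈ range (p.natDegree + 1), p.coeff q * ∫ x, x ^ q ∂(μ : Measure ℝ) := by
    intro μ hμ p
    simp_rw [Polynomial.eval_eq_sum_range]
    refine ⟨integrable_finsetSum _ fun q _ => (hpow hμ q).const_mul _, ?_⟩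
    rw [integral_finsetSum _ fun q _ => (hpow hμ q).const_mul _]
    simp_rw [integral_const_mul]
  have happ : ∀ {μ : Prob ℝ}, (∀ᵐ x ∂(μ : Measure ℝ), x ∈ Icc (-1) 1) →
      ∀ (p : ℝ[X]) (δ : ℝ), (∀ x ∈ Icc (-1 : ℝ) 1, |p.eval x - f x| < δ) →
      |∫ x, f x ∂(μ : Measure ℝ) - ∫ x, p.eval x ∂(μ : Measure ℝ)| ≤ δ := by
    intro μ hμ p δ hp
    rw [← integral_sub (f.integrable _) (hpoly hμ p).1]
    have := norm_integral_le_of_norm_le_const (C := δ) (hμ.mono fun x hx => by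
        rw [norm_eq_abs, abs_sub_comm]; exact (hp x hx).le)
    simpa using this
  rw [Metric.tendsto_nhds]
  intro η hη
  obtain ⟨p, hp⟩ := exists_polynomial_near_of_continuousOn (-1) 1 f f.continuous.continuousOn
    (η / 3) (by positivity)
  have hlim : Tendsto (fun i => ∑ q ∈ range (p.natDegree + 1),
      p.coeff q * ∫ x, x ^ q ∂(ν i : Measure ℝ)) F
      (𝓝 (∑ q ∈ range (p.natDegree + 1), p.coeff q * ∫ x, x ^ q ∂(ν₀ : Measure ℝ))) :=
    tendsto_finsetSum _ fun q _ => (hm q).const_mul _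
  filter_upwards [h, Metric.tendsto_nhds.1 hlim (η / 3) (by positivity)] with i hi hi2
  have h1 := happ hi p _ hp
  have h2 := happ h₀ p _ hp
  rw [dist_eq] at hi2 ⊢
  grind

/-- Restriction of the coordinates to `[-1, 1]`. -/
def clamp (x : ℝ) : ℝ := max (-1) (min 1 x)

lemma abs_clamp_le (x : ℝ) : |clamp x| ≤ 1 := by
  rw [abs_le]; exact ⟨le_max_left _ _, max_le (by norm_num) (min_le_left _ _)⟩

lemma clamp_eq {x : ℝ} (h : |x| ≤ 1) : clamp x = x := by
  rw [abs_le] at h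
  rw [clamp, min_eq_right h.2, max_eq_right h.1]

lemma clamp_neg (x : ℝ) : clamp (-x) = -clamp x := by
  simp only [clamp]
  grind

lemma continuous_clamp : Continuous clamp := by unfold clamp; fun_prop

variable {V : Type} [Fintype V]

lemma tendsto_integral_cube {ι : Type*} {F : Filter ι} {ν : ι → V → Prob ℝ}
    {ν₀ : V → Prob ℝ} (h : ∀ j, Tendsto (fun i => ν i j) F (𝓝 (ν₀ j)))
    {Φ : (V → ℝ) → ℝ} (hΦ : ContinuousOn Φ {t | ∀ j, |t j| ≤ 1})
    {C : ℝ} (hC : ∀ t, (∀ j, |t j| ≤ 1) → |Φ t| ≤ C) :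
    Tendsto (fun i => ∫ t, Φ (fun j => clamp (t j)) ∂(pi fun j => (ν i j : Measure ℝ))) F
      (𝓝 (∫ t, Φ (fun j => clamp (t j)) ∂(pi fun j => (ν₀ j : Measure ℝ)))) := by
  have h1 : Tendsto ν F (𝓝 ν₀) := tendsto_pi_nhds.2 h
  have h2 := (ProbabilityMeasure.continuous_pi).tendsto ν₀ |>.comp h1
  rw [ProbabilityMeasure.tendsto_iff_forall_integral_tendsto] at h2
  have hcont : Continuous fun t : V → ℝ => Φ fun j => clamp (t j) :=
    hΦ.comp_continuous (continuous_pi fun j => continuous_clamp.comp (continuous_apply j))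
      fun t j => abs_clamp_le _
  exact h2 (BoundedContinuousFunction.ofNormedAddCommGroup _ hcont C
    fun t => hC _ fun j => abs_clamp_le _)

end

/-! ### The logarithm of the partition function and its derivative in the noise parameter -/

section

variable {V U : Type} [Fintype V] [Fintype U] [DecidableEq V]

lemma wordWeight_update (x : V → ℤˣ) (i : V) (t : V → ℝ) :
    wordWeight x t = wordWeight x (upd t i 0) * (1 + t i * spin (x i)) := by
  rw [wordWeight, wordWeight, ← mul_prod_erase univ _ (mem_univ i),
    ← mul_prod_erase univ (fun j => 1 + upd t i 0 j * spin (x j)) (mem_univ i)]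
  simp
  rw [mul_comm]
  congr 1
  refine prod_congr rfl fun j hj => ?_
  rw [update_of_ne (ne_of_mem_erase hj)]

lemma partFn_update (χ : U → V → ℤˣ) (i : V) (t : V → ℝ) :
    partFn χ t = partFn χ (upd t i 0) + t i * partNum χ i (upd t i 0) := by
  simp only [partFn, partNum, mul_sum]
  rw [← sum_add_distrib]
  refine sum_congr rfl fun g _ => ?_
  rw [wordWeight_update (χ g) i t]
  ring

omit [Fintype V] in
lemma tanhs_update (l : V → ℝ) (i : V) (a : ℝ) : tanhs (upd l i a) = upd (tanhs l) i (tanh a) := by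
  ext j
  by_cases h : j = i
  · subst h; simp [tanhs]
  · simp [tanhs, h]

/-- The extrinsic Gibbs mean of the spin `i`: its own observation is erased. -/
def extrinsicMean (χ : U → V → ℤˣ) (i : V) (l : V → ℝ) : ℝ :=
  wordMean χ i (tanhs (upd l i 0))

lemma measurable_extrinsicMean (χ : U → V → ℤˣ) (i : V) : Measurable (extrinsicMean χ i) :=
  (measurable_wordMean_tanhs χ i).comp
    ((measurable_update_pair i).comp (measurable_id.prodMk measurable_const))

lemma abs_extrinsicMean_le (χ : U → V → ℤˣ) (i : V) (l : V → ℝ) : |extrinsicMean χ i l| ≤ 1 :=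
  abs_wordMean_le χ i (abs_tanhs_le _)

/-- The law of the extrinsic Gibbs mean. -/
def extrinsicLaw (χ : U → V → ℤˣ) (i : V) (γ : V → Measure ℝ) : Measure ℝ :=
  (pi γ).map (extrinsicMean χ i)

lemma isProbabilityMeasure_extrinsicLaw (χ : U → V → ℤˣ) (i : V) (γ : V → Measure ℝ)
    [∀ j, IsProb (γ j)] : IsProb (extrinsicLaw χ i γ) :=
  isProbabilityMeasure_map (measurable_extrinsicMean χ i).aemeasurable

lemma abs_le_one_extrinsicLaw (χ : U → V → ℤˣ) (i : V) (γ : V → Measure ℝ) :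
    ∀ᵐ x ∂(extrinsicLaw χ i γ), |x| ≤ 1 :=
  ae_abs_le_of_forall (abs_extrinsicMean_le χ i)

lemma moment_extrinsicLaw (χ : U → V → ℤˣ) (i : V) (γ : V → Measure ℝ) [∀ j, IsProb (γ j)] (q : ℕ) :
    moment (extrinsicLaw χ i γ) q =
      ∫ l, wordMean χ i (tanhs l) ^ q ∂(pi (upd γ i (dirac 0))) := by
  have : ∀ j, IsProb (upd γ i (dirac 0) j) := fun j => by
    by_cases h : j = i
    · subst h; simpa using Measure.dirac.isProbabilityMeasure
    grind
  rw [integral_pi_update γ i _ (integrable_of_abs_le_one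
    ((measurable_wordMean_tanhs χ i).pow_const q) (abs_wordMean_pow_le χ i q))
    ((measurable_wordMean_tanhs χ i).pow_const q)]
  simp_rw [integral_dirac]
  rw [moment, extrinsicLaw, integral_map (measurable_extrinsicMean χ i).aemeasurable (by fun_prop)]
  rfl

/-- The logarithm of the partition function relative to the weight of the word that was sent. -/
def logPart (χ : U → V → ℤˣ) (l : V → ℝ) : ℝ :=
  log (partFn χ (tanhs l) / wordWeight 1 (tanhs l))

omit [DecidableEq V] in
lemma measurable_logPart (χ : U → V → ℤˣ) : Measurable (logPart χ) :=
  (((continuous_partFn χ).measurable.comp measurable_tanhs).div (measurable_wordWeight_tanhs 1)).log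

lemma logPart_update [Nonempty U] (χ : U → V → ℤˣ) (i : V) (l : V → ℝ) (a : ℝ) :
    logPart χ (upd l i a) = logPart χ (upd l i 0) +
      log ((1 + extrinsicMean χ i l * tanh a) / (1 + tanh a)) := by
  have e : upd (tanhs (upd l i a)) i 0 = tanhs (upd l i 0) := by
    rw [tanhs_update, tanhs_update, update_idem, Real.tanh_zero]
  have hZ := partFn_pos χ (upd l i 0)
  have hW := wordWeight_tanhs_pos 1 (upd l i 0)
  have ha := one_add_tanh_pos a
  have hX : 0 < 1 + extrinsicMean χ i l * tanh a := by
    have : |extrinsicMean χ i l * tanh a| < 1 := by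
      rw [abs_mul]
      exact (mul_le_of_le_one_left (abs_nonneg _) (abs_extrinsicMean_le χ i l)).trans_lt
        (abs_tanh_lt_one a)
    linarith [(abs_lt.1 this).1]
  rw [logPart, logPart, ← Real.log_mul (div_pos hZ hW).ne' (div_pos hX ha).ne',
    partFn_update χ i (tanhs (upd l i a)),
    wordWeight_update 1 i (tanhs (upd l i a)), e]
  have h1 : tanhs (upd l i a) i = tanh a := by simp [tanhs]
  rw [h1, extrinsicMean, wordMean, Pi.one_apply, spin_one, mul_one]
  field_simp

omit [DecidableEq V] in
lemma abs_logPart_le [Group U] (χ : U →* (V → ℤˣ)) (l : V → ℝ) :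
    |logPart χ l| ≤ log (card U * 2 ^ card V) + ∑ j, 2 * |l j| := by
  have hZ := partFn_pos χ l
  have hW := wordWeight_tanhs_pos 1 l
  have h1 : 1 ≤ partFn χ (tanhs l) / wordWeight 1 (tanhs l) := by
    rw [one_le_div hW]
    have := single_le_sum (f := fun g => wordWeight (χ g) (tanhs l))
        (fun g _ => (wordWeight_tanhs_pos _ _).le) (mem_univ (1 : U))
    simpa [partFn] using this
  rw [logPart, abs_of_nonneg (Real.log_nonneg h1), log_div hZ.ne' hW.ne', sub_eq_add_neg]
  gcongr ?_ + ?_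
  · refine log_le_log hZ ?_
    rw [← nsmul_eq_mul, ← card_univ, ← sum_const]
    exact sum_le_sum fun g _ => wordWeight_le _ (abs_tanhs_le l)
  · rw [wordWeight, Real.log_prod (fun j _ => by
      have := one_add_tanh_pos (l j); simp [tanhs, spin_one]; linarith), ← Finset.sum_neg_distrib]
    refine sum_le_sum fun j _ => ?_
    have h2 := neg_log_one_sub_abs_tanh_le (l j)
    have h3 : log (1 - |tanh (l j)|) ≤ log (1 + tanh (l j)) :=
      log_le_log (by linarith [abs_tanh_lt_one (l j)]) (by linarith [neg_abs_le (tanh (l j))])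
    simp only [tanhs, Pi.one_apply, spin_one, mul_one]
    linarith

omit [DecidableEq V] in
lemma integrable_abs_coord {γ : V → Measure ℝ} [∀ j, IsProb (γ j)]
    (h1 : ∀ j, Integrable (fun l => |l|) (γ j)) (j : V) :
    Integrable (fun l : V → ℝ => |l j|) (pi γ) :=
  (measurePreserving_eval γ j).integrable_comp_of_integrable (h1 j)

omit [DecidableEq V] in
lemma integrable_logPart [Group U] (χ : U →* (V → ℤˣ)) {γ : V → Measure ℝ}
    [∀ j, IsProb (γ j)] (h1 : ∀ j, Integrable (fun l => |l|) (γ j)) :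
    Integrable (logPart χ) (pi γ) := by
  refine Integrable.mono' ?_ (measurable_logPart χ).aestronglyMeasurable
    (ae_of_all _ (abs_logPart_le χ))
  exact (integrable_const _).add
    (integrable_finsetSum _ fun j _ => (integrable_abs_coord h1 j).const_mul 2)

omit [Fintype V] in
lemma isProb_update {γ : V → Measure ℝ} [h : ∀ j, IsProb (γ j)] (i : V)
    (c : Measure ℝ) [hc : IsProb c] (j : V) :
    IsProb (upd γ i c j) := by
  grind

lemma abs_log_ratio_le {x : ℝ} (hx : |x| ≤ 1) (a : ℝ) :
    |log ((1 + x * tanh a) / (1 + tanh a))| ≤ 4 * |a| := by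
  have key : ∀ y : ℝ, |y| ≤ |tanh a| → |log (1 + y)| ≤ 2 * |a| := fun y hy => by
    have h1 := neg_log_one_sub_abs_tanh_le a
    have h2 := abs_tanh_lt_one a
    have h3 := abs_le.1 hy
    rw [abs_le]
    constructor
    · have := log_le_log (by linarith : 0 < 1 - |tanh a|) (by linarith : _ ≤ 1 + y)
      linarith
    · have h4 : 1 + y ≤ (1 - |tanh a|)⁻¹ := by
        rw [le_inv_comm₀ (by linarith) (by linarith), inv_eq_one_div, le_div_iff₀ (by linarith)]
        nlinarith [abs_nonneg (tanh a)]
      have := log_le_log (by linarith) h4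
      rw [Real.log_inv] at this
      linarith
  have hxt : |x * tanh a| ≤ |tanh a| := by
    rw [abs_mul]; exact mul_le_of_le_one_left (abs_nonneg _) hx
  have h2 := abs_tanh_lt_one a
  rw [log_div (by linarith [(abs_le.1 hxt).1]) (one_add_tanh_pos a).ne']
  grind

/-- Dependence of the averaged `logPart` on the law of one observation. -/
lemma hasSum_logPart_update [Group U] (χ : U →* (V → ℤˣ)) {γ : V → Measure ℝ}
    (hγ : ∀ j, IsSymmNoise (γ j)) (h1 : ∀ j, Integrable (fun l => |l|) (γ j)) (i : V)
    {c : Measure ℝ} (hc : IsSymmNoise c) (hc1 : Integrable (fun l => |l|) c) :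
    HasSum (fun p : ℕ => (∫ l, tanh l ^ (2 * (p + 1)) ∂c) *
        gexitCoeff (extrinsicLaw χ i γ) p)
      (∫ l, logPart χ l ∂(pi (upd γ i c)) -
        ∫ l, logPart χ (upd l i 0) ∂(pi γ)) := by
  have hp := fun j => (hγ j).isProb
  have hpc := hc.isProb
  have hpu := isProb_update (γ := γ) i c
  have hpr := isProbabilityMeasure_extrinsicLaw χ i γ
  have h := hasSum_gexit (ρ := extrinsicLaw χ i γ) hc hc1 (abs_le_one_extrinsicLaw χ i γ)
  convert h using 1
  have hu1 : ∀ j, Integrable (fun l => |l|) (upd γ i c j) := fun j => by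
    by_cases hj : j = i
    · subst hj; simpa
    · simpa [hj] using h1 j
  have hint := integrable_logPart χ hu1
  rw [integral_pi_update γ i c hint (measurable_logPart χ)]
  have hm2 : Measurable fun z : (V → ℝ) × ℝ =>
      log ((1 + extrinsicMean χ i z.1 * tanh z.2) / (1 + tanh z.2)) := by
    have := (measurable_extrinsicMean χ i).comp
      (measurable_fst : Measurable (Prod.fst : (V → ℝ) × ℝ → V → ℝ))
    have h3 := measurable_tanh.comp (measurable_snd : Measurable (Prod.snd : (V → ℝ) × ℝ → ℝ))
    exact (((this.mul h3).const_add 1).div (h3.const_add 1)).log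
  have hprod : Integrable (fun z : (V → ℝ) × ℝ =>
      log ((1 + extrinsicMean χ i z.1 * tanh z.2) / (1 + tanh z.2)))
      ((pi γ).prod c) :=
    Integrable.mono' ((hc1.const_mul 4).comp_snd _) hm2.aestronglyMeasurable
      (ae_of_all _ fun z => abs_log_ratio_le (abs_extrinsicMean_le χ i z.1) z.2)
  have hrow : ∀ l, Integrable (fun a =>
      log ((1 + extrinsicMean χ i l * tanh a) / (1 + tanh a))) c := fun l =>
    Integrable.mono' (hc1.const_mul 4) (hm2.comp (measurable_prodMk_left)).aestronglyMeasurable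
      (ae_of_all _ fun a => abs_log_ratio_le (abs_extrinsicMean_le χ i l) a)
  have hlog0 : Integrable (fun l => logPart χ (upd l i 0)) (pi γ) := by
    have h0 : ∀ j, Integrable (fun l => |l|) (upd γ i (dirac 0) j) :=
      fun j => by
        by_cases hj : j = i
        · subst hj
          rw [update_self]
          exact integrable_dirac (by simp)
        · simpa [hj] using h1 j
    have hpu0 := isProb_update (γ := γ) i (dirac 0)
    have := integrable_logPart χ h0
    rw [pi_update_eq, integrable_map_measure (measurable_logPart χ).aestronglyMeasurable
      (measurable_update_pair i).aemeasurable] at this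
    refine this.integral_prod_left.congr (ae_of_all _ fun l => ?_)
    exact integral_dirac _ _
  have e1 : ∀ l, ∫ a, logPart χ (upd l i a) ∂c = logPart χ (upd l i 0) +
      ∫ a, log ((1 + extrinsicMean χ i l * tanh a) / (1 + tanh a)) ∂c := fun l => by
    have h0 : (fun a => logPart χ (upd l i a)) = fun a =>
        logPart χ (upd l i 0) +
          log ((1 + extrinsicMean χ i l * tanh a) / (1 + tanh a)) :=
      funext fun a => logPart_update χ i l a
    rw [h0]
    rw [integral_add (integrable_const _) (hrow l), integral_const, probReal_univ, one_smul]
  simp_rw [e1]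
  rw [integral_add hlog0 hprod.integral_prod_left, add_sub_cancel_left,
    integral_integral_swap hprod]
  congr with a
  simp only
  have hm3 : Measurable fun x : ℝ => log ((1 + x * tanh a) / (1 + tanh a)) := by
    fun_prop
  rw [extrinsicLaw, integral_map (measurable_extrinsicMean χ i).aemeasurable
    hm3.aestronglyMeasurable]

lemma moment_extrinsicLaw_odd [Group U] (χ : U →* (V → ℤˣ)) {γ : V → Measure ℝ}
    (hγ : ∀ j, IsSymmNoise (γ j)) (i : V) (p : ℕ) :
    moment (extrinsicLaw χ i γ) (2 * p + 1) = moment (extrinsicLaw χ i γ) (2 * p + 2) := by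
  have hp := fun j => (hγ j).isProb
  have hpu := isProb_update (γ := γ) i (dirac 0)
  rw [moment_extrinsicLaw, moment_extrinsicLaw]
  obtain ⟨Q, hQ, hinv, hpi⟩ := exists_signInvariant (isSymmNoise_update hγ i isSymmNoise_dirac)
  have : IsProb (sentLaw Q) := hpi ▸ inferInstance
  rw [hpi]
  exact hinv.wordMean_odd χ i ⟨p, rfl⟩

omit [DecidableEq V] in
/-- In the even parts of the noises the even moments of a Gibbs mean are integrals of functions of
`t = tanh l` that are continuous on the whole cube. -/
lemma continuousOn_partFn_mul_pow (χ : U → V → ℤˣ) (i : V) {q : ℕ} (hq : q ≠ 0) :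
    ContinuousOn (fun t => partFn χ t * wordMean χ i t ^ q) {t | ∀ j, |t j| ≤ 1} := by
  intro t ht
  by_cases h0 : partFn χ t = 0
  · have hlim : Tendsto (partFn χ) (𝓝[{t | ∀ j, |t j| ≤ 1}] t) (𝓝 0) := by
      rw [← h0]; exact (continuous_partFn χ).continuousWithinAt
    have : partFn χ t * wordMean χ i t ^ q = 0 := by rw [h0, zero_mul]
    rw [ContinuousWithinAt, this]
    refine squeeze_zero_norm' ?_ hlim
    filter_upwards [self_mem_nhdsWithin] with u hu
    rw [norm_mul, norm_eq_abs, norm_eq_abs, abs_pow, abs_of_nonneg (partFn_nonneg χ hu)]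
    exact mul_le_of_le_one_right (partFn_nonneg χ hu)
      (pow_le_one₀ (abs_nonneg _) (abs_wordMean_le χ i hu))
  · exact ((continuous_partFn χ).continuousAt.mul
      (((continuous_partNum χ i).continuousAt.div (continuous_partFn χ).continuousAt
        h0).pow q)).continuousWithinAt

omit [DecidableEq V] in
lemma tendsto_wordMean_pow [Group U] (χ : U →* (V → ℤˣ)) (i : V) {q : ℕ} (hq : Even q)
    (hq0 : q ≠ 0) {ι : Type*} {F : Filter ι} {γ : ι → V → Measure ℝ} {γ₀ : V → Measure ℝ}
    (hγ : ∀ a j, IsSymmNoise (γ a j)) (hγ₀ : ∀ j, IsSymmNoise (γ₀ j))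
    (h : ∀ j (k : ℕ), Tendsto (fun a => ∫ l, tanh l ^ k ∂(γ a j)) F
      (𝓝 (∫ l, tanh l ^ k ∂(γ₀ j)))) :
    Tendsto (fun a => ∫ l, wordMean χ i (tanhs l) ^ q ∂(pi (γ a))) F
      (𝓝 (∫ l, wordMean χ i (tanhs l) ^ q ∂(pi γ₀))) := by
  have hp := fun a j => (hγ a j).isProb
  have hp₀ := fun j => (hγ₀ j).isProb
  choose s hsp hs hc using hγ
  choose s₀ hsp₀ hs₀ hc₀ using hγ₀
  -- law of `tanh l` under an even part
  let ν : (s : Measure ℝ) → [IsProb s] → Prob ℝ := fun s _ =>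
    ⟨s.map tanh, isProbabilityMeasure_map measurable_tanh.aemeasurable⟩
  have hν : ∀ (s : Measure ℝ) [IsProb s],
      ∀ᵐ x ∂(ν s : Measure ℝ), x ∈ Icc (-1) 1 := fun s _ => by
    change ∀ᵐ x ∂(s.map tanh), x ∈ Icc (-1) 1
    refine (ae_map_iff measurable_tanh.aemeasurable (p := fun x => x ∈ Icc (-1 : ℝ) 1)
      measurableSet_Icc).2 ?_
    exact ae_of_all _ fun l => abs_le.1 (abs_tanh_lt_one l).le
  have hmom : ∀ (s : Measure ℝ) [IsProb s] (k : ℕ),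
      ∫ x, x ^ k ∂(ν s : Measure ℝ) = ∫ l, tanh l ^ k ∂s := fun s _ k => by
    change ∫ x, x ^ k ∂(s.map tanh) = _
    rw [integral_map measurable_tanh.aemeasurable (by fun_prop)]
  have hlim : ∀ j, Tendsto (fun a => ν (s a j)) F (𝓝 (ν (s₀ j))) := fun j => by
    refine tendsto_of_moments (Eventually.of_forall fun a => hν _) (hν _) fun k => ?_
    simp_rw [hmom]
    rcases Nat.even_or_odd k with hk | hk
    · simp_rw [fun a => IsSymmNoise.even_integral_even (hs a j) (hc a j) hk,
        IsSymmNoise.even_integral_even (hs₀ j) (hc₀ j) hk]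
      exact h j k
    · simp_rw [fun a => IsSymmNoise.even_integral_odd (hs a j) hk,
        IsSymmNoise.even_integral_odd (hs₀ j) hk]
      exact tendsto_const_nhds
  have hval : ∀ (s c : V → Measure ℝ) [∀ j, IsProb (s j)]
      [∀ j, IsProb (c j)], (∀ j, (s j).map (fun l => -l) = s j) →
      (∀ j, c j = (s j).withDensity (fun l => ofReal (1 + tanh l))) →
      ∫ l, wordMean χ i (tanhs l) ^ q ∂(pi c) = (card U : ℝ)⁻¹ *
        ∫ t, (fun t => partFn χ t * wordMean χ i t ^ q) (fun j => clamp (t j))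
          ∂(pi fun j => (ν (s j) : Measure ℝ)) := by
    intro s c _ _ hs hc
    have hpi := pi_eq_sentLaw hc
    have : IsProb (sentLaw (pi s)) := hpi ▸ inferInstance
    have hspin : ∀ a : ℤˣ, spin a ^ q = 1 := fun a => by
      rcases Int.units_eq_one_or a with rfl | rfl <;> simp [spin, hq.neg_one_pow]
    rw [hpi, (signInvariant_pi hs).integral_gauge χ (integrable_of_abs_le_one
      ((measurable_wordMean_tanhs χ i).pow_const q) (abs_wordMean_pow_le χ i q))
      (fun g l => by rw [tanhs_flipBy, wordMean_flipBy, mul_pow, hspin, one_mul])]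
    congr 1
    have hmap : (pi fun j => (ν (s j) : Measure ℝ)) = (pi s).map tanhs :=
      (Measure.pi_map_pi (μ := s) (f := fun _ => tanh)
        (hμ := fun j => (inferInstance : SigmaFinite (ν (s j) : Measure ℝ)))
        fun j => measurable_tanh.aemeasurable).symm
    have hcm : Measurable fun t : V → ℝ => fun j => clamp (t j) :=
      measurable_pi_lambda _ fun j => continuous_clamp.measurable.comp (measurable_pi_apply j)
    have hΦ : Measurable fun t => partFn χ t * wordMean χ i t ^ q :=
      (continuous_partFn χ).measurable.mul ((measurable_wordMean χ i).pow_const q)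
    rw [hmap]
    refine Eq.trans ?_ (integral_map measurable_tanhs.aemeasurable
      (hΦ.comp hcm).aestronglyMeasurable).symm
    congr with l
    have : (fun j => clamp (tanhs l j)) = tanhs l :=
      funext fun j => clamp_eq (abs_tanhs_le l j)
    simp only [comp_apply, this]
  simp_rw [fun a => hval (s a) (γ a) (hs a) (hc a), hval s₀ γ₀ hs₀ hc₀]
  refine (tendsto_integral_cube hlim (continuousOn_partFn_mul_pow χ i hq0)
    (C := card U * 2 ^ card V) fun t ht => ?_).const_mul _
  rw [abs_mul, abs_pow, abs_of_nonneg (partFn_nonneg χ ht)]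
  refine (mul_le_of_le_one_right (partFn_nonneg χ ht)
      (pow_le_one₀ (abs_nonneg _) (abs_wordMean_le χ i ht))).trans ?_
  rw [← nsmul_eq_mul, ← card_univ, ← sum_const]
  exact sum_le_sum fun g _ => wordWeight_le _ ht

end

section

variable {V U : Type} [Fintype V] [Fintype U] [DecidableEq V] [Group U]

/-- The noise laws `c y` at the bits of `s`, and the reference law elsewhere. -/
def hybrid (c : ℝ → Measure ℝ) (ε : ℝ) (s : Finset V) (y : ℝ) : V → Measure ℝ :=
  fun j => if j ∈ s then c y else c ε

omit [Fintype V] in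
lemma hybrid_insert (c : ℝ → Measure ℝ) (ε : ℝ) (s : Finset V) (i : V) (y : ℝ) :
    hybrid c ε (insert i s) y = upd (hybrid c ε s y) i (c y) := by
  ext j : 1
  by_cases h : j = i
  · subst h; simp [hybrid]
  · simp [hybrid, h]

omit [Fintype V] in
lemma hybrid_of_notMem (c : ℝ → Measure ℝ) (ε : ℝ) {s : Finset V} {i : V} (hi : i ∉ s) (y : ℝ) :
    hybrid c ε s y = upd (hybrid c ε s y) i (c ε) := by
  ext j : 1
  by_cases h : j = i
  · subst h; simp [hybrid, hi]
  · simp [h]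

omit [Fintype V] in
lemma hybrid_prop {p : Measure ℝ → Prop} {c : ℝ → Measure ℝ} (hc : ∀ y, p (c y)) (ε : ℝ)
    (s : Finset V) (y : ℝ) (j : V) : p (hybrid c ε s y j) := by
  unfold hybrid
  split_ifs
  · exact hc y
  · exact hc ε

/-- The derivative in the noise parameter is obtained by varying the laws of the observations one
after the other. Each variation is a GEXIT series by `hasSum_logPart_update`; its difference
quotients converge by dominated convergence, since the moments are Lipschitz uniformly in `p`. -/
lemma hasDerivAt_logPart_hybrid (χ : U →* (V → ℤˣ)) {c : ℝ → Measure ℝ}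
    (hc : ∀ y, IsSymmNoise (c y)) (h1 : ∀ y, Integrable (fun l => |l|) (c y)) {ε : ℝ}
    {T : ℕ → ℝ} {B : ℝ}
    (hT : ∀ p : ℕ, HasDerivAt (fun y => ∫ l, tanh l ^ (2 * (p + 1)) ∂(c y)) (T p) ε)
    (hB : ∀ᶠ y in 𝓝 ε, ∀ p : ℕ, |∫ l, tanh l ^ (2 * (p + 1)) ∂(c y) -
      ∫ l, tanh l ^ (2 * (p + 1)) ∂(c ε)| ≤ B * |y - ε|) (s : Finset V) :
    HasDerivAt (fun y => ∫ l, logPart χ l ∂(pi (hybrid c ε s y)))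
      (∑ i ∈ s, ∑' p, T p * gexitCoeff (extrinsicLaw χ i fun _ => c ε) p) ε := by
  have hcp := fun y => (hc y).isProb
  induction s using Finset.induction_on with
  | empty =>
    have : ∀ y, hybrid c ε (∅ : Finset V) y = fun _ => c ε := fun y => by ext j : 1; simp [hybrid]
    simp_rw [this]
    simpa using hasDerivAt_const ε _
  | insert i s hi ih =>
    have hhp : ∀ y j, IsProb (hybrid c ε s y j) := fun y j => hybrid_prop hcp ε s y j
    set M : ℕ → ℝ → ℝ := fun p y => ∫ l, tanh l ^ (2 * (p + 1)) ∂(c y) with hM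
    set κ : ℝ → ℕ → ℝ := fun y => gexitCoeff (extrinsicLaw χ i (hybrid c ε s y)) with hκ
    have hdiff : ∀ y, HasSum (fun p => (M p y - M p ε) * κ y p)
        (∫ l, logPart χ l ∂(pi (hybrid c ε (insert i s) y)) -
          ∫ l, logPart χ l ∂(pi (hybrid c ε s y))) := fun y => by
      have hs := hybrid_prop hc ε s y
      have hs1 := hybrid_prop (p := fun c => Integrable (fun l => |l|) c) h1 ε s y
      have a := hasSum_logPart_update χ hs hs1 i (hc y) (h1 y)
      have b := hasSum_logPart_update χ hs hs1 i (hc ε) (h1 ε)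
      rw [← hybrid_insert] at a
      rw [← hybrid_of_notMem c ε hi y] at b
      have := a.sub b
      rw [sub_sub_sub_cancel_right] at this
      exact this.congr_fun fun p => by simp only [hM, hκ]; ring
    have hodd := fun y => moment_extrinsicLaw_odd χ (hybrid_prop hc ε s y) i
    have hκb : ∀ y p, |κ y p| ≤ 2 * (1 / ((2 * (p : ℝ) + 1) * (2 * p + 2))) := fun y =>
      have := isProbabilityMeasure_extrinsicLaw χ i (hybrid c ε s y)
      abs_gexitCoeff_le_of_symm (abs_le_one_extrinsicLaw χ i (hybrid c ε s y)) (hodd y)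
    -- continuity of all moments of the noise
    have hmom : ∀ k : ℕ, Tendsto (fun y => ∫ l, tanh l ^ k ∂(c y)) (𝓝 ε)
        (𝓝 (∫ l, tanh l ^ k ∂(c ε))) := fun k => by
      have heven : ∀ p, Tendsto (fun y => ∫ l, tanh l ^ (2 * (p + 1)) ∂(c y)) (𝓝 ε)
        (𝓝 (∫ l, tanh l ^ (2 * (p + 1)) ∂(c ε))) := fun p => (hT p).continuousAt
      rcases Nat.even_or_odd' k with ⟨p, rfl | rfl⟩
      · rcases p with _ | p
        · simp only [mul_zero, pow_zero, integral_const, probReal_univ, smul_eq_mul, mul_one]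
          exact tendsto_const_nhds
        · exact heven p
      · have := heven p
        simp_rw [fun y => (hc y).moment_odd (k := 2 * p + 1) ⟨p, rfl⟩]
        exact this
    have hκlim : ∀ p, Tendsto (fun y => κ y p) (𝓝[≠] ε)
        (𝓝 (gexitCoeff (extrinsicLaw χ i fun _ => c ε) p)) := fun p => by
      have hε : hybrid c ε s ε = fun _ => c ε := by ext j : 1; simp [hybrid]
      have hl : gexitCoeff (extrinsicLaw χ i fun _ => c ε) p = κ ε p := by simp only [hκ, hε]
      rw [hl]
      simp_rw [hκ, gexitCoeff_of_symm (hodd _), moment_extrinsicLaw]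
      refine Tendsto.div_const (Tendsto.sub_const ?_ 1) _
      refine (tendsto_wordMean_pow χ i (q := 2 * p + 2) ⟨p + 1, by ring⟩ (by omega)
        (fun y => isSymmNoise_update (hybrid_prop hc ε s y) i isSymmNoise_dirac)
        (isSymmNoise_update (hybrid_prop hc ε s ε) i isSymmNoise_dirac)
        fun j k => ?_)
      by_cases hj : j = i
      · subst hj; simp
      · simp only [update_of_ne hj, hybrid]
        by_cases hjs : j ∈ s
        · simp only [hjs, if_true]; exact (hmom k).mono_left nhdsWithin_le_nhds
        · simp only [hjs, if_false]; exact tendsto_const_nhds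
    rw [Finset.sum_insert hi, add_comm]
    have hsplit : ∀ y, ∫ l, logPart χ l ∂(pi (hybrid c ε (insert i s) y)) =
        ∫ l, logPart χ l ∂(pi (hybrid c ε s y)) + ∑' p, (M p y - M p ε) * κ y p :=
      fun y => by rw [(hdiff y).tsum_eq]; ring
    simp_rw [hsplit]
    refine ih.add ?_
    rw [hasDerivAt_iff_tendsto_slope]
    have hslope : ∀ y, slope (fun y => ∑' p, (M p y - M p ε) * κ y p) ε y =
        ∑' p, ((M p y - M p ε) / (y - ε)) * κ y p := fun y => by
      simp only [slope_def_field, sub_self, zero_mul, tsum_zero, sub_zero]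
      rw [← tsum_div_const]
      exact tsum_congr fun p => by ring
    refine Tendsto.congr (fun y => (hslope y).symm) ?_
    refine tendsto_tsum_of_dominated_convergence
      (bound := fun p => B * (2 * (1 / ((2 * (p : ℝ) + 1) * (2 * p + 2)))))
      ((summable_inv_odd_mul_even.mul_left 2).mul_left B) (fun p => ?_) ?_
    · refine Tendsto.mul ?_ (hκlim p)
      have := (hT p).tendsto_slope
      exact this.congr fun y => slope_def_field _ _ _
    · filter_upwards [nhdsWithin_le_nhds hB, self_mem_nhdsWithin] with y hy hne p
      have hpos : 0 < |y - ε| := abs_pos.2 (sub_ne_zero.2 hne)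
      rw [norm_mul, norm_eq_abs, norm_eq_abs, abs_div]
      have hq : |M p y - M p ε| / |y - ε| ≤ B := by rw [div_le_iff₀ hpos]; exact hy p
      exact mul_le_mul hq (hκb y p) (abs_nonneg _) ((by positivity : (0:ℝ) ≤ _ / _).trans hq)

lemma hasDerivAt_logPart {Ch : Channel} (hK : Ch.ClassK) {ε : ℝ} (hε : ε ∈ Ch.dom)
    (χ : U →* (V → ℤˣ)) :
    HasDerivAt (fun y => ∫ l, logPart χ l ∂(pi fun _ => Ch.c y))
      (∑ i, gexitSum Ch ε (gexitCoeff (extrinsicLaw χ i fun _ => Ch.c ε))) ε := by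
  classical
  obtain ⟨r, hr, B, hsub, hB⟩ := hK.local_bound hε
  have hnhds := Metric.ball_mem_nhds ε hr
  -- outside the domain the laws are replaced by the one at `ε`
  set c : ℝ → Measure ℝ := fun y => if y ∈ Ch.dom then Ch.c y else Ch.c ε with hc
  have hcdom : ∀ y ∈ Ch.dom, c y = Ch.c y := fun y hy => by simp [hc, hy]
  have hev : ∀ᶠ y in 𝓝 ε, c y = Ch.c y := by
    filter_upwards [hnhds] with y hy using hcdom y (hsub hy)
  have hcs : ∀ y, IsSymmNoise (c y) := fun y => by
    simp only [hc]; split_ifs with h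
    · exact Ch.isSymmNoise_c hK h
    · exact Ch.isSymmNoise_c hK hε
  have hci : ∀ y, Integrable (fun l => |l|) (c y) := fun y => by
    simp only [hc]; split_ifs with h
    · exact Ch.exp_abs_integrable hK h
    · exact Ch.exp_abs_integrable hK hε
  have h := hasDerivAt_logPart_hybrid χ hcs hci (ε := ε)
    (T := fun p => deriv (Ch.tanhMoment (p + 1)) ε) (B := B) (fun p => ?_) ?_ univ
  · rw [hcdom ε hε] at h
    refine h.congr_of_eventuallyEq ?_
    filter_upwards [hev] with y hy
    have : hybrid c ε (univ : Finset V) y = fun _ => Ch.c y := by ext j : 1; simp [hybrid, hy]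
    rw [this]
  · refine (hK.T_exists (p + 1) (by omega) ε hε).hasDerivAt.congr_of_eventuallyEq ?_
    filter_upwards [hev] with y hy
    rw [hy]; rfl
  · filter_upwards [hnhds] with y hy p
    rw [hcdom y (hsub hy), hcdom ε hε]
    have := (convex_ball ε r).norm_image_sub_le_of_norm_deriv_le
      (fun z hz => hK.T_exists (p + 1) (by omega) z (hsub hz))
      (fun z hz => hB p z hz) (Metric.mem_ball_self hr) hy
    exact this

end

/-! ### The posterior entropy and the MAP-GEXIT function -/

section

variable {V U : Type} [Fintype V] [Fintype U]

/-- Boltzmann weights of words, up to a common factor. -/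
lemma prod_exp_eq (x : V → ℤˣ) (l : V → ℝ) :
    ∏ j, exp (l j * spin (x j)) = (∏ j, cosh (l j)) * wordWeight x (tanhs l) := by
  rw [wordWeight, ← prod_mul_distrib]
  exact prod_congr rfl fun j _ => one_add_mul_spin_eq (l j) (x j)

lemma gibbsAvg_const_mul {w f : U → ℝ} {C : ℝ} (hC : C ≠ 0) :
    gibbsAvg (fun g => C * w g) f = gibbsAvg w f := by
  rw [gibbsAvg, gibbsAvg]
  simp_rw [mul_left_comm (f _), ← mul_sum]
  exact mul_div_mul_left _ _ hC

lemma prod_cosh_pos (l : V → ℝ) : 0 < ∏ j, cosh (l j) := prod_pos fun j _ => cosh_pos _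

lemma gibbsAvg_words (χ : U → V → ℤˣ) (l : V → ℝ) (i : V) :
    gibbsAvg (fun g => ∏ j, exp (l j * spin (χ g j))) (fun g => spin (χ g i)) =
      wordMean χ i (tanhs l) := by
  simp_rw [prod_exp_eq]
  rw [gibbsAvg_const_mul (prod_cosh_pos l).ne']
  rfl

lemma gibbsEntropy_words [Nonempty U] (χ : U → V → ℤˣ) (l : V → ℝ) :
    gibbsEntropy (fun g => ∏ j, exp (l j * spin (χ g j))) =
      logPart χ l + ∑ j, l j * (1 - wordMean χ j (tanhs l)) := by
  set t := tanhs l with ht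
  have hC := prod_cosh_pos l
  have hZ : 0 < partFn χ t := partFn_pos χ l
  have hW : 0 < wordWeight 1 t := wordWeight_tanhs_pos 1 l
  have hsum : ∑ g, ∏ j, exp (l j * spin (χ g j)) = (∏ j, cosh (l j)) * partFn χ t := by
    simp_rw [prod_exp_eq, ← mul_sum]; rfl
  have hone : exp (∑ j, l j) = (∏ j, cosh (l j)) * wordWeight 1 t := by
    rw [exp_sum, ← prod_exp_eq]
    simp [spin_one]
  have hlog : log ((∏ j, cosh (l j)) * partFn χ t) = logPart χ l + ∑ j, l j := by
    rw [← Real.log_exp (∑ j, l j), hone, logPart, ← Real.log_mul (div_pos hZ hW).ne'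
      (mul_pos hC hW).ne']
    field_simp
  have hp : ∀ g, negMulLog ((∏ j, exp (l j * spin (χ g j))) / ∑ g, ∏ j, exp (l j * spin (χ g j))) =
      wordWeight (χ g) t / partFn χ t * (logPart χ l + ∑ j, l j * (1 - spin (χ g j))) := fun g => by
    have hw : 0 < ∏ j, exp (l j * spin (χ g j)) := prod_pos fun _ _ => exp_pos _
    rw [negMulLog, log_div hw.ne' (by rw [hsum]; exact (mul_pos hC hZ).ne'), hsum, hlog,
      ← exp_sum, Real.log_exp, exp_sum, prod_exp_eq, mul_div_mul_left _ _ hC.ne']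
    simp_rw [mul_sub, mul_one, sum_sub_distrib]
    ring
  have hw1 : ∑ g, wordWeight (χ g) t = partFn χ t := rfl
  rw [gibbsEntropy]
  simp_rw [hp, mul_add, sum_add_distrib, ← sum_mul, ← sum_div, hw1,
    div_self hZ.ne', one_mul, mul_sum]
  rw [Finset.sum_comm]
  congr 1
  refine sum_congr rfl fun j _ => ?_
  have h1 : ∀ g, wordWeight (χ g) t / partFn χ t * (l j * (1 - spin (χ g j))) =
      l j * (wordWeight (χ g) t / partFn χ t) -
        l j * (spin (χ g j) * wordWeight (χ g) t / partFn χ t) := fun g => by ring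
  simp_rw [h1, sum_sub_distrib, ← mul_sum, ← sum_div, hw1, div_self hZ.ne']
  rw [wordMean, partNum]
  ring

lemma integral_posterior_correction [Group U] [DecidableEq V] (χ : U →* (V → ℤˣ))
    {γ : V → Measure ℝ} (hγ : ∀ j, IsSymmNoise (γ j)) (h1 : ∀ j, Integrable (fun l => |l|) (γ j))
    (j : V) :
    Integrable (fun l => l j * (1 - wordMean χ j (tanhs l))) (pi γ) ∧
    ∫ l, l j * (1 - wordMean χ j (tanhs l)) ∂(pi γ) = 0 := by
  have hp := fun j => (hγ j).isProb
  have ha := integrable_abs_coord h1 j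
  have hl : Integrable (fun l : V → ℝ => l j) (pi γ) :=
    ha.mono (measurable_pi_apply j).aestronglyMeasurable (ae_of_all _ fun l => by simp)
  have hlm : Integrable (fun l : V → ℝ => l j * wordMean χ j (tanhs l)) (pi γ) := by
    refine ha.mono ((measurable_pi_apply j).mul
      (measurable_wordMean_tanhs χ j)).aestronglyMeasurable (ae_of_all _ fun l => ?_)
    rw [norm_mul, norm_eq_abs, norm_eq_abs, norm_eq_abs, abs_abs]
    exact mul_le_of_le_one_right (abs_nonneg _) (abs_wordMean_le χ j (abs_tanhs_le l))
  simp_rw [mul_sub, mul_one]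
  refine ⟨hl.sub hlm, ?_⟩
  rw [integral_sub hl hlm, sub_eq_zero]
  obtain ⟨Q, hQ, hinv, hpi⟩ := exists_signInvariant hγ
  rw [hpi] at hl ⊢
  rw [hinv.nishimori χ hl]
  congr with l
  simp only [flipBy, wordMean, partNum]
  rw [← mul_div_assoc, mul_sum]
  grind

lemma integral_gibbsEntropy_words [Group U] [DecidableEq V] (χ : U →* (V → ℤˣ))
    {γ : V → Measure ℝ} (hγ : ∀ j, IsSymmNoise (γ j)) (h1 : ∀ j, Integrable (fun l => |l|) (γ j)) :
    ∫ l, gibbsEntropy (fun g => ∏ j, exp (l j * spin (χ g j))) ∂(pi γ) =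
      ∫ l, logPart χ l ∂(pi γ) := by
  have hp := fun j => (hγ j).isProb
  simp_rw [gibbsEntropy_words]
  rw [integral_add (integrable_logPart χ h1)
    (integrable_finsetSum _ fun j _ => (integral_posterior_correction χ hγ h1 j).1),
    integral_finsetSum _ fun j _ => (integral_posterior_correction χ hγ h1 j).1,
    Finset.sum_eq_zero fun j _ => (integral_posterior_correction χ hγ h1 j).2, add_zero]

end

section

open scoped Classical

variable {V A E : Type} [Fintype V] [Fintype A] [Fintype E]

/-- The encoder of an LDGM code. -/
def ldgmWord (G : Graph V A E) : (A → ℤˣ) →* (V → ℤˣ) where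
  toFun u i := ∏ e with G.bit e = i, u (G.oth e)
  map_one' := by ext; simp
  map_mul' u v := by ext; simp [prod_mul_distrib]

lemma spin_prod {ι : Type*} (s : Finset ι) (f : ι → ℤˣ) :
    spin (∏ i ∈ s, f i) = ∏ i ∈ s, spin (f i) := by
  simp [spin, Units.coe_prod]

lemma codeBit_eq (G : Graph V A E) (u : A → ℤˣ) (i : V) :
    codeBit G u i = spin (ldgmWord G u i) := by
  simp [codeBit, ldgmWord, spin_prod]

/-- The words of an LDPC code. -/
def ldpcCode (G : Graph V A E) : Subgroup (V → ℤˣ) where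
  carrier := {x | ∀ a, ∏ e with G.oth e = a, x (G.bit e) = 1}
  one_mem' a := by simp
  mul_mem' {x y} hx hy a := by simp [prod_mul_distrib, hx a, hy a]
  inv_mem' {x} hx a := by simp [hx a]

lemma prod_checks (G : Graph V A E) (x : V → ℤˣ) :
    (∏ a : A, (1 / 2 : ℝ) * (1 + ∏ e with G.oth e = a, spin (x (G.bit e)))) =
      if x ∈ ldpcCode G then 1 else 0 := by
  have h : ∀ a, (1 / 2 : ℝ) * (1 + ∏ e with G.oth e = a, spin (x (G.bit e))) =
      if ∏ e with G.oth e = a, x (G.bit e) = 1 then 1 else 0 := fun a => by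
    rw [← spin_prod]
    rcases Int.units_eq_one_or (∏ e with G.oth e = a, x (G.bit e)) with h | h <;> rw [h]
    · norm_num [spin]
    · rw [if_neg (by decide)]; norm_num [spin]
  simp_rw [h]
  split_ifs with hx
  · exact prod_eq_one fun a _ => if_pos (hx a)
  · have : ∃ a, ¬ ∏ e with G.oth e = a, x (G.bit e) = 1 := not_forall.1 hx
    obtain ⟨a, ha⟩ := this
    exact prod_eq_zero (mem_univ a) (if_neg ha)

lemma ldpcWeight_eq (G : Graph V A E) (l : V → ℝ) (x : V → ℤˣ) :
    ldpcWeight G l x = if x ∈ ldpcCode G then ∏ i, exp (l i * spin (x i)) else 0 := by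
  rw [ldpcWeight, prod_checks]
  split_ifs <;> simp

instance (G : Graph V A E) : Fintype (ldpcCode G) := Fintype.ofFinite _

lemma sum_ite_mem_subgroup (H : Subgroup (V → ℤˣ)) [Fintype H] (f : (V → ℤˣ) → ℝ) :
    ∑ x, (if x ∈ H then f x else 0) = ∑ x : H, f x := by
  rw [← sum_filter]
  exact (Finset.sum_subtype _ (fun x => by simp) f)

/-- The soft bit estimate is the Gibbs mean of a group of words. -/
lemma softBit_ldgm (G : Graph V A E) (l : V → ℝ) (i : V) :
    softBit .ldgm G l i = wordMean (ldgmWord G) i (tanhs l) := by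
  rw [softBit, ← gibbsAvg_words]
  simp_rw [codeBit_eq]
  congr 1
  ext u
  simp [ldgmWeight, codeBit_eq]

lemma softBit_ldpc (G : Graph V A E) (l : V → ℝ) (i : V) :
    softBit .ldpc G l i = wordMean (ldpcCode G).subtype i (tanhs l) := by
  rw [softBit, ← gibbsAvg_words]
  simp only [gibbsAvg, ldpcWeight_eq, mul_ite, mul_zero]
  rw [sum_ite_mem_subgroup, sum_ite_mem_subgroup]
  rfl

lemma posteriorEntropy_ldgm (G : Graph V A E) (l : V → ℝ) : posteriorEntropy .ldgm G l =
      gibbsEntropy (fun u => ∏ j, exp (l j * spin (ldgmWord G u j))) := by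
  rw [posteriorEntropy]
  congr 1
  ext u
  simp [ldgmWeight, codeBit_eq]

lemma posteriorEntropy_ldpc (G : Graph V A E) (l : V → ℝ) : posteriorEntropy .ldpc G l =
      gibbsEntropy (fun x : ldpcCode G => ∏ j, exp (l j * spin ((ldpcCode G).subtype x j))) := by
  rw [posteriorEntropy, gibbsEntropy, gibbsEntropy]
  simp only [ldpcWeight_eq]
  rw [sum_ite_mem_subgroup]
  have : ∀ (x : V → ℤˣ) (c : ℝ), negMulLog ((if x ∈ ldpcCode G then
      ∏ i, exp (l i * spin (x i)) else 0) / c) = if x ∈ ldpcCode G then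
      negMulLog ((∏ i, exp (l i * spin (x i))) / c) else 0 := fun x c => by
    split_ifs <;> simp
  simp_rw [this]
  rw [sum_ite_mem_subgroup]
  rfl

end

section

open scoped Classical

variable {V A E : Type} [Fintype V] [Fintype A] [Fintype E]

/-- The extrinsic MAP estimate of the bit `i`. -/
def mapEstimate (κ : Kind) (G : Graph V A E) (i : V) (l : V → ℝ) : ℝ :=
  softBit κ G (upd l i 0) i

/-- The law of the extrinsic MAP estimate of the bit `i`. -/
def mapLaw (κ : Kind) (Ch : Channel) (ε : ℝ) (G : Graph V A E) (i : V) : Measure ℝ :=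
  (pi fun _ => Ch.c ε).map (mapEstimate κ G i)

lemma mapLaw_ldgm (Ch : Channel) (ε : ℝ) (G : Graph V A E) (i : V) :
    mapLaw .ldgm Ch ε G i = extrinsicLaw (ldgmWord G) i fun _ => Ch.c ε := by
  rw [mapLaw, extrinsicLaw]
  congr 1
  ext l
  exact softBit_ldgm G _ i

lemma mapLaw_ldpc (Ch : Channel) (ε : ℝ) (G : Graph V A E) (i : V) :
    mapLaw .ldpc Ch ε G i = extrinsicLaw (ldpcCode G).subtype i fun _ => Ch.c ε := by
  rw [mapLaw, extrinsicLaw]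
  congr 1
  ext l
  exact softBit_ldpc G _ i

lemma hasDerivAt_integral_posteriorEntropy {Ch : Channel} (hK : Ch.ClassK) {ε : ℝ}
    (hε : ε ∈ Ch.dom) (κ : Kind) (G : Graph V A E) :
    HasDerivAt (fun y => ∫ l, posteriorEntropy κ G l ∂(pi fun _ => Ch.c y))
      (∑ i, gexitSum Ch ε (gexitCoeff (mapLaw κ Ch ε G i))) ε := by
  have hev : ∀ᶠ y in 𝓝 ε, y ∈ Ch.dom := Ch.isOpen_dom.mem_nhds hε
  cases κ with
  | ldgm =>
    simp_rw [mapLaw_ldgm, posteriorEntropy_ldgm]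
    refine (hasDerivAt_logPart hK hε (ldgmWord G)).congr_of_eventuallyEq ?_
    filter_upwards [hev] with y hy
    exact integral_gibbsEntropy_words _ (fun _ => Ch.isSymmNoise_c hK hy)
      (fun _ => Ch.exp_abs_integrable hK hy)
  | ldpc =>
    simp_rw [mapLaw_ldpc, posteriorEntropy_ldpc]
    refine (hasDerivAt_logPart hK hε (ldpcCode G).subtype).congr_of_eventuallyEq ?_
    filter_upwards [hev] with y hy
    exact integral_gibbsEntropy_words _ (fun _ => Ch.isSymmNoise_c hK hy)
      (fun _ => Ch.exp_abs_integrable hK hy)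

lemma isProbabilityMeasure_mapLaw {Ch : Channel} {ε : ℝ}
    (hε : ε ∈ Ch.dom) (κ : Kind) (G : Graph V A E) (i : V) :
    IsProb (mapLaw κ Ch ε G i) := by
  have := Ch.isProb_c hε
  cases κ with
  | ldgm => rw [mapLaw_ldgm]; exact isProbabilityMeasure_extrinsicLaw _ _ _
  | ldpc => rw [mapLaw_ldpc]; exact isProbabilityMeasure_extrinsicLaw _ _ _

lemma abs_le_one_mapLaw (Ch : Channel) (ε : ℝ) (κ : Kind) (G : Graph V A E) (i : V) :
    ∀ᵐ x ∂(mapLaw κ Ch ε G i), |x| ≤ 1 := by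
  cases κ with
  | ldgm => rw [mapLaw_ldgm]; exact abs_le_one_extrinsicLaw _ _ _
  | ldpc => rw [mapLaw_ldpc]; exact abs_le_one_extrinsicLaw _ _ _

lemma moment_mapLaw_odd {Ch : Channel} (hK : Ch.ClassK) {ε : ℝ}
    (hε : ε ∈ Ch.dom) (κ : Kind) (G : Graph V A E) (i : V) (p : ℕ) :
    moment (mapLaw κ Ch ε G i) (2 * p + 1) = moment (mapLaw κ Ch ε G i) (2 * p + 2) := by
  cases κ with
  | ldgm => rw [mapLaw_ldgm]; exact moment_extrinsicLaw_odd _ (fun _ => Ch.isSymmNoise_c hK hε) _ _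
  | ldpc => rw [mapLaw_ldpc]; exact moment_extrinsicLaw_odd _ (fun _ => Ch.isSymmNoise_c hK hε) _ _

end

section

lemma hasDerivAt_meanEntropy {Ch : Channel} (hK : Ch.ClassK) {ε : ℝ} (hε : ε ∈ Ch.dom)
    (κ : Kind) {n m : ℕ} (bd : Fin n → ℕ) (od : Fin m → ℕ) :
    HasDerivAt (meanEntropy κ Ch bd od) (ensembleAvg bd od fun G => (1 / (n : ℝ)) *
      ∑ i, gexitSum Ch ε (gexitCoeff (mapLaw κ Ch ε G i))) ε := by
  refine HasDerivAt.div_const (HasDerivAt.fun_sum fun σ _ => ?_) _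
  exact (hasDerivAt_integral_posteriorEntropy hK hε κ (socketGraph bd od σ)).const_mul _

end

/-! ### Symmetric laws on `[-1, 1]` and the degradation order -/

section

variable {α β : Type*} [MeasurableSpace α] [MeasurableSpace β]

/-- Bounded measurable functions. -/
def BddMeas (f : α → ℝ) : Prop := Measurable f ∧ ∃ C, ∀ x, |f x| ≤ C

lemma BddMeas.integrable {f : α → ℝ} (hf : BddMeas f) (μ : Measure α) [IsFiniteMeasure μ] :
    Integrable f μ := by
  obtain ⟨h, C, hC⟩ := hf
  exact Integrable.of_bound h.aestronglyMeasurable C (ae_of_all _ hC)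

lemma BddMeas.comp {f : β → ℝ} (hf : BddMeas f) {g : α → β} (hg : Measurable g) :
    BddMeas (fun x => f (g x)) :=
  ⟨hf.1.comp hg, hf.2.imp fun _ hC x => hC _⟩

lemma BddMeas.add {f g : α → ℝ} (hf : BddMeas f) (hg : BddMeas g) :
    BddMeas (fun x => f x + g x) := by
  obtain ⟨h, C, hC⟩ := hf
  obtain ⟨h', C', hC'⟩ := hg
  exact ⟨h.add h', C + C', fun x => (abs_add_le _ _).trans (add_le_add (hC x) (hC' x))⟩

lemma BddMeas.mul {f g : α → ℝ} (hf : BddMeas f) (hg : BddMeas g) :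
    BddMeas (fun x => f x * g x) := by
  obtain ⟨h, C, hC⟩ := hf
  obtain ⟨h', C', hC'⟩ := hg
  refine ⟨h.mul h', C * C', fun x => ?_⟩
  rw [abs_mul]
  exact mul_le_mul (hC x) (hC' x) (abs_nonneg _) ((abs_nonneg _).trans (hC x))

lemma bddMeas_const (c : ℝ) : BddMeas (fun _ : α => c) := ⟨measurable_const, |c|, fun _ => le_rfl⟩

lemma BddMeas.integral_right {f : α × β → ℝ} (hf : BddMeas f) (ν : Measure β)
    [IsProb ν] : BddMeas (fun x => ∫ y, f (x, y) ∂ν) := by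
  obtain ⟨h, C, hC⟩ := hf
  refine ⟨(StronglyMeasurable.integral_prod_right' h.stronglyMeasurable).measurable, C, fun x => ?_⟩
  have := norm_integral_le_of_norm_le_const (μ := ν) (f := fun y => f (x, y))
    (ae_of_all _ fun y => hC _)
  simpa using this

lemma bddMeas_clamp : BddMeas clamp := ⟨continuous_clamp.measurable, 1, abs_clamp_le⟩

end

/-- Symmetric laws on `(-1, 1]`: the laws of `tanh` of half-loglikelihoods of symmetric channels
(infinite half-loglikelihoods allowed). -/
structure IsLaw (μ : Measure ℝ) : Prop where
  prob : IsProb μ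
  supp : ∀ᵐ x ∂μ, -1 < x ∧ x ≤ 1
  symm : ∀ o : ℝ → ℝ, BddMeas o → (∀ x, o (-x) = -o x) → ∫ x, o x ∂μ = ∫ x, x * o x ∂μ

lemma IsLaw.ae_abs_le {μ : Measure ℝ} (h : IsLaw μ) : ∀ᵐ x ∂μ, |x| ≤ 1 :=
  h.supp.mono fun _ hx => abs_le.2 ⟨hx.1.le, hx.2⟩

lemma IsLaw.integrable_mul {μ : Measure ℝ} (h : IsLaw μ) {g : ℝ → ℝ} (hg : BddMeas g) :
    Integrable (fun x => x * g x) μ := by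
  have := h.prob
  refine ((bddMeas_clamp.mul hg).integrable μ).congr (h.ae_abs_le.mono fun x hx => ?_)
  simp only [clamp_eq hx]

lemma IsLaw.integral_symm {μ : Measure ℝ} (h : IsLaw μ) {g : ℝ → ℝ} (hg : BddMeas g) :
    ∫ x, g x ∂μ = ∫ x, (1 / 2) * (g x * (1 + x) + g (-x) * (1 - x)) ∂μ := by
  have := h.prob
  have hn : BddMeas fun x => g (-x) := hg.comp measurable_neg
  have ho : BddMeas fun x => (1 / 2) * (g x + (-1) * g (-x)) :=
    (bddMeas_const _).mul (hg.add ((bddMeas_const _).mul hn))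
  have he : BddMeas fun x => (1 / 2) * (g x + g (-x)) := (bddMeas_const _).mul (hg.add hn)
  have e1 : ∀ x, g x = (1 / 2) * (g x + g (-x)) + (1 / 2) * (g x + (-1) * g (-x)) := fun x => by
    ring
  have e2 : ∀ x, (1 / 2) * (g x * (1 + x) + g (-x) * (1 - x)) =
      (1 / 2) * (g x + g (-x)) + x * ((1 / 2) * (g x + (-1) * g (-x))) := fun x => by ring
  have h1 : ∫ x, g x ∂μ = ∫ x, ((1 / 2) * (g x + g (-x)) + (1 / 2) * (g x + (-1) * g (-x))) ∂μ :=
    integral_congr_ae (ae_of_all _ e1)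
  rw [h1]
  simp_rw [e2]
  rw [integral_add (he.integrable μ) (ho.integrable μ),
    integral_add (he.integrable μ) (h.integrable_mul ho), h.symm _ ho fun x => by simp; ring]

lemma isLaw_dirac_zero : IsLaw (dirac 0) where
  prob := inferInstance
  supp := by simp [ae_dirac_eq]
  symm o _ h := by
    have := h 0
    simp at this
    simp [integral_dirac]; linarith

lemma isLaw_dirac_one : IsLaw (dirac 1) where
  prob := inferInstance
  supp := by simp [ae_dirac_eq]
  symm o _ h := by simp [integral_dirac]

lemma IsSymmNoise.isLaw {c : Measure ℝ} (hc : IsSymmNoise c) : IsLaw (c.map tanh) where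
  prob := by
    have := hc.isProb
    exact isProbabilityMeasure_map measurable_tanh.aemeasurable
  supp := by
    refine (ae_map_iff measurable_tanh.aemeasurable measurableSet_Ioc).2 (ae_of_all _ fun l => ?_)
    exact ⟨Real.neg_one_lt_tanh l, (Real.tanh_lt_one l).le⟩
  symm o ho hodd := by
    obtain ⟨s, hp, hs, rfl⟩ := hc
    rw [integral_map measurable_tanh.aemeasurable ho.1.aestronglyMeasurable,
      integral_map (f := fun x => x * o x) measurable_tanh.aemeasurable
        (measurable_id.mul ho.1).aestronglyMeasurable,
      IsSymmNoise.integral_eq_even rfl, IsSymmNoise.integral_eq_even rfl]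
    have hT : BddMeas tanh := ⟨measurable_tanh, 1, fun l => (abs_tanh_lt_one l).le⟩
    have hO : BddMeas fun l => o (tanh l) := ho.comp measurable_tanh
    have z : ∀ {g : ℝ → ℝ}, (∀ l, g (-l) = -g l) → ∫ l, g l ∂s = 0 := fun {g} hg => by
      have := IsSymmNoise.integral_neg_eq hs g
      simp_rw [hg, integral_neg] at this
      linarith
    have i1 := hO.integrable s
    have i2 := (hT.mul hO).integrable s
    have i3 := (hT.mul (hT.mul hO)).integrable s
    simp_rw [add_mul, one_mul]
    rw [integral_add i1 i2, integral_add i2 i3, z fun l => by simp [tanh_neg, hodd],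
      z (g := fun l => tanh l * (tanh l * o (tanh l))) fun l => by
        simp [tanh_neg, hodd], zero_add, add_zero]

/-- Image of a product law under a binary operation. -/
def lop (op : ℝ → ℝ → ℝ) (μ ν : Measure ℝ) : Measure ℝ := (μ.prod ν).map (fun z => op z.1 z.2)

section

variable {op : ℝ → ℝ → ℝ} {μ ν : Measure ℝ}

lemma isProbabilityMeasure_lop (hop : Measurable fun z : ℝ × ℝ => op z.1 z.2)
    [IsProb μ] [IsProb ν] : IsProb (lop op μ ν) :=
  isProbabilityMeasure_map hop.aemeasurable

lemma integral_lop (hop : Measurable fun z : ℝ × ℝ => op z.1 z.2)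
    [IsProb μ] [IsProb ν] {f : ℝ → ℝ} (hf : BddMeas f) :
    ∫ x, f x ∂(lop op μ ν) = ∫ x, ∫ y, f (op x y) ∂ν ∂μ := by
  rw [lop, integral_map hop.aemeasurable hf.1.aestronglyMeasurable,
    integral_prod _ ((hf.comp hop).integrable _)]

lemma integral_lop_swap (hop : Measurable fun z : ℝ × ℝ => op z.1 z.2)
    [IsProb μ] [IsProb ν] {f : ℝ → ℝ} (hf : BddMeas f) :
    ∫ x, f x ∂(lop op μ ν) = ∫ y, ∫ x, f (op x y) ∂μ ∂ν := by
  rw [integral_lop hop hf, integral_integral_swap]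
  exact (hf.comp hop).integrable _

lemma ae_lop (hop : Measurable fun z : ℝ × ℝ => op z.1 z.2) [IsProb μ] [IsProb ν] {p q r : ℝ → Prop}
    (hr : MeasurableSet {x | r x})
    (hμ : ∀ᵐ x ∂μ, p x) (hν : ∀ᵐ x ∂ν, q x) (h : ∀ x y, p x → q y → r (op x y)) :
    ∀ᵐ x ∂(lop op μ ν), r x := by
  rw [lop, ae_map_iff hop.aemeasurable hr]
  filter_upwards [Measure.quasiMeasurePreserving_fst.ae hμ,
    Measure.quasiMeasurePreserving_snd.ae hν] with z h1 h2 using h _ _ h1 h2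

lemma lop_comm (hop : Measurable fun z : ℝ × ℝ => op z.1 z.2)
    [IsProb μ] [IsProb ν] (hc : ∀ x y, op x y = op y x) :
    lop op μ ν = lop op ν μ := by
  rw [lop, lop, ← Measure.prod_swap, Measure.map_map hop measurable_swap]
  congr 1
  ext z
  exact hc _ _

/-- Symmetrisation of both arguments of a double integral. -/
lemma integral_symm₂ (hμ : IsLaw μ) (hν : IsLaw ν) {g : ℝ → ℝ → ℝ}
    (hg : BddMeas fun z : ℝ × ℝ => g z.1 z.2) :
    ∫ x, ∫ y, g x y ∂ν ∂μ = ∫ x, ∫ y, (1 / 4) * (g x y * ((1 + x) * (1 + y)) +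
      g x (-y) * ((1 + x) * (1 - y)) + g (-x) y * ((1 - x) * (1 + y)) +
      g (-x) (-y) * ((1 - x) * (1 - y))) ∂ν ∂μ := by
  have := hν.prob
  rw [hμ.integral_symm (hg.integral_right ν)]
  congr with x
  have hx : ∀ x, BddMeas (g x) := fun x => hg.comp (measurable_prodMk_left)
  have hi : ∀ x, Integrable (fun y => (1 / 2) * (g x y * (1 + y) + g x (-y) * (1 - y))) ν :=
    fun x => by
      have h1 := (hx x).integrable ν
      have h2 := hν.integrable_mul (hx x)
      have h3 := ((hx x).comp measurable_neg).integrable ν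
      have h4 := hν.integrable_mul ((hx x).comp measurable_neg)
      refine (((h1.add h2).add (h3.sub h4)).const_mul (1 / 2)).congr (ae_of_all _ fun y => ?_)
      simp
      ring
  simp only
  rw [hν.integral_symm (hx x), hν.integral_symm (hx (-x)), ← integral_mul_const,
    ← integral_mul_const, ← integral_add ((hi x).mul_const _) ((hi (-x)).mul_const _),
    ← integral_const_mul]
  grind

end

/-- The sum of half-loglikelihoods in terms of hyperbolic tangents. -/
def box (x y : ℝ) : ℝ := (x + y) / (1 + x * y)

lemma measurable_box : Measurable fun z : ℝ × ℝ => box z.1 z.2 := by unfold box; fun_prop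

lemma measurable_mul_op : Measurable fun z : ℝ × ℝ => z.1 * z.2 := by fun_prop

lemma box_comm (x y : ℝ) : box x y = box y x := by rw [box, box, add_comm, mul_comm]

lemma box_zero (x : ℝ) : box x 0 = x := by simp [box]

lemma one_add_mul_pos {x y : ℝ} (hx : -1 < x ∧ x ≤ 1) (hy : -1 < y ∧ y ≤ 1) : 0 < 1 + x * y := by
  rcases le_or_gt 0 y with h | h
  · nlinarith
  · nlinarith

lemma box_mem {x y : ℝ} (hx : -1 < x ∧ x ≤ 1) (hy : -1 < y ∧ y ≤ 1) :
    -1 < box x y ∧ box x y ≤ 1 := by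
  have h := one_add_mul_pos hx hy
  rw [box, lt_div_iff₀ h, div_le_one h]
  constructor <;> nlinarith

lemma box_mul {x y : ℝ} (hx : -1 < x ∧ x ≤ 1) (hy : -1 < y ∧ y ≤ 1) :
    (1 + x * y) * box x y = x + y := mul_div_cancel₀ _ (one_add_mul_pos hx hy).ne'

lemma box_neg_mul {x y : ℝ} (hx : -1 < x ∧ x ≤ 1) (hy : -1 < y ∧ y ≤ 1) :
    (1 - x * y) * box x (-y) = x - y := by
  by_cases h : 1 - x * y = 0
  · have : x = 1 ∧ y = 1 := by
      rcases le_or_gt 0 y with h5 | h5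
      · constructor <;> nlinarith
      · nlinarith
    rw [h, this.1, this.2]; norm_num
  · rw [box, mul_neg, ← sub_eq_add_neg, ← sub_eq_add_neg]
    exact mul_div_cancel₀ _ h

lemma box_neg_neg (x y : ℝ) : box (-x) (-y) = -box x y := by
  rw [box, box, neg_mul_neg, ← neg_add, neg_div]

lemma box_neg_left (x y : ℝ) : box (-x) y = -box x (-y) := by rw [← box_neg_neg, neg_neg]

/-- Averages of even functions over the law of `x ⊞ w`. -/
lemma integral_box_even {μ ν : Measure ℝ} (hμ : IsLaw μ) (hν : IsLaw ν) {f : ℝ → ℝ}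
    (hf : BddMeas f) (he : ∀ x, f (-x) = f x) :
    ∫ x, f x ∂(lop box μ ν) = ∫ x, ∫ w, (1 / 2) * ((1 + x * w) * f (box x w) +
      (1 - x * w) * f (box x (-w))) ∂ν ∂μ := by
  have := hμ.prob
  have := hν.prob
  rw [integral_lop measurable_box hf, integral_symm₂ hμ hν (hf.comp measurable_box)]
  refine integral_congr_ae (ae_of_all _ fun x => integral_congr_ae (ae_of_all _ fun y => ?_))
  simp only [box_neg_left, neg_neg, he]
  ring

lemma isLaw_mul {μ ν : Measure ℝ} (hμ : IsLaw μ) (hν : IsLaw ν) : IsLaw (lop (· * ·) μ ν) := by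
  have := hμ.prob
  have := hν.prob
  refine ⟨isProbabilityMeasure_lop measurable_mul_op, ae_lop measurable_mul_op measurableSet_Ioc
    hμ.supp hν.supp fun x y hx hy => ?_, fun o ho hodd => ?_⟩
  · have := one_add_mul_pos hx hy
    constructor
    · linarith
    · rcases le_or_gt 0 y with h | h <;> nlinarith
  · have hs : ∀ᵐ z ∂(lop (· * ·) μ ν), |z| ≤ 1 :=
      ae_lop measurable_mul_op (measurableSet_le (by fun_prop) measurable_const)
        hμ.ae_abs_le hν.ae_abs_le fun x y hx hy => by simp; exact mul_le_one₀ hx (abs_nonneg _) hy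
    have e : ∫ x, x * o x ∂(lop (· * ·) μ ν) = ∫ x, clamp x * o x ∂(lop (· * ·) μ ν) :=
      integral_congr_ae (hs.mono fun x hx => by simp only [clamp_eq hx])
    rw [e, integral_lop measurable_mul_op ho, integral_lop measurable_mul_op (bddMeas_clamp.mul ho)]
    have h1 : ∀ x, ∫ y, o (x * y) ∂ν = ∫ y, y * o (x * y) ∂ν := fun x =>
      hν.symm _ (ho.comp (measurable_const_mul x)) fun y => by rw [mul_neg, hodd]
    have hB : BddMeas fun x => ∫ y, clamp y * o (x * y) ∂ν := BddMeas.integral_right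
        ((bddMeas_clamp.comp measurable_snd).mul (ho.comp measurable_mul_op)) ν
    have h2 : ∀ x, ∫ y, y * o (x * y) ∂ν = ∫ y, clamp y * o (x * y) ∂ν := fun x =>
      integral_congr_ae (hν.ae_abs_le.mono fun y hy => by simp only [clamp_eq hy])
    simp_rw [h1, h2]
    rw [hμ.symm _ hB fun x => by simp only [neg_mul, hodd, mul_neg, integral_neg]]
    refine integral_congr_ae (hμ.ae_abs_le.mono fun x hx => ?_)
    simp only
    rw [← integral_const_mul]
    refine integral_congr_ae (hν.ae_abs_le.mono fun y hy => ?_)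
    have : |x * y| ≤ 1 := by rw [abs_mul]; exact mul_le_one₀ hx (abs_nonneg _) hy
    simp only [clamp_eq hy, clamp_eq this]
    ring

lemma isLaw_box {μ ν : Measure ℝ} (hμ : IsLaw μ) (hν : IsLaw ν) : IsLaw (lop box μ ν) := by
  have := hμ.prob
  have := hν.prob
  have hsupp : ∀ᵐ z ∂(lop box μ ν), -1 < z ∧ z ≤ 1 :=
    ae_lop measurable_box measurableSet_Ioc hμ.supp hν.supp fun x y hx hy => box_mem hx hy
  refine ⟨isProbabilityMeasure_lop measurable_box, hsupp, fun o ho hodd => ?_⟩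
  have e : ∫ x, x * o x ∂(lop box μ ν) = ∫ x, clamp x * o x ∂(lop box μ ν) :=
      integral_congr_ae (hsupp.mono fun x hx => by simp only [clamp_eq (abs_le.2 ⟨hx.1.le, hx.2⟩)])
  rw [e, integral_box_even hμ hν (bddMeas_clamp.mul ho) fun x => by rw [clamp_neg, hodd]; ring,
    integral_lop measurable_box ho,
    integral_symm₂ hμ hν (ho.comp measurable_box)]
  refine integral_congr_ae (hμ.supp.mono fun x hx => integral_congr_ae (hν.supp.mono
    fun y hy => ?_))
  have hb := box_mem hx hy
  have h1 := box_mul hx hy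
  have h2 := box_neg_mul hx hy
  simp only [box_neg_left, neg_neg, hodd, clamp_eq (abs_le.2 ⟨hb.1.le, hb.2⟩)]
  have h3 : (1 - x * y) * (clamp (box x (-y)) * o (box x (-y))) = (x - y) * o (box x (-y)) := by
    rw [← h2]
    by_cases h : 1 - x * y = 0
    · simp [h]
    · have hpos : 0 < 1 - x * y := lt_of_le_of_ne (by
        rcases le_or_gt 0 y with h5 | h5 <;> nlinarith) (Ne.symm h)
      have : |box x (-y)| ≤ 1 := by
        rw [abs_le]
        constructor <;> nlinarith [hx.1, hx.2, hy.1, hy.2]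
      rw [clamp_eq this]; ring
  rw [h3, ← mul_assoc (1 + x * y), h1]
  ring

/-- Continuous bounded even functions that are convex on `[-1, 1]`: the test functions of the
degradation order. -/
structure IsEvenConvex (f : ℝ → ℝ) : Prop where
  bdd : BddMeas f
  cont : Continuous f
  even : ∀ x, f (-x) = f x
  convex : ConvexOn ℝ (Icc (-1) 1) f

/-- The degradation order: `μ` carries less information than `ν`. -/
def LawLE (μ ν : Measure ℝ) : Prop := ∀ f, IsEvenConvex f → ∫ x, f x ∂μ ≤ ∫ x, f x ∂ν

lemma LawLE.refl (μ : Measure ℝ) : LawLE μ μ := fun _ _ => le_rfl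

lemma LawLE.trans {μ ν ρ : Measure ℝ} (h : LawLE μ ν) (h' : LawLE ν ρ) : LawLE μ ρ :=
  fun f hf => (h f hf).trans (h' f hf)

lemma clamp_mem (x : ℝ) : clamp x ∈ Icc (-1 : ℝ) 1 := abs_le.1 (abs_clamp_le x)

lemma clamp_of_mem {x : ℝ} (hx : x ∈ Icc (-1 : ℝ) 1) : clamp x = x := clamp_eq (abs_le.2 hx)

lemma isEvenConvex_clamp {g : ℝ → ℝ} (hc : ContinuousOn g (Icc (-1) 1))
    (hcv : ConvexOn ℝ (Icc (-1) 1) g) (he : ∀ x ∈ Icc (-1 : ℝ) 1, g (-x) = g x) :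
    IsEvenConvex (fun x => g (clamp x)) := by
  have hcont : Continuous (fun x => g (clamp x)) := hc.comp_continuous continuous_clamp clamp_mem
  obtain ⟨C, hC⟩ := isCompact_Icc.exists_bound_of_continuousOn hc
  refine ⟨⟨hcont.measurable, C, fun x => hC _ (clamp_mem x)⟩, hcont, fun x => ?_,
    hcv.congr fun x hx => ?_⟩
  · simp only [clamp_neg]; exact he _ (clamp_mem x)
  · simp only [clamp_of_mem hx]

lemma IsLaw.integral_clamp {μ : Measure ℝ} (h : IsLaw μ) (g : ℝ → ℝ) :
    ∫ x, g (clamp x) ∂μ = ∫ x, g x ∂μ :=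
  integral_congr_ae (h.ae_abs_le.mono fun x hx => by simp only [clamp_eq hx])

lemma LawLE.integral_le {μ ν : Measure ℝ} (h : LawLE μ ν) (hμ : IsLaw μ) (hν : IsLaw ν)
    {g : ℝ → ℝ} (hc : ContinuousOn g (Icc (-1) 1))
    (hcv : ConvexOn ℝ (Icc (-1) 1) g) (he : ∀ x ∈ Icc (-1 : ℝ) 1, g (-x) = g x) :
    ∫ x, g x ∂μ ≤ ∫ x, g x ∂ν := by
  rw [← hμ.integral_clamp, ← hν.integral_clamp]
  exact h _ (isEvenConvex_clamp hc hcv he)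

lemma ConvexOn.two_point {f : ℝ → ℝ} {s : Set ℝ} (hf : ConvexOn ℝ s f) {x y a b : ℝ}
    (hx : x ∈ s) (hy : y ∈ s) (ha : 0 ≤ a) (hb : 0 ≤ b) (hab : a + b = 1) :
    f (a * x + b * y) ≤ a * f x + b * f y := hf.2 hx hy ha hb hab

lemma IsEvenConvex.le_one {f : ℝ → ℝ} (hf : IsEvenConvex f) {x : ℝ} (hx : |x| ≤ 1) : f x ≤ f 1 := by
  rw [abs_le] at hx
  have h := ConvexOn.two_point hf.convex (x := -1) (y := 1) (by simp) (by simp) (a := (1 - x) / 2)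
    (b := (1 + x) / 2) (by linarith) (by linarith) (by ring)
  have h1 := hf.even 1
  grind

lemma IsEvenConvex.zero_le {f : ℝ → ℝ} (hf : IsEvenConvex f) {x : ℝ} (hx : |x| ≤ 1) :
    f 0 ≤ f x := by
  have hx' := abs_le.1 hx
  have h := ConvexOn.two_point hf.convex (x := -x) ⟨by linarith, by linarith⟩ hx' (a := 1 / 2)
    (b := 1 / 2) (by norm_num) (by norm_num) (by norm_num)
  have e : (1 / 2 : ℝ) * -x + 1 / 2 * x = 0 := by ring
  simp only [e, hf.even] at h
  linarith

lemma dirac_zero_lawLE {μ : Measure ℝ} (hμ : IsLaw μ) : LawLE (dirac 0) μ := fun f hf => by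
    have := hμ.prob
    have h := integral_mono_ae (integrable_const (f 0)) (hf.bdd.integrable μ)
      (hμ.ae_abs_le.mono fun x hx => hf.zero_le hx)
    simpa using h

lemma lawLE_dirac_one {μ : Measure ℝ} (hμ : IsLaw μ) : LawLE μ (dirac 1) := fun f hf => by
    have := hμ.prob
    have h := integral_mono_ae (hf.bdd.integrable μ) (integrable_const (f 1))
      (hμ.ae_abs_le.mono fun x hx => hf.le_one hx)
    simpa using h

/-- The perspective of a convex function along an affine map is convex. -/
lemma convexOn_perspective {f : ℝ → ℝ} (hf : ConvexOn ℝ (Icc (-1) 1) f) {w : ℝ}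
    (hw : |w| < 1) : ConvexOn ℝ (Icc (-1) 1) (fun x => (1 + x * w) * f (box x w)) := by
  have hpos : ∀ x ∈ Icc (-1 : ℝ) 1, 0 < 1 + x * w := fun x hx => by
    have h : |x * w| < 1 := by
      rw [abs_mul]
      exact (mul_le_of_le_one_left (abs_nonneg _) (abs_le.2 hx)).trans_lt hw
    linarith [(abs_lt.1 h).1]
  have hw' := abs_lt.1 hw
  have hmem : ∀ x ∈ Icc (-1 : ℝ) 1, box x w ∈ Icc (-1 : ℝ) 1 := fun x hx => by
    have := hpos x hx
    rw [box, Set.mem_Icc, le_div_iff₀ this, div_le_one this]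
    constructor <;> nlinarith [hx.1, hx.2]
  refine ⟨convex_Icc _ _, fun x hx y hy a b ha hb hab => ?_⟩
  have hz := convex_Icc (-1 : ℝ) 1 hx hy ha hb hab
  simp at hz ⊢
  have px := hpos x hx
  have py := hpos y hy
  have pz := hpos _ hz
  have es : a * (1 + x * w) + b * (1 + y * w) = 1 + (a * x + b * y) * w := by linarith
  have h := ConvexOn.two_point hf (hmem x hx) (hmem y hy)
      (a := a * (1 + x * w) / (1 + (a * x + b * y) * w))
    (b := b * (1 + y * w) / (1 + (a * x + b * y) * w)) (by positivity) (by positivity)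
    (by rw [← add_div, es, div_self pz.ne'])
  have e : a * (1 + x * w) / (1 + (a * x + b * y) * w) * box x w +
      b * (1 + y * w) / (1 + (a * x + b * y) * w) * box y w = box (a * x + b * y) w := by
    simp only [box]
    grind
  rw [e] at h
  have := mul_le_mul_of_nonneg_left h pz.le
  refine this.trans (le_of_eq ?_)
  field_simp

/-- The test function obtained by averaging over the sign of an observation `w`. -/
def boxTest (f : ℝ → ℝ) (w x : ℝ) : ℝ :=
  (1 / 2) * ((1 + x * w) * f (box x w) + (1 - x * w) * f (box x (-w)))

lemma isEvenConvex_boxTest {f : ℝ → ℝ} (hf : IsEvenConvex f) {w : ℝ} (hw : -1 < w ∧ w ≤ 1) :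
    IsEvenConvex (fun x => boxTest f w (clamp x)) := by
  rcases hw.2.lt_or_eq with hlt | rfl
  · have habs : |w| < 1 := abs_lt.2 ⟨hw.1, hlt⟩
    have h1 := convexOn_perspective hf.convex habs
    have h2 := convexOn_perspective hf.convex (by rwa [abs_neg])
    have hbox : ∀ v : ℝ, |v| < 1 → ContinuousOn (fun x => box x v) (Icc (-1) 1) := fun v hv => by
      refine ContinuousOn.div (by fun_prop) (by fun_prop) fun x hx => ?_
      have h : |x * v| < 1 := by
        rw [abs_mul]
        exact (mul_le_of_le_one_left (abs_nonneg _) (abs_le.2 hx)).trans_lt hv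
      linarith [(abs_lt.1 h).1]
    refine isEvenConvex_clamp ?_ ?_ fun x hx => ?_
    · unfold boxTest
      have c1 := hf.cont.comp_continuousOn (hbox w habs)
      have c2 := hf.cont.comp_continuousOn (hbox (-w) (by rwa [abs_neg]))
      exact continuousOn_const.mul (((by fun_prop : ContinuousOn (fun x : ℝ => 1 + x * w) _).mul
        c1).add ((by fun_prop : ContinuousOn (fun x : ℝ => 1 - x * w) _).mul c2))
    · have := (h1.add h2).smul (c := (1 / 2 : ℝ)) (by norm_num)
      refine this.congr fun x _ => ?_
      simp only [boxTest, Pi.add_apply, smul_eq_mul]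
      ring
    · simp only [boxTest, box_neg_left, neg_neg, hf.even]
      ring
  · have hconst : ∀ x ∈ Icc (-1 : ℝ) 1, boxTest f 1 x = f 1 := fun x hx => by
      have h1 : (1 + x) * f (box x 1) = (1 + x) * f 1 := by
        by_cases h : 1 + x = 0
        · simp [h]
        · have : box x 1 = 1 := by rw [box, mul_one, add_comm x 1, div_self h]
          rw [this]
      have h2 : (1 - x) * f (box x (-1)) = (1 - x) * f 1 := by
        by_cases h : 1 - x = 0
        · simp [h]
        · have : box x (-1) = -1 := by
            rw [box, mul_neg_one, ← sub_eq_add_neg, ← sub_eq_add_neg, div_eq_iff h]; ring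
          rw [this, hf.even]
      rw [boxTest, mul_one, h1, h2]
      ring
    refine isEvenConvex_clamp (continuousOn_const.congr hconst)
      ((convexOn_const (f 1) (convex_Icc _ _)).congr fun x hx => (hconst x hx).symm) fun x hx => ?_
    grind

lemma integral_box_test {μ ν : Measure ℝ} (hμ : IsLaw μ) (hν : IsLaw ν) {f : ℝ → ℝ}
    (hf : BddMeas f) (he : ∀ x, f (-x) = f x) :
    (BddMeas fun w => ∫ x, boxTest f (clamp w) (clamp x) ∂μ) ∧
    ∫ x, f x ∂(lop box μ ν) = ∫ w, ∫ x, boxTest f (clamp w) (clamp x) ∂μ ∂ν := by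
  have := hμ.prob
  have := hν.prob
  have hB : BddMeas fun z : ℝ × ℝ => boxTest f (clamp z.1) (clamp z.2) := by
    have c1 := bddMeas_clamp.comp (measurable_fst : Measurable (Prod.fst : ℝ × ℝ → ℝ))
    have c2 := bddMeas_clamp.comp (measurable_snd : Measurable (Prod.snd : ℝ × ℝ → ℝ))
    have b1 : BddMeas fun z : ℝ × ℝ => f (box (clamp z.2) (clamp z.1)) :=
      hf.comp (measurable_box.comp (c2.1.prodMk c1.1))
    have b2 : BddMeas fun z : ℝ × ℝ => f (box (clamp z.2) (-clamp z.1)) :=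
      hf.comp (measurable_box.comp (c2.1.prodMk c1.1.neg))
    have hs := (bddMeas_const (1 / 2)).mul ((((bddMeas_const 1).add (c2.mul c1)).mul b1).add
      (((bddMeas_const 1).add ((bddMeas_const (-1)).mul (c2.mul c1))).mul b2))
    convert hs using 2
    simp only [boxTest]; ring
  refine ⟨hB.integral_right μ, ?_⟩
  rw [integral_box_even hμ hν hf he, ← integral_integral_swap (f := fun x w =>
    boxTest f (clamp w) (clamp x)) ((hB.comp measurable_swap).integrable (μ.prod ν))]
  refine integral_congr_ae (hμ.ae_abs_le.mono fun x hx => integral_congr_ae (hν.ae_abs_le.mono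
    fun w hw => ?_))
  simp only [clamp_eq hx, clamp_eq hw, boxTest]

lemma lop_box_mono {μ μ' ν : Measure ℝ} (hμ : IsLaw μ) (hμ' : IsLaw μ') (hν : IsLaw ν)
    (h : LawLE μ μ') : LawLE (lop box μ ν) (lop box μ' ν) := fun f hf => by
  have := hν.prob
  obtain ⟨b1, e1⟩ := integral_box_test hμ hν hf.bdd hf.even
  obtain ⟨b2, e2⟩ := integral_box_test hμ' hν hf.bdd hf.even
  rw [e1, e2]
  refine integral_mono_ae (b1.integrable ν) (b2.integrable ν) (hν.supp.mono fun w hw => ?_)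
  simp only [clamp_eq (abs_le.2 ⟨hw.1.le, hw.2⟩)]
  exact h _ (isEvenConvex_boxTest hf hw)

lemma lop_mul_mono {μ μ' ν : Measure ℝ} (hμ : IsLaw μ) (hμ' : IsLaw μ') (hν : IsLaw ν)
    (h : LawLE μ μ') : LawLE (lop (· * ·) μ ν) (lop (· * ·) μ' ν) := fun f hf => by
  have := hν.prob
  have := hμ.prob
  have := hμ'.prob
  have hB : ∀ (μ : Measure ℝ) [IsProb μ], BddMeas fun w => ∫ x, f (x * w) ∂μ :=
    fun μ _ => BddMeas.integral_right (f := fun z : ℝ × ℝ => f (z.2 * z.1))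
      (hf.bdd.comp (by fun_prop)) μ
  rw [integral_lop_swap measurable_mul_op hf.bdd, integral_lop_swap measurable_mul_op hf.bdd]
  refine integral_mono_ae ((hB μ).integrable ν) ((hB μ').integrable ν)
    (hν.ae_abs_le.mono fun w hw => ?_)
  have hm : ∀ x ∈ Icc (-1 : ℝ) 1, x * w ∈ Icc (-1 : ℝ) 1 := fun x hx =>
    abs_le.1 (by rw [abs_mul]; exact mul_le_one₀ (abs_le.2 hx) (abs_nonneg _) hw)
  refine h.integral_le hμ hμ' ?_ ?_ fun x _ => ?_
  · exact (hf.cont.comp (continuous_mul_const w)).continuousOn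
  · refine ⟨convex_Icc _ _, fun x hx y hy a b ha hb hab => ?_⟩
    have := hf.convex.2 (hm x hx) (hm y hy) ha hb hab
    simp at this ⊢
    grind
  · rw [neg_mul, hf.even]

/-! ### The Bhattacharyya functional -/

/-- The function whose mean is the Bhattacharyya functional. -/
def bhFun (x : ℝ) : ℝ := √(1 - x ^ 2)

/-- The Bhattacharyya functional of a law of `tanh l`. -/
def bh (μ : Measure ℝ) : ℝ := ∫ x, bhFun x ∂μ

lemma bhFun_nonneg (x : ℝ) : 0 ≤ bhFun x := Real.sqrt_nonneg _

lemma bhFun_le_one (x : ℝ) : bhFun x ≤ 1 := by rw [bhFun, Real.sqrt_le_one]; nlinarith [sq_nonneg x]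

lemma bddMeas_bhFun : BddMeas bhFun := by
  refine ⟨by unfold bhFun; fun_prop, 1, fun x => ?_⟩
  rw [abs_of_nonneg (bhFun_nonneg x)]
  exact bhFun_le_one x

lemma bhFun_neg (x : ℝ) : bhFun (-x) = bhFun x := by simp [bhFun]

lemma bh_nonneg (μ : Measure ℝ) : 0 ≤ bh μ := integral_nonneg bhFun_nonneg

lemma bh_le_one {μ : Measure ℝ} [IsProb μ] : bh μ ≤ 1 := by
  have := integral_mono (bddMeas_bhFun.integrable μ) (integrable_const 1) bhFun_le_one
  simpa [bh] using this

lemma hasDerivAt_sqrt_one_sub {a x : ℝ} (h : 0 < 1 - a * x ^ 2) :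
    HasDerivAt (fun x => √(1 - a * x ^ 2)) (-a * x / √(1 - a * x ^ 2)) x := by
  have h1 : HasDerivAt (fun x => 1 - a * x ^ 2) (-(a * (2 * x))) x := by
    simpa using ((hasDerivAt_pow 2 x).const_mul a).const_sub 1
  have := h1.sqrt h.ne'
  grind

lemma hasDerivAt_sqrt_one_sub_two {a x : ℝ} (h : 0 < 1 - a * x ^ 2) :
    HasDerivAt (fun x => -a * x / √(1 - a * x ^ 2)) (-a / √(1 - a * x ^ 2) ^ 3) x := by
  have hs := sqrt_pos.2 h
  have h1 : HasDerivAt (fun x : ℝ => -a * x) (-a) x := by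
    simpa using (hasDerivAt_id x).const_mul (-a)
  have := h1.div (hasDerivAt_sqrt_one_sub h) hs.ne'
  refine this.congr_deriv ?_
  have hsq := Real.sq_sqrt h.le
  field_simp
  rw [hsq]
  ring

lemma one_sub_mul_sq_pos {a x : ℝ} (ha : a ≤ 1) (hx : x ∈ Set.Ioo (-1 : ℝ) 1) :
    0 < 1 - a * x ^ 2 := by
  have : x ^ 2 < 1 := by nlinarith [hx.1, hx.2]
  nlinarith [sq_nonneg x]

/-- `√(1 - a x²) - a √(1 - x²)` is convex for `0 ≤ a ≤ 1`. -/
lemma convexOn_bh_mul {a : ℝ} (ha0 : 0 ≤ a) (ha : a ≤ 1) :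
    ConvexOn ℝ (Icc (-1) 1) (fun x => √(1 - a * x ^ 2) - a * √(1 - 1 * x ^ 2)) := by
  refine convexOn_of_hasDerivWithinAt2_nonneg (convex_Icc _ _) (by fun_prop)
    (f' := fun x => -a * x / √(1 - a * x ^ 2) - a * (-1 * x / √(1 - 1 * x ^ 2)))
    (f'' := fun x => -a / √(1 - a * x ^ 2) ^ 3 - a * (-1 / √(1 - 1 * x ^ 2) ^ 3)) ?_ ?_ ?_ <;>
  rw [interior_Icc] <;> intro x hx <;> have h1 := one_sub_mul_sq_pos ha hx <;>
  have h2 := one_sub_mul_sq_pos le_rfl hx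
  · exact ((hasDerivAt_sqrt_one_sub h1).sub
      ((hasDerivAt_sqrt_one_sub h2).const_mul a)).hasDerivWithinAt
  · exact ((hasDerivAt_sqrt_one_sub_two h1).sub
      ((hasDerivAt_sqrt_one_sub_two h2).const_mul a)).hasDerivWithinAt
  · have hs1 := sqrt_pos.2 h1
    have hs2 := sqrt_pos.2 h2
    have hle : √(1 - 1 * x ^ 2) ≤ √(1 - a * x ^ 2) := Real.sqrt_le_sqrt (by nlinarith [sq_nonneg x])
    have hle3 : 1 / √(1 - a * x ^ 2) ^ 3 ≤ 1 / √(1 - 1 * x ^ 2) ^ 3 :=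
      one_div_le_one_div_of_le (pow_pos hs2 3) (pow_le_pow_left₀ hs2.le hle 3)
    have e : -a / √(1 - a * x ^ 2) ^ 3 - a * (-1 / √(1 - 1 * x ^ 2) ^ 3) =
      a * (1 / √(1 - 1 * x ^ 2) ^ 3 - 1 / √(1 - a * x ^ 2) ^ 3) := by ring
    rw [e]
    exact mul_nonneg ha0 (sub_nonneg.2 hle3)

/-- `-√(1 - x²) - c x^q` is convex for small `c`. -/
lemma convexOn_neg_bh_sub {q : ℕ} {c : ℝ} (hq : 2 ≤ q) (hc0 : 0 ≤ c) (hc : c * (q * (q - 1)) ≤ 1) :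
    ConvexOn ℝ (Icc (-1) 1) (fun x => -√(1 - 1 * x ^ 2) - c * x ^ q) := by
  refine convexOn_of_hasDerivWithinAt2_nonneg (convex_Icc _ _) (by fun_prop)
    (f' := fun x => -(-1 * x / √(1 - 1 * x ^ 2)) - c * (q * x ^ (q - 1)))
    (f'' := fun x => -(-1 / √(1 - 1 * x ^ 2) ^ 3) - c * (q * ((q - 1 : ℕ) * x ^ (q - 1 - 1))))
    ?_ ?_ ?_ <;>
  rw [interior_Icc] <;> intro x hx <;> have h2 := one_sub_mul_sq_pos le_rfl hx
  · exact ((hasDerivAt_sqrt_one_sub h2).neg.sub ((hasDerivAt_pow q x).const_mul c)).hasDerivWithinAt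
  · exact ((hasDerivAt_sqrt_one_sub_two h2).neg.sub
      (((hasDerivAt_pow (q - 1) x).const_mul (q : ℝ)).const_mul c)).hasDerivWithinAt
  · have hs2 := sqrt_pos.2 h2
    have hs1 : √(1 - 1 * x ^ 2) ≤ 1 := by rw [Real.sqrt_le_one]; nlinarith [sq_nonneg x]
    have h1 : 1 ≤ 1 / √(1 - 1 * x ^ 2) ^ 3 := by
      rw [le_div_iff₀ (pow_pos hs2 3), one_mul]
      exact pow_le_one₀ hs2.le hs1
    have h3 : x ^ (q - 1 - 1) ≤ 1 := by
      refine (le_abs_self _).trans ?_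
      exact abs_pow_le_one (abs_le.2 ⟨hx.1.le, hx.2.le⟩) _
    have h4 : ((q - 1 : ℕ) : ℝ) = q - 1 := by push_cast [Nat.cast_sub (by omega : 1 ≤ q)]; ring
    have h5 : c * (q * ((q - 1 : ℕ) * x ^ (q - 1 - 1))) ≤ 1 := by
      rw [h4]
      have : 0 ≤ c * (q * ((q : ℝ) - 1)) := mul_nonneg hc0 (mul_nonneg (by linarith) (by linarith))
      nlinarith
    rw [neg_div, neg_neg]
    linarith

lemma moment_gap_le {μ ν : Measure ℝ} (hμ : IsLaw μ) (hν : IsLaw ν) (h : LawLE μ ν) {q : ℕ}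
    (hq : 2 ≤ q) (he : Even q) :
    moment ν q - moment μ q ≤ q * (q - 1) * (bh μ - bh ν) := by
  have hq' : (2 : ℝ) ≤ q := by exact_mod_cast hq
  have hpos : (0 : ℝ) < q * (q - 1) := mul_pos (by linarith) (by linarith)
  have hi : ∀ (ρ : Measure ℝ), IsLaw ρ →
      ∫ x, (-√(1 - 1 * x ^ 2) - (1 / (q * ((q : ℝ) - 1))) * x ^ q) ∂ρ =
      -bh ρ - (1 / (q * ((q : ℝ) - 1))) * moment ρ q := fun ρ hρ => by
    have := hρ.prob
    have e : ∀ x : ℝ, √(1 - 1 * x ^ 2) = bhFun x := fun x => by rw [bhFun, one_mul]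
    simp_rw [e]
    rw [integral_sub (f := fun x => -bhFun x) (bddMeas_bhFun.integrable ρ).neg
      ((integrable_pow_of_abs_le_one hρ.ae_abs_le q).const_mul _), integral_neg, integral_const_mul]
    rfl
  have key := h.integral_le hμ hν (g := fun x =>
      -√(1 - 1 * x ^ 2) - (1 / (q * ((q : ℝ) - 1))) * x ^ q)
    (by fun_prop) (convexOn_neg_bh_sub hq (by positivity) (by rw [one_div_mul_cancel hpos.ne']))
    fun x _ => by rw [neg_sq, he.neg_pow]
  rw [hi μ hμ, hi ν hν] at key
  have e : (1 / (q * ((q : ℝ) - 1))) * moment ν q - (1 / (q * ((q : ℝ) - 1))) * moment μ q ≤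
    bh μ - bh ν := by linarith
  rw [← mul_sub, one_div, inv_mul_le_iff₀ hpos] at e
  exact e

lemma bh_anti {μ ν : Measure ℝ} (hμ : IsLaw μ) (hν : IsLaw ν) (h : LawLE μ ν) : bh ν ≤ bh μ := by
  have key := h.integral_le hμ hν
    (by fun_prop) (convexOn_neg_bh_sub le_rfl le_rfl (by simp)) fun x _ => by rw [neg_sq]
  simp only [zero_mul, sub_zero, one_mul, integral_neg] at key
  exact neg_le_neg_iff.1 key

lemma bh_box {μ ν : Measure ℝ} (hμ : IsLaw μ) (hν : IsLaw ν) : bh (lop box μ ν) = bh μ * bh ν := by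
  rw [bh, integral_box_even hμ hν bddMeas_bhFun bhFun_neg, bh, bh, ← integral_mul_const]
  refine integral_congr_ae (hμ.supp.mono fun x hx => ?_)
  simp only
  rw [← integral_const_mul]
  refine integral_congr_ae (hν.supp.mono fun w hw => ?_)
  have hx2 : 0 ≤ 1 - x ^ 2 := by nlinarith [hx.1, hx.2]
  have hp : 0 < 1 + x * w := one_add_mul_pos hx hw
  have hm : 0 ≤ 1 - x * w := by rcases le_or_gt 0 w with h5 | h5 <;> nlinarith
  have key : ∀ s z : ℝ, 0 ≤ s → s ^ 2 - (s * z) ^ 2 = (1 - x ^ 2) * (1 - w ^ 2) →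
      s * bhFun z = bhFun x * bhFun w := fun s z hs h => by
    rw [bhFun, bhFun, bhFun, ← Real.sqrt_mul hx2, ← h]
    conv_lhs => rw [← Real.sqrt_sq hs]
    rw [← Real.sqrt_mul (sq_nonneg s)]
    ring
  simp only
  rw [key _ _ hp.le (by rw [box_mul hx hw]; ring), key _ _ hm (by rw [box_neg_mul hx hw]; ring)]
  ring

/-- Multiplication by an independent variable contracts gaps of the Bhattacharyya functional. -/
lemma bh_gap_mul {μ μ' ν : Measure ℝ} (hμ : IsLaw μ) (hμ' : IsLaw μ') (hν : IsLaw ν)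
    (h : LawLE μ μ') : bh (lop (· * ·) μ ν) - bh (lop (· * ·) μ' ν) ≤
      moment ν 2 * (bh μ - bh μ') := by
  have := hν.prob
  have := hμ.prob
  have := hμ'.prob
  have hB : ∀ (μ : Measure ℝ) [IsProb μ], BddMeas fun w => ∫ x, bhFun (x * w) ∂μ :=
    fun μ _ => BddMeas.integral_right (f := fun z : ℝ × ℝ => bhFun (z.2 * z.1))
      (bddMeas_bhFun.comp (by fun_prop)) μ
  rw [bh, bh, integral_lop_swap measurable_mul_op bddMeas_bhFun,
    integral_lop_swap measurable_mul_op bddMeas_bhFun,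
    ← integral_sub ((hB μ).integrable ν) ((hB μ').integrable ν), moment, ← integral_mul_const]
  refine integral_mono_ae (((hB μ).integrable ν).sub ((hB μ').integrable ν))
    ((integrable_pow_of_abs_le_one hν.ae_abs_le 2).mul_const _) (hν.ae_abs_le.mono fun w hw => ?_)
  have hw2 : w ^ 2 ≤ 1 := by simp_all
  have key := h.integral_le hμ hμ' (by fun_prop)
    (convexOn_bh_mul (sq_nonneg w) hw2) fun x _ => by rw [neg_sq]
  have e : ∀ (ρ : Measure ℝ) [IsProb ρ], ∫ x, (√(1 - w ^ 2 * x ^ 2) - w ^ 2 * √(1 - 1 * x ^ 2)) ∂ρ =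
        ∫ x, bhFun (x * w) ∂ρ - w ^ 2 * bh ρ := fun ρ _ => by
    have e1 : ∀ x : ℝ, √(1 - 1 * x ^ 2) = bhFun x := fun x => by rw [bhFun, one_mul]
    have e2 : ∀ x : ℝ, √(1 - w ^ 2 * x ^ 2) = bhFun (x * w) := fun x => by
      rw [bhFun, mul_pow, mul_comm]
    simp_rw [e1, e2]
    rw [integral_sub ((bddMeas_bhFun.comp (measurable_mul_const w)).integrable ρ)
      ((bddMeas_bhFun.integrable ρ).const_mul _), integral_const_mul]
    rfl
  grind

/-! ### Density evolution -/

/-- Properties shared by the two operations of message passing, multiplication and `⊞`. -/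
structure SoftOp (op : ℝ → ℝ → ℝ) (u : ℝ) : Prop where
  meas : Measurable fun z : ℝ × ℝ => op z.1 z.2
  unit_law : IsLaw (dirac u)
  right_unit : ∀ x, op x u = x
  comm : ∀ x y, op x y = op y x
  law : ∀ {μ ν : Measure ℝ}, IsLaw μ → IsLaw ν → IsLaw (lop op μ ν)
  mono_left : ∀ {μ μ' ν : Measure ℝ}, IsLaw μ → IsLaw μ' → IsLaw ν → LawLE μ μ' →
    LawLE (lop op μ ν) (lop op μ' ν)
  gap_left : ∀ {μ μ' ν : Measure ℝ}, IsLaw μ → IsLaw μ' → IsLaw ν → LawLE μ μ' →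
    bh (lop op μ ν) - bh (lop op μ' ν) ≤ bh μ - bh μ'

lemma IsLaw.moment_two_le {ν : Measure ℝ} (hν : IsLaw ν) : moment ν 2 ≤ 1 := by
  have := hν.prob
  exact (le_abs_self _).trans (abs_moment_le_one hν.ae_abs_le 2)

lemma softOp_mul : SoftOp (· * ·) 1 where
  meas := measurable_mul_op
  unit_law := isLaw_dirac_one
  right_unit := mul_one
  comm := mul_comm
  law := isLaw_mul
  mono_left := lop_mul_mono
  gap_left hμ hμ' hν h := (bh_gap_mul hμ hμ' hν h).trans
    (mul_le_of_le_one_left (sub_nonneg.2 (bh_anti hμ hμ' h)) hν.moment_two_le)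

lemma softOp_box : SoftOp box 0 where
  meas := measurable_box
  unit_law := isLaw_dirac_zero
  right_unit := box_zero
  comm := box_comm
  law := isLaw_box
  mono_left := lop_box_mono
  gap_left {μ μ' ν} hμ hμ' hν h := by
    have := hν.prob
    rw [bh_box hμ hν, bh_box hμ' hν, ← sub_mul]
    exact mul_le_of_le_one_right (sub_nonneg.2 (bh_anti hμ hμ' h)) bh_le_one

/-- Law of `op x₁ (op x₂ (… u))` for `k` independent variables with law `μ`. -/
def powLaw (op : ℝ → ℝ → ℝ) (u : ℝ) (μ : Measure ℝ) : ℕ → Measure ℝ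
  | 0 => dirac u
  | k + 1 => lop op μ (powLaw op u μ k)

namespace SoftOp

variable {op : ℝ → ℝ → ℝ} {u : ℝ} (h : SoftOp op u) {μ μ' ν ν' : Measure ℝ}
include h

lemma lop_comm (hμ : IsLaw μ) (hν : IsLaw ν) : lop op μ ν = lop op ν μ := by
  have := hμ.prob
  have := hν.prob
  exact SparseCode.lop_comm h.meas h.comm

lemma mono (hμ : IsLaw μ) (hμ' : IsLaw μ') (hν : IsLaw ν) (hν' : IsLaw ν')
    (h1 : LawLE μ μ') (h2 : LawLE ν ν') : LawLE (lop op μ ν) (lop op μ' ν') := by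
  refine (h.mono_left hμ hμ' hν h1).trans ?_
  rw [h.lop_comm hμ' hν, h.lop_comm hμ' hν']
  exact h.mono_left hν hν' hμ' h2

lemma gap (hμ : IsLaw μ) (hμ' : IsLaw μ') (hν : IsLaw ν) (hν' : IsLaw ν')
    (h1 : LawLE μ μ') (h2 : LawLE ν ν') :
    bh (lop op μ ν) - bh (lop op μ' ν') ≤ (bh μ - bh μ') + (bh ν - bh ν') := by
  have a := h.gap_left hμ hμ' hν h1
  have b := h.gap_left hν hν' hμ' h2
  rw [← h.lop_comm hμ' hν, ← h.lop_comm hμ' hν'] at b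
  linarith

lemma law_pow (hμ : IsLaw μ) (k : ℕ) : IsLaw (powLaw op u μ k) := by
  induction k with
  | zero => exact h.unit_law
  | succ k ih => exact h.law hμ ih

lemma mono_pow (hμ : IsLaw μ) (hμ' : IsLaw μ') (h1 : LawLE μ μ') (k : ℕ) :
    LawLE (powLaw op u μ k) (powLaw op u μ' k) := by
  induction k with
  | zero => exact LawLE.refl _
  | succ k ih => exact h.mono hμ hμ' (h.law_pow hμ k) (h.law_pow hμ' k) h1 ih

lemma gap_pow (hμ : IsLaw μ) (hμ' : IsLaw μ') (h1 : LawLE μ μ') (k : ℕ) :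
    bh (powLaw op u μ k) - bh (powLaw op u μ' k) ≤ k * (bh μ - bh μ') := by
  induction k with
  | zero => simp [powLaw]
  | succ k ih =>
    have := h.gap hμ hμ' (h.law_pow hμ k) (h.law_pow hμ' k) h1 (h.mono_pow hμ hμ' h1 k)
    push_cast
    rw [powLaw, powLaw]
    linarith

end SoftOp

/-- Finite mixture of laws. -/
def mixLaw (s : Finset ℕ) (w : ℕ → ℝ) (ν : ℕ → Measure ℝ) : Measure ℝ :=
  ∑ k ∈ s, ofReal (w k) • ν k

section

variable {s : Finset ℕ} {w : ℕ → ℝ} {ν ν' : ℕ → Measure ℝ}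

lemma integral_mixLaw (hw : ∀ k ∈ s, 0 ≤ w k) {f : ℝ → ℝ} (hf : ∀ k ∈ s, Integrable f (ν k)) :
    ∫ x, f x ∂(mixLaw s w ν) = ∑ k ∈ s, w k * ∫ x, f x ∂(ν k) := by
  rw [mixLaw, integral_finsetSum_measure fun k hk => (hf k hk).smul_measure ENNReal.ofReal_ne_top]
  simp_all

lemma isLaw_mixLaw (hw : ∀ k ∈ s, 0 ≤ w k) (hs : ∑ k ∈ s, w k = 1)
    (hν : ∀ k ∈ s, IsLaw (ν k)) : IsLaw (mixLaw s w ν) where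
  prob := by
    refine ⟨?_⟩
    have : ∀ k ∈ s, (ofReal (w k) • ν k) Set.univ = ofReal (w k) := fun k hk => by
      have := (hν k hk).prob
      simp
    rw [mixLaw, Measure.finsetSum_apply, sum_congr rfl this,
      ← ENNReal.ofReal_sum_of_nonneg hw, hs, ENNReal.ofReal_one]
  supp := by
    rw [mixLaw, ae_iff, Measure.finsetSum_apply]
    refine Finset.sum_eq_zero fun k hk => ?_
    rw [Measure.smul_apply, ae_iff.1 (hν k hk).supp, smul_zero]
  symm o ho hodd := by
    rw [integral_mixLaw hw fun k hk => have := (hν k hk).prob; ho.integrable _,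
      integral_mixLaw hw fun k hk => (hν k hk).integrable_mul ho]
    exact sum_congr rfl fun k hk => by rw [(hν k hk).symm o ho hodd]

lemma mixLaw_mono (hw : ∀ k ∈ s, 0 ≤ w k) (hν : ∀ k ∈ s, IsLaw (ν k))
    (hν' : ∀ k ∈ s, IsLaw (ν' k)) (h : ∀ k ∈ s, LawLE (ν k) (ν' k)) :
    LawLE (mixLaw s w ν) (mixLaw s w ν') := fun f hf => by
  rw [integral_mixLaw hw fun k hk => have := (hν k hk).prob; hf.bdd.integrable _,
    integral_mixLaw hw fun k hk => have := (hν' k hk).prob; hf.bdd.integrable _]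
  exact sum_le_sum fun k hk => mul_le_mul_of_nonneg_left (h k hk f hf) (hw k hk)

lemma mixLaw_gap (hw : ∀ k ∈ s, 0 ≤ w k) (hs : ∑ k ∈ s, w k = 1) (hν : ∀ k ∈ s, IsLaw (ν k))
    (hν' : ∀ k ∈ s, IsLaw (ν' k)) {D : ℝ} (h : ∀ k ∈ s, bh (ν k) - bh (ν' k) ≤ D) :
    bh (mixLaw s w ν) - bh (mixLaw s w ν') ≤ D := by
  rw [bh, bh, integral_mixLaw hw fun k hk => have := (hν k hk).prob; bddMeas_bhFun.integrable _,
    integral_mixLaw hw fun k hk => have := (hν' k hk).prob; bddMeas_bhFun.integrable _,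
    ← sum_sub_distrib, ← one_mul D, ← hs, sum_mul]
  refine sum_le_sum fun k hk => ?_
  rw [← mul_sub]
  exact mul_le_mul_of_nonneg_left (h k hk) (hw k hk)

end

/-- Law of the fold of the messages at a random node. -/
def nodeLaw (q : ℝ[X]) (op : ℝ → ℝ → ℝ) (u : ℝ) (μ : Measure ℝ) : Measure ℝ :=
  mixLaw q.support q.coeff (powLaw op u μ)

/-- Probability that a random edge is attached to a node of degree `k`. -/
def edgeWeight (q : ℝ[X]) (k : ℕ) : ℝ := k * q.coeff k / q.derivative.eval 1

/-- Law of the fold of the messages at the end of a random edge. -/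
def edgeLaw (q : ℝ[X]) (op : ℝ → ℝ → ℝ) (u : ℝ) (μ : Measure ℝ) : Measure ℝ :=
  mixLaw q.support (edgeWeight q) fun k => powLaw op u μ (k - 1)

namespace IsDegreeDist

variable {q : ℝ[X]} {dmax : ℕ} (hq : IsDegreeDist q dmax)
include hq

lemma sum_coeff : ∑ k ∈ q.support, q.coeff k = 1 := by
  have := hq.sum_one
  rw [Polynomial.eval_eq_sum, Polynomial.sum] at this
  simpa using this

omit hq in
lemma derivative_eval : q.derivative.eval 1 = ∑ k ∈ q.support, k * q.coeff k := by
  rw [Polynomial.derivative_eval, Polynomial.sum]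
  simp [mul_comm]

lemma one_le_of_mem {k : ℕ} (hk : k ∈ q.support) : 1 ≤ k := by
  rcases k with _ | k
  · exact absurd hq.coeff_zero (Polynomial.mem_support_iff.1 hk)
  · omega

lemma le_of_mem {k : ℕ} (hk : k ∈ q.support) : k ≤ dmax :=
  (Polynomial.le_natDegree_of_mem_supp k hk).trans hq.bounded

lemma one_le_derivative_eval : 1 ≤ q.derivative.eval 1 := by
  rw [derivative_eval, ← hq.sum_coeff]
  refine sum_le_sum fun k hk => le_mul_of_one_le_left (hq.nonneg k) ?_
  exact_mod_cast hq.one_le_of_mem hk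

lemma edgeWeight_nonneg (k : ℕ) : 0 ≤ edgeWeight q k :=
  div_nonneg (mul_nonneg k.cast_nonneg (hq.nonneg k)) (by linarith [hq.one_le_derivative_eval])

lemma sum_edgeWeight : ∑ k ∈ q.support, edgeWeight q k = 1 := by
  have := hq.one_le_derivative_eval
  simp_rw [edgeWeight]
  rw [← sum_div, ← derivative_eval, div_self (by linarith)]

variable {op : ℝ → ℝ → ℝ} {u : ℝ} (h : SoftOp op u) {μ μ' : Measure ℝ}
include h

lemma law_node (hμ : IsLaw μ) : IsLaw (nodeLaw q op u μ) :=
  isLaw_mixLaw (fun k _ => hq.nonneg k) hq.sum_coeff fun k _ => h.law_pow hμ k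

lemma law_edge (hμ : IsLaw μ) : IsLaw (edgeLaw q op u μ) :=
  isLaw_mixLaw (fun k _ => hq.edgeWeight_nonneg k) hq.sum_edgeWeight fun _ _ => h.law_pow hμ _

lemma mono_node (hμ : IsLaw μ) (hμ' : IsLaw μ') (h1 : LawLE μ μ') :
    LawLE (nodeLaw q op u μ) (nodeLaw q op u μ') :=
  mixLaw_mono (fun k _ => hq.nonneg k) (fun k _ => h.law_pow hμ k) (fun k _ => h.law_pow hμ' k)
    fun k _ => h.mono_pow hμ hμ' h1 k

lemma mono_edge (hμ : IsLaw μ) (hμ' : IsLaw μ') (h1 : LawLE μ μ') :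
    LawLE (edgeLaw q op u μ) (edgeLaw q op u μ') :=
  mixLaw_mono (fun k _ => hq.edgeWeight_nonneg k) (fun _ _ => h.law_pow hμ _)
    (fun _ _ => h.law_pow hμ' _) fun _ _ => h.mono_pow hμ hμ' h1 _

lemma gap_node (hμ : IsLaw μ) (hμ' : IsLaw μ') (h1 : LawLE μ μ') :
    bh (nodeLaw q op u μ) - bh (nodeLaw q op u μ') ≤ dmax * (bh μ - bh μ') := by
  refine mixLaw_gap (fun k _ => hq.nonneg k) hq.sum_coeff (fun k _ => h.law_pow hμ k)
    (fun k _ => h.law_pow hμ' k) fun k hk => (h.gap_pow hμ hμ' h1 k).trans ?_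
  exact mul_le_mul_of_nonneg_right (by exact_mod_cast hq.le_of_mem hk)
    (sub_nonneg.2 (bh_anti hμ hμ' h1))

lemma gap_edge (hμ : IsLaw μ) (hμ' : IsLaw μ') (h1 : LawLE μ μ') :
    bh (edgeLaw q op u μ) - bh (edgeLaw q op u μ') ≤ dmax * (bh μ - bh μ') := by
  refine mixLaw_gap (fun k _ => hq.edgeWeight_nonneg k) hq.sum_edgeWeight
    (fun _ _ => h.law_pow hμ _) (fun _ _ => h.law_pow hμ' _)
    fun k hk => (h.gap_pow hμ hμ' h1 _).trans ?_
  have := hq.le_of_mem hk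
  exact mul_le_mul_of_nonneg_right (by exact_mod_cast (by omega : k - 1 ≤ dmax))
    (sub_nonneg.2 (bh_anti hμ hμ' h1))

end IsDegreeDist

/-- The operation and its unit at a node: at a code bit of an LDPC code and at an information bit
of an LDGM code the half-loglikelihoods are added, at a parity check and at a code bit of an LDGM
code the hyperbolic tangents are multiplied. -/
def Kind.bitOp : Kind → ℝ → ℝ → ℝ
  | .ldgm => (· * ·)
  | .ldpc => box

/-- The unit of `Kind.bitOp`. -/
def Kind.bitUnit : Kind → ℝ
  | .ldgm => 1
  | .ldpc => 0

/-- The operation at the nodes that are not code bits. -/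
def Kind.othOp : Kind → ℝ → ℝ → ℝ
  | .ldgm => box
  | .ldpc => (· * ·)

/-- The unit of `Kind.othOp`. -/
def Kind.othUnit : Kind → ℝ
  | .ldgm => 0
  | .ldpc => 1

lemma Kind.softOp_bit : ∀ κ : Kind, SoftOp κ.bitOp κ.bitUnit
  | .ldgm => softOp_mul
  | .ldpc => softOp_box

lemma Kind.softOp_oth : ∀ κ : Kind, SoftOp κ.othOp κ.othUnit
  | .ldgm => softOp_box
  | .ldpc => softOp_mul

/-- Density evolution: law of the message sent by a code bit after `k` iterations that start from
the law `β`; `τ` is the law of an observation, `q` and `r` are the degree distributions of the code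
bits and of the other nodes. -/
def bitMsg (κ : Kind) (q r : ℝ[X]) (τ β : Measure ℝ) : ℕ → Measure ℝ
  | 0 => β
  | k + 1 => lop κ.bitOp τ (edgeLaw q κ.bitOp κ.bitUnit
      (edgeLaw r κ.othOp κ.othUnit (bitMsg κ q r τ β k)))

/-- Density evolution law of the extrinsic estimate of a code bit after `k + 1` iterations. -/
def rootLaw (κ : Kind) (q r : ℝ[X]) (τ β : Measure ℝ) (k : ℕ) : Measure ℝ :=
  nodeLaw q κ.bitOp κ.bitUnit (edgeLaw r κ.othOp κ.othUnit (bitMsg κ q r τ β k))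

section

variable {κ : Kind} {q r : ℝ[X]} {qmax rmax : ℕ} {τ β β' : Measure ℝ}
  (hq : IsDegreeDist q qmax) (hr : IsDegreeDist r rmax) (hτ : IsLaw τ)
include hq hr hτ

lemma law_bitMsg (hβ : IsLaw β) (k : ℕ) : IsLaw (bitMsg κ q r τ β k) := by
  induction k with
  | zero => exact hβ
  | succ k ih => exact κ.softOp_bit.law hτ (hq.law_edge κ.softOp_bit (hr.law_edge κ.softOp_oth ih))

lemma law_rootLaw (hβ : IsLaw β) (k : ℕ) : IsLaw (rootLaw κ q r τ β k) :=
  hq.law_node κ.softOp_bit (hr.law_edge κ.softOp_oth (law_bitMsg hq hr hτ hβ k))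

lemma bitMsg_step {μ μ' : Measure ℝ} (hμ : IsLaw μ) (hμ' : IsLaw μ') (h : LawLE μ μ') :
    LawLE (lop κ.bitOp τ (edgeLaw q κ.bitOp κ.bitUnit (edgeLaw r κ.othOp κ.othUnit μ)))
      (lop κ.bitOp τ (edgeLaw q κ.bitOp κ.bitUnit (edgeLaw r κ.othOp κ.othUnit μ'))) := by
  have a := hr.law_edge κ.softOp_oth hμ
  have a' := hr.law_edge κ.softOp_oth hμ'
  exact κ.softOp_bit.mono hτ hτ (hq.law_edge κ.softOp_bit a) (hq.law_edge κ.softOp_bit a')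
    (LawLE.refl _) (hq.mono_edge κ.softOp_bit a a' (hr.mono_edge κ.softOp_oth hμ hμ' h))

lemma bitMsg_mono (hβ : IsLaw β) (hβ' : IsLaw β') (h : LawLE β β') (k : ℕ) :
    LawLE (bitMsg κ q r τ β k) (bitMsg κ q r τ β' k) := by
  induction k with
  | zero => exact h
  | succ k ih =>
    exact bitMsg_step hq hr hτ (law_bitMsg hq hr hτ hβ k) (law_bitMsg hq hr hτ hβ' k) ih

lemma bitMsg_mono_iter (hβ : IsLaw β) (h : LawLE β (bitMsg κ q r τ β 1)) (k : ℕ) :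
    LawLE (bitMsg κ q r τ β k) (bitMsg κ q r τ β (k + 1)) := by
  induction k with
  | zero => exact h
  | succ k ih =>
    exact bitMsg_step hq hr hτ (law_bitMsg hq hr hτ hβ k) (law_bitMsg hq hr hτ hβ (k + 1)) ih

lemma rootLaw_mono {β₁ β₂ : Measure ℝ} {k l : ℕ} (hβ : IsLaw β₁) (hβ' : IsLaw β₂)
    (h : LawLE (bitMsg κ q r τ β₁ k) (bitMsg κ q r τ β₂ l)) :
    LawLE (rootLaw κ q r τ β₁ k) (rootLaw κ q r τ β₂ l) := by
  have a := law_bitMsg (κ := κ) hq hr hτ hβ k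
  have a' := law_bitMsg (κ := κ) hq hr hτ hβ' l
  exact hq.mono_node κ.softOp_bit (hr.law_edge κ.softOp_oth a) (hr.law_edge κ.softOp_oth a')
    (hr.mono_edge κ.softOp_oth a a' h)

lemma bitMsg_gap (hβ : IsLaw β) (hβ' : IsLaw β') (h : LawLE β β') {c : ℝ} (hc : 0 ≤ c)
    (hstep : ∀ {μ μ' : Measure ℝ}, IsLaw μ → IsLaw μ' → LawLE μ μ' →
      bh (lop κ.bitOp τ μ) - bh (lop κ.bitOp τ μ') ≤ c * (bh μ - bh μ')) (k : ℕ) :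
    bh (bitMsg κ q r τ β k) - bh (bitMsg κ q r τ β' k) ≤ (c * (qmax * rmax)) ^ k := by
  induction k with
  | zero =>
    have := hβ.prob
    have h1 := bh_le_one (μ := β)
    have h2 := bh_nonneg β'
    simp only [bitMsg, pow_zero]
    linarith
  | succ k ih =>
    have hμ := law_bitMsg (κ := κ) hq hr hτ hβ k
    have hμ' := law_bitMsg (κ := κ) hq hr hτ hβ' k
    have hle := bitMsg_mono (κ := κ) hq hr hτ hβ hβ' h k
    have a := hr.law_edge κ.softOp_oth hμ
    have a' := hr.law_edge κ.softOp_oth hμ'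
    have ale := hr.mono_edge κ.softOp_oth hμ hμ' hle
    have g1 := hr.gap_edge κ.softOp_oth hμ hμ' hle
    have g2 := hq.gap_edge κ.softOp_bit a a' ale
    refine (hstep (hq.law_edge κ.softOp_bit a) (hq.law_edge κ.softOp_bit a')
      (hq.mono_edge κ.softOp_bit a a' ale)).trans ?_
    rw [pow_succ', mul_assoc]
    refine mul_le_mul_of_nonneg_left (g2.trans ?_) hc
    rw [mul_assoc]
    refine mul_le_mul_of_nonneg_left (g1.trans ?_) qmax.cast_nonneg
    exact mul_le_mul_of_nonneg_left ih rmax.cast_nonneg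

/-- Density evolution started from the two boundary laws converges to the same even moments. -/
lemma exists_tendsto_moment_rootLaw (hβ : IsLaw β) (hβ' : IsLaw β') (h : LawLE β β')
    (h1 : LawLE β (bitMsg κ q r τ β 1)) {c : ℝ} (hc : 0 ≤ c) (hc1 : c * (qmax * rmax) < 1)
    (hstep : ∀ {μ μ' : Measure ℝ}, IsLaw μ → IsLaw μ' → LawLE μ μ' →
      bh (lop κ.bitOp τ μ) - bh (lop κ.bitOp τ μ') ≤ c * (bh μ - bh μ')) (p : ℕ) :
    ∃ m : ℝ, Tendsto (fun k => moment (rootLaw κ q r τ β k) (2 * p + 2)) atTop (𝓝 m) ∧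
      Tendsto (fun k => moment (rootLaw κ q r τ β' k) (2 * p + 2)) atTop (𝓝 m) := by
  have L := fun k => law_rootLaw (κ := κ) hq hr hτ hβ k
  have L' := fun k => law_rootLaw (κ := κ) hq hr hτ hβ' k
  have hev : Even (2 * p + 2) := ⟨p + 1, by ring⟩
  have hmom : ∀ {μ ν : Measure ℝ}, IsLaw μ → IsLaw ν → LawLE μ ν →
      moment μ (2 * p + 2) ≤ moment ν (2 * p + 2) := fun {μ ν} hμ hν hle => by
    refine hle.integral_le hμ hν (g := fun x => x ^ (2 * p + 2)) (by fun_prop) ?_ fun x _ =>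
      hev.neg_pow x
    exact hev.convexOn_pow.subset (Set.subset_univ _) (convex_Icc _ _)
  have hmono : Monotone fun k => moment (rootLaw κ q r τ β k) (2 * p + 2) :=
    monotone_nat_of_le_succ fun k => hmom (L k) (L (k + 1))
      (rootLaw_mono hq hr hτ hβ hβ (bitMsg_mono_iter hq hr hτ hβ h1 k))
  have hbdd : BddAbove (Set.range fun k => moment (rootLaw κ q r τ β k) (2 * p + 2)) := by
    refine ⟨1, ?_⟩
    rintro _ ⟨k, rfl⟩
    have := (L k).prob
    exact (le_abs_self _).trans (abs_moment_le_one (L k).ae_abs_le _)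
  refine ⟨_, tendsto_atTop_ciSup hmono hbdd, ?_⟩
  have hgap : ∀ k, moment (rootLaw κ q r τ β' k) (2 * p + 2) -
      moment (rootLaw κ q r τ β k) (2 * p + 2) ≤
      ((2 * p + 2 : ℕ) * ((2 * p + 2 : ℕ) - 1) * (qmax * rmax)) * (c * (qmax * rmax)) ^ k :=
    fun k => by
    have hμ := law_bitMsg (κ := κ) hq hr hτ hβ k
    have hμ' := law_bitMsg (κ := κ) hq hr hτ hβ' k
    have hle := bitMsg_mono (κ := κ) hq hr hτ hβ hβ' h k
    have g0 := bitMsg_gap (κ := κ) hq hr hτ hβ hβ' h hc hstep k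
    have g1 := hr.gap_edge κ.softOp_oth hμ hμ' hle
    have g2 := hq.gap_node κ.softOp_bit (hr.law_edge κ.softOp_oth hμ)
      (hr.law_edge κ.softOp_oth hμ') (hr.mono_edge κ.softOp_oth hμ hμ' hle)
    refine (moment_gap_le (L k) (L' k) (rootLaw_mono hq hr hτ hβ hβ' hle) (by omega) hev).trans ?_
    rw [mul_assoc, mul_assoc, mul_assoc, mul_assoc]
    refine mul_le_mul_of_nonneg_left (mul_le_mul_of_nonneg_left (g2.trans ?_) ?_) (by positivity)
    · refine mul_le_mul_of_nonneg_left (g1.trans ?_) qmax.cast_nonneg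
      exact mul_le_mul_of_nonneg_left g0 rmax.cast_nonneg
    · push_cast; linarith [(p.cast_nonneg : (0 : ℝ) ≤ p)]
  have hlim : Tendsto (fun k : ℕ => ((2 * p + 2 : ℕ) * ((2 * p + 2 : ℕ) - 1) * (qmax * rmax) : ℝ) *
      (c * (qmax * rmax)) ^ k) atTop (𝓝 0) := by
    have := (tendsto_pow_atTop_nhds_zero_of_lt_one
      (mul_nonneg hc (mul_nonneg qmax.cast_nonneg rmax.cast_nonneg)) hc1).const_mul
      ((2 * p + 2 : ℕ) * ((2 * p + 2 : ℕ) - 1) * (qmax * rmax) : ℝ)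
    simpa using this
  have hdiff := squeeze_zero (fun k => sub_nonneg.2 (hmom (L k) (L' k)
    (rootLaw_mono hq hr hτ hβ hβ' (bitMsg_mono (κ := κ) hq hr hτ hβ hβ' h k)))) hgap hlim
  have := hdiff.add (tendsto_atTop_ciSup hmono hbdd)
  simpa using this

end

section

lemma map_pi_succ {k : ℕ} {μ : Measure ℝ} [IsProb μ] {op : ℝ → ℝ → ℝ}
    (hop : Measurable fun z : ℝ × ℝ => op z.1 z.2) {f : (Fin k → ℝ) → ℝ} {g : (Fin (k + 1) → ℝ) → ℝ}
    (hf : Measurable f) (hg : Measurable g)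
    (h : ∀ᵐ z ∂(μ.prod (pi fun _ : Fin k => μ)), g (Fin.cons z.1 z.2) = op z.1 (f z.2)) :
    (pi fun _ : Fin (k + 1) => μ).map g =
      lop op μ ((pi fun _ : Fin k => μ).map f) := by
  have e := (measurePreserving_piFinSuccAbove (fun _ : Fin (k + 1) => μ) 0).symm
  rw [← e.map_eq, lop]
  have hid : μ.prod ((pi fun _ : Fin k => μ).map f) =
      (μ.prod (pi fun _ : Fin k => μ)).map (Prod.map id f) := by
    rw [← Measure.map_prod_map _ _ measurable_id hf, Measure.map_id]
  rw [hid, Measure.map_map hop (measurable_id.prodMap hf)]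
  have hcongr : (g ∘ (MeasurableEquiv.piFinSuccAbove (fun _ : Fin (k + 1) => ℝ) 0).symm)
      =ᵐ[μ.prod (pi fun _ : Fin k => μ)]
      ((fun z : ℝ × ℝ => op z.1 z.2) ∘ Prod.map id f) := by
    filter_upwards [h] with z hz
    refine Eq.trans ?_ hz
    exact congrArg g (Fin.insertNth_zero' _ _)
  rw [← Measure.map_congr hcongr, Measure.map_map hg e.measurable]

lemma map_prodMsg (μ : Measure ℝ) [IsProb μ] (k : ℕ) :
    (pi fun _ : Fin k => μ).map prodMsg = powLaw (· * ·) 1 μ k := by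
  induction k with
  | zero =>
    rw [powLaw, Measure.pi_of_empty _ 0, Measure.map_dirac' (by unfold prodMsg; fun_prop)]
    simp [prodMsg]
  | succ k ih =>
    rw [powLaw, ← ih]
    refine map_pi_succ measurable_mul_op (by unfold prodMsg; fun_prop)
      (by unfold prodMsg; fun_prop) (ae_of_all _ fun z => ?_)
    simp [prodMsg, Fin.prod_univ_succ]

lemma measurable_sumMsg {k : ℕ} : Measurable (sumMsg (k := k)) := by unfold sumMsg; fun_prop

lemma map_sumMsg {μ : Measure ℝ} (hμ : IsLaw μ) (k : ℕ) :
    (pi fun _ : Fin k => μ).map sumMsg = powLaw box 0 μ k := by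
  have := hμ.prob
  induction k with
  | zero =>
    rw [powLaw, Measure.pi_of_empty _ 0, Measure.map_dirac' measurable_sumMsg]
    simp [sumMsg]
  | succ k ih =>
    rw [powLaw, ← ih]
    have h2 : ∀ᵐ t ∂(pi fun _ : Fin k => μ), ∀ j, -1 < t j ∧ t j ≤ 1 :=
      ae_all_iff.2 fun j =>
        (measurePreserving_eval (fun _ : Fin k => μ) j).quasiMeasurePreserving.ae hμ.supp
    refine map_pi_succ measurable_box measurable_sumMsg measurable_sumMsg ?_
    filter_upwards [Measure.quasiMeasurePreserving_snd.ae h2] with z hz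
    have ha : 0 < ∏ j, (1 + z.2 j) := prod_pos fun j _ => by linarith [(hz j).1]
    have hb : 0 ≤ ∏ j, (1 - z.2 j) := Finset.prod_nonneg fun j _ => by linarith [(hz j).2]
    simp only [sumMsg, Fin.prod_univ_succ, Fin.cons_zero, Fin.cons_succ, box]
    grind

lemma edgeMix_prodMsg (q : ℝ[X]) (μ : Measure ℝ) [IsProb μ] :
    edgeMix q μ (fun _ => prodMsg) = edgeLaw q (· * ·) 1 μ := by
  simp only [edgeMix, edgeLaw, mixLaw, edgeWeight, map_prodMsg]

lemma edgeMix_sumMsg (q : ℝ[X]) {μ : Measure ℝ} (hμ : IsLaw μ) :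
    edgeMix q μ (fun _ => sumMsg) = edgeLaw q box 0 μ := by
  simp only [edgeMix, edgeLaw, mixLaw, edgeWeight, map_sumMsg hμ]

lemma nodeMix_prodMsg (q : ℝ[X]) (μ : Measure ℝ) [IsProb μ] :
    nodeMix q μ (fun _ => prodMsg) = nodeLaw q (· * ·) 1 μ := by
  simp only [nodeMix, nodeLaw, mixLaw, map_prodMsg]

lemma nodeMix_sumMsg (q : ℝ[X]) {μ : Measure ℝ} (hμ : IsLaw μ) :
    nodeMix q μ (fun _ => sumMsg) = nodeLaw q box 0 μ := by
  simp only [nodeMix, nodeLaw, mixLaw, map_sumMsg hμ]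

variable {Λ P : ℝ[X]} {lmax kmax : ℕ} (hΛ : IsDegreeDist Λ lmax) (hP : IsDegreeDist P kmax)
  {τ : Measure ℝ} (hτ : IsLaw τ)
include hΛ hP hτ

lemma ldgmMsg_eq (d : ℕ) :
    ldgmMsg Λ P τ d = edgeLaw Λ box 0 (bitMsg .ldgm P Λ τ (dirac 0) d) := by
  have hB := fun d => law_bitMsg (κ := .ldgm) hP hΛ hτ isLaw_dirac_zero d
  induction d with
  | zero =>
    have hpow : ∀ k, powLaw box 0 (dirac 0) k = dirac 0 := fun k => by
      induction k with
      | zero => rfl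
      | succ k ih =>
        rw [powLaw, ih, lop, Measure.dirac_prod_dirac, Measure.map_dirac' measurable_box]
        simp [box]
    rw [ldgmMsg, bitMsg, edgeLaw, mixLaw]
    simp_rw [hpow]
    rw [← Finset.sum_smul, ← ENNReal.ofReal_sum_of_nonneg fun k _ => hΛ.edgeWeight_nonneg k,
      hΛ.sum_edgeWeight, ENNReal.ofReal_one, one_smul]
  | succ d ih =>
    have h1 := hΛ.law_edge softOp_box (hB d)
    have := h1.prob
    have h2 : (τ.prod (edgeMix P (ldgmMsg Λ P τ d) fun _ => prodMsg)).map (fun z => z.1 * z.2) =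
        bitMsg .ldgm P Λ τ (dirac 0) (d + 1) := by
      rw [ih, edgeMix_prodMsg]; rfl
    rw [ldgmMsg, h2, edgeMix_sumMsg _ (hB (d + 1))]

lemma ldpcMsg_eq (d : ℕ) : ldpcMsg Λ P τ d = bitMsg .ldpc Λ P τ τ d := by
  have hB := fun d => law_bitMsg (κ := .ldpc) hΛ hP hτ hτ d
  induction d with
  | zero => rfl
  | succ d ih =>
    have := (hB d).prob
    rw [ldpcMsg, ih, edgeMix_prodMsg, edgeMix_sumMsg _ (hP.law_edge softOp_mul (hB d))]
    rfl

omit hΛ hP hτ in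
lemma deLaw_ldgm (hΛ : IsDegreeDist Λ lmax) (hP : IsDegreeDist P kmax) {Ch : Channel} {ε : ℝ}
    (hτ : IsLaw ((Ch.c ε).map tanh)) (d : ℕ) : deLaw .ldgm Λ P Ch ε d =
      rootLaw .ldgm P Λ ((Ch.c ε).map tanh) (dirac 0) d := by
  have h1 := hΛ.law_edge softOp_box (law_bitMsg (κ := .ldgm) hP hΛ hτ isLaw_dirac_zero d)
  have := h1.prob
  rw [deLaw, ldgmMsg_eq hΛ hP hτ, nodeMix_prodMsg]
  rfl

omit hΛ hP hτ in
lemma deLaw_ldpc (hΛ : IsDegreeDist Λ lmax) (hP : IsDegreeDist P kmax) {Ch : Channel} {ε : ℝ}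
    (hτ : IsLaw ((Ch.c ε).map tanh)) (d : ℕ) : deLaw .ldpc Λ P Ch ε d =
      rootLaw .ldpc Λ P ((Ch.c ε).map tanh) ((Ch.c ε).map tanh) d := by
  have h0 := law_bitMsg (κ := .ldpc) hΛ hP hτ hτ d
  have := h0.prob
  rw [deLaw, ldpcMsg_eq hΛ hP hτ, edgeMix_prodMsg, nodeMix_sumMsg _ (hP.law_edge softOp_mul h0)]
  rfl

end

section

/-! ### The contraction constants at low and at high noise -/

lemma bhFun_tanh (l : ℝ) : bhFun (tanh l) = 1 / cosh l := by
  have hc := cosh_pos l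
  rw [bhFun, Real.tanh_eq_sinh_div_cosh, div_pow, one_sub_div (pow_pos hc 2).ne',
    Real.cosh_sq, add_sub_cancel_left, ← Real.cosh_sq, Real.sqrt_div zero_le_one, Real.sqrt_one,
    Real.sqrt_sq hc.le]

lemma one_div_cosh_le {s : ℝ} (hs0 : 0 < s) (hs : s ≤ 1) (l : ℝ) :
    1 / cosh l ≤ 2 * exp (-s * l) := by
  have hc := cosh_pos l
  rw [div_le_iff₀ hc, Real.cosh_eq]
  have h : exp 0 ≤ exp (-s * l) * exp l + exp (-s * l) * exp (-l) := by
    rw [← exp_add, ← exp_add]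
    rcases le_total 0 l with h | h
    · have : exp 0 ≤ exp (-s * l + l) := exp_le_exp.2 (by nlinarith)
      linarith [exp_pos (-s * l + -l)]
    · have : exp 0 ≤ exp (-s * l + -l) := exp_le_exp.2 (by nlinarith)
      linarith [exp_pos (-s * l + l)]
  rw [Real.exp_zero] at h
  linarith

variable {Ch : Channel} (hK : Ch.ClassK)
include hK

lemma Channel.isLaw_tanh {ε : ℝ} (hε : ε ∈ Ch.dom) : IsLaw ((Ch.c ε).map tanh) :=
  (Ch.isSymmNoise_c hK hε).isLaw

lemma bh_noise_le {ε : ℝ} (hε : ε ∈ Ch.dom) {s : ℝ} (hs0 : 0 < s) (hs : s ≤ 1) :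
    bh ((Ch.c ε).map tanh) ≤ 2 * ∫ l, exp (-s * l) ∂(Ch.c ε) := by
  have := Ch.isProb_c hε
  rw [bh, integral_map measurable_tanh.aemeasurable bddMeas_bhFun.1.aestronglyMeasurable,
    ← integral_const_mul]
  refine integral_mono ((bddMeas_bhFun.comp measurable_tanh).integrable _)
    (Integrable.const_mul ?_ 2) fun l => ?_
  · refine (hK.exp_moment ε hε s hs0).mono' (by fun_prop) (ae_of_all _ fun l => ?_)
    rw [norm_eq_abs, Real.abs_exp]
    refine exp_le_exp.2 ?_
    nlinarith [neg_abs_le l]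
  · simp only [bhFun_tanh]
    exact one_div_cosh_le hs0 hs l

lemma exists_low_noise (D : ℝ) (hD : 0 ≤ D) : ∃ εp : ℝ, 0 < εp ∧ (εp : EReal) ≤ Ch.εmax ∧
    ∀ ε : ℝ, 0 < ε → ε < εp → ε ∈ Ch.dom ∧ bh ((Ch.c ε).map tanh) * D < 1 := by
  obtain ⟨s₀, hs₀, h⟩ := hK.low_noise
  have hs : 0 < min s₀ 1 := lt_min hs₀ one_pos
  have hlim := h (min s₀ 1) hs (min_le_left _ _)
  have hδ : 0 < 1 / (2 * (D + 1)) := by positivity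
  obtain ⟨u, hu, hsub⟩ := mem_nhdsGT_iff_exists_Ioo_subset.1 (hlim.eventually_lt_const hδ)
  obtain ⟨r, hr0, hr⟩ := EReal.lt_iff_exists_real_btwn.1 Ch.εmax_pos
  have hr0' : 0 < r := by exact_mod_cast hr0
  refine ⟨min u r, lt_min hu hr0', (EReal.coe_le_coe_iff.2 (min_le_right u r)).trans hr.le,
    fun ε h0 h1 => ?_⟩
  have hε : ε ∈ Ch.dom := ⟨h0, (EReal.coe_lt_coe_iff.2 (h1.trans_le (min_le_right _ _))).trans hr⟩
  refine ⟨hε, ?_⟩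
  have hb := bh_noise_le hK hε hs (min_le_right _ _)
  have hlt : ∫ l, exp (-min s₀ 1 * l) ∂(Ch.c ε) < 1 / (2 * (D + 1)) :=
    hsub ⟨h0, h1.trans_le (min_le_left _ _)⟩
  have h2 : bh ((Ch.c ε).map tanh) < 1 / (D + 1) := by
    have e : 1 / (D + 1) = 2 * (1 / (2 * (D + 1))) := by field_simp
    rw [e]; linarith
  have h3 := bh_nonneg ((Ch.c ε).map tanh)
  rw [lt_div_iff₀ (by linarith)] at h2
  linarith

lemma moment_two_noise_le {ε : ℝ} (hε : ε ∈ Ch.dom) {H : ℝ} (hH : 0 < H) :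
    moment ((Ch.c ε).map tanh) 2 ≤ Ch.delta ε H := by
  have := Ch.isProb_c hε
  have hm : MeasurableSet {l : ℝ | H < |l|} := measurableSet_lt measurable_const (by fun_prop)
  rw [moment, integral_map measurable_tanh.aemeasurable (by fun_prop), Channel.delta]
  have h1 : ∫ l, ((exp (4 * H) - 1) + {l : ℝ | H < |l|}.indicator 1 l) ∂(Ch.c ε) =
      exp (4 * H) - 1 + (Ch.c ε).real {l | H < |l|} := by
    rw [integral_add (integrable_const _)
      (show Integrable ({l : ℝ | H < |l|}.indicator 1) (Ch.c ε) from
        (integrable_const (1 : ℝ)).indicator hm),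
      integral_const, probReal_univ, one_smul, integral_indicator_one hm]
  rw [← h1]
  refine integral_mono (IsSymmNoise.integrable_tanh_pow _ 2) ((integrable_const _).add
    ((integrable_const (1 : ℝ)).indicator hm)) fun l => ?_
  have h2 := abs_tanh_lt_one l
  have h3 : tanh l ^ 2 ≤ |tanh l| := by rw [← sq_abs]; nlinarith [abs_nonneg (tanh l)]
  have h4 : 4 * H + 1 ≤ exp (4 * H) := add_one_le_exp _
  by_cases hl : H < |l|
  · rw [Set.indicator_of_mem (by exact hl)]
    simp
    linarith
  · rw [Set.indicator_of_notMem (by exact hl), add_zero]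
    have h5 := neg_log_one_sub_abs_tanh_le l
    have h6 := Real.log_le_sub_one_of_pos (by linarith : 0 < 1 - |tanh l|)
    linarith [not_lt.1 hl]

lemma exists_high_noise (D : ℝ) (hD : 0 ≤ D) : ∃ εg : ℝ, 0 ≤ εg ∧ (εg : EReal) < Ch.εmax ∧
    ∀ ε : ℝ, εg < ε → (ε : EReal) < Ch.εmax →
      ε ∈ Ch.dom ∧ moment ((Ch.c ε).map tanh) 2 * D < 1 := by
  obtain ⟨H, hH, hlim⟩ := hK.high_noise
  have hδ : 0 < 1 / (D + 1) := by positivity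
  obtain ⟨s, hs, hsub⟩ := mem_comap.1 (hlim.eventually_lt_const hδ)
  obtain ⟨a, ha, hIoo⟩ := (mem_nhdsLT_iff_exists_Ioo_subset' Ch.εmax_pos).1 hs
  obtain ⟨b, hb, hb'⟩ := EReal.lt_iff_exists_real_btwn.1 (max_lt ha Ch.εmax_pos)
  have hb0 : 0 < b := by simp_all
  refine ⟨b, hb0.le, hb', fun ε h1 h2 => ?_⟩
  have hε : ε ∈ Ch.dom := ⟨hb0.trans h1, h2⟩
  refine ⟨hε, ?_⟩
  have hlt : Ch.delta ε (H ε) < 1 / (D + 1) := hsub (hIoo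
    ⟨((le_max_left a 0).trans_lt hb).trans (EReal.coe_lt_coe_iff.2 h1), h2⟩)
  have h3 := (moment_two_noise_le hK hε (hH ε)).trans_lt hlt
  have h0 : 0 ≤ moment ((Ch.c ε).map tanh) 2 := integral_nonneg fun x => sq_nonneg x
  rw [lt_div_iff₀ (by linarith)] at h3
  linarith

end

/-! ### Finite averages -/

/-- `A` is the expectation functional of a finitely supported probability distribution. -/
def IsFinAvg {X : Type} (A : (X → ℝ) → ℝ) : Prop :=
  ∃ (ι : Type) (_ : Fintype ι) (p : ι → ℝ) (v : ι → X), (∀ i, 0 ≤ p i) ∧ ∑ i, p i = 1 ∧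
    ∀ φ, A φ = ∑ i, p i * φ (v i)

namespace IsFinAvg

variable {X Y : Type} {A : (X → ℝ) → ℝ}

lemma point (x : X) : IsFinAvg (fun φ : X → ℝ => φ x) :=
  ⟨Unit, inferInstance, fun _ => 1, fun _ => x, fun _ => zero_le_one, by simp, fun φ => by simp⟩

lemma bind (hA : IsFinAvg A) {B : X → (Y → ℝ) → ℝ} (hB : ∀ x, IsFinAvg (B x)) :
    IsFinAvg (fun φ => A fun x => B x φ) := by
  obtain ⟨ι, _, p, v, hp, hs, hA⟩ := hA
  choose κ fκ q w hq hqs hB using hB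
  refine ⟨Σ i, κ (v i), inferInstance, fun z => p z.1 * q _ z.2, fun z => w _ z.2,
    fun z => mul_nonneg (hp _) (hq _ _), ?_, fun φ => ?_⟩
  · rw [Fintype.sum_sigma]
    simp_rw [← mul_sum, hqs, mul_one, hs]
  · change (A fun x => B x φ) = _
    rw [hA, Fintype.sum_sigma]
    simp_rw [hB, mul_sum, mul_assoc]

lemma map (hA : IsFinAvg A) (f : X → Y) : IsFinAvg (fun φ : Y → ℝ => A fun x => φ (f x)) :=
  hA.bind fun x => point (f x)

lemma uniform {ι : Type} (s : Finset ι) (hs : 0 < s.card) {B : ι → (Y → ℝ) → ℝ}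
    (hB : ∀ x, IsFinAvg (B x)) : IsFinAvg (fun φ => (∑ x ∈ s, B x φ) / s.card) := by
  have hu : IsFinAvg (fun φ : ι → ℝ => (∑ x ∈ s, φ x) / s.card) := by
    refine ⟨s, inferInstance, fun _ => 1 / s.card, fun x => x, fun _ => by positivity, ?_,
      fun φ => ?_⟩
    · have : (s.card : ℝ) ≠ 0 := by exact_mod_cast hs.ne'
      simp [this]
    · rw [← mul_sum, Finset.sum_coe_sort s φ]; ring
  exact hu.bind hB

lemma add (hA : IsFinAvg A) (φ ψ : X → ℝ) : A (fun x => φ x + ψ x) = A φ + A ψ := by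
  obtain ⟨ι, _, p, v, hp, hs, hA⟩ := hA
  simp_rw [hA, mul_add, sum_add_distrib]

lemma const (hA : IsFinAvg A) (c : ℝ) : A (fun _ => c) = c := by
  obtain ⟨ι, _, p, v, hp, hs, hA⟩ := hA
  rw [hA, ← sum_mul, hs, one_mul]

lemma mono (hA : IsFinAvg A) {φ ψ : X → ℝ} (h : ∀ x, φ x ≤ ψ x) : A φ ≤ A ψ := by
  obtain ⟨ι, _, p, v, hp, hs, hA⟩ := hA
  rw [hA, hA]
  exact sum_le_sum fun i _ => mul_le_mul_of_nonneg_left (h _) (hp i)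

lemma abs_sub_le (hA : IsFinAvg A) {φ ψ : X → ℝ} {C : ℝ} (h : ∀ x, |φ x - ψ x| ≤ C) :
    |A φ - A ψ| ≤ C := by
  have h1 : A φ ≤ A (fun x => ψ x + C) := hA.mono fun x => by linarith [(abs_le.1 (h x)).2]
  have h2 : A ψ ≤ A (fun x => φ x + C) := hA.mono fun x => by linarith [(abs_le.1 (h x)).1]
  rw [hA.add, hA.const] at h1 h2
  rw [abs_le]; constructor <;> linarith

lemma abs_le (hA : IsFinAvg A) {φ : X → ℝ} {C : ℝ} (h : ∀ x, |φ x| ≤ C) : |A φ| ≤ C := by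
  have := hA.abs_sub_le (ψ := fun _ => 0) (fun x => by simpa using h x)
  rwa [hA.const, sub_zero] at this

lemma integral (hA : IsFinAvg A) {Ω : Type} [MeasurableSpace Ω] {μ : Measure Ω} {g : X → Ω → ℝ}
    (hg : ∀ x, Integrable (g x) μ) : A (fun x => ∫ ω, g x ω ∂μ) = ∫ ω, A (fun x => g x ω) ∂μ := by
  obtain ⟨ι, _, p, v, hp, hs, hA⟩ := hA
  simp_rw [hA]
  rw [integral_finsetSum _ fun i _ => (hg _).const_mul _]
  simp_rw [integral_const_mul]

lemma bddMeas (hA : IsFinAvg A) {Ω : Type} [MeasurableSpace Ω] {g : X → Ω → ℝ}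
    {C : ℝ} (hg : ∀ x, Measurable (g x)) (hC : ∀ x ω, |g x ω| ≤ C) :
    BddMeas (fun ω => A (fun x => g x ω)) := by
  refine ⟨?_, C, fun ω => hA.abs_le fun x => hC x ω⟩
  obtain ⟨ι, _, p, v, hp, hs, hA⟩ := hA
  simp_rw [hA]
  exact Finset.measurable_sum _ fun i _ => (hg _).const_mul _

end IsFinAvg

/-- Average of a function of a list of independent entries with the given distributions. -/
def iterAvg {T : Type} : List ((T → ℝ) → ℝ) → (List T → ℝ) → ℝ
  | [], ψ => ψ []
  | A :: F, ψ => A fun x => iterAvg F fun L => ψ (x :: L)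

section

variable {T : Type}

lemma isFinAvg_iterAvg {F : List ((T → ℝ) → ℝ)} (hF : ∀ A ∈ F, IsFinAvg A) :
    IsFinAvg (iterAvg F) := by
  induction F with
  | nil => exact IsFinAvg.point []
  | cons A F ih =>
    exact (hF A List.mem_cons_self).bind
      fun x => (ih fun A hA => hF A (List.mem_cons_of_mem _ hA)).map _

lemma iterAvg_congr {F : List ((T → ℝ) → ℝ)} {ψ ψ' : List T → ℝ}
    (h : ∀ L, L.length = F.length → ψ L = ψ' L) : iterAvg F ψ = iterAvg F ψ' := by
  induction F generalizing ψ ψ' with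
  | nil => exact h [] rfl
  | cons A F ih =>
    rw [iterAvg, iterAvg]
    grind

lemma iterAvg_append (F F' : List ((T → ℝ) → ℝ)) (ψ : List T → ℝ) :
    iterAvg (F ++ F') ψ = iterAvg F fun L => iterAvg F' fun L' => ψ (L ++ L') := by
  induction F generalizing ψ with
  | nil => rfl
  | cons A F ih =>
    rw [List.cons_append, iterAvg, iterAvg]
    congr 1
    ext x
    rw [ih]
    rfl

end

/-! ### Uniformly random matchings of half-edges -/

section

variable {S R : Type} [DecidableEq S] [DecidableEq R]

/-- The half-edge matched to a half-edge. -/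
def partner (σ : S ≃ R) : S ⊕ R → S ⊕ R
  | .inl s => .inr (σ s)
  | .inr r => .inl (σ.symm r)

/-- The matching modified so that `s` is matched to `r`. -/
def force (σ : S ≃ R) (s : S) (r : R) : S ≃ R := σ.trans (Equiv.swap (σ s) r)

omit [DecidableEq S] in
lemma force_self (σ : S ≃ R) (s : S) (r : R) : force σ s r s = r := by simp [force]

omit [DecidableEq S] in
lemma force_of_ne {σ : S ≃ R} {s s' : S} {r : R} (h : s' ≠ s) (h' : σ s' ≠ r) :
    force σ s r s' = σ s' := by
  exact Equiv.swap_apply_of_ne_of_ne (fun e => h (σ.injective e)) h'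

omit [DecidableEq S] in
lemma force_force (σ : S ≃ R) (s : S) (r : R) : force (force σ s r) s (σ s) = σ := by
  ext x
  simp only [force, Equiv.trans_apply, Equiv.swap_apply_left]
  rw [Equiv.swap_comm r, Equiv.swap_apply_self]

omit [DecidableEq S] in
lemma force_force' (σ : S ≃ R) (s : S) (r : R) : force (force σ s r) (σ.symm r) r = σ := by
  ext x
  simp only [force, Equiv.trans_apply, Equiv.apply_symm_apply, Equiv.swap_apply_right]
  rw [Equiv.swap_apply_self]

omit [DecidableEq S] in
lemma force_symm_apply (σ : S ≃ R) (s : S) (r : R) : (force σ s r).symm r = s := by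
  rw [Equiv.symm_apply_eq, force_self]

/-- The matching modified so that the half-edges `h` and `x` are matched. -/
def forcePair (σ : S ≃ R) : S ⊕ R → S ⊕ R → S ≃ R
  | .inl s, .inr r => force σ s r
  | .inr r, .inl s => force σ s r
  | _, _ => σ

omit [DecidableEq S] in
lemma partner_forcePair_self (σ : S ≃ R) {h x : S ⊕ R} (hx : x.isLeft = !h.isLeft) :
    partner (forcePair σ h x) h = x := by
  rcases h with s | r <;> rcases x with s' | r' <;> simp at hx
  · simp [partner, forcePair, force_self]
  · simp [partner, forcePair, force_symm_apply]

omit [DecidableEq S] in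
lemma partner_forcePair_of_ne (σ : S ≃ R) {h x y : S ⊕ R} (h1 : y ≠ h) (h2 : y ≠ x)
    (h3 : partner σ y ≠ h) (h4 : partner σ y ≠ x) : partner (forcePair σ h x) y = partner σ y := by
  have key : ∀ s r, (y ≠ .inl s) → (y ≠ .inr r) → (partner σ y ≠ .inl s) → (partner σ y ≠ .inr r) →
      partner (force σ s r) y = partner σ y := by
    intro s r a b c d
    rcases y with s' | r'
    · simp only [partner, ne_eq, Sum.inl.injEq, Sum.inr.injEq] at a d ⊢
      exact force_of_ne a d
    · simp only [partner, ne_eq, Sum.inl.injEq, Sum.inr.injEq] at b c ⊢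
      rw [Equiv.symm_apply_eq, force_of_ne c (by simpa using b), Equiv.apply_symm_apply]
  rcases h with s | r <;> rcases x with s' | r'
  · rfl
  · exact key _ _ h1 h2 h3 h4
  · exact key _ _ h2 h1 h4 h3
  · rfl

variable [Fintype S] [Fintype R]

/-- The half-edges that can be matched to a half-edge on the given side. -/
def oppSide (S R : Type) [Fintype S] [Fintype R] (b : Bool) : Finset (S ⊕ R) :=
  univ.filter fun x => x.isLeft = !b

omit [DecidableEq S] [DecidableEq R] in
lemma mem_oppSide {b : Bool} {x : S ⊕ R} : x ∈ oppSide S R b ↔ x.isLeft = !b := by simp [oppSide]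

omit [DecidableEq S] [DecidableEq R] in
lemma sum_oppSide_true (f : S ⊕ R → ℝ) : ∑ x ∈ oppSide S R true, f x = ∑ r, f (.inr r) := by
  rw [oppSide, sum_filter, Fintype.sum_sum_type]
  simp

omit [DecidableEq S] [DecidableEq R] in
lemma sum_oppSide_false (f : S ⊕ R → ℝ) : ∑ x ∈ oppSide S R false, f x = ∑ s, f (.inl s) := by
  rw [oppSide, sum_filter, Fintype.sum_sum_type]
  simp

omit [DecidableEq S] [DecidableEq R] in
lemma card_oppSide (hE : card R = card S) (b : Bool) : (oppSide S R b).card = card S := by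
  have h : ((oppSide S R b).card : ℝ) = card S := by
    rw [Finset.cast_card]
    cases b
    · rw [sum_oppSide_false]; simp
    · rw [sum_oppSide_true]; simp [hE]
  exact_mod_cast h

/-- Resampling the partner of the half-edge `h` does not change the average over the matchings. -/
lemma sum_forcePair (h : S ⊕ R) (F : (S ≃ R) → ℝ) (hE : card R = card S) :
    ∑ x ∈ oppSide S R h.isLeft, ∑ σ, F (forcePair σ h x) = card S * ∑ σ, F σ := by
  rcases h with s | r
  · simp only [Sum.isLeft_inl, sum_oppSide_true, forcePair]
    have hinv : Involutive fun z : R × (S ≃ R) => (z.2 s, force z.2 s z.1) := fun z => by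
      ext : 1
      · simp [force_self]
      · simp [force_force]
    rw [← hE, ← Fintype.sum_prod_type', ← Equiv.sum_comp hinv.toPerm]
    simp only [Involutive.coe_toPerm, force_force]
    rw [Fintype.sum_prod_type]
    simp
  · simp only [Sum.isLeft_inr, sum_oppSide_false, forcePair]
    have hinv : Involutive fun z : S × (S ≃ R) => (z.2.symm r, force z.2 z.1 r) := fun z => by
        ext : 1
        · simp [force_symm_apply]
        · simp [force_force']
    rw [← Fintype.sum_prod_type', ← Equiv.sum_comp hinv.toPerm]
    simp only [Involutive.coe_toPerm, force_force']
    rw [Fintype.sum_prod_type]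
    simp

end

/-! ### Local limits of messages on random matchings -/

section

variable {S R T : Type} [DecidableEq S] [DecidableEq R]

/-- The message that reaches the half-edge `h` after `D` steps: messages are combined at the partner
`x` of `h` from those reaching the siblings of `x`; the initial messages equal `β`. -/
def incMsg (sib : S ⊕ R → List (S ⊕ R)) (comb : S ⊕ R → List T → T) (β : T) (σ : S ≃ R) :
    ℕ → S ⊕ R → T
  | 0, _ => β
  | D + 1, h => comb (partner σ h) ((sib (partner σ h)).map (incMsg sib comb β σ D))

variable [Fintype S] [Fintype R]

/-- The distribution of `incMsg` if every partner is drawn independently. -/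
def idealAvg (sib : S ⊕ R → List (S ⊕ R)) (comb : S ⊕ R → List T → T) (β : T) :
    ℕ → Bool → (T → ℝ) → ℝ
  | 0, _, φ => φ β
  | D + 1, b, φ => (∑ x ∈ oppSide S R b,
      iterAvg (replicate (sib x).length (idealAvg sib comb β D !b)) fun L => φ (comb x L)) /
        (oppSide S R b).card

omit [DecidableEq S] [DecidableEq R] in
lemma isFinAvg_idealAvg (sib : S ⊕ R → List (S ⊕ R)) (comb : S ⊕ R → List T → T) (β : T)
    (hE : card R = card S) (hpos : 0 < card S) (D : ℕ) (b : Bool) :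
    IsFinAvg (idealAvg sib comb β D b) := by
  induction D generalizing b with
  | zero => exact IsFinAvg.point β
  | succ D ih =>
    refine IsFinAvg.uniform (oppSide S R b) (by rw [card_oppSide hE]; exact hpos) fun x => ?_
    refine (isFinAvg_iterAvg fun A hA => ?_).map (comb x)
    grind

/-- Incidence structure of the half-edges: `sib x` lists the other half-edges at the node of `x`. -/
structure Incidence {M : Type} (node : S ⊕ R → M) (sib : S ⊕ R → List (S ⊕ R)) (K : ℕ) : Prop where
  nodup : ∀ x, (sib x).Nodup
  side : ∀ x, ∀ y ∈ sib x, y.isLeft = x.isLeft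
  node_eq : ∀ x, ∀ y ∈ sib x, node y = node x
  ne : ∀ x, ∀ y ∈ sib x, y ≠ x
  length_lt : ∀ x, (sib x).length < K
  card_le : ∀ v, ∀ s : Finset (S ⊕ R), (∀ x ∈ s, node x = v) → s.card ≤ K

/-- Weight of a list of tasks: bounds the number of half-edges explored by them. -/
def taskWeight (K : ℕ) (tasks : List (ℕ × (S ⊕ R))) : ℕ := (tasks.map fun p => K ^ p.1).sum

/-- The messages along the half-edges of a list are asymptotically independent and distributed as in
`idealAvg`. The partner of the first half-edge is resampled; with high probability the new partner
belongs to a node that has not been visited, and the claim for the list in which the first half-edge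
is replaced by the siblings of its partner applies. The map `Θ` collects the resampled pairs. -/
lemma abs_avg_incMsg_sub_le {M : Type} [DecidableEq M] {node : S ⊕ R → M}
    {sib : S ⊕ R → List (S ⊕ R)} {K : ℕ} (hI : Incidence node sib K)
    (comb : S ⊕ R → List T → T) (β : T)
    (hE : card R = card S) (hpos : 0 < card S) (W : ℕ) :
    ∀ (tasks : List (ℕ × (S ⊕ R))) (Θ : (S ≃ R) → (S ≃ R)) (U : Finset (S ⊕ R)) (V : Finset M)
      (ψ : List T → ℝ),
      taskWeight K tasks ≤ W → (∀ L, |ψ L| ≤ 1) →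
      (∀ σ y, y ∉ U → partner σ y ∉ U → partner (Θ σ) y = partner σ y) →
      (tasks.map Prod.snd).Nodup → (∀ p ∈ tasks, p.2 ∉ U ∧ node p.2 ∈ V) →
      (∀ y ∈ U, node y ∈ V) →
      |(∑ σ : S ≃ R, ψ (tasks.map fun p => incMsg sib comb β (Θ σ) p.1 p.2)) /
          card (S ≃ R) -
        iterAvg (tasks.map fun p => idealAvg sib comb β p.1 p.2.isLeft) ψ| ≤
      W * (2 * (V.card + W) * K) / card S := by
  have hS0 : (0 : ℝ) < card S := by exact_mod_cast hpos
  have hne : Nonempty (S ≃ R) := ⟨Fintype.equivOfCardEq hE.symm⟩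
  have hM0 : (0 : ℝ) < card (S ≃ R) := by exact_mod_cast Fintype.card_pos
  have hfin := isFinAvg_idealAvg sib comb β hE hpos
  have hK : 0 < K := by
    obtain ⟨s⟩ := Fintype.card_pos_iff.1 hpos
    exact (Nat.zero_le _).trans_lt (hI.length_lt (.inl s))
  have hK' : (0 : ℝ) < K := by exact_mod_cast hK
  have hIT : ∀ (F : List (ℕ × (S ⊕ R))),
      IsFinAvg (iterAvg (F.map fun p => idealAvg sib comb β p.1 p.2.isLeft)) := fun F =>
    isFinAvg_iterAvg fun A hA => by
      obtain ⟨p, _, rfl⟩ := List.mem_map.1 hA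
      exact hfin _ _
  have havg : ∀ F : (S ≃ R) → ℝ, (∀ σ, |F σ| ≤ 1) → |(∑ σ, F σ) / card (S ≃ R)| ≤ 1 :=
    fun F hF => by
      rw [abs_div, abs_of_pos hM0, div_le_one hM0]
      refine (abs_sum_le_sum_abs _ _).trans ((sum_le_sum fun σ _ => hF σ).trans ?_)
      simp
  induction W using Nat.strong_induction_on with
  | _ W ih =>
  intro tasks Θ U V ψ hW hψ hΘ hnd hT hU
  rcases tasks with _ | ⟨⟨D, h⟩, rest⟩
  · simp only [List.map_nil, iterAvg, sum_const, card_univ, nsmul_eq_mul]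
    rw [mul_div_cancel_left₀ _ hM0.ne', sub_self, abs_zero]
    positivity
  have hrest : ∀ p ∈ rest, p.2 ∉ U ∧ node p.2 ∈ V := fun p hp => hT p (List.mem_cons_of_mem _ hp)
  have hhead := hT (D, h) List.mem_cons_self
  rw [List.map_cons, List.nodup_cons] at hnd
  rcases D with _ | D
  · have hlt : taskWeight K rest < W := by
      simp only [taskWeight, List.map_cons, List.sum_cons, pow_zero] at hW ⊢; omega
    have := ih _ hlt rest Θ U V (fun L => ψ (β :: L)) le_rfl (fun L => hψ _) hΘ hnd.2 hrest hU
    simp only [List.map_cons, iterAvg, incMsg, idealAvg] at this ⊢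
    refine this.trans ?_
    have : ((taskWeight K rest : ℕ) : ℝ) ≤ W := by exact_mod_cast hlt.le
    gcongr
  · -- the number of half-edges explored after the first step
    have hW1 : 1 ≤ W := by
      have := Nat.pow_pos (n := D + 1) hK
      simp only [taskWeight, List.map_cons, List.sum_cons] at hW; omega
    set tasks' : S ⊕ R → List (ℕ × (S ⊕ R)) := fun x => (sib x).map (fun y => (D, y)) ++ rest
      with htasks'
    have hWx : ∀ x, taskWeight K (tasks' x) ≤ W - 1 := fun x => by
      have h1 : taskWeight K (tasks' x) = (sib x).length * K ^ D + taskWeight K rest := by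
        simp [taskWeight, htasks', comp_def]
      have h2 : (sib x).length * K ^ D + K ^ D ≤ K ^ (D + 1) := by
        rw [pow_succ', ← Nat.succ_mul]
        exact Nat.mul_le_mul_right _ (hI.length_lt x)
      have h3 := Nat.pow_pos (n := D) hK
      simp only [taskWeight, List.map_cons, List.sum_cons] at hW h1 ⊢
      omega
    set ψ' : S ⊕ R → List T → ℝ := fun x L =>
      ψ (comb x (L.take (sib x).length) :: L.drop (sib x).length) with hψ'
    -- the partner `x` of `h` is resampled; `A x` and `B x` are the two averages for a given `x`
    set A : S ⊕ R → ℝ := fun x => (∑ σ : S ≃ R, ψ (((D + 1, h) :: rest).map fun p =>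
      incMsg sib comb β (Θ (forcePair σ h x)) p.1 p.2)) / card (S ≃ R) with hA
    set B : S ⊕ R → ℝ := fun x => iterAvg ((tasks' x).map fun p =>
      idealAvg sib comb β p.1 p.2.isLeft) (ψ' x) with hB
    have hcard : ((oppSide S R h.isLeft).card : ℝ) = card S := by rw [card_oppSide hE]
    have hLHS : (∑ σ : S ≃ R, ψ (((D + 1, h) :: rest).map fun p =>
        incMsg sib comb β (Θ σ) p.1 p.2)) / card (S ≃ R) =
        (∑ x ∈ oppSide S R h.isLeft, A x) / card S := by
      rw [hA, ← sum_div, sum_forcePair h (fun σ => ψ (((D + 1, h) :: rest).map fun p =>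
        incMsg sib comb β (Θ σ) p.1 p.2)) hE]
      field_simp
    have hRHS : iterAvg (((D + 1, h) :: rest).map fun p =>
        idealAvg sib comb β p.1 p.2.isLeft) ψ =
        (∑ x ∈ oppSide S R h.isLeft, B x) / card S := by
      rw [List.map_cons, iterAvg, idealAvg, hcard]
      congr 1
      refine sum_congr rfl fun x hx => ?_
      have hx' := mem_oppSide.1 hx
      have hmap : (tasks' x).map (fun p => idealAvg sib comb β p.1 p.2.isLeft) =
          replicate (sib x).length (idealAvg sib comb β D !h.isLeft) ++
            rest.map fun p => idealAvg sib comb β p.1 p.2.isLeft := by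
        rw [htasks', List.map_append, List.map_map]
        congr 1
        refine List.eq_replicate_iff.2 ⟨by simp, fun a ha => ?_⟩
        obtain ⟨y, hy, rfl⟩ := List.mem_map.1 ha
        simp only [comp_apply, hI.side x y hy, hx']
      simp only [hB]
      rw [hmap, iterAvg_append]
      refine iterAvg_congr fun L hL => ?_
      rw [List.length_replicate] at hL
      refine iterAvg_congr fun L' _ => ?_
      simp only [hψ']
      rw [List.take_left' hL, List.drop_left' hL]
    -- at a node that has not been visited the claim for `W - 1` applies
    have hgood : ∀ x ∈ oppSide S R h.isLeft, node x ∉ V → |A x - B x| ≤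
        (W - 1 : ℕ) * (2 * ((V.card + 1 : ℕ) + (W - 1 : ℕ)) * K) / card S := by
      intro x hx hxV
      have hx' := mem_oppSide.1 hx
      have hxU : x ∉ U := fun hxU => hxV (hU x hxU)
      have hpair : ∀ σ, partner (Θ (forcePair σ h x)) h = x := fun σ => by
        rw [hΘ _ _ hhead.1 (by rw [partner_forcePair_self σ hx']; exact hxU),
          partner_forcePair_self σ hx']
      have key := ih (W - 1) (by omega) (tasks' x) (fun σ => Θ (forcePair σ h x))
        (insert h (insert x U)) (insert (node x) V) (ψ' x) (hWx x) (fun L => hψ _)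
        (fun σ y hy hy' => ?_) ?_ (fun p hp => ?_) (fun y hy => ?_)
      · rw [Finset.card_insert_of_notMem hxV] at key
        convert key using 4
        refine sum_congr rfl fun σ _ => ?_
        simp only [hψ', htasks', List.map_cons, List.map_append, List.map_map]
        rw [List.take_left' (by simp), List.drop_left' (by simp), incMsg, hpair]
        rfl
      · simp only [mem_insert, not_or] at hy hy'
        have e := partner_forcePair_of_ne σ (h := h) (x := x) hy.1 hy.2.1 hy'.1 hy'.2.1
        rw [hΘ _ _ hy.2.2 (by rw [e]; exact hy'.2.2), e]
      · rw [htasks', List.map_append, List.map_map]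
        refine List.Nodup.append (by simpa [comp_def] using hI.nodup x) hnd.2 ?_
        intro y hy hy'
        have hy1 : y ∈ sib x := by simpa using hy
        obtain ⟨p, hp, rfl⟩ := List.mem_map.1 hy'
        exact hxV (hI.node_eq x _ hy1 ▸ (hrest p hp).2)
      · rcases List.mem_append.1 hp with hp | hp
        · obtain ⟨y, hy, rfl⟩ := List.mem_map.1 hp
          have hyn := hI.node_eq x y hy
          simp only [mem_insert, not_or]
          refine ⟨⟨fun e => ?_, hI.ne x y hy, fun hyU => hxV (hyn ▸ hU y hyU)⟩, Or.inl hyn⟩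
          have := hhead.2
          simp only [← e, hyn] at this
          exact hxV this
        · have hp' := hrest p hp
          simp only [mem_insert, not_or]
          refine ⟨⟨fun e => hnd.1 ?_, fun e => hxV (e ▸ hp'.2), hp'.1⟩, Or.inr hp'.2⟩
          exact List.mem_map.2 ⟨p, hp, e⟩
      · simp only [mem_insert] at hy ⊢
        rcases hy with rfl | rfl | hy
        · exact Or.inr hhead.2
        · exact Or.inl rfl
        · exact Or.inr (hU y hy)
    have hbad : ∀ x, |A x - B x| ≤ 2 := fun x => by
      have h1 : |A x| ≤ 1 := havg _ fun σ => hψ _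
      have h2 : |B x| ≤ 1 := (hIT (tasks' x)).abs_le fun L => hψ _
      exact (abs_sub _ _).trans (by linarith)
    -- every visited node has at most `K` half-edges
    have hbadcard : (((oppSide S R h.isLeft).filter fun x => node x ∈ V).card : ℝ) ≤
        V.card * K := by
      have := Finset.card_le_mul_card_image_of_maps_to
        (s := (oppSide S R h.isLeft).filter fun x => node x ∈ V) (t := V) (f := node)
        (fun x hx => (mem_filter.1 hx).2) K
        (fun v _ => hI.card_le v _ fun x hx => (mem_filter.1 hx).2)
      rw [mul_comm] at this
      exact_mod_cast this
    rw [hLHS, hRHS, ← sub_div, ← sum_sub_distrib, abs_div, abs_of_pos hS0]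
    have hcast : ((W - 1 : ℕ) : ℝ) = W - 1 := by push_cast [Nat.cast_sub hW1]; ring
    have hsum : |∑ x ∈ oppSide S R h.isLeft, (A x - B x)| ≤
        (W - 1) * (2 * (V.card + W) * K) + V.card * K * 2 := by
      refine (abs_sum_le_sum_abs _ _).trans ?_
      rw [← Finset.sum_filter_add_sum_filter_not _ (fun x => node x ∈ V), add_comm]
      refine add_le_add ?_ ?_
      · have : ∀ x ∈ (oppSide S R h.isLeft).filter (fun x => ¬ node x ∈ V), |A x - B x| ≤
            (W - 1) * (2 * (V.card + W) * K) / card S := fun x hx => by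
          obtain ⟨hx1, hx2⟩ := mem_filter.1 hx
          refine (hgood x hx1 hx2).trans (le_of_eq ?_)
          rw [hcast]; push_cast; ring
        refine (sum_le_sum this).trans ?_
        rw [sum_const, nsmul_eq_mul, mul_div_assoc', div_le_iff₀ hS0, mul_comm]
        have hle : (((oppSide S R h.isLeft).filter (fun x => ¬ node x ∈ V)).card : ℝ) ≤
            card S := by
          rw [← hcard]; exact_mod_cast Finset.card_filter_le _ _
        have hW1' : (1 : ℝ) ≤ W := by exact_mod_cast hW1
        refine mul_le_mul_of_nonneg_left hle ?_
        exact mul_nonneg (by linarith) (by positivity)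
      · refine (sum_le_sum fun x _ => hbad x).trans ?_
        rw [sum_const, nsmul_eq_mul]
        exact mul_le_mul_of_nonneg_right hbadcard zero_le_two
    rw [div_le_div_iff_of_pos_right hS0]
    refine hsum.trans ?_
    have hW0 : (0 : ℝ) ≤ W := W.cast_nonneg
    nlinarith [mul_nonneg hW0 hK'.le]

end

/-! ### Laws of messages and density evolution -/

/-- Law of a message combined from independent messages with laws in `L`. -/
def SoftOp.fold {op : ℝ → ℝ → ℝ} {u : ℝ} (h : SoftOp op u) :
    List (Prob ℝ) → Prob ℝ
  | [] => ⟨dirac u, inferInstance⟩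
  | μ :: L => ⟨lop op μ (h.fold L), isProbabilityMeasure_lop h.meas⟩

/-- Law of the message sent by a node: the code bits also use their observation. -/
def combLaw {S R : Type} (κ : Kind) (τ : Prob ℝ) (x : S ⊕ R)
    (L : List (Prob ℝ)) : Prob ℝ :=
  if x.isLeft then ⟨lop κ.bitOp τ (κ.softOp_bit.fold L), isProbabilityMeasure_lop κ.softOp_bit.meas⟩
  else κ.softOp_oth.fold L

lemma combLaw_left {S R : Type} (κ : Kind) (τ : Prob ℝ) {x : S ⊕ R}
    (hx : x.isLeft = true) (L : List (Prob ℝ)) : combLaw κ τ x L =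
      ⟨lop κ.bitOp τ (κ.softOp_bit.fold L), isProbabilityMeasure_lop κ.softOp_bit.meas⟩ :=
  if_pos hx

lemma combLaw_right {S R : Type} (κ : Kind) (τ : Prob ℝ) {x : S ⊕ R}
    (hx : x.isLeft = false) (L : List (Prob ℝ)) :
    combLaw κ τ x L = κ.softOp_oth.fold L :=
  if_neg (by simp [hx])

/-- The functional `A` averages the integrals of test functions to those of `μ`, up to `e`. -/
def AvgNear (A : (Prob ℝ → ℝ) → ℝ) (μ : Measure ℝ) (e : ℝ) : Prop :=
  ∀ f : ℝ → ℝ, Measurable f → (∀ x, |f x| ≤ 1) →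
    |A (fun ν => ∫ x, f x ∂(ν : Measure ℝ)) - ∫ x, f x ∂μ| ≤ e

lemma abs_integral_le_one {α : Type*} [MeasurableSpace α] {f : α → ℝ} (hb : ∀ x, |f x| ≤ 1)
    (μ : Measure α) [IsProb μ] : |∫ x, f x ∂μ| ≤ 1 := by
  have := norm_integral_le_of_norm_le_const (μ := μ) (f := f) (ae_of_all _ hb)
  simpa using this

section

variable {op : ℝ → ℝ → ℝ} {u : ℝ} (h : SoftOp op u) {A : (Prob ℝ → ℝ) → ℝ}
  (hA : IsFinAvg A) {μ : Measure ℝ} (hμ : IsLaw μ) {e : ℝ} (hAμ : AvgNear A μ e)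
include h hA hμ hAμ

lemma abs_iterAvg_fold_sub_le (m : ℕ) {f : ℝ → ℝ} (hf : Measurable f) (hb : ∀ x, |f x| ≤ 1) :
    |iterAvg (replicate m A) (fun L => ∫ x, f x ∂(h.fold L : Measure ℝ)) -
      ∫ x, f x ∂(powLaw op u μ m)| ≤ m * e := by
  have := hμ.prob
  induction m generalizing f with
  | zero => simp [iterAvg, SoftOp.fold, powLaw]
  | succ m ih =>
    have := (h.law_pow hμ m).prob
    have hB : BddMeas f := ⟨hf, 1, hb⟩
    have hIt : IsFinAvg (iterAvg (replicate m A)) := isFinAvg_iterAvg fun A' hA' => by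
      rw [List.eq_of_mem_replicate hA']; exact hA
    have hfx : ∀ x, Measurable fun y => f (op x y) := fun x =>
      (hf.comp h.meas).comp measurable_prodMk_left
    set g : List (Prob ℝ) → ℝ → ℝ := fun L x =>
      ∫ y, f (op x y) ∂(h.fold L : Measure ℝ) with hg
    have hgB : ∀ L, BddMeas (g L) := fun L => (hB.comp h.meas).integral_right _
    have hg1 : ∀ L x, |g L x| ≤ 1 := fun L x => abs_integral_le_one (fun y => hb _) _
    set G : ℝ → ℝ := fun x => iterAvg (replicate m A) fun L => g L x with hG
    have hGB : BddMeas G := hIt.bddMeas (fun L => (hgB L).1) hg1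
    have hG1 : ∀ x, |G x| ≤ 1 := fun x => hIt.abs_le fun L => hg1 L x
    have e1 : iterAvg (replicate (m + 1) A) (fun L => ∫ x, f x ∂(h.fold L : Measure ℝ)) =
        A fun ν => ∫ x, G x ∂(ν : Measure ℝ) := by
      rw [List.replicate_succ, iterAvg]
      congr 1
      ext ν
      rw [hG, ← hIt.integral fun L => (hgB L).integrable _]
      congr 1
      ext L
      exact integral_lop h.meas hB
    rw [e1, powLaw, integral_lop h.meas hB]
    have h1 := hAμ G hGB.1 hG1
    have hPB : BddMeas fun x => ∫ y, f (op x y) ∂(powLaw op u μ m) :=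
      (hB.comp h.meas).integral_right _
    have h2 : |∫ x, G x ∂μ - ∫ x, ∫ y, f (op x y) ∂(powLaw op u μ m) ∂μ| ≤ m * e := by
      rw [← integral_sub (hGB.integrable μ) (hPB.integrable μ)]
      have := norm_integral_le_of_norm_le_const (μ := μ)
        (f := fun x => G x - ∫ y, f (op x y) ∂(powLaw op u μ m))
        (ae_of_all _ fun x => ih (hfx x) fun y => hb _)
      simpa using this
    grind

/-- Folding at a random node, when its degree is close to a mixture with weights `w`. -/
lemma abs_avg_fold_sub_le {ι : Type} (X : Finset ι) (hX : 0 < X.card) (len : ι → ℕ) {K : ℕ}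
    (hlen : ∀ x, len x ≤ K) {s : Finset ℕ} {w : ℕ → ℝ} (hw : ∀ k ∈ s, 0 ≤ w k) (d : ℕ → ℕ)
    {η : ℝ} (hη : ∀ f : ℕ → ℝ, (∀ k, |f k| ≤ 1) →
      |(∑ x ∈ X, f (len x)) / X.card - ∑ k ∈ s, w k * f (d k)| ≤ η)
    {f : ℝ → ℝ} (hf : Measurable f) (hb : ∀ x, |f x| ≤ 1) :
    |(∑ x ∈ X, iterAvg (replicate (len x) A) fun L => ∫ x, f x ∂(h.fold L : Measure ℝ)) /
        X.card - ∫ x, f x ∂(mixLaw s w fun k => powLaw op u μ (d k))| ≤ η + K * e := by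
  have he : 0 ≤ e := (abs_nonneg _).trans (hAμ (fun _ => 0) measurable_const (by simp))
  have hX' : (0 : ℝ) < X.card := by exact_mod_cast hX
  have hP := fun k => (h.law_pow hμ k).prob
  rw [integral_mixLaw hw fun k _ => (show BddMeas f from ⟨hf, 1, hb⟩).integrable _]
  have h1 := hη (fun k => ∫ x, f x ∂(powLaw op u μ k)) fun k => abs_integral_le_one hb _
  refine (abs_sub_le _ ((∑ x ∈ X, ∫ y, f y ∂(powLaw op u μ (len x))) / X.card) _).trans ?_
  rw [add_comm η]
  refine add_le_add ?_ h1
  rw [← sub_div, ← sum_sub_distrib, abs_div, abs_of_pos hX', div_le_iff₀ hX']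
  refine (abs_sum_le_sum_abs _ _).trans ((sum_le_sum fun x _ =>
    (abs_iterAvg_fold_sub_le h hA hμ hAμ (len x) hf hb).trans
      (mul_le_mul_of_nonneg_right (by exact_mod_cast hlen x : (len x : ℝ) ≤ K) he)).trans ?_)
  rw [sum_const, nsmul_eq_mul, mul_comm]

end

/-- Accumulated error of density evolution. -/
def deErr (η K : ℝ) : ℕ → ℝ
  | 0 => 0
  | D + 1 => η + K * deErr η K D

lemma tendsto_deErr {η : ℕ → ℝ} (hη : Tendsto η atTop (𝓝 0)) (K : ℝ) (D : ℕ) :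
    Tendsto (fun N => deErr (η N) K D) atTop (𝓝 0) := by
  induction D with
  | zero => exact tendsto_const_nhds
  | succ D ih => simpa [deErr] using hη.add (ih.const_mul K)

section

variable {S R : Type} [Fintype S] [Fintype R] {sib : S ⊕ R → List (S ⊕ R)}
  {K : ℕ} (hlen : ∀ x, (sib x).length ≤ K)
  (hE : card R = card S) (hpos : 0 < card S)
  {κ : Kind} {q r : ℝ[X]} {qmax rmax : ℕ} (hq : IsDegreeDist q qmax) (hr : IsDegreeDist r rmax)
  {τ β : Prob ℝ} (hτ : IsLaw τ) (hβ : IsLaw β) {η : ℝ}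
  (hηq : ∀ f : ℕ → ℝ, (∀ k, |f k| ≤ 1) → |(∑ x ∈ oppSide S R false, f (sib x).length) /
    (oppSide S R false).card - ∑ k ∈ q.support, edgeWeight q k * f (k - 1)| ≤ η)
  (hηr : ∀ f : ℕ → ℝ, (∀ k, |f k| ≤ 1) → |(∑ x ∈ oppSide S R true, f (sib x).length) /
    (oppSide S R true).card - ∑ k ∈ r.support, edgeWeight r k * f (k - 1)| ≤ η)
include hlen hE hpos hq hr hτ hβ hηq hηr

/-- The averaged laws of the messages with independent partners follow density evolution. -/
lemma avgNear_idealAvg (k : ℕ) :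
    AvgNear (idealAvg sib (combLaw κ τ) β (2 * k) false) (bitMsg κ q r τ β k) (deErr η K (2 * k)) ∧
    AvgNear (idealAvg sib (combLaw κ τ) β (2 * k + 1) true)
      (edgeLaw r κ.othOp κ.othUnit (bitMsg κ q r τ β k)) (deErr η K (2 * k + 1)) := by
  have hfin := isFinAvg_idealAvg sib (combLaw κ τ) β hE hpos
  have hlaw := fun k => law_bitMsg (κ := κ) hq hr hτ hβ k
  have hcard : ∀ b, 0 < (oppSide S R b).card := fun b => by rw [card_oppSide hE]; exact hpos
  have hodd : ∀ k, AvgNear (idealAvg sib (combLaw κ τ) β (2 * k) false) (bitMsg κ q r τ β k)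
      (deErr η K (2 * k)) → AvgNear (idealAvg sib (combLaw κ τ) β (2 * k + 1) true)
      (edgeLaw r κ.othOp κ.othUnit (bitMsg κ q r τ β k)) (deErr η K (2 * k + 1)) := by
    intro k hk f hf hb
    have := abs_avg_fold_sub_le κ.softOp_oth (hfin (2 * k) false) (hlaw k) hk (oppSide S R true)
      (hcard true) (fun x => (sib x).length) hlen (fun j _ => hr.edgeWeight_nonneg j)
      (fun j => j - 1) hηr hf hb
    refine Eq.trans_le (congrArg (fun a => |a / _ - _|) (sum_congr rfl fun x hx => ?_)) this
    have hx' := mem_oppSide.1 hx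
    simp only [combLaw_right κ τ hx', Bool.not_true]
  induction k with
  | zero =>
    have h0 : AvgNear (idealAvg sib (combLaw κ τ) β (2 * 0) false) (bitMsg κ q r τ β 0)
        (deErr η K (2 * 0)) := fun f _ _ => by simp [idealAvg, bitMsg, deErr]
    exact ⟨h0, hodd 0 h0⟩
  | succ k ih =>
    have h2 : AvgNear (idealAvg sib (combLaw κ τ) β (2 * (k + 1)) false)
        (bitMsg κ q r τ β (k + 1)) (deErr η K (2 * (k + 1))) := by
      intro f hf hb
      have hB : BddMeas f := ⟨hf, 1, hb⟩
      have hm := κ.softOp_bit.meas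
      have hL := hr.law_edge κ.softOp_oth (hlaw k)
      have hP := (hq.law_edge κ.softOp_bit hL).prob
      -- the observation is averaged first
      set g : ℝ → ℝ := fun y => ∫ x, f (κ.bitOp x y) ∂(τ : Measure ℝ) with hg
      have hgB : BddMeas g := BddMeas.integral_right
          (hB.comp (hm.comp measurable_swap)) (τ : Measure ℝ)
      have hg1 : ∀ y, |g y| ≤ 1 := fun y => abs_integral_le_one (fun _ => hb _) _
      have hsw : ∀ (ν : Measure ℝ) [IsProb ν],
          ∫ x, f x ∂(lop κ.bitOp τ ν) = ∫ y, g y ∂ν := fun ν _ => integral_lop_swap hm hB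
      have := abs_avg_fold_sub_le κ.softOp_bit (hfin (2 * k + 1) true) hL ih.2 (oppSide S R false)
        (hcard false) (fun x => (sib x).length) hlen (fun j _ => hq.edgeWeight_nonneg j)
        (fun j => j - 1) hηq hgB.1 hg1
      rw [bitMsg, hsw, show 2 * (k + 1) = (2 * k + 1) + 1 by ring, deErr, idealAvg]
      refine Eq.trans_le (congrArg (fun a => |a / _ - _|) (sum_congr rfl fun x hx => ?_)) this
      have hx' := mem_oppSide.1 hx
      simp only [combLaw_left κ τ hx', Bool.not_false]
      congr 1
      ext L
      exact hsw _
    exact ⟨h2, hodd (k + 1) h2⟩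

/-- The averaged law of the message combined at a random code bit follows density evolution. -/
lemma abs_avg_root_sub_le {ι : Type} (X : Finset ι) (hX : 0 < X.card) (len : ι → ℕ)
    (hlen' : ∀ x, len x ≤ K) {η' : ℝ} (hη' : ∀ f : ℕ → ℝ, (∀ k, |f k| ≤ 1) →
      |(∑ x ∈ X, f (len x)) / X.card - ∑ k ∈ q.support, q.coeff k * f k| ≤ η') (k : ℕ)
    {f : ℝ → ℝ} (hf : Measurable f) (hb : ∀ x, |f x| ≤ 1) :
    |(∑ x ∈ X, iterAvg (replicate (len x) (idealAvg sib (combLaw κ τ) β (2 * k + 1) true))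
        fun L => ∫ x, f x ∂(κ.softOp_bit.fold L : Measure ℝ)) / X.card -
      ∫ x, f x ∂(rootLaw κ q r τ β k)| ≤ η' + K * deErr η K (2 * k + 1) :=
  abs_avg_fold_sub_le κ.softOp_bit (isFinAvg_idealAvg sib (combLaw κ τ) β hE hpos _ _)
    (hr.law_edge κ.softOp_oth (law_bitMsg hq hr hτ hβ k))
    (avgNear_idealAvg hlen hE hpos hq hr hτ hβ hηq hηr k).2 X hX len hlen'
    (fun j _ => hq.nonneg j) (fun j => j) hη' hf hb

end

/-! ### The socket ensembles -/

section

variable {n : ℕ} {deg : Fin n → ℕ} {K : ℕ}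

/-- Number of nodes of degree `k`. -/
def degCount (deg : Fin n → ℕ) (k : ℕ) : ℕ := (univ.filter fun i => deg i = k).card

lemma sum_deg_eq (hK : ∀ i, deg i ≤ K) (g : ℕ → ℝ) :
    ∑ i, g (deg i) = ∑ k ∈ range (K + 1), degCount deg k * g k := by
  rw [← Finset.sum_fiberwise_of_maps_to fun i _ => Finset.mem_range_succ_iff.2 (hK i)]
  refine sum_congr rfl fun k _ => ?_
  rw [sum_congr rfl fun i hi => by rw [(mem_filter.1 hi).2], sum_const, nsmul_eq_mul]
  rfl

lemma sum_socket_eq (hK : ∀ i, deg i ≤ K) (g : ℕ → ℝ) : ∑ s : Σ i, Fin (deg i), g (deg s.1) =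
      ∑ k ∈ range (K + 1), k * degCount deg k * g k := by
  rw [Fintype.sum_sigma]
  simp
  rw [sum_deg_eq hK fun k => k * g k]
  exact sum_congr rfl fun k _ => by ring

lemma sum_support_eq {q : ℝ[X]} {dmax : ℕ} (hq : IsDegreeDist q dmax) (hd : dmax ≤ K)
    {g : ℕ → ℝ} (hg : ∀ k, q.coeff k = 0 → g k = 0) :
    ∑ k ∈ q.support, g k = ∑ k ∈ range (K + 1), g k := by
  refine Finset.sum_subset (fun k hk => Finset.mem_range_succ_iff.2 ((hq.le_of_mem hk).trans hd))
    fun k _ hk => hg k (Polynomial.notMem_support_iff.1 hk)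

lemma abs_sum_mul_sub_le {s : Finset ℕ} {a b f : ℕ → ℝ} (hf : ∀ k, |f k| ≤ 1) :
    |∑ k ∈ s, a k * f k - ∑ k ∈ s, b k * f k| ≤ ∑ k ∈ s, |a k - b k| := by
  rw [← sum_sub_distrib]
  refine (abs_sum_le_sum_abs _ _).trans (sum_le_sum fun k _ => ?_)
  rw [← sub_mul, abs_mul]
  exact mul_le_of_le_one_right (abs_nonneg _) (hf k)

end

section

variable {n : ℕ → ℕ} {deg : ∀ N, Fin (n N) → ℕ} {K dmax : ℕ} (hK : ∀ N i, deg N i ≤ K)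
  {q : ℝ[X]} (hq : IsDegreeDist q dmax) (hd : dmax ≤ K)
  (hfreq : ∀ k, Tendsto (fun N => (degCount (deg N) k : ℝ) / n N) atTop (𝓝 (q.coeff k)))
include hK hq hd hfreq

lemma exists_node_freq : ∃ η : ℕ → ℝ, Tendsto η atTop (𝓝 0) ∧ ∀ N (f : ℕ → ℝ),
    (∀ k, |f k| ≤ 1) → |(∑ i, f (deg N i)) / (univ : Finset (Fin (n N))).card -
      ∑ k ∈ q.support, q.coeff k * f k| ≤ η N := by
  refine ⟨fun N => ∑ k ∈ range (K + 1), |(degCount (deg N) k : ℝ) / n N - q.coeff k|,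
    ?_, fun N f hf => ?_⟩
  · rw [← sum_const_zero]
    refine tendsto_finsetSum _ fun k _ => ?_
    simpa using ((hfreq k).sub_const (q.coeff k)).abs
  · rw [sum_deg_eq (hK N) f, card_univ, card_fin, sum_div,
      sum_support_eq hq hd fun k hk => by rw [hk, zero_mul]]
    refine Eq.trans_le ?_ (abs_sum_mul_sub_le hf)
    grind

lemma exists_edge_freq : ∃ η : ℕ → ℝ, Tendsto η atTop (𝓝 0) ∧ ∀ N (f : ℕ → ℝ),
    (∀ k, |f k| ≤ 1) → |(∑ s : Σ i, Fin (deg N i), f (deg N s.1 - 1)) / card (Σ i, Fin (deg N i)) -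
      ∑ k ∈ q.support, edgeWeight q k * f (k - 1)| ≤ η N := by
  have hcard : ∀ N, (card (Σ i, Fin (deg N i)) : ℝ) =
      ∑ k ∈ range (K + 1), (k : ℝ) * (degCount (deg N) k : ℝ) := fun N => by
    have := sum_socket_eq (hK N) fun _ => 1
    simpa using this
  refine ⟨fun N => ∑ k ∈ range (K + 1), |(k * degCount (deg N) k : ℝ) /
    card (Σ i, Fin (deg N i)) - edgeWeight q k|, ?_, fun N f hf => ?_⟩
  · rw [← sum_const_zero]
    refine tendsto_finsetSum _ fun k _ => ?_
    have h1 : Tendsto (fun N => (k * ((degCount (deg N) k : ℝ) / n N)) /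
        ∑ j ∈ range (K + 1), j * ((degCount (deg N) j : ℝ) / n N)) atTop
        (𝓝 (edgeWeight q k)) := by
      have hder : q.derivative.eval 1 = ∑ j ∈ range (K + 1), j * q.coeff j := by
        rw [IsDegreeDist.derivative_eval, sum_support_eq hq hd fun k hk => by rw [hk, mul_zero]]
      rw [edgeWeight, hder]
      refine ((hfreq k).const_mul _).div (tendsto_finsetSum _ fun j _ => (hfreq j).const_mul _) ?_
      linarith [hq.one_le_derivative_eval]
    have h2 : ∀ N, (k * degCount (deg N) k : ℝ) / card (Σ i, Fin (deg N i)) =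
        (k * ((degCount (deg N) k : ℝ) / n N)) /
          ∑ j ∈ range (K + 1), j * ((degCount (deg N) j : ℝ) / n N) := fun N => by
      rw [hcard]
      rcases Nat.eq_zero_or_pos (n N) with h0 | h0
      · have : ∀ k, degCount (deg N) k = 0 := fun k => by
          rw [degCount, Finset.card_eq_zero, Finset.filter_eq_empty_iff]
          intro i
          exact absurd i.2 (by omega)
        simp [this]
      · have h0' : (n N : ℝ) ≠ 0 := by exact_mod_cast h0.ne'
        simp_rw [mul_div_assoc']
        rw [← sum_div, div_div_div_cancel_right₀ h0']
    simp_rw [h2]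
    simpa using (h1.sub_const (edgeWeight q k)).abs
  · rw [sum_socket_eq (hK N) fun k => f (k - 1), sum_div,
      sum_support_eq hq hd fun k hk => by rw [edgeWeight, hk]; simp]
    refine Eq.trans_le ?_ (abs_sum_mul_sub_le fun k => hf (k - 1))
    grind

end

section

variable {n m : ℕ} (bd : Fin n → ℕ) (od : Fin m → ℕ)

/-- The half-edges: sockets at code bits and sockets at other nodes. -/
abbrev Socket := (Σ i, Fin (bd i)) ⊕ (Σ a, Fin (od a))

/-- The bijections between the two kinds of sockets, one for each graph of the ensemble. -/
abbrev Matching := (Σ i, Fin (bd i)) ≃ (Σ a, Fin (od a))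

/-- The node of a socket. -/
def socketNode : Socket bd od → Fin n ⊕ Fin m
  | .inl s => .inl s.1
  | .inr r => .inr r.1

/-- The other sockets at the node of a socket. -/
def socketSib : Socket bd od →
    List (Socket bd od)
  | .inl s => ((finRange (bd s.1)).erase s.2).map fun j => .inl ⟨s.1, j⟩
  | .inr r => ((finRange (od r.1)).erase r.2).map fun j => .inr ⟨r.1, j⟩

/-- The sockets at a code bit. -/
def socketsAt (i : Fin n) : List (Socket bd od) :=
  (finRange (bd i)).map fun j => .inl ⟨i, j⟩

lemma length_socketSib_inl (s : Σ i, Fin (bd i)) :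
    (socketSib bd od (.inl s)).length = bd s.1 - 1 := by
  simp [socketSib, List.length_erase_of_mem]

lemma length_socketSib_inr (r : Σ a, Fin (od a)) :
    (socketSib bd od (.inr r)).length = od r.1 - 1 := by
  simp [socketSib, List.length_erase_of_mem]

lemma mem_erase_finRange {k : ℕ} {a b : Fin k} : a ∈ (finRange k).erase b ↔ a ≠ b := by
  rw [(nodup_finRange k).mem_erase_iff]
  simp

lemma incidence_socket {K : ℕ} (hb : ∀ i, bd i ≤ K) (ho : ∀ a, od a ≤ K) :
    Incidence (socketNode bd od) (socketSib bd od) K where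
  nodup x := by
    rcases x with s | r
    · refine List.Nodup.map (fun j j' h => ?_) ((nodup_finRange _).erase _)
      simpa using h
    · refine List.Nodup.map (fun j j' h => ?_) ((nodup_finRange _).erase _)
      simpa using h
  side x y hy := by rcases x with s | r <;> obtain ⟨j, _, rfl⟩ := List.mem_map.1 hy <;> rfl
  node_eq x y hy := by rcases x with s | r <;> obtain ⟨j, _, rfl⟩ := List.mem_map.1 hy <;> rfl
  ne x y hy := by
    rcases x with ⟨i, k⟩ | ⟨a, k⟩ <;> obtain ⟨j, hj, rfl⟩ := List.mem_map.1 hy <;>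
    · rw [mem_erase_finRange] at hj
      simpa using hj
  length_lt x := by
    rcases x with s | r
    · rw [length_socketSib_inl]
      have := s.2.2
      have := hb s.1
      omega
    · rw [length_socketSib_inr]
      have := r.2.2
      have := ho r.1
      omega
  card_le v s hs := by
    rcases v with i | a
    · have hsub : s ⊆ univ.image fun j : Fin (bd i) =>
          (.inl ⟨i, j⟩ : Socket bd od) := fun x hx => by
        have := hs x hx
        rcases x with ⟨i', k⟩ | r
        · simp only [socketNode, Sum.inl.injEq] at this
          grind
        · simp [socketNode] at this
      refine (Finset.card_le_card hsub).trans (Finset.card_image_le.trans ?_)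
      simpa using hb i
    · have hsub : s ⊆ univ.image fun j : Fin (od a) =>
          (.inr ⟨a, j⟩ : Socket bd od) := fun x hx => by
        have := hs x hx
        rcases x with s | ⟨a', k⟩
        · simp [socketNode] at this
        · simp only [socketNode, Sum.inr.injEq] at this
          grind
      refine (Finset.card_le_card hsub).trans (Finset.card_image_le.trans ?_)
      simpa using ho a

/-- Average over the matchings of a function of the messages that reach a code bit. -/
lemma abs_avg_root_messages_sub_le {T : Type} {K : ℕ} (hb : ∀ i, bd i ≤ K) (ho : ∀ a, od a ≤ K)
    (hE : card (Σ a, Fin (od a)) = card (Σ i, Fin (bd i)))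
    (hpos : 0 < card (Σ i, Fin (bd i)))
    (comb : Socket bd od → List T → T) (β : T) (D : ℕ) (i : Fin n)
    {ψ : List T → ℝ} (hψ : ∀ L, |ψ L| ≤ 1) :
    |(∑ σ, ψ ((socketsAt bd od i).map (incMsg (socketSib bd od) comb β σ D))) /
        card (Matching bd od) -
      iterAvg (replicate (bd i) (idealAvg (socketSib bd od) comb β D true)) ψ| ≤
      ((K * K ^ D : ℕ) * (2 * (1 + (K * K ^ D : ℕ)) * K)) / card (Σ i, Fin (bd i)) := by
  have key := abs_avg_incMsg_sub_le (incidence_socket bd od hb ho) comb β hE hpos (K * K ^ D)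
    ((socketsAt bd od i).map fun h => (D, h)) id ∅ {.inl i} ψ ?_ hψ (fun _ _ _ _ => rfl) ?_ ?_ ?_
  · simp only [Finset.card_singleton, Nat.cast_one, id] at key
    have e1 : ((socketsAt bd od i).map fun h => (D, h)).map (fun p =>
        idealAvg (socketSib bd od) comb β p.1 p.2.isLeft) =
        replicate (bd i) (idealAvg (socketSib bd od) comb β D true) := by
      refine List.eq_replicate_iff.2 ⟨by simp [socketsAt], fun A hA => ?_⟩
      simp only [socketsAt, List.map_map, List.mem_map] at hA
      obtain ⟨j, _, rfl⟩ := hA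
      rfl
    rw [e1] at key
    simp only [List.map_map] at key
    exact key
  · have : taskWeight K ((socketsAt bd od i).map fun h => (D, h)) = bd i * K ^ D := by
      simp [taskWeight, socketsAt, comp_def]
    rw [this]
    exact Nat.mul_le_mul_right _ (hb i)
  · rw [List.map_map]
    simp
    exact (nodup_finRange _).map fun j j' h => by simpa using h
  · intro p hp
    simp only [socketsAt, List.map_map, List.mem_map] at hp
    obtain ⟨j, _, rfl⟩ := hp
    simp [socketNode]
  · simp

end

/-! ### Short cycles are rare -/

section

variable {S R M : Type} [DecidableEq S] [DecidableEq R] [DecidableEq M]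

/-- Marks the messages that come from the node `v`. -/
def combReturn (node : S ⊕ R → M) (v : M) (x : S ⊕ R) (L : List Bool) : Bool :=
  decide (node x = v) || L.any id

lemma iterAvg_any_le {A : (Bool → ℝ) → ℝ} (hA : IsFinAvg A) {c : ℝ}
    (hc : A (fun b => if b then 1 else 0) ≤ c) (m : ℕ) :
    iterAvg (replicate m A) (fun L => if L.any id then (1 : ℝ) else 0) ≤ m * c := by
  induction m with
  | zero => simp [iterAvg]
  | succ m ih =>
    have hIt : IsFinAvg (iterAvg (replicate m A)) := isFinAvg_iterAvg fun A' hA' => by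
      rw [List.eq_of_mem_replicate hA']; exact hA
    calc _ ≤ A (fun b => (if b then 1 else 0) + m * c) := hA.mono fun b => by
            cases b
            · grind
            · have h0 : 0 ≤ (m : ℝ) * c := le_trans (le_of_eq (hIt.const 0).symm)
                ((hIt.mono fun L => by split_ifs <;> norm_num).trans ih)
              have h1 := hIt.const 1
              simp [h1, h0]
      _ ≤ _ := by rw [hA.add, hA.const]; push_cast; linarith

variable [Fintype S] [Fintype R]

omit [DecidableEq S] [DecidableEq R] in
lemma idealAvg_return_le {node : S ⊕ R → M}
    {sib : S ⊕ R → List (S ⊕ R)} {K : ℕ} (hI : Incidence node sib K)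
    (hE : card R = card S) (hpos : 0 < card S) (v : M) (D : ℕ) (b : Bool) :
    idealAvg sib (combReturn node v) false D b (fun b => if b then 1 else 0) ≤
      deErr ((K : ℝ) / card S) K D := by
  have hS0 : (0 : ℝ) < card S := by positivity
  have hfin := isFinAvg_idealAvg sib (combReturn node v) false hE hpos
  induction D generalizing b with
  | zero => simp [idealAvg, deErr]
  | succ D ih =>
    rw [idealAvg, deErr, card_oppSide hE]
    have h0 : 0 ≤ deErr ((K : ℝ) / card S) K D := by
      exact le_trans (le_of_eq ((hfin D b).const 0).symm)
        (((hfin D b).mono fun b => by split_ifs <;> norm_num).trans (ih b))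
    have hx : ∀ x, iterAvg (replicate (sib x).length (idealAvg sib (combReturn node v) false D !b))
        (fun L => if combReturn node v x L then (1 : ℝ) else 0) ≤
        (if node x = v then 1 else 0) + K * deErr ((K : ℝ) / card S) K D := fun x => by
      have hIt : IsFinAvg (iterAvg (replicate (sib x).length
          (idealAvg sib (combReturn node v) false D !b))) := isFinAvg_iterAvg fun A' hA' => by
        grind
      have h1 := iterAvg_any_le (hfin D !b) (ih !b) (sib x).length
      have h2 : ((sib x).length : ℝ) ≤ K := by exact_mod_cast (hI.length_lt x).le
      have h3 := mul_le_mul_of_nonneg_right h2 h0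
      calc _ ≤ iterAvg (replicate (sib x).length (idealAvg sib (combReturn node v) false D !b))
              (fun L => (if L.any id then (1 : ℝ) else 0) + (if node x = v then 1 else 0)) :=
            hIt.mono fun L => by
              unfold combReturn
              grind
        _ ≤ _ := by rw [hIt.add, hIt.const]; linarith
    rw [div_le_iff₀ hS0, add_mul, div_mul_cancel₀ _ hS0.ne']
    refine (sum_le_sum fun x _ => hx x).trans ?_
    rw [sum_add_distrib, sum_const, card_oppSide hE, nsmul_eq_mul]
    refine add_le_add ?_ (le_of_eq (by ring))
    rw [Finset.sum_ite, sum_const_zero, add_zero, sum_const, nsmul_eq_mul, mul_one]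
    exact_mod_cast hI.card_le v _ fun x hx => (mem_filter.1 hx).2

end

/-! ### The local limit of the socket ensembles -/

namespace DegreeSequence

variable {q r : ℝ[X]} {qmax rmax : ℕ} (S : DegreeSequence q r qmax rmax)

/-- The sockets on the side of the code bits. -/
abbrev BitSocket (N : ℕ) : Type := Σ i, Fin (S.bitDeg N i)

/-- The sockets on the other side. -/
abbrev OthSocket (N : ℕ) : Type := Σ a, Fin (S.othDeg N a)

lemma card_eq (N : ℕ) : card (S.OthSocket N) = card (S.BitSocket N) := by simp [S.sum_eq]

lemma n_le_card (N : ℕ) : S.n N ≤ card (S.BitSocket N) := by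
  rw [Fintype.card_sigma]
  calc S.n N = ∑ _i : Fin (S.n N), 1 := by simp
    _ ≤ _ := sum_le_sum fun i _ => by simpa using (S.bitDeg_mem N i).1

lemma tendsto_inv_card : Tendsto (fun N => (1 : ℝ) / card (S.BitSocket N)) atTop (𝓝 0) := by
  have : Tendsto (fun N => card (S.BitSocket N)) atTop atTop :=
    tendsto_atTop_mono S.n_le_card S.n_tendsto
  exact tendsto_one_div_atTop_nhds_zero_nat.comp this

lemma bitDeg_le (N : ℕ) (i) : S.bitDeg N i ≤ qmax + rmax := by have := (S.bitDeg_mem N i).2; omega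

lemma othDeg_le (N : ℕ) (a) : S.othDeg N a ≤ qmax + rmax := by have := (S.othDeg_mem N a).2; omega

/-- The average over the matching and over the code bit of a function of the messages that reach the
code bit is asymptotically that for independent partners. -/
lemma exists_message_bound (D : ℕ) : ∃ e : ℕ → ℝ, Tendsto e atTop (𝓝 0) ∧
    ∀ N (T : Type) (comb : Fin (S.n N) → S.BitSocket N ⊕ S.OthSocket N → List T → T) (β : T)
      (ψ : List T → ℝ), 0 < S.n N → (∀ L, |ψ L| ≤ 1) →
      |(∑ σ, (1 / (S.n N : ℝ)) * ∑ i, ψ ((socketsAt (S.bitDeg N) (S.othDeg N) i).map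
          (incMsg (socketSib (S.bitDeg N) (S.othDeg N)) (comb i) β σ D))) /
          card (S.BitSocket N ≃ S.OthSocket N) -
        (1 / (S.n N : ℝ)) * ∑ i, iterAvg (replicate (S.bitDeg N i)
          (idealAvg (socketSib (S.bitDeg N) (S.othDeg N)) (comb i) β D true)) ψ| ≤ e N := by
  set K := qmax + rmax with hK
  set C : ℝ := (K * K ^ D : ℕ) * (2 * (1 + (K * K ^ D : ℕ)) * K) with hC
  refine ⟨fun N => C * (1 / card (S.BitSocket N)), by
    simpa using S.tendsto_inv_card.const_mul C, fun N T comb β ψ hn hψ => ?_⟩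
  have hn' : (0 : ℝ) < S.n N := by exact_mod_cast hn
  have key := fun i => abs_avg_root_messages_sub_le (S.bitDeg N) (S.othDeg N) (S.bitDeg_le N)
    (S.othDeg_le N) (S.card_eq N) (hn.trans_le (S.n_le_card N)) (comb i) β D i hψ
  rw [← mul_sum, Finset.sum_comm, mul_div_assoc, ← mul_sub, sum_div,
    ← sum_sub_distrib, abs_mul, abs_of_pos (by positivity), one_div, inv_mul_le_iff₀ hn']
  refine (abs_sum_le_sum_abs _ _).trans ((sum_le_sum fun i _ => key i).trans ?_)
  rw [sum_const, card_univ, card_fin, nsmul_eq_mul, ← hC]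
  simp only [mul_one_div, le_refl]

lemma eventually_n_pos : ∀ᶠ N in atTop, 0 < S.n N :=
  (tendsto_atTop.1 S.n_tendsto 1).mono fun _ h => h

/-- The law combined from the messages that reach a random code bit converges to density
evolution. -/
lemma tendsto_avg_root (hq : IsDegreeDist q qmax) (hr : IsDegreeDist r rmax) (κ : Kind)
    {τ β : Prob ℝ} (hτ : IsLaw τ) (hβ : IsLaw β) (k : ℕ)
    {f : ℝ → ℝ} (hf : Measurable f) (hb : ∀ x, |f x| ≤ 1) :
    Tendsto (fun N => (∑ σ, (1 / (S.n N : ℝ)) * ∑ i, ∫ x, f x ∂(κ.softOp_bit.fold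
        ((socketsAt (S.bitDeg N) (S.othDeg N) i).map
          (incMsg (socketSib (S.bitDeg N) (S.othDeg N)) (combLaw κ τ) β σ (2 * k + 1))) :
            Measure ℝ)) / card (S.BitSocket N ≃ S.OthSocket N)) atTop
      (𝓝 (∫ x, f x ∂(rootLaw κ q r τ β k))) := by
  obtain ⟨e, he, hbd⟩ := S.exists_message_bound (2 * k + 1)
  obtain ⟨η', hη', hη'b⟩ := exists_node_freq (fun N i => S.bitDeg_le N i) hq (by omega) S.bit_freq
  obtain ⟨η₁, hη₁, hη₁b⟩ := exists_edge_freq (fun N i => S.bitDeg_le N i) hq (by omega) S.bit_freq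
  obtain ⟨η₂, hη₂, hη₂b⟩ := exists_edge_freq (fun N i => S.othDeg_le N i) hr (by omega) S.oth_freq
  set η : ℕ → ℝ := fun N => max (η₁ N) (η₂ N) with hη
  have hη0 : Tendsto η atTop (𝓝 0) := by simpa using hη₁.max hη₂
  set K : ℝ := ((qmax + rmax : ℕ) : ℝ) with hK
  rw [tendsto_iff_dist_tendsto_zero]
  refine squeeze_zero' (g := fun N => e N + (η' N + K * deErr (η N) K (2 * k + 1)))
    (Eventually.of_forall fun N => dist_nonneg) ?_ ?_
  · filter_upwards [S.eventually_n_pos] with N hn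
    have h1 := hbd N _ (fun _ => combLaw κ τ) β
      (fun L => ∫ x, f x ∂(κ.softOp_bit.fold L : Measure ℝ)) hn fun L => abs_integral_le_one hb _
    have hpos := hn.trans_le (S.n_le_card N)
    have h2 := abs_avg_root_sub_le (sib := socketSib (S.bitDeg N) (S.othDeg N))
      (fun x => ?_) (S.card_eq N) hpos hq hr (κ := κ) hτ hβ (η := η N) ?_ ?_
      (univ : Finset (Fin (S.n N))) (by simpa using hn) (S.bitDeg N) (S.bitDeg_le N)
      (hη'b N) k hf hb
    · rw [dist_eq]
      refine (abs_sub_le _ _ _).trans (add_le_add h1 ?_)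
      rw [card_univ, card_fin] at h2
      rw [one_div, inv_mul_eq_div]
      exact h2
    · rcases x with s | t
      · rw [length_socketSib_inl]
        have := S.bitDeg_le N s.1
        omega
      · rw [length_socketSib_inr]
        have := S.othDeg_le N t.1
        omega
    · intro g hg
      rw [sum_oppSide_false, card_oppSide (S.card_eq N)]
      simp only [length_socketSib_inl]
      exact (hη₁b N g hg).trans (le_max_left _ _)
    · intro g hg
      rw [sum_oppSide_true, card_oppSide (S.card_eq N), ← S.card_eq N]
      simp only [length_socketSib_inr]
      exact (hη₂b N g hg).trans (le_max_right _ _)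
  · simpa using he.add (hη'.add ((tendsto_deErr hη0 K (2 * k + 1)).const_mul K))

/-- Few code bits lie on short closed walks. -/
lemma tendsto_avg_return (D : ℕ) :
    Tendsto (fun N => (∑ σ, (1 / (S.n N : ℝ)) * ∑ i, (if ((socketsAt (S.bitDeg N) (S.othDeg N)
        i).map (incMsg (socketSib (S.bitDeg N) (S.othDeg N))
          (combReturn (socketNode (S.bitDeg N) (S.othDeg N)) (.inl i)) false σ D)).any id
            then (1 : ℝ) else 0)) / card (S.BitSocket N ≃ S.OthSocket N)) atTop (𝓝 0) := by
  obtain ⟨e, he, hbd⟩ := S.exists_message_bound D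
  set K : ℝ := ((qmax + rmax : ℕ) : ℝ) with hK
  refine squeeze_zero' (g := fun N => e N + K * deErr (K * (1 / card (S.BitSocket N))) K D)
    (Eventually.of_forall fun N => ?_) ?_ ?_
  · positivity
  · filter_upwards [S.eventually_n_pos] with N hn
    have hpos := hn.trans_le (S.n_le_card N)
    have hn' : (0 : ℝ) < S.n N := by exact_mod_cast hn
    have h1 := hbd N _ (fun i => combReturn (socketNode (S.bitDeg N) (S.othDeg N)) (.inl i)) false
      (fun L => if L.any id then 1 else 0) hn fun L => by split_ifs <;> simp
    have hI := incidence_socket (S.bitDeg N) (S.othDeg N) (S.bitDeg_le N) (S.othDeg_le N)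
    have h2 : (1 / (S.n N : ℝ)) * ∑ i, iterAvg (replicate (S.bitDeg N i)
        (idealAvg (socketSib (S.bitDeg N) (S.othDeg N))
          (combReturn (socketNode (S.bitDeg N) (S.othDeg N)) (.inl i)) false D true))
        (fun L => if L.any id then (1 : ℝ) else 0) ≤
        K * deErr (K * (1 / card (S.BitSocket N))) K D := by
      rw [one_div, inv_mul_le_iff₀ hn']
      have hle := fun i => idealAvg_return_le hI (S.card_eq N) hpos (.inl i) D true
      have hfin := fun i => isFinAvg_idealAvg (socketSib (S.bitDeg N) (S.othDeg N))
        (combReturn (socketNode (S.bitDeg N) (S.othDeg N)) (.inl i)) false (S.card_eq N) hpos D true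
      rw [← hK, ← mul_one_div] at hle
      refine (sum_le_sum fun i _ => (iterAvg_any_le (hfin i) (hle i) _).trans
        (mul_le_mul_of_nonneg_right (c := K)
          (by rw [hK]; exact_mod_cast S.bitDeg_le N i) ?_)).trans ?_
      · refine le_trans ?_ (hle i)
        exact le_trans (le_of_eq ((hfin i).const 0).symm)
          ((hfin i).mono fun b => by split_ifs <;> norm_num)
      · simp
    linarith [le_of_abs_le h1]
  · have h0 := S.tendsto_inv_card.const_mul K
    rw [mul_zero] at h0
    simpa using he.add ((tendsto_deErr h0 K D).const_mul K)

end DegreeSequence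

/-! ### Sums over independent spins -/

section

variable {ι : Type} [DecidableEq ι]

/-- `P` is an affine function of the coordinate `j`. -/
def AffineAt (P : (ι → ℝ) → ℝ) (j : ι) : Prop := ∀ ξ s, P (upd ξ j s) =
  (1 + s) / 2 * P (upd ξ j 1) + (1 - s) / 2 * P (upd ξ j (-1))

/-- `P` does not depend on the coordinate `j`. -/
def IndepOf {α : Type} (P : (ι → ℝ) → α) (j : ι) : Prop := ∀ ξ s, P (upd ξ j s) = P ξ

lemma AffineAt.mul {P Q : (ι → ℝ) → ℝ} {j : ι} (hP : AffineAt P j) (hQ : IndepOf Q j) :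
    AffineAt (fun ξ => P ξ * Q ξ) j := fun ξ s => by
  simp only [hQ ξ s, hQ ξ 1, hQ ξ (-1), hP ξ s]; ring

lemma AffineAt.const_add {P : (ι → ℝ) → ℝ} {j : ι} (hP : AffineAt P j) (c : ℝ) :
    AffineAt (fun ξ => c + P ξ) j := fun ξ s => by
  simp only [hP ξ s]; ring

lemma affineAt_coord (j : ι) : AffineAt (fun ξ => ξ j) j := fun ξ s => by simp; ring

lemma indepOf_coord {i j : ι} (h : i ≠ j) : IndepOf (fun ξ : ι → ℝ => ξ i) j :=
  fun ξ s => update_of_ne h s ξ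

lemma IndepOf.prod {α : Type} {S : Finset α} {g : α → (ι → ℝ) → ℝ} {j : ι}
    (h : ∀ a ∈ S, IndepOf (g a) j) : IndepOf (fun ξ => ∏ a ∈ S, g a ξ) j :=
  fun ξ s => prod_congr rfl fun a ha => h a ha ξ s

lemma IndepOf.affineAt {P : (ι → ℝ) → ℝ} {j : ι} (h : IndepOf P j) : AffineAt P j := fun ξ s => by
  rw [h, h, h]; ring

/-- A product is affine in a coordinate that occurs in one factor only. -/
lemma AffineAt.prod {α : Type} [DecidableEq α] {S : Finset α} {g : α → (ι → ℝ) → ℝ} {j : ι}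
    (a₀ : α) (h₀ : AffineAt (g a₀) j) (h : ∀ a ∈ S, a ≠ a₀ → IndepOf (g a) j) :
    AffineAt (fun ξ => ∏ a ∈ S, g a ξ) j := by
  by_cases ha : a₀ ∈ S
  · simp_rw [← mul_prod_erase S _ ha]
    exact h₀.mul (IndepOf.prod fun a hm => h a (Finset.mem_of_mem_erase hm) (ne_of_mem_erase hm))
  · exact (IndepOf.prod fun a hm => h a hm fun e => ha (e ▸ hm)).affineAt

variable [Fintype ι]

lemma sum_spin_coord {P : (ι → ℝ) → ℝ} {j : ι} (hP : AffineAt P j) (s : ℝ) :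
    ∑ x : ι → ℤˣ, P (fun i => spin (x i)) * (1 + s * spin (x j)) =
      ∑ x : ι → ℤˣ, P (upd (fun i => spin (x i)) j s) := by
  set f : (ι → ℤˣ) → ℝ := fun x => P (fun i => spin (x i)) * (1 + s * spin (x j)) with hf
  let φ : (ι → ℤˣ) → ι → ℤˣ := fun x => upd x j (-x j)
  have hφ : Involutive φ := fun x => by simp [φ]
  have h1 : ∑ x, f (φ x) = ∑ x, f x := Equiv.sum_comp (hφ.toPerm φ) f
  have hup : ∀ (x : ι → ℤˣ) (a : ℤˣ), (fun i => spin (upd x j a i)) =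
      upd (fun i => spin (x i)) j (spin a) := fun x a => by
    grind
  have h2 : ∀ x, f x + f (φ x) = 2 * P (upd (fun i => spin (x i)) j s) := fun x => by
    have hself : P (fun i => spin (x i)) = P (upd (fun i => spin (x i)) j (spin (x j))) := by
      congr 1
      exact (update_eq_self j _).symm
    simp only [hf, φ, hup, update_self]
    rw [hself, hP _ s]
    rcases Int.units_eq_one_or (x j) with h | h <;> rw [h] <;> simp [spin] <;> ring
  have h3 : 2 * ∑ x, f x = ∑ x, (f x + f (φ x)) := by rw [sum_add_distrib, h1, two_mul]
  simp_rw [h2, ← mul_sum] at h3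
  linarith

/-- Averaging independent spins with means `s j`, `j ∈ L`, in a function that is affine in each of
them amounts to replacing the spins by their means. -/
lemma sum_spin_affine (L : Finset ι) (s : ι → ℝ) {P : (ι → ℝ) → ℝ} (hP : ∀ j ∈ L, AffineAt P j) :
    ∑ x : ι → ℤˣ, P (fun i => spin (x i)) * ∏ j ∈ L, (1 + s j * spin (x j)) =
      ∑ x : ι → ℤˣ, P (fun i => if i ∈ L then s i else spin (x i)) := by
  induction L using Finset.induction_on generalizing P with
  | empty => simp
  | insert j L hj ih =>
    simp_rw [prod_insert hj, ← mul_assoc]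
    have hcomm : ∀ (ξ : ι → ℝ) (v : ℝ), (fun i => if i ∈ L then s i else upd ξ j v i) =
        upd (fun i => if i ∈ L then s i else ξ i) j v := fun ξ v => by
      grind
    rw [ih (P := fun ξ => P ξ * (1 + s j * ξ j)) fun i hi =>
      (hP i (Finset.mem_insert_of_mem hi)).mul fun ξ v => by
        rw [update_of_ne (by rintro rfl; exact hj hi)]]
    simp only [hj, if_false]
    rw [sum_spin_coord (P := fun ξ => P fun i => if i ∈ L then s i else ξ i)
      (fun ξ v => by simp only [hcomm]; exact hP j (Finset.mem_insert_self _ _) _ _)]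
    grind

end

/-! ### Codes on trees -/

lemma prod_filter_lt_succ {ι : Type*} [Fintype ι] (g : ι → ℕ) (k : ℕ) (f : ι → ℝ) :
    ∏ i with g i < k + 1, f i = (∏ i with g i < k, f i) * ∏ i with g i = k, f i := by
  classical
  rw [← Finset.prod_union (Finset.disjoint_filter.2 fun i _ h => h.ne), ← Finset.filter_or]
  simp only [Order.lt_add_one_iff, le_iff_lt_or_eq]

/-- A rooted tree with two kinds of nodes: the root is a code bit, `up` and `upB` are the
parents. -/
structure RootedTree (B O : Type) where
  root : B
  up : O → B
  upB : B → Option O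
  height : B → ℕ
  height_eq_zero : ∀ w, height w = 0 ↔ w = root
  upB_root : upB root = none
  exists_up : ∀ w, w ≠ root → ∃ a, upB w = some a
  height_up : ∀ w a, upB w = some a → height w = height (up a) + 1

namespace RootedTree

variable {B O : Type} [Fintype B] [Fintype O] [DecidableEq B] [DecidableEq O]
  (T : RootedTree B O)

/-- The children of a code bit. -/
def kids (w : B) : Finset O := univ.filter fun a => T.up a = w

/-- The children of the other nodes. -/
def kidsO (a : O) : Finset B := univ.filter fun w => T.upB w = some a

lemma mem_kids {w : B} {a : O} : a ∈ T.kids w ↔ T.up a = w := by simp [kids]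

lemma mem_kidsO {w : B} {a : O} : w ∈ T.kidsO a ↔ T.upB w = some a := by simp [kidsO]

/-- Value of a parity check. -/
def check (ξ : B → ℝ) (a : O) : ℝ := ξ (T.up a) * ∏ w ∈ T.kidsO a, ξ w

/-- Value of the node above a code bit. -/
def upVal (υ : O → ℝ) (w : B) : ℝ := (T.upB w).elim 1 υ

/-- Value of a code bit that is generated by its neighbours. -/
def gen (υ : O → ℝ) (w : B) : ℝ := T.upVal υ w * ∏ a ∈ T.kids w, υ a

/-- Nodes of a given height. -/
def level (k : ℕ) : Finset B := univ.filter fun w => T.height w = k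

/-- Nodes of smaller height. -/
def below (k : ℕ) : Finset B := univ.filter fun w => T.height w < k

lemma mem_level {w : B} {k : ℕ} : w ∈ T.level k ↔ T.height w = k := by simp [level]

lemma mem_below {w : B} {k : ℕ} : w ∈ T.below k ↔ T.height w < k := by simp [below]

lemma exists_height_lt : ∃ k, T.level k = ∅ ∧ T.below k = univ ∧ ∀ w, T.height w < k := by
  have h : ∀ w, T.height w < univ.sup T.height + 1 := fun w =>
      Nat.lt_succ_of_le (le_sup (mem_univ w))
  exact ⟨_, Finset.filter_false_of_mem fun w _ => (h w).ne,
    Finset.filter_true_of_mem fun w _ => h w, h⟩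

lemma level_zero : T.level 0 = {T.root} := by ext w; simp [level, T.height_eq_zero]

lemma below_zero : T.below 0 = ∅ := by simp [below]

lemma prod_below_succ (k : ℕ) (f : B → ℝ) :
    ∏ w ∈ T.below (k + 1), f w = (∏ w ∈ T.below k, f w) * ∏ w ∈ T.level k, f w :=
  prod_filter_lt_succ T.height k f

lemma prod_checks_level (k : ℕ) (f : O → ℝ) :
    ∏ a with T.height (T.up a) = k, f a = ∏ w ∈ T.level k, ∏ a ∈ T.kids w, f a := by
  rw [← Finset.prod_fiberwise_of_maps_to (t := T.level k) (g := T.up)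
    (fun a ha => by simpa [level] using ha)]
  refine prod_congr rfl fun w hw => prod_congr ?_ fun _ _ => rfl
  ext a
  rw [mem_level] at hw
  simp only [mem_filter, mem_univ, true_and, kids]
  exact ⟨fun h => h.2, fun h => ⟨by rw [h, hw], h⟩⟩

lemma prod_bits_level (k : ℕ) (f : B → ℝ) :
    ∏ w ∈ T.level (k + 1), f w = ∏ a with T.height (T.up a) = k, ∏ w ∈ T.kidsO a, f w := by
  rw [← Finset.prod_biUnion fun a _ b _ hab => disjoint_left.2 fun w h1 h2 => hab
    (Option.some_injective _ ((T.mem_kidsO.1 h1).symm.trans (T.mem_kidsO.1 h2)))]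
  refine prod_congr ?_ fun _ _ => rfl
  ext w
  simp only [Finset.mem_biUnion, mem_filter, mem_univ, true_and, mem_level, mem_kidsO]
  refine ⟨fun hw => ?_, fun ⟨a, ha, hw⟩ => by rw [T.height_up w a hw, ha]⟩
  obtain ⟨a, ha⟩ := T.exists_up w fun e => by rw [(T.height_eq_zero w).2 e] at hw; omega
  exact ⟨a, by have := T.height_up w a ha; omega, ha⟩

section

variable {s μ : B → ℝ} {ν : O → ℝ} {K : B → ℝ}
  (hν : ∀ a, ν a = ∏ w ∈ T.kidsO a, μ w)
  (hμ : ∀ w, ∀ ξ : ℤˣ, (1 + s w * spin ξ) * ∏ a ∈ T.kids w, (1 + spin ξ * ν a) =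
    K w * (1 + μ w * spin ξ))
include hν hμ

lemma ldpc_peel (F : ℝ → ℝ) (k : ℕ) :
    ∑ x : B → ℤˣ, F (spin (x T.root)) * (∏ a with T.height (T.up a) < k + 1,
        (1 + T.check (fun w => spin (x w)) a)) * (∏ w ∈ T.below (k + 1), (1 + s w * spin (x w))) *
        ∏ w ∈ T.level (k + 1), (1 + μ w * spin (x w)) =
    (∏ w ∈ T.level k, K w) * ∑ x : B → ℤˣ, F (spin (x T.root)) *
      (∏ a with T.height (T.up a) < k, (1 + T.check (fun w => spin (x w)) a)) *
      (∏ w ∈ T.below k, (1 + s w * spin (x w))) * ∏ w ∈ T.level k, (1 + μ w * spin (x w)) := by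
  have hroot := (T.height_eq_zero _).2 rfl
  rw [sum_spin_affine (T.level (k + 1)) μ (P := fun ξ => F (ξ T.root) *
    (∏ a with T.height (T.up a) < k + 1, (1 + T.check ξ a)) *
    ∏ w ∈ T.below (k + 1), (1 + s w * ξ w)) fun j hj => ?_, mul_sum]
  · refine sum_congr rfl fun x _ => ?_
    set ξ : B → ℝ := fun w => if w ∈ T.level (k + 1) then μ w else spin (x w)
    have h0 : ∀ {w}, T.height w < k + 1 → ξ w = spin (x w) := fun h =>
      if_neg fun h' => h.ne (T.mem_level.1 h')
    have e1 : ∏ a with T.height (T.up a) < k, (1 + T.check ξ a) =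
        ∏ a with T.height (T.up a) < k, (1 + T.check (fun w => spin (x w)) a) :=
      prod_congr rfl fun a ha => by
        have ha := (mem_filter.1 ha).2
        rw [check, check, h0 (by omega)]
        congr 2
        exact prod_congr rfl fun w hw => h0 (by rw [T.height_up w a (T.mem_kidsO.1 hw)]; omega)
    have e2 : ∏ w ∈ T.level k, ∏ a ∈ T.kids w, (1 + T.check ξ a) =
        ∏ w ∈ T.level k, ∏ a ∈ T.kids w, (1 + spin (x w) * ν a) :=
      prod_congr rfl fun w hw => prod_congr rfl fun a ha => by
        rw [mem_level] at hw
        rw [check, hν, T.mem_kids.1 ha, h0 (by omega)]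
        congr 2
        exact prod_congr rfl fun v hv => if_pos (T.mem_level.2
          (by rw [T.height_up v a (T.mem_kidsO.1 hv), T.mem_kids.1 ha, hw]))
    have e3 : ∏ w ∈ T.below (k + 1), (1 + s w * ξ w) =
        ∏ w ∈ T.below (k + 1), (1 + s w * spin (x w)) :=
      prod_congr rfl fun w hw => by rw [h0 (T.mem_below.1 hw)]
    have e4 : (∏ w ∈ T.level k, ∏ a ∈ T.kids w, (1 + spin (x w) * ν a)) *
        ∏ w ∈ T.level k, (1 + s w * spin (x w)) =
        (∏ w ∈ T.level k, K w) * ∏ w ∈ T.level k, (1 + μ w * spin (x w)) := by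
      rw [← prod_mul_distrib, ← prod_mul_distrib]
      exact prod_congr rfl fun w _ => by rw [mul_comm, hμ]
    rw [h0 (by omega), prod_filter_lt_succ, T.prod_checks_level, e1, e2, e3, T.prod_below_succ]
    linear_combination F (spin (x T.root)) * (∏ a with T.height (T.up a) < k,
      (1 + T.check (fun w => spin (x w)) a)) * (∏ w ∈ T.below k, (1 + s w * spin (x w))) * e4
  · rw [mem_level] at hj
    have hne : j ≠ T.root := fun e => by rw [e] at hj; omega
    obtain ⟨a₀, ha₀⟩ := T.exists_up j hne
    have hup : ∀ a, T.height (T.up a) < k + 1 → T.up a ≠ j := fun a ha e => by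
      rw [e] at ha; omega
    have h1 : IndepOf (fun ξ : B → ℝ => F (ξ T.root)) j := fun ξ v => by
      simp only [update_of_ne hne.symm]
    have h2 : IndepOf (fun ξ : B → ℝ => ∏ w ∈ T.below (k + 1), (1 + s w * ξ w)) j :=
      IndepOf.prod fun w hw ξ v => by
        rw [mem_below] at hw
        rw [update_of_ne (by rintro rfl; omega)]
    have h3 : AffineAt (fun ξ : B → ℝ => ∏ a with T.height (T.up a) < k + 1,
        (1 + T.check ξ a)) j := by
      refine AffineAt.prod a₀ ?_ fun a ha hne' ξ v => ?_
      · have h4 : AffineAt (fun ξ : B → ℝ => ∏ w ∈ T.kidsO a₀, ξ w) j :=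
          AffineAt.prod j (affineAt_coord j) fun w _ hw => indepOf_coord hw
        simpa only [check, mul_comm] using (h4.mul (indepOf_coord
          (hup a₀ (by have := T.height_up j a₀ ha₀; omega)))).const_add 1
      · simp only [check]
        rw [update_of_ne (hup a (mem_filter.1 ha).2)]
        congr 2
        refine prod_congr rfl fun w hw => update_of_ne ?_ _ _
        rintro rfl
        rw [mem_kidsO, ha₀] at hw
        exact hne' (Option.some_injective _ hw).symm
    simpa only [mul_comm] using (h3.mul h1).mul h2

/-- Belief propagation computes the marginal at the root of an LDPC code on a tree. -/
lemma ldpc_root (hK : ∀ w, 0 < K w) : ∃ C : ℝ, 0 < C ∧ ∀ F : ℝ → ℝ,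
    ∑ x : B → ℤˣ, F (spin (x T.root)) * (∏ a, (1 + T.check (fun w => spin (x w)) a)) *
        ∏ w, (1 + s w * spin (x w)) =
      C * ∑ x : B → ℤˣ, F (spin (x T.root)) * (1 + μ T.root * spin (x T.root)) := by
  have key : ∀ k, ∃ C : ℝ, 0 < C ∧ ∀ F : ℝ → ℝ,
      ∑ x : B → ℤˣ, F (spin (x T.root)) * (∏ a with T.height (T.up a) < k,
        (1 + T.check (fun w => spin (x w)) a)) * (∏ w ∈ T.below k, (1 + s w * spin (x w))) *
        ∏ w ∈ T.level k, (1 + μ w * spin (x w)) =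
      C * ∑ x : B → ℤˣ, F (spin (x T.root)) * (1 + μ T.root * spin (x T.root)) := fun k => by
    induction k with
    | zero => exact ⟨1, one_pos, fun F => by simp [level_zero, below_zero]⟩
    | succ k ih =>
      obtain ⟨C, hC, h⟩ := ih
      refine ⟨(∏ w ∈ T.level k, K w) * C, mul_pos (prod_pos fun w _ => hK w) hC, fun F => ?_⟩
      rw [T.ldpc_peel hν hμ, h, mul_assoc]
  obtain ⟨k, h1, h2, hlt⟩ := T.exists_height_lt
  obtain ⟨C, hC, h⟩ := key k
  refine ⟨C, hC, fun F => ?_⟩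
  rw [← h F, h1, h2]
  simp [hlt]

end

section

variable {μ : B → ℝ} {ν : O → ℝ} {K : O → ℝ}
  (hν : ∀ a, ∀ ξ : ℤˣ, ∏ w ∈ T.kidsO a, (1 + μ w * spin ξ) = K a * (1 + ν a * spin ξ))
include hν

lemma ldgm_peel {s : B → ℝ} (hμ : ∀ w, μ w = s w * ∏ a ∈ T.kids w, ν a) (k : ℕ) :
    ∑ u : O → ℤˣ, (∏ w ∈ T.below (k + 1), (1 + s w * T.gen (fun a => spin (u a)) w)) *
        ∏ w ∈ T.level (k + 1), (1 + μ w * T.upVal (fun a => spin (u a)) w) =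
    (∏ a with T.height (T.up a) = k, K a) * ∑ u : O → ℤˣ,
      (∏ w ∈ T.below k, (1 + s w * T.gen (fun a => spin (u a)) w)) *
        ∏ w ∈ T.level k, (1 + μ w * T.upVal (fun a => spin (u a)) w) := by
  set L : Finset O := univ.filter fun a => T.height (T.up a) = k with hL
  have hLm : ∀ {a}, a ∈ L ↔ T.height (T.up a) = k := fun {a} => by simp [hL]
  have hloc : ∀ {υ υ' : O → ℝ} {w}, (∀ a, T.height (T.up a) < T.height w → υ a = υ' a) →
      T.upVal υ w = T.upVal υ' w := fun {υ υ' w} h => by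
    rw [upVal, upVal]
    rcases h' : T.upB w with _ | a
    · rfl
    · exact h a (by have := T.height_up w a h'; omega)
  have e0 : ∀ u : O → ℤˣ, ∏ w ∈ T.level (k + 1), (1 + μ w * T.upVal (fun a => spin (u a)) w) =
      (∏ a ∈ L, K a) * ∏ a ∈ L, (1 + ν a * spin (u a)) := fun u => by
    rw [T.prod_bits_level, ← prod_mul_distrib]
    refine prod_congr rfl fun a _ => (prod_congr rfl fun w hw => ?_).trans (hν a (u a))
    rw [upVal, T.mem_kidsO.1 hw]
    rfl
  simp_rw [e0, mul_left_comm _ (∏ a ∈ L, K a), ← mul_sum]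
  congr 1
  rw [sum_spin_affine L ν (P := fun υ => ∏ w ∈ T.below (k + 1), (1 + s w * T.gen υ w))
    fun j hj => ?_]
  · refine sum_congr rfl fun u _ => ?_
    have hupv : ∀ w, T.height w ≤ k → T.upVal (fun a => if a ∈ L then ν a else spin (u a)) w =
        T.upVal (fun a => spin (u a)) w := fun w hw =>
      hloc fun a ha => if_neg fun h => by rw [hLm] at h; omega
    rw [T.prod_below_succ]
    congr 1 <;> refine prod_congr rfl fun w hw => ?_
    · rw [mem_below] at hw
      rw [gen, gen, hupv w hw.le]
      congr 3
      exact prod_congr rfl fun a ha => if_neg fun h => by rw [hLm, T.mem_kids.1 ha] at h; omega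
    · rw [mem_level] at hw
      rw [gen, hupv w hw.le, hμ, prod_congr rfl fun a ha =>
        if_pos (by rw [hLm, T.mem_kids.1 ha, hw])]
      ring
  · rw [hLm] at hj
    have hind : ∀ w, T.height w < k + 1 → IndepOf (fun υ : O → ℝ => T.upVal υ w) j :=
      fun w hw υ v => hloc fun a ha => update_of_ne (by rintro rfl; omega) _ _
    refine AffineAt.prod (T.up j) ?_ fun w hw hne ξ v => ?_
    · have h2 : AffineAt (fun υ : O → ℝ => ∏ a ∈ T.kids (T.up j), υ a) j :=
        AffineAt.prod j (affineAt_coord j) fun a _ ha => indepOf_coord ha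
      have h3 : IndepOf (fun _ : O → ℝ => s (T.up j)) j := fun _ _ => rfl
      simpa only [gen, mul_comm] using ((h2.mul (hind (T.up j) (by omega))).mul h3).const_add 1
    · have h2 : ∏ a ∈ T.kids w, upd ξ j v a = ∏ a ∈ T.kids w, ξ a :=
        prod_congr rfl fun a ha => update_of_ne
          (by rintro rfl; exact hne (T.mem_kids.1 ha).symm) _ _
      simp only [gen, hind w (T.mem_below.1 hw) ξ v, h2]

/-- Belief propagation computes the marginal at the root of an LDGM code on a tree. -/
lemma ldgm_root {s : B → ℝ} (hμ : ∀ w, w ≠ T.root → μ w = s w * ∏ a ∈ T.kids w, ν a)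
    (hK : ∀ a, 0 < K a) : ∃ C : ℝ, 0 < C ∧ ∀ v : ℝ,
    ∑ u : O → ℤˣ, ∏ w, (1 + upd s T.root v w * T.gen (fun a => spin (u a)) w) =
      C * (1 + v * ∏ a ∈ T.kids T.root, ν a) := by
  have key : ∀ k, ∃ C : ℝ, 0 < C ∧ ∀ v : ℝ,
      ∑ u : O → ℤˣ, (∏ w ∈ T.below k, (1 + upd s T.root v w *
        T.gen (fun a => spin (u a)) w)) *
        ∏ w ∈ T.level k, (1 + upd μ T.root (v * ∏ a ∈ T.kids T.root, ν a) w *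
          T.upVal (fun a => spin (u a)) w) =
      C * (1 + v * ∏ a ∈ T.kids T.root, ν a) := fun k => by
    induction k with
    | zero =>
      refine ⟨card (O → ℤˣ), by exact_mod_cast Fintype.card_pos, fun v => ?_⟩
      simp [level_zero, below_zero, upVal, T.upB_root, mul_add]
    | succ k ih =>
      obtain ⟨C, hC, h⟩ := ih
      refine ⟨(∏ a with T.height (T.up a) = k, K a) * C,
        mul_pos (prod_pos fun a _ => hK a) hC, fun v => ?_⟩
      rw [T.ldgm_peel (ν := ν) (K := K) (fun a ξ => ?_) (fun w => ?_), h, mul_assoc]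
      · rw [← hν]
        refine prod_congr rfl fun w hw => ?_
        rw [update_of_ne]
        rintro rfl
        rw [mem_kidsO, T.upB_root] at hw
        cases hw
      · rcases eq_or_ne w T.root with rfl | hw
        · simp
        · simp [hw, hμ w hw]
  obtain ⟨k, h1, h2, -⟩ := T.exists_height_lt
  obtain ⟨C, hC, h⟩ := key k
  refine ⟨C, hC, fun v => ?_⟩
  rw [← h v, h1, h2]
  simp

end

end RootedTree

/-! ### Belief propagation on the computational tree -/

section

variable {V A E : Type} {G : Graph V A E} {i : V} {d : ℕ}

/-- The walk to a node of the computational tree. -/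
def TreeBit.walk (w : TreeBit G i d) : List E := Subtype.val w

/-- The walk to a node of the computational tree. -/
def TreeOth.walk (a : TreeOth G i d) : List E := Subtype.val a

/-- The walk that ends with an edge of the computational tree. -/
def TreeEdge.walk (e : TreeEdge G i d) : List E := Subtype.val e

lemma TreeBit.ext {w w' : TreeBit G i d} (h : w.walk = w'.walk) : w = w' := Subtype.ext h
lemma TreeOth.ext {w w' : TreeOth G i d} (h : w.walk = w'.walk) : w = w' := Subtype.ext h

lemma TreeBit.isWalk (w : TreeBit G i d) : IsWalk G i w.walk := w.2.1
lemma TreeOth.isWalk (w : TreeOth G i d) : IsWalk G i w.walk := w.2.1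
lemma TreeEdge.isWalk (w : TreeEdge G i d) : IsWalk G i w.walk := w.2.1

lemma TreeBit.length_le (w : TreeBit G i d) : w.walk.length ≤ d := w.2.2.1
lemma TreeOth.length_le (w : TreeOth G i d) : w.walk.length ≤ d := w.2.2.1
lemma TreeEdge.length_le (w : TreeEdge G i d) : w.walk.length ≤ d := w.2.2.1

lemma TreeBit.even (w : TreeBit G i d) : Even w.walk.length := w.2.2.2
lemma TreeOth.odd (w : TreeOth G i d) : Odd w.walk.length := w.2.2.2
lemma TreeEdge.ne_nil (w : TreeEdge G i d) : w.walk ≠ [] := w.2.2.2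

lemma TreeOth.ne_nil (w : TreeOth G i d) : w.walk ≠ [] := fun h => by
  have := w.odd
  rw [h] at this
  simp at this

/-- A code bit of the computational tree, given by a walk. -/
def TreeBit.of (w : List E) (h1 : IsWalk G i w) (h2 : w.length ≤ d) (h3 : Even w.length) :
    TreeBit G i d := ⟨w, h1, h2, h3⟩

/-- Another node of the computational tree, given by a walk. -/
def TreeOth.of (w : List E) (h1 : IsWalk G i w) (h2 : w.length ≤ d) (h3 : Odd w.length) :
    TreeOth G i d := ⟨w, h1, h2, h3⟩

/-- An edge of the computational tree, given by a walk. -/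
def TreeEdge.of (w : List E) (h1 : IsWalk G i w) (h2 : w.length ≤ d) (h3 : w ≠ []) :
    TreeEdge G i d := ⟨w, h1, h2, h3⟩

lemma TreeBit.walk_of {w : List E} (h1 : IsWalk G i w) (h2 : w.length ≤ d)
    (h3 : Even w.length) : (TreeBit.of w h1 h2 h3).walk = w := rfl
lemma TreeOth.walk_of {w : List E} (h1 : IsWalk G i w) (h2 : w.length ≤ d)
    (h3 : Odd w.length) : (TreeOth.of w h1 h2 h3).walk = w := rfl

lemma walk_treeRoot : (treeRoot G i d).walk = [] := rfl

lemma TreeBit.walk_eq_nil {w : TreeBit G i d} : w.walk = [] ↔ w = treeRoot G i d :=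
  ⟨fun h => TreeBit.ext h, fun h => by rw [h, walk_treeRoot]⟩

lemma treeProj_eq (w : TreeBit G i d) : treeProj G i d w = w.walk.head?.elim i G.bit := by
  obtain ⟨_ | ⟨e, w⟩, h⟩ := w <;> rfl

lemma compTree_bit_of_odd (w : TreeEdge G i d) (h : Odd w.walk.length) :
    ((compTree G i d).bit w).walk = w.walk.tail := by
  have : ¬ Even (Subtype.val w).length := Nat.not_even_iff_odd.2 h
  exact congrArg TreeBit.walk (dif_neg this)

lemma compTree_bit_of_even (w : TreeEdge G i d) (h : Even w.walk.length) :
    ((compTree G i d).bit w).walk = w.walk := by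
  have : Even (Subtype.val w).length := h
  exact congrArg TreeBit.walk (dif_pos this)

lemma compTree_oth_of_odd (w : TreeEdge G i d) (h : Odd w.walk.length) :
    ((compTree G i d).oth w).walk = w.walk := by
  have : Odd (Subtype.val w).length := h
  exact congrArg TreeOth.walk (dif_pos this)

lemma compTree_oth_of_even (w : TreeEdge G i d) (h : Even w.walk.length) :
    ((compTree G i d).oth w).walk = w.walk.tail := by
  have : ¬ Odd (Subtype.val w).length := not_odd_iff_even.2 h
  exact congrArg TreeOth.walk (dif_neg this)

lemma even_tail_length {w : List E} (h : Odd w.length) : Even w.tail.length := by grind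

lemma odd_tail_length {w : List E} (h : Even w.length) (h0 : w ≠ []) : Odd w.tail.length := by
  rw [List.length_tail]
  exact Nat.Even.sub_odd (List.length_pos_iff.2 h0) h odd_one

lemma length_tail_le {w : List E} (h : w.length ≤ d) : w.tail.length ≤ d := by
  rw [List.length_tail]
  omega

end

section

open scoped Classical

variable {V A E : Type} [Finite E] (G : Graph V A E) (i : V) (d : ℕ)

/-- The computational tree as a rooted tree. -/
def walkTree : RootedTree (TreeBit G i d) (TreeOth G i d) where
  root := treeRoot G i d
  up a := .of a.walk.tail a.isWalk.tail (length_tail_le a.length_le) (even_tail_length a.odd)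
  upB w := if h : w.walk = [] then none else some
    (.of w.walk.tail w.isWalk.tail (length_tail_le w.length_le) (odd_tail_length w.even h))
  height w := w.walk.length / 2
  height_eq_zero w := by
    have h1 := w.even
    rw [Nat.even_iff] at h1
    rw [← TreeBit.walk_eq_nil, ← List.length_eq_zero_iff]
    omega
  upB_root := dif_pos rfl
  exists_up w hw := ⟨_, dif_neg fun h => hw (TreeBit.walk_eq_nil.1 h)⟩
  height_up w a h := by
    by_cases h0 : w.walk = []
    · rw [dif_pos h0] at h; cases h
    · rw [dif_neg h0] at h
      obtain rfl := Option.some_injective _ h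
      have h1 := w.even
      have h2 := List.length_pos_iff.2 h0
      simp only [TreeBit.walk_of, TreeOth.walk_of, List.length_tail]
      rw [Nat.even_iff] at h1
      omega

variable {G i d}

lemma walkTree_upB_eq {w : TreeBit G i d} {a : TreeOth G i d} :
    (walkTree G i d).upB w = some a ↔ w.walk ≠ [] ∧ w.walk.tail = a.walk := by
  by_cases h : w.walk = []
  · simp [walkTree, h]
  · simp only [walkTree, h, dite_false, ne_eq, not_false_eq_true, true_and]
    exact ⟨fun h' => congrArg TreeOth.walk (Option.some_injective _ h'),
      fun h' => congrArg some (TreeOth.ext h')⟩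

lemma walkTree_up_eq {a : TreeOth G i d} {w : TreeBit G i d} :
    (walkTree G i d).up a = w ↔ a.walk.tail = w.walk :=
  ⟨fun h => congrArg TreeBit.walk h, fun h => TreeBit.ext h⟩

/-- The edge that joins a node to its parent. -/
def TreeOth.edge (a : TreeOth G i d) : TreeEdge G i d := .of a.walk a.isWalk a.length_le a.ne_nil

/-- The edge that joins a code bit to its parent. -/
def TreeBit.edge (w : TreeBit G i d) (h : w.walk ≠ []) : TreeEdge G i d :=
  .of w.walk w.isWalk w.length_le h

/-- The edges of the computational tree join every node except the root to its parent. -/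
lemma prod_treeEdge {M : Type} [CommMonoid M] (g : TreeEdge G i d → M) :
    ∏ e, g e = (∏ a : TreeOth G i d, g a.edge) *
      ∏ w : {w : TreeBit G i d // w.walk ≠ []}, g (w.1.edge w.2) := by
  let f : TreeOth G i d ⊕ {w : TreeBit G i d // w.walk ≠ []} → TreeEdge G i d :=
    Sum.elim (fun a => a.edge) (fun w => w.1.edge w.2)
  have hf : Bijective f := by
    constructor
    · rintro (a | w) (a' | w') h <;> have h' := congrArg TreeEdge.walk h
      · exact congrArg _ (TreeOth.ext h')
      · have h2 := a.odd
        have h3 : a.walk = w'.1.walk := h'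
        rw [h3] at h2
        exact absurd h2 (not_odd_iff_even.2 w'.1.even)
      · have h2 := a'.odd
        have h3 : w.1.walk = a'.walk := h'
        rw [← h3] at h2
        exact absurd h2 (not_odd_iff_even.2 w.1.even)
      · exact congrArg _ (Subtype.ext (TreeBit.ext h'))
    · intro e
      rcases Nat.even_or_odd e.walk.length with h | h
      · exact ⟨.inr ⟨.of e.walk e.isWalk e.length_le h, e.ne_nil⟩, rfl⟩
      · exact ⟨.inl (.of e.walk e.isWalk e.length_le h), rfl⟩
  rw [← (Equiv.ofBijective f hf).prod_comp, Fintype.prod_sum_type]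
  rfl

lemma oth_edge_oth (a : TreeOth G i d) : (compTree G i d).oth a.edge = a :=
  TreeOth.ext (compTree_oth_of_odd _ a.odd)

lemma bit_edge_oth (a : TreeOth G i d) : (compTree G i d).bit a.edge = (walkTree G i d).up a :=
  TreeBit.ext (compTree_bit_of_odd _ a.odd)

lemma bit_edge_bit (w : TreeBit G i d) (h : w.walk ≠ []) : (compTree G i d).bit (w.edge h) = w :=
  TreeBit.ext (compTree_bit_of_even _ w.even)

lemma upB_eq_oth_edge (w : TreeBit G i d) (h : w.walk ≠ []) :
    (walkTree G i d).upB w = some ((compTree G i d).oth (w.edge h)) :=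
  walkTree_upB_eq.2 ⟨h, (compTree_oth_of_even (w.edge h) w.even).symm⟩

lemma prod_compTree_oth {M : Type} [CommMonoid M] (a : TreeOth G i d) (ξ : TreeBit G i d → M) :
    ∏ e with (compTree G i d).oth e = a, ξ ((compTree G i d).bit e) =
      ξ ((walkTree G i d).up a) * ∏ w ∈ (walkTree G i d).kidsO a, ξ w := by
  rw [prod_filter, prod_treeEdge]
  simp_rw [oth_edge_oth, bit_edge_oth, bit_edge_bit]
  congr 1
  · simp
  · have h1 : ∀ w : {w : TreeBit G i d // w.walk ≠ []},
        (if (compTree G i d).oth (w.1.edge w.2) = a then ξ w.1 else 1) =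
        if (walkTree G i d).upB w.1 = some a then ξ w.1 else 1 := fun w => by
      simp [upB_eq_oth_edge w.1 w.2]
    simp_rw [h1]
    rw [RootedTree.kidsO, prod_filter, ← Finset.prod_subtype
      (univ.filter fun w : TreeBit G i d => w.walk ≠ []) (fun w => by simp)
      fun w => if (walkTree G i d).upB w = some a then ξ w else 1, prod_filter]
    refine prod_congr rfl fun w _ => ?_
    by_cases h : w.walk = []
    · simp [walkTree_upB_eq, h]
    · simp [h]

lemma prod_compTree_bit {M : Type} [CommMonoid M] (w : TreeBit G i d) (υ : TreeOth G i d → M) :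
    ∏ e with (compTree G i d).bit e = w, υ ((compTree G i d).oth e) =
      ((walkTree G i d).upB w).elim 1 υ * ∏ a ∈ (walkTree G i d).kids w, υ a := by
  rw [prod_filter, prod_treeEdge, mul_comm]
  simp_rw [oth_edge_oth, bit_edge_oth, bit_edge_bit]
  congr 1
  · by_cases h : w.walk = []
    · have : (walkTree G i d).upB w = none := dif_pos h
      rw [this]
      exact prod_eq_one fun w' _ => if_neg fun (h' : w'.1 = w) => w'.2 (by rw [h', h])
    · rw [Finset.prod_eq_single ⟨w, h⟩, if_pos rfl, upB_eq_oth_edge w h]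
      · rfl
      · grind
      · simp
  · rw [RootedTree.kids, prod_filter]

lemma wordMean_compTree_ldpc {s μ : TreeBit G i d → ℝ} {ν : TreeOth G i d → ℝ}
    {K : TreeBit G i d → ℝ}
    (hν : ∀ a, ν a = ∏ w ∈ (walkTree G i d).kidsO a, μ w)
    (hμ : ∀ w, ∀ ξ : ℤˣ, (1 + s w * spin ξ) * ∏ a ∈ (walkTree G i d).kids w, (1 + spin ξ * ν a) =
      K w * (1 + μ w * spin ξ)) (hK : ∀ w, 0 < K w) :
    wordMean (ldpcCode (compTree G i d)).subtype (treeRoot G i d) s = μ (treeRoot G i d) := by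
  obtain ⟨C, hC, h⟩ := (walkTree G i d).ldpc_root hν hμ hK
  have hroot : (walkTree G i d).root = treeRoot G i d := rfl
  simp only [hroot] at h
  have key : ∀ F : ℝ → ℝ, ∑ x : ldpcCode (compTree G i d), F (spin (x.1 (treeRoot G i d))) *
      wordWeight x.1 s = (1 / 2) ^ card (TreeOth G i d) *
        (C * ∑ x : TreeBit G i d → ℤˣ, F (spin (x (treeRoot G i d))) *
          (1 + μ (treeRoot G i d) * spin (x (treeRoot G i d)))) := fun F => by
    rw [← sum_ite_mem_subgroup (ldpcCode (compTree G i d))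
      fun x => F (spin (x (treeRoot G i d))) * wordWeight x s]
    rw [← h F, mul_sum]
    refine sum_congr rfl fun x _ => ?_
    have h2 := prod_checks (compTree G i d) x
    have h3 : ∀ a, (1 / 2 : ℝ) * (1 + ∏ e with (compTree G i d).oth e = a,
        spin (x ((compTree G i d).bit e))) =
        1 / 2 * (1 + (walkTree G i d).check (fun w => spin (x w)) a) := fun a => by
      rw [prod_compTree_oth a fun w => spin (x w)]; rfl
    simp_rw [h3] at h2
    rw [prod_mul_distrib, Finset.prod_const, card_univ] at h2
    have h4 : (if x ∈ ldpcCode (compTree G i d) then F (spin (x (treeRoot G i d))) *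
        wordWeight x s else 0) = F (spin (x (treeRoot G i d))) * wordWeight x s *
          if x ∈ ldpcCode (compTree G i d) then 1 else 0 := by split_ifs <;> simp
    rw [h4, ← h2, wordWeight]
    ring
  have hN := key id
  have hZ := key fun _ => 1
  simp at hN hZ
  set r := treeRoot G i d
  have hsum : ∑ x : TreeBit G i d → ℤˣ, spin (x r) = 0 := by
    have := sum_spin_affine {r} 0 (fun j hj => by
      rw [Finset.mem_singleton] at hj; subst hj; exact affineAt_coord _)
    simpa using this
  have hn : ∑ x : TreeBit G i d → ℤˣ, spin (x r) * (1 + μ r * spin (x r)) =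
      card (TreeBit G i d → ℤˣ) * μ r := by
    have : ∀ x : TreeBit G i d → ℤˣ, spin (x r) * (1 + μ r * spin (x r)) = spin (x r) + μ r :=
      fun x => by linear_combination μ r * spin_sq (x r)
    rw [sum_congr rfl fun x _ => this x, sum_add_distrib, hsum]
    simp
  have hz : ∑ x : TreeBit G i d → ℤˣ, (1 + μ r * spin (x r)) = card (TreeBit G i d → ℤˣ) := by
    simp_rw [sum_add_distrib, ← mul_sum, hsum]
    simp
  rw [wordMean, partNum, partFn]
  simp
  rw [hN, hZ, hn, hz]
  field_simp

lemma wordMean_compTree_ldgm {s μ : TreeBit G i d → ℝ} {ν K : TreeOth G i d → ℝ}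
    (hν : ∀ a, ∀ ξ : ℤˣ, ∏ w ∈ (walkTree G i d).kidsO a, (1 + μ w * spin ξ) =
      K a * (1 + ν a * spin ξ))
    (hμ : ∀ w, w ≠ treeRoot G i d → μ w = s w * ∏ a ∈ (walkTree G i d).kids w, ν a)
    (hK : ∀ a, 0 < K a) (hs : s (treeRoot G i d) = 0) :
    wordMean (ldgmWord (compTree G i d)) (treeRoot G i d) s =
      ∏ a ∈ (walkTree G i d).kids (treeRoot G i d), ν a := by
  obtain ⟨C, hC, h⟩ := (walkTree G i d).ldgm_root hν hμ hK
  set r := treeRoot G i d with hr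
  have hroot : (walkTree G i d).root = r := rfl
  simp only [hroot] at h
  have hgen : ∀ u w, (walkTree G i d).gen (fun a => spin (u a)) w =
      spin (ldgmWord (compTree G i d) u w) := fun u w => by
    have : ldgmWord (compTree G i d) u w = _ := prod_compTree_bit w u
    rw [this, RootedTree.gen, RootedTree.upVal, spin_mul, spin_prod]
    rcases (walkTree G i d).upB w with _ | a <;> simp [spin_one]
  simp_rw [hgen] at h
  have hprod : ∀ (u : TreeOth G i d → ℤˣ) (v : ℝ),
      ∏ w, (1 + upd s r v w * spin (ldgmWord (compTree G i d) u w)) =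
      (1 + v * spin (ldgmWord (compTree G i d) u r)) * wordWeight (ldgmWord (compTree G i d) u) s :=
    fun u v => by
      rw [wordWeight, ← mul_prod_erase _ _ (mem_univ r),
        ← mul_prod_erase _ (fun w => 1 + s w * _) (mem_univ r)]
      rw [update_self, hs, zero_mul, add_zero, one_mul]
      congr 1
      refine prod_congr rfl fun w hw => ?_
      rw [update_of_ne (ne_of_mem_erase hw)]
  simp_rw [hprod] at h
  have h0 := h 0
  have h1 := h 1
  simp only [zero_mul, add_zero, one_mul, add_mul, sum_add_distrib, mul_one] at h0 h1
  rw [h0] at h1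
  rw [wordMean, partNum, partFn, h0, add_left_cancel (h1.trans (mul_one_add C _)),
    mul_div_cancel_left₀ _ hC.ne']

end

section

/-- Values of a message are hyperbolic tangents of half-loglikelihoods in `(-∞, ∞]`. -/
def IsMsg (x : ℝ) : Prop := -1 < x ∧ x ≤ 1

lemma IsMsg.mul {x y : ℝ} (hx : IsMsg x) (hy : IsMsg y) : IsMsg (x * y) := by
  obtain ⟨h1, h2⟩ := hx
  obtain ⟨h3, h4⟩ := hy
  refine ⟨?_, ?_⟩
  · nlinarith [one_add_mul_pos ⟨h1, h2⟩ ⟨h3, h4⟩]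
  · exact (le_abs_self _).trans (by
      rw [abs_mul]
      exact mul_le_one₀ (abs_le.2 ⟨h1.le, h2⟩) (abs_nonneg _) (abs_le.2 ⟨h3.le, h4⟩))

lemma Kind.isMsg_bitOp (κ : Kind) {x y : ℝ} (hx : IsMsg x) (hy : IsMsg y) :
    IsMsg (κ.bitOp x y) := by
  cases κ with
  | ldgm => exact hx.mul hy
  | ldpc => exact box_mem hx hy

lemma Kind.isMsg_othOp (κ : Kind) {x y : ℝ} (hx : IsMsg x) (hy : IsMsg y) :
    IsMsg (κ.othOp x y) := by
  cases κ with
  | ldgm => exact box_mem hx hy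
  | ldpc => exact hx.mul hy

lemma Kind.isMsg_bitUnit (κ : Kind) : IsMsg κ.bitUnit := by cases κ <;> simp [IsMsg, Kind.bitUnit]

lemma Kind.isMsg_othUnit (κ : Kind) : IsMsg κ.othUnit := by cases κ <;> simp [IsMsg, Kind.othUnit]

lemma isMsg_foldr {op : ℝ → ℝ → ℝ} {u : ℝ} (hu : IsMsg u)
    (h : ∀ {x y}, IsMsg x → IsMsg y → IsMsg (op x y)) {L : List ℝ} (hL : ∀ x ∈ L, IsMsg x) :
    IsMsg (L.foldr op u) := by
  induction L with
  | nil => exact hu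
  | cons x L ih => simp_all

lemma mul_box_spin {x y : ℝ} (hx : IsMsg x) (hy : IsMsg y) (ξ : ℤˣ) :
    (1 + x * spin ξ) * (1 + y * spin ξ) = (1 + x * y) * (1 + box x y * spin ξ) := by
  linear_combination x * y * spin_sq ξ - spin ξ * box_mul hx hy

/-- Multiplying the likelihoods of a spin amounts to adding the half-loglikelihoods. -/
lemma exists_prod_box {L : List ℝ} (hL : ∀ x ∈ L, IsMsg x) : ∃ K : ℝ, 0 < K ∧ ∀ ξ : ℤˣ,
    (L.map fun x => 1 + x * spin ξ).prod = K * (1 + L.foldr box 0 * spin ξ) := by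
  induction L with
  | nil => exact ⟨1, one_pos, fun ξ => by simp⟩
  | cons x L ih =>
    have hL' : ∀ y ∈ L, IsMsg y := fun y hy => hL y (List.mem_cons_of_mem _ hy)
    have hx := hL x List.mem_cons_self
    obtain ⟨K, hK, h⟩ := ih hL'
    have hy : IsMsg (L.foldr box 0) := isMsg_foldr (Kind.isMsg_bitUnit .ldpc) box_mem hL'
    refine ⟨K * (1 + x * L.foldr box 0), mul_pos hK (one_add_mul_pos hx hy), fun ξ => ?_⟩
    rw [List.map_cons, List.prod_cons, h, List.foldr_cons]
    linear_combination K * mul_box_spin hx hy ξ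

end

section

variable {V A E : Type}

/-- Lists of the edges around the edges and the code bits of a graph. -/
structure EdgeLists (G : Graph V A E) where
  bitSib : E → List E
  othSib : E → List E
  edgesAt : V → List E
  bitSib_nodup : ∀ e, (bitSib e).Nodup
  othSib_nodup : ∀ e, (othSib e).Nodup
  edgesAt_nodup : ∀ v, (edgesAt v).Nodup
  mem_bitSib : ∀ e c, c ∈ bitSib e ↔ c ≠ e ∧ G.bit c = G.bit e
  mem_othSib : ∀ e c, c ∈ othSib e ↔ c ≠ e ∧ G.oth c = G.oth e
  mem_edgesAt : ∀ v c, c ∈ edgesAt v ↔ G.bit c = v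

variable {G : Graph V A E} (κ : Kind) (L : EdgeLists G) (θ : ℝ → ℝ) (t : V → ℝ)

/-- The message of a code bit to an edge after `k` iterations, for the observations `t` and initial
messages `θ (t v)`. -/
def edgeMsg : ℕ → E → ℝ
  | 0, e => θ (t (G.bit e))
  | k + 1, e => κ.bitOp (t (G.bit e)) (((L.bitSib e).map fun c =>
      ((L.othSib c).map (edgeMsg k)).foldr κ.othOp κ.othUnit).foldr κ.bitOp κ.bitUnit)

/-- The message to a code bit along an edge. -/
def checkMsg (k : ℕ) (c : E) : ℝ :=
  ((L.othSib c).map (edgeMsg κ L θ t k)).foldr κ.othOp κ.othUnit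

/-- The extrinsic estimate of a code bit that belief propagation computes. -/
def rootMsg (v : V) (k : ℕ) : ℝ :=
  ((L.edgesAt v).map (checkMsg κ L θ t k)).foldr κ.bitOp κ.bitUnit

lemma edgeMsg_succ (k : ℕ) (e : E) : edgeMsg κ L θ t (k + 1) e = κ.bitOp (t (G.bit e))
    (((L.bitSib e).map (checkMsg κ L θ t k)).foldr κ.bitOp κ.bitUnit) := rfl

variable {t θ} (ht : ∀ v, IsMsg (t v)) (hθ : ∀ x, IsMsg x → IsMsg (θ x))
include ht hθ

lemma isMsg_edgeMsg (k : ℕ) (e : E) : IsMsg (edgeMsg κ L θ t k e) := by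
  induction k generalizing e with
  | zero => exact hθ _ (ht _)
  | succ k ih =>
    refine κ.isMsg_bitOp (ht _) (isMsg_foldr κ.isMsg_bitUnit κ.isMsg_bitOp fun x hx => ?_)
    obtain ⟨c, _, rfl⟩ := List.mem_map.1 hx
    refine isMsg_foldr κ.isMsg_othUnit κ.isMsg_othOp fun x hx => ?_
    grind

lemma isMsg_checkMsg (k : ℕ) (c : E) : IsMsg (checkMsg κ L θ t k c) := by
  refine isMsg_foldr κ.isMsg_othUnit κ.isMsg_othOp fun x hx => ?_
  obtain ⟨l, _, rfl⟩ := List.mem_map.1 hx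
  exact isMsg_edgeMsg κ L ht hθ k l

lemma isMsg_rootMsg (k : ℕ) (v : V) : IsMsg (rootMsg κ L θ t v k) := by
  refine isMsg_foldr κ.isMsg_bitUnit κ.isMsg_bitOp fun x hx => ?_
  obtain ⟨c, _, rfl⟩ := List.mem_map.1 hx
  exact isMsg_checkMsg κ L ht hθ k c

end

section

open scoped Classical

variable {V A E : Type} [Finite E] {G : Graph V A E} (L : EdgeLists G) {i : V} {d : ℕ}

lemma prod_kidsO_eq {M : Type} [CommMonoid M] (hd : Even d) (a : TreeOth G i d) {c : E}
    {z : List E} (ha : a.walk = c :: z) {g : TreeBit G i d → M} {f : E → M}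
    (hg : ∀ w e, w.walk = e :: a.walk → g w = f e) :
    ∏ w ∈ (walkTree G i d).kidsO a, g w = ((L.othSib c).map f).prod := by
  have hlen : a.walk.length < d := lt_of_le_of_ne a.length_le fun h => by
    have := a.odd
    grind
  rw [← List.prod_toFinset f (L.othSib_nodup c)]
  symm
  have hwalk : ∀ e ∈ (L.othSib c).toFinset, IsWalk G i (e :: a.walk) := fun e he => by
    rw [mem_toFinset, L.mem_othSib] at he
    have h1 := a.isWalk
    have h2 := a.odd
    rw [ha] at h1 h2 ⊢
    exact ⟨h1, he.1, by rw [if_pos h2]; exact he.2⟩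
  refine prod_bij (fun e he => .of (e :: a.walk) (hwalk e he) hlen
    (by rw [length_cons]; exact a.odd.add_one)) (fun e he => ?_) (fun e _ e' _ h => ?_)
    (fun w hw => ?_) fun e he => (hg _ e rfl).symm
  · rw [RootedTree.mem_kidsO, walkTree_upB_eq]
    exact ⟨List.cons_ne_nil _ _, rfl⟩
  · exact (List.cons.inj (congrArg TreeBit.walk h)).1
  · rw [RootedTree.mem_kidsO, walkTree_upB_eq] at hw
    obtain ⟨e, z', hw'⟩ := exists_cons_of_ne_nil hw.1
    have hz : z' = a.walk := by grind
    subst hz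
    have h1 := w.isWalk
    rw [hw', ha] at h1
    have h2 := a.odd
    rw [ha] at h2
    refine ⟨e, ?_, TreeBit.ext hw'.symm⟩
    rw [mem_toFinset, L.mem_othSib]
    have h3 := h1.2.2
    rw [if_pos h2] at h3
    exact ⟨h1.2.1, h3⟩

lemma prod_kids_eq {M : Type} [CommMonoid M] (w : TreeBit G i d) (hlen : w.walk.length < d)
    {g : TreeOth G i d → M} {f : E → M} (hg : ∀ a c, a.walk = c :: w.walk → g a = f c) :
    ∏ a ∈ (walkTree G i d).kids w, g a =
      ((w.walk.head?.elim (L.edgesAt i) L.bitSib).map f).prod := by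
  set K := w.walk.head?.elim (L.edgesAt i) L.bitSib with hK
  have hnd : K.Nodup := by
    rw [hK]
    rcases w.walk.head? with _ | e
    · exact L.edgesAt_nodup i
    · exact L.bitSib_nodup e
  have hmem : ∀ c, c ∈ K ↔ IsWalk G i (c :: w.walk) := fun c => by
    have h1 := w.isWalk
    have h2 := w.even
    rw [hK]
    rcases h : w.walk with _ | ⟨e, z⟩
    · exact L.mem_edgesAt i c
    · rw [h] at h1 h2
      simp only [List.head?_cons, Option.elim_some, L.mem_bitSib]
      rw [IsWalk, if_neg (not_odd_iff_even.2 h2)]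
      grind
  rw [← List.prod_toFinset f hnd]
  symm
  refine prod_bij (fun c hc => .of (c :: w.walk) ((hmem c).1 (mem_toFinset.1 hc)) hlen
    (by rw [length_cons]; exact w.even.add_one)) (fun c hc => ?_) (fun e _ e' _ h => ?_)
    (fun a ha => ?_) fun e he => (hg _ e rfl).symm
  · rw [RootedTree.mem_kids, walkTree_up_eq]
    rfl
  · exact (List.cons.inj (congrArg TreeOth.walk h)).1
  · rw [RootedTree.mem_kids, walkTree_up_eq] at ha
    obtain ⟨c, z, hc⟩ := exists_cons_of_ne_nil a.ne_nil
    have hz : z = w.walk := by grind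
    subst hz
    exact ⟨c, mem_toFinset.2 ((hmem c).2 (hc ▸ a.isWalk)), TreeOth.ext hc.symm⟩

lemma prod_kids_leaf {M : Type} [CommMonoid M] (w : TreeBit G i d) (hlen : w.walk.length = d)
    (g : TreeOth G i d → M) : ∏ a ∈ (walkTree G i d).kids w, g a = 1 := by
  have : (walkTree G i d).kids w = ∅ := by
    rw [Finset.eq_empty_iff_forall_notMem]
    intro a ha
    rw [RootedTree.mem_kids, walkTree_up_eq] at ha
    have h1 := a.length_le
    have h2 := congrArg List.length ha
    have h3 := List.length_pos_iff.2 a.ne_nil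
    rw [List.length_tail] at h2
    omega
  rw [this, Finset.prod_empty]

variable (κ : Kind)

/-- Gibbs mean of a code bit for the observations `t`. -/
def codeMean {V A E : Type} [Fintype V] [Fintype A] [Fintype E] (κ : Kind) (G : Graph V A E) (i : V)
    (t : V → ℝ) : ℝ :=
  match κ with
  | .ldgm => wordMean (ldgmWord G) i t
  | .ldpc => wordMean (ldpcCode G).subtype i t

lemma softBit_eq_codeMean {V A E : Type} [Fintype V] [Fintype A] [Fintype E] (κ : Kind)
    (G : Graph V A E) (l : V → ℝ) (i : V) : softBit κ G l i = codeMean κ G i (tanhs l) := by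
  cases κ with
  | ldgm => exact softBit_ldgm G l i
  | ldpc => exact softBit_ldpc G l i

variable {θ : ℝ → ℝ} {t : V → ℝ} (ht : ∀ v, IsMsg (t v)) (hθ : ∀ x, IsMsg x → IsMsg (θ x))
include ht hθ

/-- Belief propagation computes the extrinsic mean of the root of the computational tree. -/
lemma codeMean_compTree {k : ℕ} (hd : d = 2 * (k + 1)) {s : TreeBit G i d → ℝ}
    (hroot : s (treeRoot G i d) = 0)
    (hs : ∀ w e z, w.walk = e :: z →
      s w = if w.walk.length < d then t (G.bit e) else θ (t (G.bit e))) :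
    codeMean κ (compTree G i d) (treeRoot G i d) s = rootMsg κ L θ t i k := by
  have hde : Even d := hd ▸ even_two_mul _
  set μ : TreeBit G i d → ℝ := fun w => w.walk.head?.elim (rootMsg κ L θ t i k)
    (edgeMsg κ L θ t (k + 1 - w.walk.length / 2)) with hμ
  set ν : TreeOth G i d → ℝ := fun a => a.walk.head?.elim 0
    (checkMsg κ L θ t (k - a.walk.length / 2)) with hν
  have hμw : ∀ w e z, w.walk = e :: z →
      μ w = edgeMsg κ L θ t (k + 1 - w.walk.length / 2) e := fun w e z h => by
    simp only [hμ, h, List.head?_cons, Option.elim_some]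
  have hνa : ∀ a c z, a.walk = c :: z →
      ν a = checkMsg κ L θ t (k - a.walk.length / 2) c := fun a c z h => by
    simp only [hν, h, List.head?_cons, Option.elim_some]
  -- messages from the children of a node
  have hkidO : ∀ a : TreeOth G i d, ∀ w e, w.walk = e :: a.walk →
      μ w = edgeMsg κ L θ t (k - a.walk.length / 2) e := fun a w e h => by
    rw [hμw w e _ h, h, length_cons]
    have := a.odd
    rw [Nat.odd_iff] at this
    congr 1
    omega
  have hkid : ∀ w : TreeBit G i d, ∀ a c, a.walk = c :: w.walk →
      ν a = checkMsg κ L θ t (k - w.walk.length / 2) c := fun w a c h => by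
    rw [hνa a c _ h, h, length_cons]
    have := w.even
    rw [Nat.even_iff] at this
    congr 1
    omega
  have hstep : ∀ w : TreeBit G i d, ∀ e z, w.walk = e :: z → w.walk.length < d →
      μ w = κ.bitOp (s w) (((w.walk.head?.elim (L.edgesAt i) L.bitSib).map
        (checkMsg κ L θ t (k - w.walk.length / 2))).foldr κ.bitOp κ.bitUnit) := fun w e z h hl => by
    have h1 := w.even
    rw [Nat.even_iff] at h1
    rw [hμw w e z h, hs w e z h, if_pos hl,
      show k + 1 - w.walk.length / 2 = (k - w.walk.length / 2) + 1 by omega, edgeMsg_succ]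
    simp only [h, List.head?_cons, Option.elim_some]
  have hleaf : ∀ w : TreeBit G i d, ∀ e z, w.walk = e :: z → w.walk.length = d → μ w = s w :=
    fun w e z h hl => by
      rw [hμw w e z h, hs w e z h, hl, if_neg (lt_irrefl _), show k + 1 - d / 2 = 0 by omega]
      rfl
  have hpos : (0 : ℕ) < d := by omega
  have hr : ∀ w : TreeBit G i d, w.walk = [] → s w = 0 := fun w h => by
    rw [TreeBit.walk_eq_nil.1 h]; exact hroot
  have hsm : ∀ w, IsMsg (s w) := fun w => by
    rcases h : w.walk with _ | ⟨e, z⟩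
    · rw [hr w h]; simp [IsMsg]
    · rw [hs w e z h]
      split_ifs
      · exact ht _
      · exact hθ _ (ht _)
  have hcm := isMsg_checkMsg κ L ht hθ
  have hem := isMsg_edgeMsg κ L ht hθ
  cases κ with
  | ldpc =>
    have hK : ∀ w : TreeBit G i d, ∃ K : ℝ, 0 < K ∧ ∀ ξ : ℤˣ,
        (1 + s w * spin ξ) * ∏ a ∈ (walkTree G i d).kids w, (1 + spin ξ * ν a) =
          K * (1 + μ w * spin ξ) := fun w => by
      rcases lt_or_eq_of_le w.length_le with hl | hl
      · set M : List ℝ := (w.walk.head?.elim (L.edgesAt i) L.bitSib).map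
          (checkMsg .ldpc L θ t (k - w.walk.length / 2)) with hM
        have hMm : ∀ x ∈ M, IsMsg x := fun x hx => by
          obtain ⟨c, _, rfl⟩ := List.mem_map.1 hx
          exact hcm _ _
        obtain ⟨K, hK, h⟩ := exists_prod_box hMm
        have hbm : IsMsg (M.foldr box 0) := isMsg_foldr (Kind.isMsg_bitUnit .ldpc) box_mem hMm
        refine ⟨K * (1 + s w * M.foldr box 0), mul_pos hK (one_add_mul_pos (hsm w) hbm),
          fun ξ => ?_⟩
        have e1 : ∏ a ∈ (walkTree G i d).kids w, (1 + spin ξ * ν a) =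
            (M.map fun x => 1 + x * spin ξ).prod := by
          rw [hM, List.map_map]
          refine prod_kids_eq L w hl fun a c h => ?_
          rw [hkid w a c h, mul_comm]
          rfl
        have e2 : μ w = box (s w) (M.foldr box 0) := by
          rcases hw : w.walk with _ | ⟨e, z⟩
          · rw [hr w hw, box_comm, box_zero]
            simp only [hμ, hM, hw, List.length_nil, Nat.zero_div, Nat.sub_zero]
            rfl
          · exact hstep w e z hw hl
        rw [e1, h, e2]
        linear_combination K * mul_box_spin (hsm w) hbm ξ
      · obtain ⟨e, z, hw⟩ := exists_cons_of_ne_nil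
          (List.length_pos_iff.1 (by rw [hl]; exact hpos))
        exact ⟨1, one_pos, fun ξ => by
          rw [prod_kids_leaf w hl, hleaf w e z hw hl, mul_one, one_mul]⟩
    choose K hKpos hK using hK
    refine (wordMean_compTree_ldpc (s := s) (μ := μ) (ν := ν) (K := K) (fun a => ?_) hK hKpos).trans
      rfl
    obtain ⟨c, z, hc⟩ := exists_cons_of_ne_nil a.ne_nil
    rw [hνa a c z hc, prod_kidsO_eq L hde a hc (hkidO a)]
    rfl
  | ldgm =>
    have hK : ∀ a : TreeOth G i d, ∃ K : ℝ, 0 < K ∧ ∀ ξ : ℤˣ,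
        ∏ w ∈ (walkTree G i d).kidsO a, (1 + μ w * spin ξ) = K * (1 + ν a * spin ξ) := fun a => by
      obtain ⟨c, z, hc⟩ := exists_cons_of_ne_nil a.ne_nil
      obtain ⟨K, hK, h⟩ := exists_prod_box (L := (L.othSib c).map
        (edgeMsg .ldgm L θ t (k - a.walk.length / 2))) fun x hx => by
          obtain ⟨c, _, rfl⟩ := List.mem_map.1 hx
          exact hem _ _
      refine ⟨K, hK, fun ξ => ?_⟩
      simp only [List.map_map] at h
      rw [hνa a c z hc, prod_kidsO_eq L hde a hc fun w e hw => by rw [hkidO a w e hw]]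
      exact h ξ
    choose K hKpos hK using hK
    refine (wordMean_compTree_ldgm (s := s) (μ := μ) (ν := ν) (K := K) hK (fun w hw => ?_) hKpos
      hroot).trans ?_
    · obtain ⟨e, z, hw⟩ := exists_cons_of_ne_nil fun h => hw (TreeBit.walk_eq_nil.1 h)
      rcases lt_or_eq_of_le w.length_le with hl | hl
      · rw [hstep w e z hw hl, prod_kids_eq L w hl (hkid w)]
        rfl
      · rw [prod_kids_leaf w hl, hleaf w e z hw hl, mul_one]
    · rw [prod_kids_eq L (treeRoot G i d) hpos (hkid _)]
      simp only [walk_treeRoot, List.length_nil, Nat.zero_div, Nat.sub_zero]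
      rfl

end

/-! ### Laws of the messages on tree-like neighbourhoods -/

section

variable {V : Type} [Fintype V] {γ : V → Measure ℝ} [∀ v, IsProb (γ v)]

/-- `f` is a function of the observations in `S` and has law `μ`. -/
structure LocalLaw (γ : V → Measure ℝ) (S : Set V) (f : (V → ℝ) → ℝ) (μ : Measure ℝ) : Prop where
  meas : Measurable f
  dep : DependsOn f S
  law : (pi γ).map f = μ

lemma indepFun_of_dependsOn {f g : (V → ℝ) → ℝ} (hf : Measurable f) (hg : Measurable g)
    {S S' : Set V} (hfS : DependsOn f S) (hgS : DependsOn g S') (hd : Disjoint S S') :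
    ProbabilityTheory.IndepFun f g (pi γ) := by
  classical
  have hind := (ProbabilityTheory.iIndepFun_pi (μ := γ) (X := fun _ x => x)
    fun _ => aemeasurable_id).indepFun_finset S.toFinset S'.toFinset
      (by rwa [Set.disjoint_toFinset]) fun v => measurable_pi_apply v
  have hext : ∀ (A : Finset V) (f : (V → ℝ) → ℝ), Measurable f → Measurable fun z : A → ℝ =>
      f fun v => if h : v ∈ A then z ⟨v, h⟩ else 0 := fun A f hf => by
    refine hf.comp (measurable_pi_lambda _ fun v => ?_)
    by_cases h : v ∈ A
    · simpa [h] using measurable_pi_apply _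
    · simp [h]
  have := hind.comp (hext S.toFinset f hf) (hext S'.toFinset g hg)
  have e1 : (fun z : S.toFinset → ℝ => f fun v => if h : v ∈ S.toFinset then z ⟨v, h⟩ else 0) ∘
      (fun (l : V → ℝ) (i : S.toFinset) => l i) = f := by
    ext l
    exact hfS fun v hv => by simp [hv]
  have e2 : (fun z : S'.toFinset → ℝ => g fun v => if h : v ∈ S'.toFinset then z ⟨v, h⟩ else 0) ∘
      (fun (l : V → ℝ) (i : S'.toFinset) => l i) = g := by
    ext l
    exact hgS fun v hv => by simp [hv]
  rwa [e1, e2] at this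

omit [Fintype V] in
lemma dependsOn_mono {f : (V → ℝ) → ℝ} {S S' : Set V} (h : DependsOn f S) (hS : S ⊆ S') :
    DependsOn f S' := fun _ _ hxy => h fun v hv => hxy v (hS hv)

omit [∀ v, IsProb (γ v)] in
lemma LocalLaw.mono {S S' : Set V} {f : (V → ℝ) → ℝ} {μ : Measure ℝ} (h : LocalLaw γ S f μ)
    (hS : S ⊆ S') : LocalLaw γ S' f μ := ⟨h.meas, dependsOn_mono h.dep hS, h.law⟩

lemma LocalLaw.op {op : ℝ → ℝ → ℝ} (hop : Measurable fun z : ℝ × ℝ => op z.1 z.2) {S S' : Set V}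
    {f g : (V → ℝ) → ℝ} {μ ν : Measure ℝ} (hf : LocalLaw γ S f μ) (hg : LocalLaw γ S' g ν)
    (hd : Disjoint S S') : LocalLaw γ (S ∪ S') (fun l => op (f l) (g l)) (lop op μ ν) where
  meas := hop.comp (hf.meas.prodMk hg.meas)
  dep x y h := congrArg₂ op (hf.dep fun v hv => h v (Or.inl hv))
    (hg.dep fun v hv => h v (Or.inr hv))
  law := by
    have := (indepFun_of_dependsOn (γ := γ) hf.meas hg.meas hf.dep hg.dep
        hd).map_prod_eq_prod_map_map
      hf.meas.aemeasurable hg.meas.aemeasurable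
    rw [lop, ← hf.law, ← hg.law, ← this, Measure.map_map hop (hf.meas.prodMk hg.meas)]
    rfl

/-- Messages that depend on disjoint sets of observations are combined as independent ones. -/
lemma LocalLaw.fold {op : ℝ → ℝ → ℝ} {u : ℝ} (h : SoftOp op u) {ι : Type} {L : List ι}
    {S : ι → Set V} {f : ι → (V → ℝ) → ℝ} {μ : ι → Prob ℝ}
    (hf : ∀ x ∈ L, LocalLaw γ (S x) (f x) (μ x : Measure ℝ))
    (hd : L.Pairwise fun x y => Disjoint (S x) (S y)) :
    LocalLaw γ (⋃ x ∈ L, S x) (fun l => (L.map fun x => f x l).foldr op u)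
      (h.fold (L.map μ) : Measure ℝ) := by
  induction L with
  | nil =>
    refine ⟨measurable_const, fun _ _ _ => rfl, ?_⟩
    simp
    rfl
  | cons x L ih =>
    rw [List.pairwise_cons] at hd
    have h1 := ih (fun y hy => hf y (List.mem_cons_of_mem _ hy)) hd.2
    refine ((hf x List.mem_cons_self).op h.meas h1 ?_).mono ?_
    · simp_all
    · simp

end

lemma localLaw_coord {V : Type} [Fintype V] {c : Measure ℝ} [IsProb c] {f : ℝ → ℝ}
    (hf : Measurable f) (v : V) :
    LocalLaw (fun _ : V => c) {v} (fun l => f (l v)) (c.map f) where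
  meas := hf.comp (measurable_pi_apply v)
  dep x y h := congrArg f (h v rfl)
  law := by
    have h := (measurePreserving_eval (fun _ : V => c) v).map_eq
    exact (Measure.map_map hf (measurable_pi_apply v)).symm.trans (congrArg (Measure.map f) h)

section

variable {V A E : Type} {G : Graph V A E} (κ : Kind) (L : EdgeLists G) (τ β : Prob ℝ)

/-- The law of `edgeMsg` if all messages are independent. -/
def edgeMsgLaw : ℕ → E → Prob ℝ
  | 0, _ => β
  | k + 1, e => ⟨lop κ.bitOp τ (κ.softOp_bit.fold ((L.bitSib e).map fun c =>
      κ.softOp_oth.fold ((L.othSib c).map (edgeMsgLaw k)))),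
      isProbabilityMeasure_lop κ.softOp_bit.meas⟩

/-- The law of `checkMsg` if all messages are independent. -/
def checkMsgLaw (k : ℕ) (c : E) : Prob ℝ :=
  κ.softOp_oth.fold ((L.othSib c).map (edgeMsgLaw κ L τ β k))

/-- The law of `rootMsg` if all messages are independent. -/
def rootMsgLaw (v : V) (k : ℕ) : Prob ℝ :=
  κ.softOp_bit.fold ((L.edgesAt v).map (checkMsgLaw κ L τ β k))

end

section

variable {V A E : Type} [Fintype V] [Finite E] {G : Graph V A E} (κ : Kind) (L : EdgeLists G)
  {i : V} {d : ℕ}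

/-- The nodes of the graph below a walk. -/
def shadow (G : Graph V A E) (i : V) (d : ℕ) (z : List E) : Set V :=
  {v | ∃ w : TreeBit G i d, z <:+ w.walk ∧ treeProj G i d w = v}

omit [Fintype V] [Finite E] in
lemma shadow_anti {z z' : List E} (h : z <:+ z') : shadow G i d z' ⊆ shadow G i d z :=
  fun _ ⟨w, hw, hv⟩ => ⟨w, h.trans hw, hv⟩

variable (hinj : Injective (treeProj G i d))
include hinj

omit [Fintype V] [Finite E] in
lemma disjoint_shadow {z z' : List E} (hl : z.length = z'.length) (hne : z ≠ z') :
    Disjoint (shadow G i d z) (shadow G i d z') := by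
  rw [Set.disjoint_left]
  rintro v ⟨w, hw, hv⟩ ⟨w', hw', hv'⟩
  obtain rfl := hinj (hv.trans hv'.symm)
  exact hne ((List.suffix_of_suffix_length_le hw hw' hl.le).eq_of_length hl)

omit [Fintype V] [Finite E] in
lemma notMem_shadow (w : TreeBit G i d) {c : E} {z : List E} (hz : c :: w.walk = z) :
    treeProj G i d w ∉ shadow G i d z := by
  rintro ⟨w', hw', hv⟩
  obtain rfl := hinj hv
  have := hw'.length_le
  rw [← hz, length_cons] at this
  omega

variable {c : Measure ℝ} [IsProb c] {θ : ℝ → ℝ} (hθ : Measurable θ)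
  {τ β : Prob ℝ} (hτ : c.map tanh = τ) (hβ : c.map (fun l => θ (tanh l)) = β)
omit [Finite E] in
lemma localLaw_checkMsg_of {k : ℕ} (e : E) (w : List E)
    (ih : ∀ l ∈ L.othSib e, LocalLaw (fun _ : V => c) (shadow G i d (l :: e :: w))
      (fun x => edgeMsg κ L θ (tanhs x) k l) (edgeMsgLaw κ L τ β k l : Measure ℝ)) :
    LocalLaw (fun _ : V => c) (shadow G i d (e :: w)) (fun x => checkMsg κ L θ (tanhs x) k e)
      (checkMsgLaw κ L τ β k e : Measure ℝ) := by
  refine (LocalLaw.fold κ.softOp_oth (S := fun l => shadow G i d (l :: e :: w)) ih ?_).mono ?_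
  · refine (L.othSib_nodup e).imp fun {l l'} h => disjoint_shadow hinj (by simp) fun h' => h ?_
    exact (List.cons.inj h').1
  · exact Set.iUnion₂_subset fun l _ => shadow_anti (List.suffix_cons _ _)

include hθ hτ hβ

omit [Finite E] in
lemma localLaw_edgeMsg (k : ℕ) (e : E) (w : List E) (hw : IsWalk G i (e :: w))
    (heven : Even (e :: w).length) (hlen : (e :: w).length + 2 * k ≤ d) :
    LocalLaw (fun _ : V => c) (shadow G i d (e :: w)) (fun x => edgeMsg κ L θ (tanhs x) k e)
      (edgeMsgLaw κ L τ β k e : Measure ℝ) := by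
  induction k generalizing e w with
  | zero =>
    have h1 := localLaw_coord (c := c) (hθ.comp measurable_tanh) (G.bit e)
    rw [show c.map (θ ∘ tanh) = β from hβ] at h1
    refine h1.mono (Set.singleton_subset_iff.2
      ⟨.of (e :: w) hw (by omega) heven, List.suffix_rfl, ?_⟩)
    rw [treeProj_eq]
    rfl
  | succ k ih =>
    let z : TreeBit G i d := .of (e :: w) hw (by omega) heven
    have hz : treeProj G i d z = G.bit e := by rw [treeProj_eq]; rfl
    have h1 := localLaw_coord (c := c) measurable_tanh (G.bit e)
    rw [hτ] at h1
    have hc : ∀ c' ∈ L.bitSib e, IsWalk G i (c' :: e :: w) := fun c' hc' => by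
      rw [L.mem_bitSib] at hc'
      exact ⟨hw, hc'.1, by rw [if_neg (not_odd_iff_even.2 heven)]; exact hc'.2⟩
    have h2 := LocalLaw.fold κ.softOp_bit (L := L.bitSib e)
        (S := fun c' => shadow G i d (c' :: e :: w))
      (fun c' hc' => localLaw_checkMsg_of (c := c) (θ := θ) (τ := τ) (β := β) (k := k) κ L
        hinj c' (e :: w)
        fun l hl => ?_) ?_
    · refine (LocalLaw.op κ.softOp_bit.meas h1 h2 ?_).mono ?_
      · simp only [Set.disjoint_iUnion_right, Set.disjoint_singleton_left]
        intro c' _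
        rw [← hz]
        exact notMem_shadow hinj z rfl
      · refine Set.union_subset (Set.singleton_subset_iff.2 ⟨z, List.suffix_rfl, hz⟩) ?_
        exact Set.iUnion₂_subset fun l _ => shadow_anti (List.suffix_cons _ _)
    · rw [L.mem_othSib] at hl
      refine ih l (c' :: e :: w) ⟨hc c' hc', hl.1, ?_⟩ ?_ ?_
      · rw [if_pos (show Odd (c' :: e :: w).length from heven.add_one)]; exact hl.2
      · exact heven.add_one.add_one
      · simp only [length_cons] at hlen ⊢; omega
    · refine (L.bitSib_nodup e).imp fun {l l'} h => disjoint_shadow hinj (by simp) fun h' => h ?_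
      exact (List.cons.inj h').1

omit [Finite E] in
/-- On a tree-like neighbourhood the messages are independent. -/
lemma map_rootMsg [DecidableEq V] {k : ℕ} (hd : d = 2 * (k + 1)) :
    (pi fun _ : V => c).map
        (fun l => rootMsg κ L θ (tanhs (upd l i 0)) i k) =
      rootMsgLaw κ L τ β i k := by
  have h2 := LocalLaw.fold κ.softOp_bit (L := L.edgesAt i) (S := fun c' => shadow G i d [c'])
      (fun c' hc' => localLaw_checkMsg_of (c := c) (θ := θ) (τ := τ) (β := β) (k := k) κ L
        hinj c' []
        fun l hl => ?_) ?_
  · have h3 : ∀ l : V → ℝ, rootMsg κ L θ (tanhs (upd l i 0)) i k =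
        rootMsg κ L θ (tanhs l) i k := fun l => by
      refine h2.dep fun v hv => update_of_ne ?_ _ _
      rintro rfl
      simp only [Set.mem_iUnion] at hv
      obtain ⟨c', _, hv⟩ := hv
      exact notMem_shadow hinj (treeRoot G v d) rfl hv
    simp_rw [h3]
    exact h2.law
  · rw [L.mem_othSib] at hl
    refine localLaw_edgeMsg κ L hinj hθ hτ hβ k l [c'] ⟨(L.mem_edgesAt i c').1 hc', hl.1, ?_⟩ ?_ ?_
    · exact hl.2
    · exact even_two
    · simp only [length_cons, List.length_nil]; omega
  · refine (L.edgesAt_nodup i).imp fun {l l'} h => disjoint_shadow hinj (by simp) fun h' => h ?_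
    exact (List.cons.inj h').1

end

section

variable {n m : ℕ} (bd : Fin n → ℕ) (od : Fin m → ℕ) (σ : Matching bd od)

/-- The edge lists of a graph obtained by matching sockets. -/
def socketLists : EdgeLists (socketGraph bd od σ) where
  bitSib s := ((finRange (bd s.1)).erase s.2).map fun j => ⟨s.1, j⟩
  othSib s := ((finRange (od (σ s).1)).erase (σ s).2).map fun j => σ.symm ⟨(σ s).1, j⟩
  edgesAt i := (finRange (bd i)).map fun j => ⟨i, j⟩
  bitSib_nodup s := ((nodup_finRange _).erase _).map fun j j' h => by simpa using h
  othSib_nodup s := ((nodup_finRange _).erase _).map fun j j' h => by simpa using h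
  edgesAt_nodup i := (nodup_finRange _).map fun j j' h => by simpa using h
  mem_bitSib s c := by
    simp only [List.mem_map, mem_erase_finRange]
    constructor
    · rintro ⟨j, hj, rfl⟩
      exact ⟨fun h => hj (eq_of_heq (Sigma.ext_iff.1 h).2), rfl⟩
    · rintro ⟨h1, h2⟩
      obtain ⟨i, a⟩ := s
      obtain ⟨i', a'⟩ := c
      obtain rfl : i' = i := h2
      exact ⟨a', fun h => h1 (by rw [h]), rfl⟩
  mem_othSib s c := by
    simp only [List.mem_map, mem_erase_finRange]
    constructor
    · rintro ⟨j, hj, rfl⟩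
      exact ⟨fun h => hj (eq_of_heq (Sigma.ext_iff.1 (σ.symm_apply_eq.1 h)).2),
        by simp [socketGraph]⟩
    · rintro ⟨h1, h2⟩
      have h2' : (σ c).1 = (σ s).1 := h2
      have h1' : σ c ≠ σ s := fun h => h1 (σ.injective h)
      obtain ⟨r, rfl⟩ : ∃ r, c = σ.symm r := ⟨σ c, by simp⟩
      rw [Equiv.apply_symm_apply] at h1' h2'
      generalize σ s = r' at *
      obtain ⟨i, a⟩ := r
      obtain ⟨i', a'⟩ := r'
      obtain rfl : i = i' := h2'
      exact ⟨a, fun h => h1' (by rw [h]), rfl⟩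
  mem_edgesAt i c := by
    simp only [List.mem_map, List.mem_finRange, true_and]
    constructor
    · rintro ⟨j, rfl⟩; rfl
    · rintro rfl; exact ⟨c.2, rfl⟩

variable (κ : Kind) (τ β : Prob ℝ)

lemma checkMsgLaw_socket_of {k : ℕ} (h : ∀ s, edgeMsgLaw κ (socketLists bd od σ) τ β k s =
    incMsg (socketSib bd od) (combLaw κ τ) β σ (2 * k) (.inr (σ s))) (s : Σ i, Fin (bd i)) :
    checkMsgLaw κ (socketLists bd od σ) τ β k s =
      incMsg (socketSib bd od) (combLaw κ τ) β σ (2 * k + 1) (.inl s) := by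
  rw [checkMsgLaw, incMsg, combLaw_right κ τ (by rfl)]
  change κ.softOp_oth.fold ((((finRange (od (σ s).1)).erase (σ s).2).map
    fun j => σ.symm ⟨(σ s).1, j⟩).map _) = _
  simp only [partner, socketSib, List.map_map]
  congr 1
  simp_all

lemma edgeMsgLaw_socket (k : ℕ) (s : Σ i, Fin (bd i)) : edgeMsgLaw κ (socketLists bd od σ) τ β k s =
      incMsg (socketSib bd od) (combLaw κ τ) β σ (2 * k) (.inr (σ s)) := by
  induction k generalizing s with
  | zero => rfl
  | succ k ih =>
    have h := checkMsgLaw_socket_of bd od σ κ τ β ih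
    rw [show 2 * (k + 1) = (2 * k + 1) + 1 by ring, incMsg, combLaw_left κ τ (by rfl), edgeMsgLaw]
    congr 3
    have : partner σ (.inr (σ s)) = .inl s := by simp [partner]
    rw [this]
    change κ.softOp_bit.fold ((((finRange (bd s.1)).erase s.2).map fun j =>
      (⟨s.1, j⟩ : Σ i, Fin (bd i))).map (checkMsgLaw κ (socketLists bd od σ) τ β k)) = _
    congr 1
    simp only [socketSib, List.map_map]
    exact List.map_congr_left fun j _ => h _

/-- The law of the estimate of belief propagation in terms of the labels of the half-edges. -/
lemma rootMsgLaw_socket (i : Fin n) (k : ℕ) : rootMsgLaw κ (socketLists bd od σ) τ β i k =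
    κ.softOp_bit.fold ((socketsAt bd od i).map
      (incMsg (socketSib bd od) (combLaw κ τ) β σ (2 * k + 1))) := by
  rw [rootMsgLaw]
  congr 1
  change ((finRange (bd i)).map fun j => (⟨i, j⟩ : Σ i, Fin (bd i))).map _ = _
  simp only [socketsAt, List.map_map]
  exact List.map_congr_left fun j _ =>
    checkMsgLaw_socket_of bd od σ κ τ β (edgeMsgLaw_socket bd od σ κ τ β k) _

end

/-! ### Words supported on a part of the graph -/

section

open scoped Classical

variable {T V U : Type} [Fintype T] [Fintype V] [Fintype U] [Group U] (π : T → V) (F : Finset T)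

/-- The word on `V` that is given by `x` on the image of the complement of `F` and by `y`
elsewhere. -/
def extendWord (x : T → ℤˣ) (y : V → ℤˣ) (v : V) : ℤˣ :=
  (∏ w with w ∉ F ∧ π w = v, x w) * if ∃ w, w ∉ F ∧ π w = v then 1 else y v

omit [Fintype V] in
lemma extendWord_mul (x x' : T → ℤˣ) (y y' : V → ℤˣ) :
    extendWord π F (x * x') (y * y') = extendWord π F x y * extendWord π F x' y' := by
  ext v
  simp only [extendWord, Pi.mul_apply, prod_mul_distrib]
  split_ifs
  · simp
  · rw [mul_mul_mul_comm]

omit [Fintype V] in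
lemma extendWord_one : extendWord π F 1 1 = 1 := by
  ext v
  simp [extendWord]

omit [Fintype V] in
lemma extendWord_of_not (x : T → ℤˣ) (y : V → ℤˣ) {v : V} (h : ¬∃ w, w ∉ F ∧ π w = v) :
    extendWord π F x y v = y v := by
  rw [extendWord, if_neg h, prod_eq_one, one_mul]
  intro w hw
  exact absurd ⟨w, (mem_filter.1 hw).2⟩ h

variable {π F}

omit [Fintype V] in
lemma extendWord_proj (hπ : Injective π) (x : T → ℤˣ) (y : V → ℤˣ) {w : T}
    (hw : w ∉ F) : extendWord π F x y (π w) = x w := by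
  have : (univ.filter fun z => z ∉ F ∧ π z = π w) = {w} := by
    ext z
    simp only [mem_filter, mem_univ, true_and, Finset.mem_singleton]
    exact ⟨fun h => hπ h.2, fun h => by rw [h]; exact ⟨hw, rfl⟩⟩
  rw [extendWord, this, Finset.prod_singleton, if_pos ⟨w, hw, rfl⟩, mul_one]

lemma wordWeight_extendWord (hπ : Injective π) (x : T → ℤˣ) (y : V → ℤˣ) (t : V → ℝ) :
    wordWeight (extendWord π F x y) t = (∏ w with w ∉ F, (1 + t (π w) * spin (x w))) *
      ∏ v with ¬∃ w, w ∉ F ∧ π w = v, (1 + t v * spin (y v)) := by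
  rw [wordWeight, ← Finset.prod_filter_mul_prod_filter_not univ (fun v => ∃ w, w ∉ F ∧ π w = v)]
  congr 1
  · symm
    refine prod_bij (fun w _ => π w) (fun w hw => ?_) (fun w _ w' _ h => hπ h)
      (fun v hv => ?_) fun w hw => ?_
    · grind
    · grind
    · rw [extendWord_proj hπ x y (mem_filter.1 hw).2]
  · refine prod_congr rfl fun v hv => ?_
    rw [extendWord_of_not π F x y (mem_filter.1 hv).2]

variable (π F)

/-- The words given by `χ` outside `F`, with arbitrary values elsewhere. -/
def freeWord (χ : U →* (T → ℤˣ)) : U × (V → ℤˣ) →* (V → ℤˣ) where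
  toFun z := extendWord π F (χ z.1) z.2
  map_one' := by simp [extendWord_one]
  map_mul' z z' := by simp [extendWord_mul]

/-- The subgroup on which the bits in `F` are frozen to `+1`. -/
def frozenCode (χ : U →* (T → ℤˣ)) : Subgroup U where
  carrier := {u | ∀ w ∈ F, χ u w = 1}
  one_mem' w _ := by simp
  mul_mem' {u v} hu hv w hw := by simp [hu w hw, hv w hw]
  inv_mem' {u} hu w hw := by simp [hu w hw]

/-- The words given by `χ`, frozen to `+1` on `F` and at the nodes not in the image of `π`. -/
def frozenWord (χ : U →* (T → ℤˣ)) : frozenCode F χ →* (V → ℤˣ) where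
  toFun u := extendWord π F (χ u) 1
  map_one' := by simp [extendWord_one]
  map_mul' u u' := by
    have := extendWord_mul π F (χ u) (χ u') 1 1
    rw [one_mul] at this
    simp [this]

variable {π F}

/-- Free bits do not contribute to the mean: they are treated as erased. -/
lemma wordMean_freeWord (hπ : Injective π) (χ : U →* (T → ℤˣ)) {w : T} (hw : w ∉ F)
    (l : V → ℝ) : wordMean (freeWord π F χ) (π w) (tanhs l) =
      wordMean χ w fun z => if z ∈ F then 0 else tanhs l (π z) := by
  set B : (V → ℤˣ) → ℝ := fun y => ∏ v with ¬∃ w, w ∉ F ∧ π w = v, (1 + tanhs l v * spin (y v))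
  have hBpos : 0 < ∑ y, B y := sum_pos (fun y _ => prod_pos fun v _ => by
    have h1 : |tanhs l v * spin (y v)| < 1 := by
      rw [abs_mul, abs_spin, mul_one]; exact abs_tanh_lt_one _
    linarith [(abs_lt.1 h1).1]) Finset.univ_nonempty
  have hA : ∀ u, wordWeight (χ u) (fun z => if z ∈ F then 0 else tanhs l (π z)) =
      ∏ w with w ∉ F, (1 + tanhs l (π w) * spin (χ u w)) := fun u => by
    rw [wordWeight, prod_filter]
    grind
  have hW : ∀ z : U × (V → ℤˣ), wordWeight (freeWord π F χ z) (tanhs l) =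
      wordWeight (χ z.1) (fun z => if z ∈ F then 0 else tanhs l (π z)) * B z.2 := fun z => by
    rw [hA]; exact wordWeight_extendWord hπ _ _ _
  have hx : ∀ z : U × (V → ℤˣ), freeWord π F χ z (π w) = χ z.1 w := fun z =>
    extendWord_proj hπ _ _ hw
  have h1 : partNum (freeWord π F χ) (π w) (tanhs l) =
      partNum χ w (fun z => if z ∈ F then 0 else tanhs l (π z)) * ∑ y, B y := by
    simp only [partNum, hW, hx, Fintype.sum_prod_type, Finset.sum_mul_sum, mul_assoc]
  have h2 : partFn (freeWord π F χ) (tanhs l) =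
      partFn χ (fun z => if z ∈ F then 0 else tanhs l (π z)) * ∑ y, B y := by
    simp only [partFn, hW, Fintype.sum_prod_type, Finset.sum_mul_sum]
  rw [wordMean, wordMean, h1, h2, mul_div_mul_right _ _ hBpos.ne']

/-- Bits frozen to `+1` are treated as known. -/
lemma wordMean_frozenWord (hπ : Injective π) (χ : U →* (T → ℤˣ)) {w : T} (hw : w ∉ F)
    (l : V → ℝ) : wordMean (frozenWord π F χ) (π w) (tanhs l) =
      wordMean χ w fun z => if z ∈ F then 1 else tanhs l (π z) := by
  set B : ℝ := ∏ v with ¬∃ w, w ∉ F ∧ π w = v, (1 + tanhs l v) with hB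
  have hBpos : 0 < B := prod_pos fun v _ => by
    linarith [(abs_lt.1 (abs_tanh_lt_one (l v))).1, show tanhs l v = tanh (l v) from rfl]
  set A : U → ℝ := fun u => ∏ w with w ∉ F, (1 + tanhs l (π w) * spin (χ u w)) with hA
  have hW : ∀ u, wordWeight (frozenWord π F χ u) (tanhs l) = A u * B := fun u => by
    refine (wordWeight_extendWord hπ _ _ _).trans ?_
    simp [hA, hB, spin_one]
  have hT : ∀ u, wordWeight (χ u) (fun z => if z ∈ F then 1 else tanhs l (π z)) =
      if u ∈ frozenCode F χ then 2 ^ F.card * A u else 0 := fun u => by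
    rw [wordWeight, ← Finset.prod_filter_mul_prod_filter_not univ (fun z => z ∈ F)]
    have e1 : ∏ z with z ∉ F, (1 + (if z ∈ F then 1 else tanhs l (π z)) * spin (χ u z)) = A u :=
      prod_congr rfl fun z hz => by rw [if_neg (mem_filter.1 hz).2]
    rw [e1]
    by_cases h : u ∈ frozenCode F χ
    · rw [if_pos h, prod_congr rfl (g := fun _ => (2 : ℝ)) fun z hz => ?_]
      · simp
      · have hz' := (mem_filter.1 hz).2
        rw [if_pos hz', h z hz', spin_one]; norm_num
    · rw [if_neg h]
      obtain ⟨z, hz, hne⟩ : ∃ z ∈ F, χ u z ≠ 1 := by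
        by_contra! h'
        exact h h'
      rw [prod_eq_zero (mem_filter.2 ⟨mem_univ z, hz⟩), zero_mul]
      rw [if_pos hz, (Int.units_eq_one_or _).resolve_left hne]
      simp [spin]
  have hx : ∀ u, frozenWord π F χ u (π w) = χ u w := fun u => extendWord_proj hπ _ _ hw
  have hsum : ∀ f : U → ℝ, ∑ u, (if u ∈ frozenCode F χ then f u else 0) =
      ∑ u : frozenCode F χ, f u := fun f => by
    rw [← sum_filter]
    exact Finset.sum_subtype _ (by simp) f
  have h1 : 2 ^ F.card * partNum (frozenWord π F χ) (π w) (tanhs l) =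
      partNum χ w (fun z => if z ∈ F then 1 else tanhs l (π z)) * B := by
    simp only [partNum, hW, hx, hT, mul_ite, mul_zero, hsum, mul_sum, sum_mul]
    exact sum_congr rfl fun u _ => by ring
  have h2 : 2 ^ F.card * partFn (frozenWord π F χ) (tanhs l) =
      partFn χ (fun z => if z ∈ F then 1 else tanhs l (π z)) * B := by
    simp only [partFn, hW, hT, hsum, mul_sum, sum_mul]
    exact sum_congr rfl fun u _ => by ring
  rw [wordMean, wordMean, ← mul_div_mul_right _ (partFn χ _) hBpos.ne', ← h1, ← h2,
    mul_div_mul_left _ _ (by positivity)]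

end

/-! ### The neighbourhood of a node and its computational tree -/

section

open scoped Classical

variable {V A E : Type} [Fintype E] {G : Graph V A E} {i : V} {d : ℕ}

/-- The projection of the non-bit nodes of the computational tree. -/
def othProj (a : TreeOth G i d) : A := G.oth (a.walk.head a.ne_nil)

omit [Fintype E] in
lemma othProj_eq {a : TreeOth G i d} {c : E} {z : List E} (h : a.walk = c :: z) :
    othProj a = G.oth c := by
  simp only [othProj, h, List.head_cons]

omit [Fintype E] in
lemma treeProj_cons {w : TreeBit G i d} {e : E} {z : List E} (h : w.walk = e :: z) :
    treeProj G i d w = G.bit e := by rw [treeProj_eq, h]; rfl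

/-- The edges at a non-bit node lift to the computational tree. -/
lemma prod_lift_oth {M : Type} [CommMonoid M] (L : EdgeLists G) (hd : Even d) (a : TreeOth G i d)
    (f : V → M) : ∏ e with G.oth e = othProj a, f (G.bit e) =
      ∏ e with (compTree G i d).oth e = a, f (treeProj G i d ((compTree G i d).bit e)) := by
  rw [prod_compTree_oth a fun w => f (treeProj G i d w)]
  obtain ⟨c, z, h⟩ := exists_cons_of_ne_nil a.ne_nil
  rw [prod_kidsO_eq L hd a h
    (fun w e hw => by rw [treeProj_cons hw]), othProj_eq h,
      ← List.prod_toFinset _ (L.othSib_nodup c)]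
  have hup : treeProj G i d ((walkTree G i d).up a) = G.bit c := by
    have h1 : ((walkTree G i d).up a).walk = z := by
      rw [← walkTree_up_eq.1 (rfl : (walkTree G i d).up a = _), h]; rfl
    have h2 := a.isWalk
    have h3 := a.odd
    rw [h] at h2 h3
    rcases z with _ | ⟨b, z⟩
    · rw [treeProj_eq, h1]
      exact h2.symm
    · rw [treeProj_cons h1]
      have h4 := h2.2.2
      grind
  rw [hup, ← prod_insert (f := fun e => f (G.bit e))]
  · refine prod_congr ?_ fun _ _ => rfl
    ext e
    simp only [mem_filter, mem_univ, true_and, mem_insert, mem_toFinset, L.mem_othSib]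
    grind
  · rw [mem_toFinset, L.mem_othSib]
    exact fun h => h.1 rfl

/-- The edges at a code bit in the interior lift to the computational tree. -/
lemma prod_lift_bit {M : Type} [CommMonoid M] (L : EdgeLists G) (w : TreeBit G i d)
    (hw : w.walk.length < d) (f : A → M) : ∏ e with G.bit e = treeProj G i d w, f (G.oth e) =
      ∏ e with (compTree G i d).bit e = w, f (othProj ((compTree G i d).oth e)) := by
  rw [prod_compTree_bit w fun a => f (othProj a), prod_kids_eq L w hw
    fun a c ha => by rw [othProj_eq ha]]
  rcases h : w.walk with _ | ⟨e, z⟩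
  · have h1 : (walkTree G i d).upB w = none := by
      rw [TreeBit.walk_eq_nil.1 h]; exact (walkTree G i d).upB_root
    rw [h1, treeProj_eq, h]
    simp
    rw [← List.prod_toFinset _ (L.edgesAt_nodup i)]
    refine prod_congr ?_ fun _ _ => rfl
    ext e
    refine mem_filter.trans ?_
    rw [mem_toFinset, L.mem_edgesAt]
    exact and_iff_right (mem_univ _)
  · have h2 := w.isWalk
    have h3 := w.even
    rw [h] at h2 h3
    rcases z with _ | ⟨b, z⟩
    · grind
    have h3' : Odd (b :: z).length := by grind
    have hle := w.length_le
    rw [h, length_cons] at hle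
    have h1 : (walkTree G i d).upB w = some (.of (b :: z) h2.1 (by omega) h3') :=
      walkTree_upB_eq.2 (by rw [h]; exact ⟨List.cons_ne_nil _ _, rfl⟩)
    have h4 := h2.2.2
    rw [if_pos h3'] at h4
    rw [h1, treeProj_cons h]
    simp
    rw [othProj_eq rfl, ← h4, ← List.prod_toFinset _ (L.bitSib_nodup e),
      ← prod_insert (f := fun e => f (G.oth e))]
    · refine prod_congr ?_ fun _ _ => rfl
      ext c
      simp only [mem_filter, mem_univ, true_and, mem_insert, mem_toFinset, L.mem_bitSib]
      grind
    · rw [mem_toFinset, L.mem_bitSib]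
      exact fun h => h.1 rfl

omit [Fintype E] in
/-- The neighbours of an interior code bit belong to the tree. -/
lemma exists_othProj (w : TreeBit G i d) (hw : w.walk.length < d) {e : E}
    (he : G.bit e = treeProj G i d w) : ∃ a : TreeOth G i d, othProj a = G.oth e := by
  have h2 := w.isWalk
  have h3 := w.even
  rcases h : w.walk with _ | ⟨e', z⟩
  · rw [treeProj_eq, h] at he
    rw [h] at hw
    exact ⟨.of [e] he hw odd_one, othProj_eq (z := []) rfl⟩
  · rw [treeProj_cons h] at he
    rw [h] at h2 h3 hw
    by_cases hee : e = e'
    · subst hee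
      rcases z with _ | ⟨b, z⟩
      · exact absurd h3 Nat.not_even_one
      have h3' : Odd (b :: z).length := by
        rw [length_cons] at h3; exact Nat.not_even_iff_odd.1 (by simpa [parity_simps] using h3)
      have h4 := h2.2.2
      rw [if_pos h3'] at h4
      rw [length_cons] at hw
      exact ⟨.of (b :: z) h2.1 (by omega) h3', (othProj_eq (z := z) rfl).trans h4.symm⟩
    · refine ⟨.of (e :: e' :: z) ⟨h2, hee, ?_⟩ hw (by rw [length_cons]; exact h3.add_one),
        othProj_eq (z := e' :: z) rfl⟩
      rw [if_neg (not_odd_iff_even.2 h3)]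
      exact he

end

/-! ### Comparison of the MAP estimate with belief propagation -/

section

variable {V U U' : Type} [Fintype V] [DecidableEq V] [Fintype U] [Group U] [Fintype U'] [Group U']

omit [Group U] in
lemma extrinsicLaw_eq {χ : U → V → ℤˣ} {i : V} {γ : V → Measure ℝ} {f : (V → ℝ) → ℝ}
    (h : ∀ l, wordMean χ i (tanhs (upd l i 0)) = f l) :
    extrinsicLaw χ i γ = (pi γ).map f :=
  congrArg (fun f => (pi γ).map f) (funext h)

/-- Removing words from a group code increases the even moments of the extrinsic means. -/
lemma moment_extrinsicLaw_mono (χ : U →* (V → ℤˣ)) (χ' : U' →* (V → ℤˣ))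
    (hsub : ∀ h, ∃ g, χ g = χ' h) {c : Measure ℝ} (hc : IsSymmNoise c) (i : V) {q : ℕ}
    (hq : Even q) :
    moment (extrinsicLaw χ i fun _ => c) q ≤ moment (extrinsicLaw χ' i fun _ => c) q := by
  have := hc.isProb
  have h1 := isProb_update (γ := fun _ : V => c) i (dirac 0)
  rw [moment_extrinsicLaw, moment_extrinsicLaw]
  obtain ⟨Q, _, hQ, hpi⟩ := exists_signInvariant
    (isSymmNoise_update (fun _ => hc) i isSymmNoise_dirac)
  rw [hpi]
  have h2 : IsProb (sentLaw Q) := hpi ▸ inferInstance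
  exact hQ.wordMean_mono χ χ' hsub i hq

end

/-- The initial messages for which belief propagation underestimates the MAP estimate. -/
def Kind.loLeaf : Kind → ℝ → ℝ
  | .ldgm => fun _ => 0
  | .ldpc => id

/-- The initial messages for which belief propagation overestimates the MAP estimate. -/
def Kind.hiLeaf : Kind → ℝ → ℝ
  | .ldgm => id
  | .ldpc => fun _ => 1

section

open scoped Classical

variable {V A E : Type} [Fintype V] [Fintype A] [Fintype E] {G : Graph V A E} (L : EdgeLists G)
  {i : V} {d k : ℕ}

omit [Fintype V] in
lemma isMsg_tanhs (l : V → ℝ) (v : V) : IsMsg (tanhs l v) :=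
  ⟨(abs_lt.1 (abs_tanh_lt_one (l v))).1, (abs_lt.1 (abs_tanh_lt_one (l v))).2.le⟩

/-- The leaves of the computational tree. -/
def treeLeaves (G : Graph V A E) (i : V) (d : ℕ) : Finset (TreeBit G i d) :=
  univ.filter fun w => w.walk.length = d

omit [Fintype V] [Fintype A] in
lemma mem_treeLeaves {w : TreeBit G i d} : w ∈ treeLeaves G i d ↔ w.walk.length = d := by
  simp [treeLeaves]

omit [Fintype V] [Fintype A] in
lemma root_notMem_treeLeaves (hd : d = 2 * (k + 1)) : treeRoot G i d ∉ treeLeaves G i d := by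
  rw [mem_treeLeaves, walk_treeRoot, List.length_nil]
  omega

omit [Fintype V] in
lemma tanhs_update_self (l : V → ℝ) : tanhs (upd l i 0) i = 0 := by simp [tanhs]

variable (hd : d = 2 * (k + 1))
include hd

omit [Fintype V] [Fintype A] in
lemma codeMean_leaves (κ : Kind) {x : ℝ} (hx : IsMsg x) (l : V → ℝ) :
    codeMean κ (compTree G i d) (treeRoot G i d)
      (fun z => if z ∈ treeLeaves G i d then x else tanhs (upd l i 0) (treeProj G i d z)) =
    rootMsg κ L (fun _ => x) (tanhs (upd l i 0)) i k := by
  refine codeMean_compTree L κ (isMsg_tanhs _) (fun _ _ => hx) hd ?_ fun w e z h => ?_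
  · rw [if_neg (root_notMem_treeLeaves hd)]
    exact tanhs_update_self l
  · have hle := w.length_le
    by_cases hw : w.walk.length < d
    · rw [if_pos hw, if_neg (fun h' => hw.ne (mem_treeLeaves.1 h')), treeProj_cons h]
    · rw [if_neg hw, if_pos (mem_treeLeaves.2 (by omega))]

omit [Fintype V] [Fintype A] in
lemma codeMean_observations (κ : Kind) (l : V → ℝ) : codeMean κ (compTree G i d) (treeRoot G i d)
      (fun z => tanhs (upd l i 0) (treeProj G i d z)) =
    rootMsg κ L id (tanhs (upd l i 0)) i k := by
  refine codeMean_compTree L κ (isMsg_tanhs _) (fun _ hx => hx) hd (tanhs_update_self l)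
    fun w e z h => ?_
  rw [treeProj_cons h]
  simp

variable (hinj : Injective (treeProj G i d)) {c : Measure ℝ} (hc : IsSymmNoise c) {q : ℕ}
  (hq : Even q)
include hinj hc hq

omit [Fintype A] in
lemma moment_le_map_ldpc : moment ((pi fun _ : V => c).map
      fun l => rootMsg .ldpc L id (tanhs (upd l i 0)) i k) q ≤
    moment (extrinsicLaw (ldpcCode G).subtype i fun _ => c) q := by
  refine le_of_eq_of_le ?_ (moment_extrinsicLaw_mono
    (freeWord (treeProj G i d) ∅ (ldpcCode (compTree G i d)).subtype) (ldpcCode G).subtype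
    (fun h => ?_) hc i hq)
  · refine (congrArg (moment · q) (extrinsicLaw_eq fun l => ?_)).symm
    refine (wordMean_freeWord hinj (ldpcCode (compTree G i d)).subtype
      (notMem_empty (treeRoot G i d)) _).trans ?_
    exact codeMean_observations L hd .ldpc l
  · refine ⟨(⟨fun w => h.1 (treeProj G i d w), fun a => ?_⟩, h.1), ?_⟩
    · rw [← prod_lift_oth L (hd ▸ even_two_mul _) a h.1]
      exact h.2 _
    · ext1 v
      by_cases hv : ∃ w, w ∉ (∅ : Finset (TreeBit G i d)) ∧ treeProj G i d w = v
      · obtain ⟨w, hw, rfl⟩ := hv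
        exact extendWord_proj hinj _ _ hw
      · exact extendWord_of_not _ _ _ _ hv

omit [Fintype A] in
lemma map_le_moment_ldpc : moment (extrinsicLaw (ldpcCode G).subtype i fun _ => c) q ≤
    moment ((pi fun _ : V => c).map
      fun l => rootMsg .ldpc L (fun _ => 1) (tanhs (upd l i 0)) i k) q := by
  refine (moment_extrinsicLaw_mono (ldpcCode G).subtype
    (frozenWord (treeProj G i d) (treeLeaves G i d) (ldpcCode (compTree G i d)).subtype)
    (fun u => ?_) hc i hq).trans_eq ?_
  · refine ⟨⟨frozenWord (treeProj G i d) (treeLeaves G i d)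
      (ldpcCode (compTree G i d)).subtype u, fun b => ?_⟩, rfl⟩
    by_cases hb : ∃ a : TreeOth G i d, othProj a = b
    · obtain ⟨a, rfl⟩ := hb
      rw [prod_lift_oth L (hd ▸ even_two_mul _) a, ← u.1.2 a]
      refine prod_congr rfl fun e _ => ?_
      set w := (compTree G i d).bit e
      by_cases hw : w ∈ treeLeaves G i d
      · refine (extendWord_of_not _ _ _ _ ?_).trans (u.2 w hw).symm
        grind
      · exact extendWord_proj hinj _ _ hw
    · refine prod_eq_one fun e he => extendWord_of_not _ _ _ _ ?_
      rintro ⟨w, hw, h⟩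
      refine hb ?_
      rw [mem_treeLeaves] at hw
      rw [← (mem_filter.1 he).2]
      exact exists_othProj w (lt_of_le_of_ne w.length_le hw) h.symm
  · refine congrArg (moment · q) (extrinsicLaw_eq fun l => ?_)
    refine (wordMean_frozenWord hinj (ldpcCode (compTree G i d)).subtype
      (root_notMem_treeLeaves hd) _).trans ?_
    exact codeMean_leaves L hd .ldpc ⟨by norm_num, le_rfl⟩ l

lemma moment_le_map_ldgm : moment ((pi fun _ : V => c).map
      fun l => rootMsg .ldgm L (fun _ => 0) (tanhs (upd l i 0)) i k) q ≤
    moment (extrinsicLaw (ldgmWord G) i fun _ => c) q := by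
  refine le_of_eq_of_le ?_ (moment_extrinsicLaw_mono
    (freeWord (treeProj G i d) (treeLeaves G i d) (ldgmWord (compTree G i d))) (ldgmWord G)
    (fun u => ?_) hc i hq)
  · refine (congrArg (moment · q) (extrinsicLaw_eq fun l => ?_)).symm
    refine (wordMean_freeWord hinj (ldgmWord (compTree G i d))
      (root_notMem_treeLeaves hd) _).trans ?_
    exact codeMean_leaves L hd .ldgm ⟨by norm_num, zero_le_one⟩ l
  · refine ⟨(fun a => u (othProj a), ldgmWord G u), ?_⟩
    ext1 v
    by_cases hv : ∃ w, w ∉ treeLeaves G i d ∧ treeProj G i d w = v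
    · obtain ⟨w, hw, rfl⟩ := hv
      refine (extendWord_proj hinj _ _ hw).trans ?_
      rw [mem_treeLeaves] at hw
      exact (prod_lift_bit L w (lt_of_le_of_ne w.length_le hw) u).symm
    · exact extendWord_of_not _ _ _ _ hv

lemma map_le_moment_ldgm : moment (extrinsicLaw (ldgmWord G) i fun _ => c) q ≤
    moment ((pi fun _ : V => c).map
      fun l => rootMsg .ldgm L id (tanhs (upd l i 0)) i k) q := by
  refine (moment_extrinsicLaw_mono (ldgmWord G)
    (frozenWord (treeProj G i d) ∅ (ldgmWord (compTree G i d))) (fun u => ?_) hc i hq).trans_eq ?_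
  · refine ⟨fun b => ∏ a with othProj a = b, u.1 a, ?_⟩
    ext1 v
    -- both sides are products over the edges of the tree whose code bit lies above `v`
    trans ∏ e, if treeProj G i d ((compTree G i d).bit e) = v then
      u.1 ((compTree G i d).oth e) else 1
    · rw [← Finset.prod_fiberwise univ (fun e => (compTree G i d).oth e)]
      change ∏ e with G.bit e = v, ∏ a with othProj a = G.oth e, u.1 a = _
      rw [Finset.prod_comm' (t' := univ)
        (s' := fun a => univ.filter fun e => G.oth e = othProj a ∧ G.bit e = v)
        (by intro e a; simp; tauto)]
      refine prod_congr rfl fun a _ => ?_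
      rw [← Finset.filter_filter, prod_filter,
        prod_lift_oth L (hd ▸ even_two_mul _) a fun w => if w = v then u.1 a else 1]
      refine prod_congr rfl fun e he => ?_
      rw [(mem_filter.1 he).2]
    · rw [← Finset.prod_fiberwise univ (fun e => (compTree G i d).bit e)]
      change _ = (∏ w with w ∉ (∅ : Finset (TreeBit G i d)) ∧ treeProj G i d w = v,
        ∏ e with (compTree G i d).bit e = w, u.1 ((compTree G i d).oth e)) * _
      rw [Pi.one_apply, ite_self, mul_one]
      simp
      rw [prod_filter]
      refine prod_congr rfl fun w _ => ?_
      split_ifs with h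
      · refine prod_congr rfl fun e he => ?_
        rw [(mem_filter.1 he).2, if_pos h]
      · refine prod_eq_one fun e he => ?_
        rw [(mem_filter.1 he).2, if_neg h]
  · refine congrArg (moment · q) (extrinsicLaw_eq fun l => ?_)
    refine (wordMean_frozenWord hinj (ldgmWord (compTree G i d))
      (notMem_empty (treeRoot G i d)) _).trans ?_
    exact codeMean_observations L hd .ldgm l

/-- On a tree-like neighbourhood the MAP estimate is at least as good as belief propagation started
from pessimistic messages. -/
lemma moment_lo_le_mapLaw [dV : DecidableEq V] {Ch : Channel} {ε : ℝ} (h : c = Ch.c ε) (κ : Kind) :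
    moment ((pi fun _ : V => c).map
      fun l => rootMsg κ L κ.loLeaf (tanhs (upd l i 0)) i k) q ≤
    moment (mapLaw κ Ch ε G i) q := by
  obtain rfl : dV = fun a b => Classical.propDecidable (a = b) := Subsingleton.elim _ _
  subst h
  cases κ with
  | ldgm => rw [mapLaw_ldgm]; exact moment_le_map_ldgm L hd hinj hc hq
  | ldpc => rw [mapLaw_ldpc]; exact moment_le_map_ldpc L hd hinj hc hq

/-- On a tree-like neighbourhood the MAP estimate is at most as good as belief propagation started
from optimistic messages. -/
lemma moment_mapLaw_le_hi [dV : DecidableEq V] {Ch : Channel} {ε : ℝ} (h : c = Ch.c ε) (κ : Kind) :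
    moment (mapLaw κ Ch ε G i) q ≤
    moment ((pi fun _ : V => c).map
      fun l => rootMsg κ L κ.hiLeaf (tanhs (upd l i 0)) i k) q := by
  obtain rfl : dV = fun a b => Classical.propDecidable (a = b) := Subsingleton.elim _ _
  subst h
  cases κ with
  | ldgm => rw [mapLaw_ldgm]; exact map_le_moment_ldgm L hd hinj hc hq
  | ldpc => rw [mapLaw_ldpc]; exact map_le_moment_ldpc L hd hinj hc hq

end

/-! ### Nodes without a tree-like neighbourhood lie on short closed walks -/

section

variable {n m : ℕ} {bd : Fin n → ℕ} {od : Fin m → ℕ} {σ : Matching bd od}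

lemma mem_socketSib {x y : Socket bd od} :
    x ∈ socketSib bd od y ↔ x ≠ y ∧ socketNode bd od x = socketNode bd od y := by
  rcases y with ⟨i, j⟩ | ⟨a, j⟩ <;> rcases x with ⟨i', j'⟩ | ⟨a', j'⟩ <;>
    simp only [socketSib, socketNode, List.mem_map, mem_erase_finRange]
  · grind
  · simp
  · simp
  grind

variable (σ)

/-- A non-backtracking walk of length at most `D` that leaves through `h` reaches the code bit
`i`. -/
def Returns (i : Fin n) (D : ℕ) (h : Socket bd od) : Prop :=
  incMsg (socketSib bd od) (combReturn (socketNode bd od) (.inl i)) false σ D h = true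

variable {σ} {i : Fin n}

lemma returns_succ {D : ℕ} {h : Socket bd od} :
    Returns σ i (D + 1) h ↔ socketNode bd od (partner σ h) = .inl i ∨
      ∃ x ∈ socketSib bd od (partner σ h), Returns σ i D x := by
  simp [Returns, incMsg, combReturn]

lemma Returns.succ {D : ℕ} {h : Socket bd od} (hr : Returns σ i D h) :
    Returns σ i (D + 1) h := by
  induction D generalizing h with
  | zero => simp [Returns, incMsg] at hr
  | succ D ih =>
    rw [returns_succ] at hr ⊢
    grind

lemma Returns.mono {D D' : ℕ} (hD : D ≤ D') {h : Socket bd od}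
    (hr : Returns σ i D h) : Returns σ i D' h := by
  induction hD with
  | refl => exact hr
  | step _ ih => exact ih.succ

variable (σ)

/-- The half-edge through which the last step, along `e`, of a walk of length `k` departs. -/
def depart (k : ℕ) (e : Σ i, Fin (bd i)) : Socket bd od :=
  if Odd k then .inl e else .inr (σ e)

lemma partner_partner (h : Socket bd od) :
    partner σ (partner σ h) = h := by
  rcases h with s | r <;> simp [partner]

/-- The node at which a walk ends. -/
def walkEnd (i : Fin n) : List (Σ i, Fin (bd i)) → Fin n ⊕ Fin m
  | [] => .inl i
  | e :: z => socketNode bd od (partner σ (depart σ (z.length + 1) e))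

variable {σ}

lemma socketNode_depart {e : Σ i, Fin (bd i)} {z : List (Σ i, Fin (bd i))}
    (h : IsWalk (socketGraph bd od σ) i (e :: z)) :
    socketNode bd od (depart σ (z.length + 1) e) = walkEnd σ i z := by
  rcases z with _ | ⟨f, z⟩
  · have h1 : e.1 = i := h
    simp [depart, walkEnd, socketNode, h1]
  · have h1 := h.2.2
    rw [length_cons] at h1 ⊢
    by_cases ho : Odd (z.length + 1)
    · rw [if_pos ho] at h1
      have h2 : (σ e).1 = (σ f).1 := h1
      have h3 : ¬ Odd (z.length + 1 + 1) := not_odd_iff_even.2 ho.add_one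
      simp [depart, walkEnd, socketNode, partner, ho, h3, h2]
    · rw [if_neg ho] at h1
      have h2 : e.1 = f.1 := h1
      have h3 : Odd (z.length + 1 + 1) := (not_odd_iff_even.1 ho).add_one
      simp [depart, walkEnd, socketNode, partner, ho, h3, h2]

lemma depart_ne_partner {k : ℕ} {e f : Σ i, Fin (bd i)} (h : e ≠ f) :
    depart σ (k + 1) e ≠ partner σ (depart σ k f) := by
  by_cases ho : Odd k
  · have h3 : ¬ Odd (k + 1) := not_odd_iff_even.2 ho.add_one
    simpa [depart, partner, ho, h3] using h
  · have h3 : Odd (k + 1) := (not_odd_iff_even.1 ho).add_one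
    simpa [depart, partner, ho, h3] using h

/-- A return after the end of a walk is a return from its start. -/
lemma exists_returns_of_walk {D : ℕ} {e : Σ i, Fin (bd i)} {z : List (Σ i, Fin (bd i))}
    (h : IsWalk (socketGraph bd od σ) i (e :: z)) (hr : Returns σ i D (depart σ (z.length + 1) e)) :
    ∃ s : Σ i, Fin (bd i), s.1 = i ∧ Returns σ i (D + z.length) (.inl s) := by
  induction z generalizing e D with
  | nil =>
    refine ⟨e, h, ?_⟩
    simpa [depart] using hr
  | cons f z ih =>
    have h1 : Returns σ i (D + 1) (depart σ (z.length + 1) f) := returns_succ.2 (Or.inr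
      ⟨_, mem_socketSib.2 ⟨depart_ne_partner h.2.1, socketNode_depart h⟩, hr⟩)
    obtain ⟨s, hs, hs'⟩ := ih h.1 h1
    grind

/-- A walk can be followed backwards. -/
lemma returns_reverse {e : Σ i, Fin (bd i)} {z : List (Σ i, Fin (bd i))}
    (h : IsWalk (socketGraph bd od σ) i (e :: z)) :
    Returns σ i (z.length + 1) (partner σ (depart σ (z.length + 1) e)) := by
  induction z generalizing e with
  | nil =>
    refine returns_succ.2 (Or.inl ?_)
    rw [partner_partner]
    exact socketNode_depart h
  | cons f z ih =>
    refine returns_succ.2 (Or.inr ⟨_, ?_, ih h.1⟩)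
    rw [partner_partner]
    exact mem_socketSib.2 ⟨(depart_ne_partner h.2.1).symm, (socketNode_depart h).symm⟩

/-- Two walks with the same end close up to a return. -/
lemma exists_returns_of_ne {w w' : List (Σ i, Fin (bd i))}
    (hw : IsWalk (socketGraph bd od σ) i w) (hw' : IsWalk (socketGraph bd od σ) i w') (hne : w ≠ w')
    (hend : walkEnd σ i w = walkEnd σ i w') :
    ∃ s : Σ i, Fin (bd i), s.1 = i ∧ Returns σ i (w.length + w'.length) (.inl s) := by
  induction w generalizing w' with
  | nil =>
    rcases w' with _ | ⟨f, z'⟩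
    · grind
    · obtain ⟨s, hs, hs'⟩ := exists_returns_of_walk (D := 1) hw' (returns_succ.2 (Or.inl hend.symm))
      grind
  | cons e z ih =>
    rcases w' with _ | ⟨f, z'⟩
    · obtain ⟨s, hs, hs'⟩ := exists_returns_of_walk (D := 1) hw (returns_succ.2 (Or.inl hend))
      grind
    -- the walks end on the same side of the graph, so their lengths have the same parity
    have hpar : Odd (z.length + 1) ↔ Odd (z'.length + 1) := by
      rw [walkEnd, walkEnd] at hend
      by_cases h1 : Odd (z.length + 1) <;> by_cases h2 : Odd (z'.length + 1) <;>
        simp [depart, h1, h2, partner, socketNode] at hend ⊢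
    have hdep : ∀ e' : Σ i, Fin (bd i),
        depart σ (z.length + 1) e' = depart σ (z'.length + 1) e' := fun e' => by
      simp only [depart, hpar]
    by_cases hef : e = f
    · subst hef
      have hz : walkEnd σ i z = walkEnd σ i z' := by
        rw [← socketNode_depart hw, ← socketNode_depart hw', hdep]
      obtain ⟨s, hs, hs'⟩ := ih (w' := z') hw.tail hw'.tail (fun h => hne (by rw [h])) hz
      exact ⟨s, hs, hs'.mono (by simp; omega)⟩
    · have h1 : partner σ (depart σ (z'.length + 1) f) ∈
          socketSib bd od (partner σ (depart σ (z.length + 1) e)) := by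
        refine mem_socketSib.2 ⟨fun h => hef ?_, hend.symm⟩
        have h2 := congrArg (partner σ) h
        rw [partner_partner, partner_partner] at h2
        unfold depart at h2
        split_ifs at h2
        · grind
        · simp_all
      obtain ⟨s, hs, hs'⟩ := exists_returns_of_walk hw
        (returns_succ.2 (Or.inr ⟨_, h1, returns_reverse hw'⟩))
      grind

/-- If the neighbourhood of `i` is not a tree, then a short closed walk starts at `i`. -/
lemma any_returns_of_not_injective {d : ℕ} (h : ¬Injective (treeProj (socketGraph bd od σ) i d)) :
    ((socketsAt bd od i).map (incMsg (socketSib bd od)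
      (combReturn (socketNode bd od) (.inl i)) false σ (2 * d))).any id = true := by
  obtain ⟨w, w', hp, hne⟩ : ∃ w w', treeProj (socketGraph bd od σ) i d w =
      treeProj (socketGraph bd od σ) i d w' ∧ w ≠ w' := by
    simpa [Injective] using h
  have hend : ∀ w : TreeBit (socketGraph bd od σ) i d,
      walkEnd σ i w.walk = .inl (treeProj (socketGraph bd od σ) i d w) := fun w => by
    have h1 := w.even
    rcases h2 : w.walk with _ | ⟨e, z⟩
    · rw [treeProj_eq, h2]; rfl
    · rw [treeProj_cons h2]
      rw [h2, length_cons] at h1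
      simp [walkEnd, depart, not_odd_iff_even.2 h1, partner, socketNode, socketGraph]
  obtain ⟨s, rfl, hs⟩ := exists_returns_of_ne w.isWalk w'.isWalk (fun h' => hne (TreeBit.ext h'))
    (by rw [hend, hend, hp])
  have h1 := hs.mono (D' := 2 * d) (by have := w.length_le; have := w'.length_le; omega)
  rw [List.any_eq_true]
  refine ⟨true, List.mem_map.2 ⟨.inl s, ?_, h1⟩, rfl⟩
  exact List.mem_map.2 ⟨s.2, List.mem_finRange _, rfl⟩

end

/-! ### Belief propagation estimates are bounded away from `±1` unless they equal `1` -/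

section

variable {V : Type}

/-- Messages `m` as functions of the observations that are `1` or bounded away from `±1` in terms of
at most `c` observations. -/
structure Tame (c : ℕ) (m : (V → ℝ) → ℝ) : Prop where
  isMsg : ∀ l, IsMsg (m l)
  bound : ∃ W : List V, W.length ≤ c ∧ ∀ l, m l = 1 ∨
    exp (-(c + 2 * (W.map fun v => |l v|).sum)) ≤ 1 - |m l|

lemma Tame.mono {c c' : ℕ} (hc : c ≤ c') {m : (V → ℝ) → ℝ} (h : Tame c m) : Tame c' m := by
  obtain ⟨W, hW, hb⟩ := h.bound
  refine ⟨h.isMsg, W, hW.trans hc, fun l => (hb l).imp_right fun h' => le_trans ?_ h'⟩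
  have : (c : ℝ) ≤ c' := by exact_mod_cast hc
  exact exp_le_exp.2 (by linarith)

lemma tame_const {c : ℕ} (x : ℝ) (hx : x = 0 ∨ x = 1) : Tame c fun _ : V → ℝ => x := by
  rcases hx with rfl | rfl
  · refine ⟨fun _ => ⟨by norm_num, zero_le_one⟩, [], Nat.zero_le _, fun l => Or.inr ?_⟩
    simp_all
  · exact ⟨fun _ => ⟨by norm_num, le_rfl⟩, [], Nat.zero_le _, fun l => Or.inl rfl⟩

lemma exp_le_one_sub_abs_tanh (l : ℝ) : exp (-(2 * |l|)) ≤ 1 - |tanh l| := by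
  have h1 : 0 < 1 - |tanh l| := sub_pos.2 (abs_tanh_lt_one l)
  rw [← Real.le_log_iff_exp_le h1]
  linarith [neg_log_one_sub_abs_tanh_le l]

lemma tame_tanhs (v : V) : Tame 1 fun l => tanhs l v := by
  refine ⟨fun l => isMsg_tanhs l v, [v], le_rfl, fun l => Or.inr ?_⟩
  refine le_trans (exp_le_exp.2 ?_) (exp_le_one_sub_abs_tanh (l v))
  simp

lemma le_one_sub_abs_mul {x y a b : ℝ} (ha : 0 ≤ a) (hb : 0 ≤ b) (ha1 : a ≤ 1) (hb1 : b ≤ 1)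
    (hx : IsMsg x) (hy : IsMsg y) (h : x = 1 ∨ a ≤ 1 - |x|) (h' : y = 1 ∨ b ≤ 1 - |y|) :
    x * y = 1 ∨ a * b ≤ 1 - |x * y| := by
  have hy1 : |y| ≤ 1 := abs_le.2 ⟨hy.1.le, hy.2⟩
  rw [abs_mul]
  rcases h with rfl | h
  · rcases h' with rfl | h'
    · left; norm_num
    · right; rw [abs_one, one_mul]; nlinarith
  · right
    nlinarith [mul_nonneg (abs_nonneg x) (sub_nonneg.2 hy1)]

lemma le_one_sub_abs_box {x y a b : ℝ} (ha : 0 ≤ a) (hb : 0 ≤ b) (ha1 : a ≤ 1) (hb1 : b ≤ 1)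
    (hx : IsMsg x) (hy : IsMsg y) (h : x = 1 ∨ a ≤ 1 - |x|) (h' : y = 1 ∨ b ≤ 1 - |y|) :
    box x y = 1 ∨ a * b / 2 ≤ 1 - |box x y| := by
  have hx1 : |x| ≤ 1 := abs_le.2 ⟨hx.1.le, hx.2⟩
  have hy1 : |y| ≤ 1 := abs_le.2 ⟨hy.1.le, hy.2⟩
  rcases h with rfl | h
  · left
    have := hy.1
    rw [box, one_mul]
    exact div_self (by linarith)
  rcases h' with rfl | h'
  · left
    have := hx.1
    rw [box, mul_one, add_comm]
    exact div_self (by linarith)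
  right
  -- the main inequality for the numerator and the denominator
  have hpos : 0 ≤ 1 + x * y := by
    have := abs_mul x y
    have h1 : |x * y| ≤ 1 := by rw [this]; exact mul_le_one₀ hx1 (abs_nonneg _) hy1
    linarith [neg_abs_le (x * y)]
  rcases hpos.eq_or_lt with h0 | hpos
  · rw [box, ← h0, div_zero, abs_zero, sub_zero]
    nlinarith
  have hle : 1 + x * y ≤ 2 := by
    nlinarith [abs_le.1 hx1, abs_le.1 hy1, abs_mul x y, le_abs_self (x * y),
      mul_le_one₀ hx1 (abs_nonneg _) hy1]
  have key : a * b ≤ 1 + x * y - |x + y| := by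
    have hab : a * b ≤ (1 - |x|) * (1 - |y|) := mul_le_mul h h' hb (by linarith)
    have h2 : (1 - |x|) * (1 - |y|) ≤ 1 + x * y - |x + y| := by
      rcases abs_cases x with ⟨e1, _⟩ | ⟨e1, _⟩ <;> rcases abs_cases y with ⟨e2, _⟩ | ⟨e2, _⟩ <;>
        rcases abs_cases (x + y) with ⟨e3, _⟩ | ⟨e3, _⟩ <;> rw [e1, e2, e3] <;>
        rw [e1] at hx1 <;> rw [e2] at hy1 <;> nlinarith
    exact hab.trans h2
  rw [box, abs_div, abs_of_pos hpos, le_sub_iff_add_le, ← le_sub_iff_add_le', div_le_iff₀ hpos]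
  nlinarith [mul_nonneg ha hb]

lemma Tame.op {op : ℝ → ℝ → ℝ} {c c' : ℕ} {m m' : (V → ℝ) → ℝ} (h : Tame c m) (h' : Tame c' m')
    (hop : ∀ x y, IsMsg x → IsMsg y → IsMsg (op x y))
    (hbd : ∀ {x y a b : ℝ}, 0 ≤ a → 0 ≤ b → a ≤ 1 → b ≤ 1 → IsMsg x → IsMsg y →
      (x = 1 ∨ a ≤ 1 - |x|) → (y = 1 ∨ b ≤ 1 - |y|) → (op x y = 1 ∨ a * b / 2 ≤ 1 - |op x y|)) :
    Tame (c + c' + 1) fun l => op (m l) (m' l) := by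
  obtain ⟨W, hW, hb⟩ := h.bound
  obtain ⟨W', hW', hb'⟩ := h'.bound
  refine ⟨fun l => hop _ _ (h.isMsg l) (h'.isMsg l), W ++ W', by rw [List.length_append]; omega,
    fun l => (hbd (exp_nonneg _) (exp_nonneg _) ?_ ?_ (h.isMsg l) (h'.isMsg l) (hb l)
      (hb' l)).imp_right fun h1 => le_trans ?_ h1⟩
  · have : 0 ≤ (W.map fun v => |l v|).sum := List.sum_nonneg (by simp)
    exact Real.exp_le_one_iff.2 (by linarith [(Nat.cast_nonneg c : (0 : ℝ) ≤ c)])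
  · have : 0 ≤ (W'.map fun v => |l v|).sum := List.sum_nonneg (by simp)
    exact Real.exp_le_one_iff.2 (by linarith [(Nat.cast_nonneg c' : (0 : ℝ) ≤ c')])
  · rw [← exp_add, le_div_iff₀ two_pos]
    calc _ ≤ exp (-(((c + c' + 1 : ℕ) : ℝ) + 2 * ((W ++ W').map fun v => |l v|).sum)) * exp 1 := by
          gcongr
          linarith [add_one_le_exp 1]
      _ ≤ _ := by
          rw [← exp_add, List.map_append, List.sum_append]
          grind

lemma Kind.tame_bitOp (κ : Kind) {c c' : ℕ} {m m' : (V → ℝ) → ℝ} (h : Tame c m)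
    (h' : Tame c' m') : Tame (c + c' + 1) fun l => κ.bitOp (m l) (m' l) := by
  refine h.op h' (fun x y => κ.isMsg_bitOp) fun {x y a b} ha hb ha1 hb1 hx hy h1 h2 => ?_
  cases κ with
  | ldgm =>
    refine (le_one_sub_abs_mul ha hb ha1 hb1 hx hy h1 h2).imp_right fun h3 => le_trans ?_ h3
    linarith [mul_nonneg ha hb]
  | ldpc => exact le_one_sub_abs_box ha hb ha1 hb1 hx hy h1 h2

lemma Kind.tame_othOp (κ : Kind) {c c' : ℕ} {m m' : (V → ℝ) → ℝ} (h : Tame c m)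
    (h' : Tame c' m') : Tame (c + c' + 1) fun l => κ.othOp (m l) (m' l) := by
  refine h.op h' (fun x y => κ.isMsg_othOp) fun {x y a b} ha hb ha1 hb1 hx hy h1 h2 => ?_
  cases κ with
  | ldgm => exact le_one_sub_abs_box ha hb ha1 hb1 hx hy h1 h2
  | ldpc =>
    refine (le_one_sub_abs_mul ha hb ha1 hb1 hx hy h1 h2).imp_right fun h3 => le_trans ?_ h3
    linarith [mul_nonneg ha hb]

lemma tame_foldr {op : ℝ → ℝ → ℝ} {u : ℝ} (hu : u = 0 ∨ u = 1)
    (hop : ∀ {c c' : ℕ} {m m' : (V → ℝ) → ℝ}, Tame c m → Tame c' m' →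
      Tame (c + c' + 1) fun l => op (m l) (m' l)) {ι : Type} {f : ι → (V → ℝ) → ℝ} {c K : ℕ}
    {L : List ι} (hL : L.length ≤ K) (hf : ∀ x ∈ L, Tame c (f x)) :
    Tame (K * (c + 1)) fun l => (L.map fun x => f x l).foldr op u := by
  have : Tame (L.length * (c + 1)) fun l => (L.map fun x => f x l).foldr op u := by
    clear hL
    induction L with
    | nil => exact tame_const u hu
    | cons x L ih =>
      have h1 := hop (hf x List.mem_cons_self) (ih fun y hy => hf y (List.mem_cons_of_mem _ hy))
      refine h1.mono (le_of_eq ?_)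
      rw [length_cons]
      ring
  exact this.mono (Nat.mul_le_mul_right _ hL)

variable {A E : Type} {G : Graph V A E} (κ : Kind) (L : EdgeLists G) {K : ℕ}

/-- A bound for the number of observations in the neighbourhood of a node. -/
def tameBound (K : ℕ) : ℕ → ℕ
  | 0 => 1
  | k + 1 => 1 + K * (K * (tameBound K k + 1) + 1) + 1

lemma Kind.bitUnit_eq (κ : Kind) : κ.bitUnit = 0 ∨ κ.bitUnit = 1 := by
  cases κ <;> simp [Kind.bitUnit]

lemma Kind.othUnit_eq (κ : Kind) : κ.othUnit = 0 ∨ κ.othUnit = 1 := by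
  cases κ <;> simp [Kind.othUnit]

variable (hb : ∀ e, (L.bitSib e).length ≤ K) (ho : ∀ e, (L.othSib e).length ≤ K)
  (he : ∀ v, (L.edgesAt v).length ≤ K)
include hb ho

lemma tame_edgeMsg (k : ℕ) (e : E) : Tame (tameBound K k) fun l =>
    edgeMsg κ L id (tanhs l) k e := by
  induction k generalizing e with
  | zero => exact tame_tanhs _
  | succ k ih =>
    refine κ.tame_bitOp (tame_tanhs (G.bit e)) (tame_foldr κ.bitUnit_eq κ.tame_bitOp
      (hb e) fun c _ => ?_)
    exact tame_foldr κ.othUnit_eq κ.tame_othOp (ho c) fun c _ => ih c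

include he

lemma tame_rootMsg (k : ℕ) (v : V) :
    Tame (tameBound K (k + 1)) fun l => rootMsg κ L id (tanhs l) v k := by
  refine Tame.mono (c := K * (K * (tameBound K k + 1) + 1)) (by rw [tameBound]; omega) ?_
  refine tame_foldr κ.bitUnit_eq κ.tame_bitOp (he v) fun c _ => ?_
  exact tame_foldr κ.othUnit_eq κ.tame_othOp (ho c) fun c _ => tame_edgeMsg κ L hb ho k c

end

section

/-- The integrand of `gexitCoeff`. -/
def gexitFun (p : ℕ) (x : ℝ) : ℝ :=
  x ^ (2 * p + 1) / (2 * p + 1) - x ^ (2 * p + 2) / (2 * p + 2) - 1 / ((2 * p + 1) * (2 * p + 2))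

lemma continuous_gexitFun (p : ℕ) : Continuous (gexitFun p) := by unfold gexitFun; fun_prop

lemma gexitFun_one (p : ℕ) : gexitFun p 1 = 0 := by
  rw [gexitFun]
  field_simp
  ring

lemma integral_gexitFun {ρ : Measure ℝ} [IsProb ρ] (hρ : ∀ᵐ x ∂ρ, |x| ≤ 1) (p : ℕ) :
    ∫ x, gexitFun p x ∂ρ = gexitCoeff ρ p := by
  have h := integrable_pow_of_abs_le_one hρ
  simp only [gexitFun]
  have h1 : Integrable (fun x : ℝ =>
      x ^ (2 * p + 1) / (2 * p + 1) - x ^ (2 * p + 2) / (2 * p + 2)) ρ :=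
    ((h _).div_const _).sub ((h _).div_const _)
  rw [integral_sub h1 (integrable_const _), integral_sub ((h _).div_const _) ((h _).div_const _),
    integral_div, integral_div, integral_const]
  simp [gexitCoeff, moment]

lemma abs_gexitFun_le {x Y : ℝ} (hx : |x| ≤ 1) (hY : 1 ≤ Y) (h : x = 1 ∨ Y⁻¹ ≤ 1 - |x|) (p : ℕ) :
    |gexitFun p x| ≤ 3 * Y / (2 * p + 1) ^ 2 := by
  rcases h with rfl | h
  · rw [gexitFun_one, abs_zero]; positivity
  have hpow : ∀ k : ℕ, 0 < k → |x| ^ k ≤ Y / k := fun k hk => by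
    calc |x| ^ k ≤ (1 - Y⁻¹) ^ k := by gcongr; linarith
      _ ≤ exp (-Y⁻¹) ^ k := by
          refine pow_le_pow_left₀ ?_ ?_ k
          · grind
          · linarith [add_one_le_exp (-Y⁻¹)]
      _ = (exp (k * Y⁻¹))⁻¹ := by rw [← Real.exp_nat_mul, ← Real.exp_neg]; ring_nf
      _ ≤ (k * Y⁻¹)⁻¹ := by
          refine inv_anti₀ (by positivity) ?_
          linarith [add_one_le_exp (k * Y⁻¹)]
      _ = Y / k := by rw [mul_inv, inv_inv]; ring
  have h1 : (0 : ℝ) < 2 * p + 1 := by positivity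
  have e1 : |x ^ (2 * p + 1) / (2 * p + 1)| ≤ Y / (2 * p + 1) ^ 2 := by
    rw [abs_div, abs_pow, abs_of_pos h1, div_le_div_iff₀ h1 (by positivity)]
    have := hpow (2 * p + 1) (by omega)
    push_cast at this
    rw [le_div_iff₀ h1] at this
    nlinarith
  have e2 : |x ^ (2 * p + 2) / (2 * p + 2)| ≤ Y / (2 * p + 1) ^ 2 := by
    have h2 : (0 : ℝ) < 2 * p + 2 := by positivity
    rw [abs_div, abs_pow, abs_of_pos h2, div_le_div_iff₀ h2 (by positivity)]
    have := hpow (2 * p + 2) (by omega)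
    push_cast at this
    rw [le_div_iff₀ h2] at this
    have h3 : 0 ≤ |x| ^ (2 * p + 2) := by positivity
    nlinarith [mul_nonneg h3 h1.le]
  have e3 : |1 / ((2 * p + 1) * (2 * p + 2) : ℝ)| ≤ Y / (2 * p + 1) ^ 2 := by
    rw [abs_of_pos (by positivity), div_le_div_iff₀ (by positivity) (by positivity)]
    nlinarith
  calc |gexitFun p x| ≤ _ := (abs_sub _ _).trans (add_le_add_left (abs_sub _ _) _)
    _ ≤ Y / (2 * p + 1) ^ 2 + Y / (2 * p + 1) ^ 2 + Y / (2 * p + 1) ^ 2 := by linarith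
    _ = _ := by ring

lemma summable_const_div_odd_sq (B : ℝ) : Summable fun p : ℕ => 3 * B / (2 * (p : ℝ) + 1) ^ 2 := by
  have h : Summable fun p : ℕ => 6 * |B| * (1 / ((2 * (p : ℝ) + 1) * (2 * p + 2))) :=
    summable_inv_odd_mul_even.mul_left _
  refine Summable.of_norm_bounded h fun p => ?_
  have h1 : (0 : ℝ) < 2 * p + 1 := by positivity
  rw [norm_eq_abs, abs_div, abs_of_pos (by positivity : (0 : ℝ) < (2 * p + 1) ^ 2), abs_mul,
    abs_of_pos (by norm_num : (0 : ℝ) < 3), mul_one_div,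
      div_le_div_iff₀ (by positivity) (by positivity)]
  nlinarith [mul_nonneg (abs_nonneg B) h1.le, mul_nonneg (mul_nonneg (abs_nonneg B) h1.le)
    (Nat.cast_nonneg p : (0:ℝ) ≤ p)]

/-- The exponential of a sum of at most `c` terms. -/
lemma exp_sum_le {V : Type} {c : ℕ} {W : List V} (hW : W.length ≤ c) (g : V → ℝ)
    (hg : ∀ v, 0 ≤ g v) :
    exp (W.map g).sum ≤ 1 + (W.map fun v => exp (c * g v)).sum := by
  rcases eq_or_ne W [] with rfl | hne
  · simp
  obtain ⟨v, hv, h⟩ := List.exists_le_of_sum_le (f := fun _ => (W.map g).sum)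
    (g := fun v => W.length * g v) hne (by
      rw [List.map_const', List.sum_replicate, List.sum_map_mul_left, nsmul_eq_mul])
  have h1 : exp (W.map g).sum ≤ exp (c * g v) := by
    refine exp_le_exp.2 (h.trans ?_)
    have : (W.length : ℝ) ≤ c := by exact_mod_cast hW
    exact mul_le_mul_of_nonneg_right this (hg v)
  have h2 : exp (c * g v) ≤ (W.map fun v => exp (c * g v)).sum :=
    List.single_le_sum (by simp only [List.mem_map]; rintro _ ⟨z, _, rfl⟩; positivity) _
      (List.mem_map.2 ⟨v, hv, rfl⟩)
  linarith

variable {V : Type} [Fintype V] [DecidableEq V] {c : Measure ℝ} [IsProb c]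

/-- The coefficients of the GEXIT function of a tame estimate decay quadratically. -/
lemma Tame.abs_gexitCoeff_le {M : ℕ} {m : (V → ℝ) → ℝ} (hm : Tame M m) (i : V)
    (hmu : Measurable fun l : V → ℝ => m (upd l i 0))
    (hexp : Integrable (fun x => exp ((2 * M) * |x|)) c) (p : ℕ) :
    |gexitCoeff ((pi fun _ : V => c).map fun l => m (upd l i 0)) p| ≤
      3 * (exp M * (1 + M * ∫ x, exp ((2 * M) * |x|) ∂c)) / (2 * p + 1) ^ 2 := by
  obtain ⟨W, hW, hb⟩ := hm.bound
  have habs : ∀ l, |m l| ≤ 1 := fun l => abs_le.2 ⟨(hm.isMsg l).1.le, (hm.isMsg l).2⟩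
  have hprob := isProbabilityMeasure_map (μ := pi fun _ : V => c) hmu.aemeasurable
  rw [← integral_gexitFun (ae_abs_le_of_forall fun l => habs _),
    integral_map hmu.aemeasurable (continuous_gexitFun p).aestronglyMeasurable]
  -- `Y⁻¹` bounds the distance of the estimate from `±1`, and `𝔼 Y` depends on `M` and `c` only
  set Y : (V → ℝ) → ℝ := fun l =>
    exp M * (1 + (W.map fun v => exp ((2 * M) * |l v|)).sum) with hY
  have hsumnn : ∀ l : V → ℝ, 0 ≤ (W.map fun v => exp ((2 * M) * |l v|)).sum := fun l =>
    List.sum_nonneg (by simp only [List.mem_map]; rintro _ ⟨z, _, rfl⟩; positivity)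
  have hY1 : ∀ l, 1 ≤ Y l := fun l => by
    have h1 : 1 ≤ exp M := Real.one_le_exp (Nat.cast_nonneg _)
    have := hsumnn l
    nlinarith
  have hpt : ∀ l, |gexitFun p (m (upd l i 0))| ≤ 3 * Y l / (2 * p + 1) ^ 2 := fun l => by
    refine abs_gexitFun_le (habs _) (hY1 l) ((hb _).imp_right fun h => le_trans ?_ h) p
    rw [Real.exp_neg]
    refine inv_anti₀ (exp_pos _) ?_
    rw [exp_add]
    refine mul_le_mul_of_nonneg_left ?_ (exp_nonneg _)
    have h1 := exp_sum_le hW (fun v => 2 * |l v|) fun v => by positivity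
    have h2 : 2 * (W.map fun v => |upd l i 0 v|).sum ≤ (W.map fun v => 2 * |l v|).sum := by
      rw [← List.sum_map_mul_left]
      refine List.sum_le_sum fun v _ => ?_
      by_cases hv : v = i
      · subst hv; simp
      · simp [hv]
    refine (exp_le_exp.2 h2).trans (h1.trans (le_of_eq ?_))
    simp only [show ∀ v, (M : ℝ) * (2 * |l v|) = 2 * M * |l v| from fun v => by ring]
  have hint : ∀ v, Integrable (fun l : V → ℝ => exp ((2 * M) * |l v|)) (pi fun _ => c) :=
    fun v => (measurePreserving_eval (fun _ : V => c) v).integrable_comp_of_integrable hexp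
  have hval : ∀ v, ∫ l : V → ℝ, exp ((2 * M) * |l v|) ∂(pi fun _ => c) =
      ∫ x, exp ((2 * M) * |x|) ∂c := fun v => by
    have h := (measurePreserving_eval (fun _ : V => c) v).map_eq
    conv_rhs => rw [← h]
    rw [integral_map (measurable_pi_apply v).aemeasurable
      (Continuous.aestronglyMeasurable (by fun_prop))]
  have hW' : Integrable (fun l : V → ℝ => (W.map fun v => exp ((2 * M) * |l v|)).sum)
      (pi fun _ => c) ∧ ∫ l : V → ℝ, (W.map fun v => exp ((2 * M) * |l v|)).sum
        ∂(pi fun _ => c) = W.length * ∫ x, exp ((2 * M) * |x|) ∂c := by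
    clear hpt hY1 hsumnn hY hb hW
    induction W with
    | nil => simp
    | cons v W ih =>
      simp only [List.map_cons, List.sum_cons, length_cons]
      refine ⟨(hint v).add ih.1, ?_⟩
      rw [integral_add (hint v) ih.1, hval, ih.2]
      push_cast
      ring
  calc |∫ l, gexitFun p (m (upd l i 0)) ∂(pi fun _ : V => c)| ≤
      ∫ l, 3 * Y l / (2 * p + 1) ^ 2 ∂(pi fun _ : V => c) := by
        refine norm_integral_le_of_norm_le (g := fun l => 3 * Y l / (2 * p + 1) ^ 2) ?_
          (ae_of_all _ fun l => (norm_eq_abs _).trans_le (hpt l))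
        exact ((((integrable_const _).add hW'.1).const_mul _).const_mul _).div_const _
    _ = 3 * (exp M * (1 + W.length * ∫ x, exp ((2 * M) * |x|) ∂c)) / (2 * p + 1) ^ 2 := by
        rw [integral_div, integral_const_mul, integral_const_mul,
          integral_add (integrable_const _) hW'.1, hW'.2]
        simp
    _ ≤ _ := by
        have : 0 ≤ ∫ x, exp ((2 * M) * |x|) ∂c := integral_nonneg fun _ => exp_nonneg _
        gcongr

end

/-! ### Averages over the ensemble -/

section

variable {n m : ℕ} (bd : Fin n → ℕ) (od : Fin m → ℕ)

/-- The average over the matchings of the sockets and over the code bits. -/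
def socketAvg (F : (Matching bd od) → Fin n → ℝ) : ℝ :=
  (∑ σ, (1 / (n : ℝ)) * ∑ i, F σ i) / card (Matching bd od)

variable {bd od} {F F' : (Matching bd od) → Fin n → ℝ}

lemma socketAvg_mono (h : ∀ σ i, F σ i ≤ F' σ i) : socketAvg bd od F ≤ socketAvg bd od F' := by
  unfold socketAvg
  gcongr with σ _ i _
  exact h σ i

lemma socketAvg_add : socketAvg bd od (fun σ i => F σ i + F' σ i) =
    socketAvg bd od F + socketAvg bd od F' := by
  simp only [socketAvg, sum_add_distrib, mul_add, add_div]

lemma socketAvg_const_mul (c : ℝ) :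
    socketAvg bd od (fun σ i => c * F σ i) = c * socketAvg bd od F := by
  simp only [socketAvg, ← mul_sum, mul_left_comm _ c, mul_div_assoc]

lemma socketAvg_const (hn : 0 < n) (hc : card (Σ i, Fin (bd i)) = card (Σ a, Fin (od a))) (c : ℝ) :
    socketAvg bd od (fun _ _ => c) = c := by
  have : Nonempty (Matching bd od) := Fintype.card_eq.1 hc
  simp only [socketAvg, sum_const, card_univ, card_fin, nsmul_eq_mul]
  field_simp

lemma abs_socketAvg_le {u : ℝ} (hu : 0 ≤ u) (h : ∀ σ i, |F σ i| ≤ u) : |socketAvg bd od F| ≤ u := by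
  have h1 : ∀ σ, |(1 / (n : ℝ)) * ∑ i, F σ i| ≤ u := fun σ => by
    rw [abs_mul, abs_of_nonneg (by positivity : (0 : ℝ) ≤ 1 / n), one_div, inv_mul_eq_div]
    refine div_le_of_le_mul₀ (Nat.cast_nonneg _) hu ((abs_sum_le_sum_abs _ _).trans
      ((sum_le_sum fun i _ => h σ i).trans (le_of_eq ?_)))
    simp [mul_comm]
  rw [socketAvg, abs_div, Nat.abs_cast]
  refine div_le_of_le_mul₀ (Nat.cast_nonneg _) hu ((abs_sum_le_sum_abs _ _).trans
      ((sum_le_sum fun σ _ => h1 σ).trans (le_of_eq ?_)))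
  simp [mul_comm]

lemma socketAvg_gexitSum {Ch : Channel} (hK : Ch.ClassK) {ε : ℝ} (hε : ε ∈ Ch.dom)
    {a : (Matching bd od) → Fin n → ℕ → ℝ} (ha : ∀ σ i, Summable (a σ i)) :
    socketAvg bd od (fun σ i => gexitSum Ch ε (a σ i)) =
      gexitSum Ch ε fun p => socketAvg bd od fun σ i => a σ i p := by
  obtain ⟨r, hr, B, -, hB⟩ := hK.local_bound hε
  have hs : ∀ σ i, HasSum (fun p => deriv (Ch.tanhMoment (p + 1)) ε * a σ i p)
      (gexitSum Ch ε (a σ i)) := fun σ i => by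
    refine (Summable.of_norm_bounded ((ha σ i).abs.mul_left B) fun p => ?_).hasSum
    rw [norm_mul, norm_eq_abs, norm_eq_abs]
    exact mul_le_mul_of_nonneg_right (hB p ε (Metric.mem_ball_self hr)) (abs_nonneg _)
  have h := (hasSum_sum (s := univ) fun σ _ => ((hasSum_sum (s := univ)
    fun i _ => hs σ i).mul_left (1 / (n : ℝ)))).div_const
      (card (Matching bd od) : ℝ)
  refine h.tsum_eq.symm.trans (tsum_congr fun p => ?_)
  rw [← socketAvg_const_mul, socketAvg]

end

local notation:max "𝒢[" S "," N "]" => socketGraph (DegreeSequence.bitDeg S N) (DegreeSequence.othDeg S N)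
local notation:max "ℒ[" S "," N "]" => socketLists (DegreeSequence.bitDeg S N) (DegreeSequence.othDeg S N)
local notation:max "𝔼[" S "," N "]" => socketAvg (DegreeSequence.bitDeg S N) (DegreeSequence.othDeg S N)

lemma IsLaw.moment_odd {μ : Measure ℝ} (h : IsLaw μ) (p : ℕ) :
    moment μ (2 * p + 1) = moment μ (2 * p + 2) := by
  have hc : ∀ᵐ x ∂μ, clamp x = x := h.ae_abs_le.mono fun x hx => clamp_eq hx
  have h1 := h.symm (fun x => clamp x ^ (2 * p + 1))
    ⟨by have := continuous_clamp; fun_prop, 1, fun x =>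
      abs_pow_le_one (abs_clamp_le x) _⟩ fun x => by
        have : clamp (-x) = -clamp x := by
          unfold clamp
          rcases le_total x 1 with h1 | h1 <;> rcases le_total (-1) x with h2 | h2 <;>
            simp [min_def, max_def] <;> split_ifs <;> linarith
        rw [this, Odd.neg_pow (odd_two_mul_add_one p)]
  rw [moment, moment]
  refine (integral_congr_ae (hc.mono fun x hx => ?_)).trans
    (h1.trans (integral_congr_ae (hc.mono fun x hx => ?_)))
  · simp only [hx]
  · simp only [hx]; ring

namespace DegreeSequence

variable {q r : ℝ[X]} {qmax rmax : ℕ} (S : DegreeSequence q r qmax rmax)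

/-- Ensemble averages of quantities that are bounded by the predictions of belief propagation on
tree-like neighbourhoods. -/
lemma eventually_socketAvg_le (hq : IsDegreeDist q qmax) (hr : IsDegreeDist r rmax) (κ : Kind)
    {τ β : Prob ℝ} (hτ : IsLaw (τ : Measure ℝ)) (hβ : IsLaw (β : Measure ℝ)) (k : ℕ)
    {f : ℝ → ℝ} (hf : Measurable f) {B : ℝ} (hB : 0 < B) (hb : ∀ x, |f x| ≤ B)
    {F : ∀ N, (S.BitSocket N ≃ S.OthSocket N) → Fin (S.n N) → ℝ} {C : ℝ}
    (hF : ∀ N σ i, Injective (treeProj (𝒢[S, N] σ) i (2 * (k + 1))) →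
      F N σ i ≤ ∫ x, f x ∂(rootMsgLaw κ (ℒ[S, N] σ) τ β i k :
        Measure ℝ)) (hC : ∀ N σ i, F N σ i ≤ C) {δ : ℝ} (hδ : 0 < δ) :
    ∀ᶠ N in atTop, 𝔼[S, N] (F N) ≤ ∫ x, f x ∂rootLaw κ q r τ β k + δ := by
  set I : ∀ N, (S.BitSocket N ≃ S.OthSocket N) → Fin (S.n N) → ℝ := fun N σ i =>
    if ((socketsAt (S.bitDeg N) (S.othDeg N) i).map (incMsg (socketSib (S.bitDeg N) (S.othDeg N))
      (combReturn (socketNode (S.bitDeg N) (S.othDeg N)) (.inl i)) false σ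
        (2 * (2 * (k + 1))))).any id then (1 : ℝ) else 0 with hI
  set J : ∀ N, (S.BitSocket N ≃ S.OthSocket N) → Fin (S.n N) → ℝ := fun N σ i =>
    ∫ x, f x / B ∂(κ.softOp_bit.fold ((socketsAt (S.bitDeg N) (S.othDeg N) i).map
      (incMsg (socketSib (S.bitDeg N) (S.othDeg N)) (combLaw κ τ) β σ (2 * k + 1))) : Measure ℝ)
    with hJ
  have hlimI : Tendsto (fun N => 𝔼[S, N] (I N)) atTop (𝓝 0) := S.tendsto_avg_return _
  have hlimJ : Tendsto (fun N => 𝔼[S, N] (J N)) atTop (𝓝 (∫ x, f x / B ∂rootLaw κ q r τ β k)) :=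
    S.tendsto_avg_root hq hr κ hτ hβ k (hf.div_const B) fun x => by
      rw [abs_div, abs_of_pos hB, div_le_one hB]; exact hb x
  -- where the neighbourhood is not a tree, the trivial bound applies; `I` marks these code bits
  have hle : ∀ N σ i, F N σ i ≤ B * J N σ i + (|C| + B) * I N σ i := fun N σ i => by
    have e1 : B * J N σ i = ∫ x, f x ∂(rootMsgLaw κ (ℒ[S, N] σ) τ β i k : Measure ℝ) := by
      rw [hJ, rootMsgLaw_socket]
      simp only [integral_div]
      field_simp
    by_cases hinj : Injective (treeProj (𝒢[S, N] σ) i (2 * (k + 1)))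
    · have : 0 ≤ I N σ i := by simp only [hI]; split_ifs <;> norm_num
      have h1 := hF N σ i hinj
      have h2 : 0 ≤ |C| + B := by positivity
      linarith [mul_nonneg h2 this]
    · have h1 : I N σ i = 1 := if_pos (any_returns_of_not_injective hinj)
      have h2 := norm_integral_le_of_norm_le_const (f := f) (μ := (rootMsgLaw κ
        (ℒ[S, N] σ) τ β i k : Measure ℝ)) (ae_of_all _ hb)
      rw [norm_eq_abs, probReal_univ, mul_one] at h2
      rw [h1, mul_one]
      grind
  have hlim := (hlimJ.const_mul B).add (hlimI.const_mul (|C| + B))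
  have e2 : B * ∫ x, f x / B ∂rootLaw κ q r τ β k + (|C| + B) * 0 =
      ∫ x, f x ∂rootLaw κ q r τ β k := by
    rw [integral_div]
    field_simp
    ring
  rw [e2] at hlim
  filter_upwards [hlim.eventually (ge_mem_nhds (lt_add_of_pos_right _ hδ))] with N hN
  refine (socketAvg_mono (hle N)).trans ?_
  rwa [socketAvg_add, socketAvg_const_mul, socketAvg_const_mul]

/-- Ensemble averages of quantities that agree with the predictions of belief propagation on
tree-like neighbourhoods. -/
lemma tendsto_socketAvg (hq : IsDegreeDist q qmax) (hr : IsDegreeDist r rmax) (κ : Kind)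
    {τ β : Prob ℝ} (hτ : IsLaw (τ : Measure ℝ)) (hβ : IsLaw (β : Measure ℝ)) (k : ℕ)
    {f : ℝ → ℝ} (hf : Measurable f) {B : ℝ} (hB : 0 < B) (hb : ∀ x, |f x| ≤ B)
    {F : ∀ N, (S.BitSocket N ≃ S.OthSocket N) → Fin (S.n N) → ℝ} {C : ℝ}
    (hF : ∀ N σ i, Injective (treeProj (𝒢[S, N] σ) i (2 * (k + 1))) →
      F N σ i = ∫ x, f x ∂(rootMsgLaw κ (ℒ[S, N] σ) τ β i k :
        Measure ℝ)) (hC : ∀ N σ i, |F N σ i| ≤ C) :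
    Tendsto (fun N => 𝔼[S, N] (F N)) atTop (𝓝 (∫ x, f x ∂rootLaw κ q r τ β k)) := by
  rw [Metric.tendsto_nhds]
  intro δ hδ
  have h1 := S.eventually_socketAvg_le hq hr κ hτ hβ k hf hB hb
    (fun N σ i hi => (hF N σ i hi).le) (fun N σ i => (le_abs_self _).trans (hC N σ i)) (half_pos hδ)
  have h2 := S.eventually_socketAvg_le hq hr κ hτ hβ k hf.neg hB (fun x => by simpa using hb x)
    (fun N σ i hi => by rw [hF N σ i hi]; simp [integral_neg])
    (F := fun N σ i => -1 * F N σ i)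
    (fun N σ i => by rw [neg_one_mul]; exact (neg_le_abs _).trans (hC N σ i)) (half_pos hδ)
  filter_upwards [h1, h2] with N h1 h2
  simp only [Pi.neg_apply, integral_neg] at h2
  rw [socketAvg_const_mul] at h2
  rw [dist_eq, abs_lt]
  constructor <;> linarith

end DegreeSequence

/-! ### The estimates of belief propagation -/

section

variable {V A E : Type} [Fintype E] {G : Graph V A E} (κ : Kind) (i : V)

lemma bpEstimate_zero (l : V → ℝ) : bpEstimate κ G i 0 l = κ.bitUnit := by classical
  rw [bpEstimate, softBit_eq_codeMean]
  have hlen : ∀ w : TreeBit G i 0, w.walk.length = 0 := fun w => Nat.le_zero.1 w.length_le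
  have hoth : ∀ a : TreeOth G i 0, False := fun a =>
    a.ne_nil (List.length_eq_zero_iff.1 (Nat.le_zero.1 a.length_le))
  have hroot : ∀ w : TreeBit G i 0, w = treeRoot G i 0 := fun w =>
    TreeBit.walk_eq_nil.1 (List.length_eq_zero_iff.1 (hlen w))
  set s : TreeBit G i 0 → ℝ := tanhs fun ν => upd l i 0 (treeProj G i 0 ν)
  have hs : s (treeRoot G i 0) = 0 := tanhs_update_self l
  cases κ with
  | ldgm =>
    refine (wordMean_compTree_ldgm (μ := s) (ν := fun _ => 0) (K := fun _ => 1)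
      (fun a => (hoth a).elim) (fun w hw => absurd (hroot w) hw) (fun a => (hoth a).elim)
        hs).trans ?_
    exact prod_kids_leaf _ rfl _
  | ldpc =>
    refine (wordMean_compTree_ldpc (ν := fun _ => 0)
      (fun a => (hoth a).elim) (fun w ξ => ?_) fun _ => one_pos).trans hs
    simp_all

lemma bpEstimate_succ [DecidableEq V] (L : EdgeLists G) (k : ℕ) (l : V → ℝ) :
    bpEstimate κ G i (2 * (k + 1)) l = rootMsg κ L id (tanhs (upd l i 0)) i k := by
  rw [bpEstimate, softBit_eq_codeMean]
  convert codeMean_observations L rfl κ l using 5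
  congr!

lemma measurable_bpEstimate (d : ℕ) : Measurable (bpEstimate κ G i d) := by
  classical
  have : bpEstimate κ G i d = fun l => codeMean κ (compTree G i d) (treeRoot G i d)
      (fun ν => tanhs (upd l i 0) (treeProj G i d ν)) := by
    ext l
    rw [bpEstimate, softBit_eq_codeMean]
    congr
  rw [this]
  have hm : Measurable fun (l : V → ℝ) (ν : TreeBit G i d) =>
      tanhs (upd l i 0) (treeProj G i d ν) := by
    refine measurable_pi_lambda _ fun ν => measurable_tanh.comp ?_
    by_cases h : treeProj G i d ν = i
    · simp [h]
    · fun_prop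
  cases κ with
  | ldgm => exact (measurable_wordMean _ _).comp hm
  | ldpc => exact (measurable_wordMean _ _).comp hm

end

section

variable {Ch : Channel} {ε : ℝ} (κ : Kind) {n m : ℕ}

lemma bpLaw_zero (hε : ε ∈ Ch.dom) {E : Type} [Fintype E] (G : Graph (Fin n) (Fin m) E)
    (i : Fin n) : bpLaw κ Ch ε G i 0 = dirac κ.bitUnit := by
  have := Ch.isProb_c hε
  have h : bpEstimate κ G i 0 = fun _ => κ.bitUnit := funext fun l => bpEstimate_zero κ i l
  rw [bpLaw, h, Measure.map_const, measure_univ, one_smul]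

lemma isProbabilityMeasure_bpLaw (hε : ε ∈ Ch.dom) {E : Type} [Fintype E]
    (G : Graph (Fin n) (Fin m) E) (i : Fin n) (d : ℕ) :
    IsProb (bpLaw κ Ch ε G i d) := by
  have := Ch.isProb_c hε
  exact isProbabilityMeasure_map (measurable_bpEstimate κ i d).aemeasurable

lemma abs_le_one_bpLaw {E : Type} [Fintype E] (G : Graph (Fin n) (Fin m) E) (i : Fin n) (d : ℕ) :
    ∀ᵐ x ∂(bpLaw κ Ch ε G i d), |x| ≤ 1 := by
  classical
  refine ae_abs_le_of_forall fun l => ?_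
  rw [bpEstimate, softBit_eq_codeMean]
  cases κ with
  | ldgm => exact abs_wordMean_le _ _ (abs_tanhs_le _)
  | ldpc => exact abs_wordMean_le _ _ (abs_tanhs_le _)

lemma gexitCoeff_dirac_zero (p : ℕ) :
    |gexitCoeff (dirac 0) p| ≤ 1 / ((2 * p + 1) * (2 * p + 2)) := by
  rw [gexitCoeff, moment, moment, integral_dirac, integral_dirac]
  simp only [ne_eq, Nat.add_eq_zero_iff, one_ne_zero, and_false, not_false_eq_true, zero_pow,
    OfNat.ofNat_ne_zero, zero_div, sub_zero, zero_sub, abs_neg]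
  rw [abs_of_pos (by positivity)]

lemma gexitCoeff_dirac_one (p : ℕ) : gexitCoeff (dirac 1) p = 0 := by
  rw [← integral_gexitFun (by simp [ae_dirac_eq]), integral_dirac, gexitFun_one]

/-- Quadratic decay of the GEXIT coefficients, uniform over the graphs with bounded degrees. -/
lemma exists_bound_bpLaw (hK : Ch.ClassK) (hε : ε ∈ Ch.dom) (K t : ℕ) :
    ∃ u : ℕ → ℝ, Summable u ∧ ∀ {n m : ℕ} (bd : Fin n → ℕ) (od : Fin m → ℕ)
      (σ : Matching bd od), (∀ i, bd i ≤ K) → (∀ a, od a ≤ K) →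
      ∀ i p, |gexitCoeff (bpLaw κ Ch ε (socketGraph bd od σ) i (2 * t)) p| ≤ u p := by
  have := Ch.isProb_c hε
  rcases t with _ | k
  · refine ⟨_, summable_inv_odd_mul_even, fun bd od σ _ _ i p => ?_⟩
    rw [mul_zero, bpLaw_zero κ hε]
    rcases κ.bitUnit_eq with h | h <;> rw [h]
    · exact gexitCoeff_dirac_zero p
    · rw [gexitCoeff_dirac_one, abs_zero]; positivity
  · set M := tameBound K (k + 1) with hM
    have hMpos : (0 : ℝ) < 2 * M := by
      have : 0 < M := by rw [hM, tameBound]; omega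
      positivity
    refine ⟨_, summable_const_div_odd_sq (exp M * (1 + M * ∫ x, exp ((2 * M) * |x|)
      ∂(Ch.c ε))), fun {n m} bd od σ hb ho i p => ?_⟩
    set L := socketLists bd od σ
    have hlen : ∀ {c K : ℕ} (x : Fin c), c ≤ K → ((finRange c).erase x).length ≤ K :=
      fun x hc => (List.length_erase_le).trans (by simpa using hc)
    have htame := tame_rootMsg κ L (fun e => by simpa [L, socketLists] using hlen e.2 (hb e.1))
      (fun e => by simpa [L, socketLists] using hlen (σ e).2 (ho (σ e).1))
      (fun v => by simpa [L, socketLists] using hb v) k i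
    have hfun : bpEstimate κ (socketGraph bd od σ) i (2 * (k + 1)) =
        fun l => rootMsg κ L id (tanhs (upd l i 0)) i k :=
      funext fun l => bpEstimate_succ κ i L k l
    rw [bpLaw, hfun]
    refine htame.abs_gexitCoeff_le i ?_ (hK.exp_moment ε hε _ hMpos) p
    rw [← hfun]
    exact measurable_bpEstimate κ i _

lemma hasDerivAt_gexitIntegral_bpLaw (hK : Ch.ClassK) (hε : ε ∈ Ch.dom) (bd : Fin n → ℕ)
    (od : Fin m → ℕ) (σ : Matching bd od) (i : Fin n) (t : ℕ) :
    HasDerivAt (gexitIntegral Ch (bpLaw κ Ch ε (socketGraph bd od σ) i (2 * t)))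
      (gexitSum Ch ε (gexitCoeff (bpLaw κ Ch ε (socketGraph bd od σ) i (2 * t)))) ε ∧
    Summable (gexitCoeff (bpLaw κ Ch ε (socketGraph bd od σ) i (2 * t))) := by
  obtain ⟨u, hu, hb⟩ := exists_bound_bpLaw κ hK hε (∑ i, bd i + ∑ a, od a) t
  have hs : Summable (gexitCoeff (bpLaw κ Ch ε (socketGraph bd od σ) i (2 * t))) :=
    Summable.of_norm_bounded hu fun p => hb bd od σ
      (fun i => (single_le_sum (fun _ _ => Nat.zero_le _) (mem_univ i)).trans
        (Nat.le_add_right _ _))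
      (fun a => (single_le_sum (fun _ _ => Nat.zero_le _) (mem_univ a)).trans
        (Nat.le_add_left _ _)) i p
  have := isProbabilityMeasure_bpLaw κ hε (socketGraph bd od σ) i (2 * t)
  exact ⟨hasDerivAt_gexitIntegral hK hε (abs_le_one_bpLaw κ _ i _) hs, hs⟩

/-- On a tree-like neighbourhood the messages of belief propagation are independent. -/
lemma bpLaw_of_injective (hε : ε ∈ Ch.dom) {τ : Prob ℝ}
    (hτ : (Ch.c ε).map tanh = τ) (bd : Fin n → ℕ) (od : Fin m → ℕ)
    (σ : Matching bd od) (i : Fin n) (k : ℕ)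
    (hinj : Injective (treeProj (socketGraph bd od σ) i (2 * (k + 1)))) :
    bpLaw κ Ch ε (socketGraph bd od σ) i (2 * (k + 1)) =
      rootMsgLaw κ (socketLists bd od σ) τ τ i k := by
  have := Ch.isProb_c hε
  rw [← map_rootMsg κ (socketLists bd od σ) hinj measurable_id hτ hτ rfl, bpLaw]
  congr 1
  ext l
  exact bpEstimate_succ κ i _ k l

lemma abs_gexitFun_clamp_le (p : ℕ) (x : ℝ) : |gexitFun p (clamp x)| ≤ 3 := by
  have hx := abs_clamp_le x
  have h1 : (1 : ℝ) ≤ 2 * p + 1 := by simp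
  have key : ∀ (k : ℕ) {c : ℝ}, 1 ≤ c → |clamp x ^ k / c| ≤ 1 := fun k c hc => by
    rw [abs_div, abs_pow, abs_of_pos (by linarith : 0 < c), div_le_one (by linarith)]
    exact (pow_le_one₀ (abs_nonneg _) hx).trans hc
  have e3 : |1 / ((2 * p + 1) * (2 * p + 2) : ℝ)| ≤ 1 := by
    rw [abs_of_pos (by positivity), div_le_one (by positivity)]
    nlinarith
  calc |gexitFun p (clamp x)| ≤ _ := (abs_sub _ _).trans (add_le_add_left (abs_sub _ _) _)
    _ ≤ 1 + 1 + 1 := add_le_add (add_le_add (key _ h1) (key _ (by linarith))) e3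
    _ = 3 := by norm_num

lemma integral_gexitFun_clamp {ρ : Measure ℝ} [IsProb ρ] (hρ : ∀ᵐ x ∂ρ, |x| ≤ 1)
    (p : ℕ) : ∫ x, gexitFun p (clamp x) ∂ρ = gexitCoeff ρ p := by
  rw [← integral_gexitFun hρ]
  exact integral_congr_ae (hρ.mono fun x hx => by simp only [clamp_eq hx])

lemma abs_gexitCoeff_le_three {ρ : Measure ℝ} [IsProb ρ] (hρ : ∀ᵐ x ∂ρ, |x| ≤ 1)
    (p : ℕ) : |gexitCoeff ρ p| ≤ 3 := by
  rw [← integral_gexitFun_clamp hρ]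
  refine (norm_integral_le_of_norm_le_const (f := fun x => gexitFun p (clamp x))
    (ae_of_all _ (abs_gexitFun_clamp_le p))).trans ?_
  simp

end

/-! ### The limits of the GEXIT functions -/

namespace DegreeSequence

variable {q r : ℝ[X]} {qmax rmax : ℕ} (S : DegreeSequence q r qmax rmax) (κ : Kind)
  {Ch : Channel} {ε : ℝ} (hK : Ch.ClassK) (hε : ε ∈ Ch.dom) (hq : IsDegreeDist q qmax)
  (hr : IsDegreeDist r rmax)
include hK hε

lemma bpGexit_eq (Λ P : ℝ[X]) (N t : ℕ) : bpGexit κ Λ P Ch (S.bitDeg N) (S.othDeg N) (2 * t) ε =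
      gexitNorm κ Λ P * gexitSum Ch ε fun p => 𝔼[S, N] fun σ i =>
        gexitCoeff (bpLaw κ Ch ε (𝒢[S, N] σ) i (2 * t)) p := by
  rw [← socketAvg_gexitSum hK hε fun σ i => (hasDerivAt_gexitIntegral_bpLaw κ hK hε _ _ σ i t).2,
    ← socketAvg_const_mul]
  change 𝔼[S, N] (fun σ i => gexitNorm κ Λ P * gexitFunctional Ch _ ε) = _
  congr 1
  ext σ i
  rw [gexitFunctional, (hasDerivAt_gexitIntegral_bpLaw κ hK hε _ _ σ i t).1.deriv]

lemma mapGexit_eq (Λ P : ℝ[X]) (N : ℕ) : mapGexit κ Λ P Ch (S.bitDeg N) (S.othDeg N) ε =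
      gexitNorm κ Λ P * gexitSum Ch ε fun p => 𝔼[S, N] fun σ i =>
        gexitCoeff (mapLaw κ Ch ε (𝒢[S, N] σ) i) p := by
  have hs : ∀ σ i, Summable (gexitCoeff (mapLaw κ Ch ε (𝒢[S, N] σ) i)) := fun σ i => by
    have := isProbabilityMeasure_mapLaw hε κ (𝒢[S, N] σ) i
    exact summable_gexitCoeff_of_symm (abs_le_one_mapLaw _ _ _ _ _) (moment_mapLaw_odd hK hε κ _ i)
  rw [← socketAvg_gexitSum hK hε hs, mapGexit, (hasDerivAt_meanEntropy hK hε κ _ _).deriv]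
  rfl

lemma tendsto_bpGexit_zero (Λ P : ℝ[X]) :
    Tendsto (fun N => bpGexit κ Λ P Ch (S.bitDeg N) (S.othDeg N) (2 * 0) ε) atTop
      (𝓝 (gexitNorm κ Λ P * gexitSum Ch ε (gexitCoeff (dirac κ.bitUnit)))) := by
  refine tendsto_const_nhds.congr' ?_
  filter_upwards [S.eventually_n_pos] with N hn
  rw [S.bpGexit_eq κ hK hε]
  simp only [mul_zero, bpLaw_zero κ hε, socketAvg_const hn (S.card_eq N).symm]

include hq hr

/-- The ensemble average of the GEXIT function of belief propagation converges to the prediction of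
density evolution. -/
lemma tendsto_bpGexit_succ (Λ P : ℝ[X]) (k : ℕ) :
    Tendsto (fun N => bpGexit κ Λ P Ch (S.bitDeg N) (S.othDeg N) (2 * (k + 1)) ε) atTop
      (𝓝 (gexitNorm κ Λ P * gexitSum Ch ε (gexitCoeff (rootLaw κ q r ((Ch.c ε).map tanh)
        ((Ch.c ε).map tanh) k)))) := by
  have hτ := Ch.isLaw_tanh hK hε
  obtain ⟨u, hu, hb⟩ := exists_bound_bpLaw κ hK hε (qmax + rmax) (k + 1)
  simp_rw [S.bpGexit_eq κ hK hε]
  refine (tendsto_gexitSum hK hε hu ?_ fun p => ?_).const_mul _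
  · refine Eventually.of_forall fun N p => abs_socketAvg_le ?_ fun σ i =>
      hb _ _ σ (S.bitDeg_le N) (S.othDeg_le N) i p
    exact (abs_nonneg _).trans (hb (m := 1) (fun _ => 0) (fun _ => 0) (Equiv.refl _)
      (fun _ => Nat.zero_le _) (fun _ => Nat.zero_le _) 0 p)
  · have hroot := law_rootLaw (κ := κ) hq hr hτ hτ k
    have := hroot.prob
    rw [← integral_gexitFun_clamp hroot.ae_abs_le]
    let τ : Prob ℝ := ⟨_, hτ.prob⟩
    refine S.tendsto_socketAvg hq hr κ (τ := τ) (β := τ) hτ hτ k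
      ((continuous_gexitFun p).comp continuous_clamp).measurable three_pos
      (abs_gexitFun_clamp_le p) (C := 3) (fun N σ i hinj => ?_) fun N σ i => ?_
    · have h1 := bpLaw_of_injective κ hε (τ := τ) rfl _ _ σ i k hinj
      rw [← h1]
      have := isProbabilityMeasure_bpLaw κ hε (𝒢[S, N] σ) i (2 * (k + 1))
      exact (integral_gexitFun_clamp (abs_le_one_bpLaw κ _ i _) p).symm
    · have := isProbabilityMeasure_bpLaw κ hε (𝒢[S, N] σ) i (2 * (k + 1))
      exact abs_gexitCoeff_le_three (abs_le_one_bpLaw κ _ i _) p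

/-- If belief propagation started from pessimistic and from optimistic messages have the same limit,
then the MAP estimate has this limit as well. -/
lemma tendsto_mapGexit (Λ P : ℝ[X]) {lo hi : Prob ℝ}
    (hlo : IsLaw (lo : Measure ℝ)) (hhi : IsLaw (hi : Measure ℝ))
    (elo : (Ch.c ε).map (fun l => κ.loLeaf (tanh l)) = lo)
    (ehi : (Ch.c ε).map (fun l => κ.hiLeaf (tanh l)) = hi) {μ : ℕ → ℝ}
    (tlo : ∀ p, Tendsto (fun k => moment (rootLaw κ q r ((Ch.c ε).map tanh) lo k) (2 * p + 2))
      atTop (𝓝 (μ p)))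
    (thi : ∀ p, Tendsto (fun k => moment (rootLaw κ q r ((Ch.c ε).map tanh) hi k) (2 * p + 2))
      atTop (𝓝 (μ p))) :
    Tendsto (fun N => mapGexit κ Λ P Ch (S.bitDeg N) (S.othDeg N) ε) atTop
      (𝓝 (gexitNorm κ Λ P * gexitSum Ch ε fun p => (μ p - 1) / ((2 * p + 1) * (2 * p + 2)))) := by
  have hc := Ch.isSymmNoise_c hK hε
  have := Ch.isProb_c hε
  have hlf : (Measurable κ.loLeaf ∧ Measurable κ.hiLeaf) ∧
      ∀ x, IsMsg x → IsMsg (κ.loLeaf x) ∧ IsMsg (κ.hiLeaf x) := by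
    cases κ
    exacts [⟨⟨measurable_const, measurable_id⟩, fun _ h => ⟨⟨neg_one_lt_zero, zero_le_one⟩, h⟩⟩,
      ⟨⟨measurable_id, measurable_const⟩, fun _ h => ⟨h, by norm_num [Kind.hiLeaf], le_rfl⟩⟩]
  let τ : Prob ℝ := ⟨_, (Ch.isLaw_tanh hK hε).prob⟩
  have hτ : IsLaw (τ : Measure ℝ) := Ch.isLaw_tanh hK hε
  set F : ℕ → ∀ N, (S.BitSocket N ≃ S.OthSocket N) → Fin (S.n N) → ℝ := fun p N σ i =>
    moment (mapLaw κ Ch ε (𝒢[S, N] σ) i) (2 * p + 2) with hF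
  have hF1 : ∀ p N σ i, |F p N σ i| ≤ 1 := fun p N σ i => by
    have := isProbabilityMeasure_mapLaw hε κ (𝒢[S, N] σ) i
    exact abs_moment_le_one (abs_le_one_mapLaw _ _ _ _ _) _
  have hcoeff : ∀ N p, 𝔼[S, N] (fun σ i => gexitCoeff (mapLaw κ Ch ε (𝒢[S, N] σ) i) p) =
      𝔼[S, N] fun σ i => 1 / ((2 * p + 1) * (2 * p + 2)) * (F p N σ i + -1) := fun N p => by
    congr! 3 with σ i
    rw [gexitCoeff_of_symm (moment_mapLaw_odd hK hε κ _ i), hF]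
    ring
  simp_rw [S.mapGexit_eq κ hK hε, hcoeff]
  refine (tendsto_gexitSum hK hε (summable_inv_odd_mul_even.mul_left 2) ?_ fun p => ?_).const_mul _
  · refine Eventually.of_forall fun N p => abs_socketAvg_le (by positivity) fun σ i => ?_
    rw [abs_mul, abs_of_pos (by positivity), mul_comm]
    gcongr
    linarith [abs_add_le (F p N σ i) (-1), hF1 p N σ i, abs_neg (1 : ℝ), abs_one (α := ℝ)]
  · have hpow : ∀ x : ℝ, |clamp x ^ (2 * p + 2)| ≤ 1 := fun x =>
      abs_pow_le_one (abs_clamp_le x) _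
    have hpm : Measurable fun x : ℝ => clamp x ^ (2 * p + 2) :=
      continuous_clamp.measurable.pow_const _
    have hev : Even (2 * p + 2) := ⟨p + 1, by ring⟩
    have hmc : ∀ {ρ : Measure ℝ}, (∀ᵐ x ∂ρ, |x| ≤ 1) →
        ∫ x, clamp x ^ (2 * p + 2) ∂ρ = moment ρ (2 * p + 2) := fun hρ =>
      integral_congr_ae (hρ.mono fun x hx => by simp only [clamp_eq hx])
    have hrm : ∀ {lf : ℝ → ℝ} {β : Prob ℝ}, Measurable lf →
        (∀ x, IsMsg x → IsMsg (lf x)) → (Ch.c ε).map (fun l => lf (tanh l)) = β →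
        ∀ N σ i k, Injective (treeProj (𝒢[S, N] σ) i (2 * (k + 1))) →
        ∫ x, clamp x ^ (2 * p + 2) ∂(rootMsgLaw κ (ℒ[S, N] σ) τ β i k : Measure ℝ) =
        moment ((pi fun _ => Ch.c ε).map fun l => rootMsg κ (ℒ[S, N] σ) lf
          (tanhs (upd l i 0)) i k) (2 * p + 2) := fun h1 h2 hβ N σ i k hinj => by
      rw [← map_rootMsg κ (ℒ[S, N] σ) hinj h1 (τ := τ) rfl hβ rfl]
      have h := fun l => isMsg_rootMsg κ (ℒ[S, N] σ) (isMsg_tanhs (upd l i 0)) h2 k i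
      exact hmc (ae_abs_le_of_forall fun l => abs_le.2 ⟨(h l).1.le, (h l).2⟩)
    -- the sandwich: belief propagation from optimistic messages above, from pessimistic ones below
    have hup : ∀ k, ∀ δ > 0, ∀ᶠ N in atTop, 𝔼[S, N] (F p N) ≤
        moment (rootLaw κ q r τ hi k) (2 * p + 2) + δ := fun k δ hδ => by
      rw [← hmc (law_rootLaw (κ := κ) hq hr hτ hhi k).ae_abs_le]
      refine S.eventually_socketAvg_le hq hr κ hτ hhi k hpm one_pos hpow
        (fun N σ i hinj => ?_) (fun N σ i => (le_abs_self _).trans (hF1 p N σ i)) hδ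
      rw [hrm hlf.1.2 (fun x hx => (hlf.2 x hx).2) ehi N σ i k hinj]
      exact moment_mapLaw_le_hi _ rfl hinj hc hev rfl κ
    have hdn : ∀ k, ∀ δ > 0, ∀ᶠ N in atTop, moment (rootLaw κ q r τ lo k) (2 * p + 2) - δ ≤
        𝔼[S, N] (F p N) := fun k δ hδ => by
      have h1 := S.eventually_socketAvg_le hq hr κ hτ hlo k hpm.neg one_pos
        (fun x => (abs_neg _).trans_le (hpow x)) (F := fun N σ i => -1 * F p N σ i)
        (fun N σ i hinj => ?_) (C := 1) (fun N σ i => ?_) hδ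
      · simp only [Pi.neg_apply, integral_neg] at h1
        rw [hmc (law_rootLaw (κ := κ) hq hr hτ hlo k).ae_abs_le] at h1
        filter_upwards [h1] with N h1
        rw [socketAvg_const_mul] at h1
        linarith
      · simp only [Pi.neg_apply, integral_neg]
        rw [hrm hlf.1.1 (fun x hx => (hlf.2 x hx).1) elo N σ i k hinj, neg_one_mul, neg_le_neg_iff]
        exact moment_lo_le_mapLaw _ rfl hinj hc hev rfl κ
      · linarith [(abs_le.1 (hF1 p N σ i)).1]
    have hlim : Tendsto (fun N => 𝔼[S, N] (F p N)) atTop (𝓝 (μ p)) := by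
      refine tendsto_order.2 ⟨fun a ha => ?_, fun a ha => ?_⟩
      · obtain ⟨k, h⟩ := ((tlo p).eventually_const_lt ha).exists
        change a < moment (rootLaw κ q r τ lo k) _ at h
        filter_upwards [hdn k _ (half_pos (sub_pos.2 h))] with N h3 using by linarith
      · obtain ⟨k, h⟩ := ((thi p).eventually_lt_const ha).exists
        change moment (rootLaw κ q r τ hi k) _ < a at h
        filter_upwards [hup k _ (half_pos (sub_pos.2 h))] with N h3 using by linarith
    rw [show (μ p - 1) / ((2 * (p : ℝ) + 1) * (2 * p + 2)) =
      1 / ((2 * p + 1) * (2 * p + 2)) * (μ p + -1) by ring]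
    refine ((hlim.add_const (-1)).const_mul _).congr' ?_
    filter_upwards [S.eventually_n_pos] with N hn
    rw [socketAvg_const_mul, socketAvg_add, socketAvg_const hn (S.card_eq N).symm]

end DegreeSequence

lemma SoftOp.lop_unit {op : ℝ → ℝ → ℝ} {u : ℝ} (h : SoftOp op u) {μ : Measure ℝ} (hμ : IsLaw μ) :
    lop op μ (dirac u) = μ := by
  have := hμ.prob
  rw [lop, Measure.prod_dirac, Measure.map_map h.meas (by fun_prop)]
  exact (Measure.map_congr (ae_of_all _ fun x => h.right_unit x)).trans Measure.map_id

section

variable {Ch : Channel} {ε : ℝ} {κ : Kind} {q r : ℝ[X]} {qmax rmax : ℕ} (hK : Ch.ClassK)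
  (hε : ε ∈ Ch.dom) (hq : IsDegreeDist q qmax) (hr : IsDegreeDist r rmax)
include hK hε

lemma hasDerivAt_gexitIntegral_of_isLaw {ρ : Measure ℝ} (hρ : IsLaw ρ) :
    HasDerivAt (gexitIntegral Ch ρ) (gexitSum Ch ε (gexitCoeff ρ)) ε := by
  have := hρ.prob
  exact hasDerivAt_gexitIntegral hK hε hρ.ae_abs_le
    (summable_gexitCoeff_of_symm hρ.ae_abs_le hρ.moment_odd)

include hq hr

/-- The GEXIT functions of density evolution converge if the even moments do. -/
lemma tendsto_gexitSum_rootLaw {β : Measure ℝ} (hβ : IsLaw β) {μ : ℕ → ℝ}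
    (h : ∀ p, Tendsto (fun k => moment (rootLaw κ q r ((Ch.c ε).map tanh) β k) (2 * p + 2))
      atTop (𝓝 (μ p))) :
    Tendsto (fun k => gexitSum Ch ε (gexitCoeff (rootLaw κ q r ((Ch.c ε).map tanh) β k))) atTop
      (𝓝 (gexitSum Ch ε fun p => (μ p - 1) / ((2 * p + 1) * (2 * p + 2)))) := by
  have hL := fun k => law_rootLaw (κ := κ) hq hr (Ch.isLaw_tanh hK hε) hβ k
  refine tendsto_gexitSum hK hε (summable_inv_odd_mul_even.mul_left 2)
    (Eventually.of_forall fun k p => ?_) fun p => ?_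
  · have := (hL k).prob
    have h1 := abs_moment_le_one (hL k).ae_abs_le (2 * p + 2)
    rw [gexitCoeff_of_symm (hL k).moment_odd, abs_div,
      abs_of_pos (by positivity : (0 : ℝ) < (2 * p + 1) * (2 * p + 2)), mul_one_div]
    gcongr
    grind
  · simp_rw [gexitCoeff_of_symm (hL _).moment_odd]
    exact ((h p).sub_const 1).div_const _

/-- The GEXIT functions of MAP decoding, of belief propagation and of density evolution have the
same limit if density evolution forgets its initial messages. -/
lemma exists_gexit_limit (Λ P : ℝ[X]) {lo hi : Measure ℝ} (hlo : IsLaw lo) (hhi : IsLaw hi)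
    (elo : (Ch.c ε).map (fun l => κ.loLeaf (tanh l)) = lo)
    (ehi : (Ch.c ε).map (fun l => κ.hiLeaf (tanh l)) = hi)
    (hbp : (Ch.c ε).map tanh = lo ∨ (Ch.c ε).map tanh = hi)
    (hlim : ∀ p, ∃ m : ℝ,
      Tendsto (fun k => moment (rootLaw κ q r ((Ch.c ε).map tanh) lo k) (2 * p + 2)) atTop (𝓝 m) ∧
      Tendsto (fun k => moment (rootLaw κ q r ((Ch.c ε).map tanh) hi k) (2 * p + 2)) atTop (𝓝 m))
    (hde : ∀ t, deLaw κ Λ P Ch ε t = rootLaw κ q r ((Ch.c ε).map tanh) lo t) :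
    ∃ (gBP : ℕ → ℝ) (g : ℝ), Tendsto gBP atTop (𝓝 g) ∧
      (∀ t, DifferentiableAt ℝ (gexitIntegral Ch (deLaw κ Λ P Ch ε t)) ε) ∧
      Tendsto (fun t => deGexit κ Λ P Ch ε t) atTop (𝓝 g) ∧
      ∀ S : DegreeSequence q r qmax rmax,
        (∀ N, DifferentiableAt ℝ (meanEntropy κ Ch (S.bitDeg N) (S.othDeg N)) ε) ∧
        Tendsto (fun N => mapGexit κ Λ P Ch (S.bitDeg N) (S.othDeg N) ε) atTop (𝓝 g) ∧
        (∀ t N σ i, DifferentiableAt ℝ (gexitIntegral Ch (bpLaw κ Ch ε (𝒢[S, N] σ) i (2 * t))) ε) ∧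
        (∀ t, Tendsto (fun N => bpGexit κ Λ P Ch (S.bitDeg N) (S.othDeg N) (2 * t) ε)
          atTop (𝓝 (gBP t))) := by
  have hτ := Ch.isLaw_tanh hK hε
  choose μ tlo thi using hlim
  have hroot := fun k => law_rootLaw (κ := κ) hq hr hτ hlo k
  have tbp : ∀ p, Tendsto (fun k => moment (rootLaw κ q r ((Ch.c ε).map tanh)
      ((Ch.c ε).map tanh) k) (2 * p + 2)) atTop (𝓝 (μ p)) := by
    grind
  -- the truncation at depth `2 (k + 1)` corresponds to `k + 1` iterations
  refine ⟨fun t => t.casesOn (gexitNorm κ Λ P * gexitSum Ch ε (gexitCoeff (dirac κ.bitUnit)))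
      fun k => gexitNorm κ Λ P * gexitSum Ch ε (gexitCoeff
        (rootLaw κ q r ((Ch.c ε).map tanh) ((Ch.c ε).map tanh) k)),
    gexitNorm κ Λ P * gexitSum Ch ε fun p => (μ p - 1) / ((2 * p + 1) * (2 * p + 2)),
    (tendsto_add_atTop_iff_nat 1).1 ((tendsto_gexitSum_rootLaw hK hε hq hr hτ tbp).const_mul _),
    fun t => ?_, ?_, fun S => ⟨fun N => (hasDerivAt_meanEntropy hK hε κ _ _).differentiableAt, ?_,
      fun t N σ i => (hasDerivAt_gexitIntegral_bpLaw κ hK hε _ _ σ i t).1.differentiableAt,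
      fun t => ?_⟩⟩
  · rw [hde]
    exact (hasDerivAt_gexitIntegral_of_isLaw hK hε (hroot t)).differentiableAt
  · refine ((tendsto_gexitSum_rootLaw hK hε hq hr hlo tlo).const_mul _).congr fun t => ?_
    rw [deGexit, hde, gexitFunctional, (hasDerivAt_gexitIntegral_of_isLaw hK hε (hroot t)).deriv]
  · exact S.tendsto_mapGexit κ hK hε hq hr Λ P (lo := ⟨lo, hlo.prob⟩) (hi := ⟨hi, hhi.prob⟩)
      hlo hhi elo ehi tlo thi
  · rcases t with _ | k
    · exact S.tendsto_bpGexit_zero κ hK hε Λ P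
    · exact S.tendsto_bpGexit_succ κ hK hε hq hr Λ P k

end

end

end SparseCode

open SparseCode in
theorem corollary1 (Ch : Channel) (hK : Ch.ClassK) (lmax kmax : ℕ) :
    -- LDGM ensembles at high noise: code bits sit on the check side, with degree distribution `P`
    (∃ εg : ℝ, 0 ≤ εg ∧ (εg : EReal) < Ch.εmax ∧
      ∀ Λ P : ℝ[X], IsDegreeDist Λ lmax → IsDegreeDist P kmax →
      ∀ ε : ℝ, εg < ε → (ε : EReal) < Ch.εmax →
      ∃ (gBP : ℕ → ℝ) (g : ℝ),
        Tendsto gBP atTop (𝓝 g) ∧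
        (∀ t, DifferentiableAt ℝ (gexitIntegral Ch (deLaw .ldgm Λ P Ch ε t)) ε) ∧
        Tendsto (fun t => deGexit .ldgm Λ P Ch ε t) atTop (𝓝 g) ∧
        ∀ S : DegreeSequence P Λ kmax lmax,
          (∀ N, DifferentiableAt ℝ (meanEntropy .ldgm Ch (S.bitDeg N) (S.othDeg N)) ε) ∧
          Tendsto (fun N => mapGexit .ldgm Λ P Ch (S.bitDeg N) (S.othDeg N) ε) atTop (𝓝 g) ∧
          (∀ t N σ i, DifferentiableAt ℝ (gexitIntegral Ch
            (bpLaw .ldgm Ch ε (socketGraph (S.bitDeg N) (S.othDeg N) σ) i (2 * t))) ε) ∧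
          (∀ t, Tendsto (fun N => bpGexit .ldgm Λ P Ch (S.bitDeg N) (S.othDeg N) (2 * t) ε)
            atTop (𝓝 (gBP t)))) ∧
    -- LDPC ensembles at low noise: code bits sit on the variable side, with degree distribution `Λ`
    (∃ εp : ℝ, 0 < εp ∧ (εp : EReal) ≤ Ch.εmax ∧
      ∀ Λ P : ℝ[X], IsDegreeDist Λ lmax → IsDegreeDist P kmax →
      ∀ ε : ℝ, 0 < ε → ε < εp →
      ∃ (gBP : ℕ → ℝ) (g : ℝ),
        Tendsto gBP atTop (𝓝 g) ∧
        (∀ t, DifferentiableAt ℝ (gexitIntegral Ch (deLaw .ldpc Λ P Ch ε t)) ε) ∧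
        Tendsto (fun t => deGexit .ldpc Λ P Ch ε t) atTop (𝓝 g) ∧
        ∀ S : DegreeSequence Λ P lmax kmax,
          (∀ N, DifferentiableAt ℝ (meanEntropy .ldpc Ch (S.bitDeg N) (S.othDeg N)) ε) ∧
          Tendsto (fun N => mapGexit .ldpc Λ P Ch (S.bitDeg N) (S.othDeg N) ε) atTop (𝓝 g) ∧
          (∀ t N σ i, DifferentiableAt ℝ (gexitIntegral Ch
            (bpLaw .ldpc Ch ε (socketGraph (S.bitDeg N) (S.othDeg N) σ) i (2 * t))) ε) ∧
          (∀ t, Tendsto (fun N => bpGexit .ldpc Λ P Ch (S.bitDeg N) (S.othDeg N) (2 * t) ε)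
            atTop (𝓝 (gBP t)))) := by
  constructor
  · obtain ⟨εg, h0, h1, h⟩ := exists_high_noise hK (lmax * kmax : ℝ) (by positivity)
    refine ⟨εg, h0, h1, fun Λ P hΛ hP ε h2 h3 => ?_⟩
    obtain ⟨hε, hc⟩ := h ε h2 h3
    have hτ := Ch.isLaw_tanh hK hε
    have := Ch.isProb_c hε
    refine exists_gexit_limit hK hε hP hΛ Λ P isLaw_dirac_zero hτ
      (by simp [Kind.loLeaf, Measure.map_const]) rfl (Or.inr rfl) ?_ (deLaw_ldgm hΛ hP hτ)
    have h0 := law_bitMsg (κ := .ldgm) hP hΛ hτ isLaw_dirac_zero 1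
    refine exists_tendsto_moment_rootLaw hP hΛ hτ isLaw_dirac_zero hτ (dirac_zero_lawLE hτ)
      (dirac_zero_lawLE h0) (integral_nonneg fun x => sq_nonneg x) (by rwa [mul_comm (kmax : ℝ)]) ?_
    intro μ μ' hμ hμ' hle
    change bh (lop (· * ·) _ μ) - bh (lop (· * ·) _ μ') ≤ _
    rw [softOp_mul.lop_comm hτ hμ, softOp_mul.lop_comm hτ hμ']
    exact bh_gap_mul hμ hμ' hτ hle
  · obtain ⟨εp, h0, h1, h⟩ := exists_low_noise hK (lmax * kmax : ℝ) (by positivity)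
    refine ⟨εp, h0, h1, fun Λ P hΛ hP ε h2 h3 => ?_⟩
    obtain ⟨hε, hc⟩ := h ε h2 h3
    have hτ := Ch.isLaw_tanh hK hε
    have := Ch.isProb_c hε
    refine exists_gexit_limit hK hε hΛ hP Λ P hτ isLaw_dirac_one rfl
      (by simp [Kind.hiLeaf, Measure.map_const]) (Or.inl rfl) ?_ (deLaw_ldpc hΛ hP hτ)
    refine exists_tendsto_moment_rootLaw hΛ hP hτ hτ isLaw_dirac_one (lawLE_dirac_one hτ)
      ?_ (bh_nonneg _) hc ?_
    · have hν := hΛ.law_edge softOp_box (hP.law_edge softOp_mul hτ)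
      have h4 := softOp_box.mono hτ hτ isLaw_dirac_zero hν (fun _ _ => le_rfl) (dirac_zero_lawLE hν)
      rwa [softOp_box.lop_unit hτ] at h4
    · intro μ μ' hμ hμ' _
      change bh (lop box _ μ) - bh (lop box _ μ') ≤ _
      rw [bh_box hτ hμ, bh_box hτ hμ', mul_sub]
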